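/- Let $\mathbb F$ be the field with two elements, let $G$ be a finite tree with vertex set $V$ and integer weights $w(v)$, and let $v_0\in V$ be a chosen root. **The algebra.** $\mathcal K$ is the $\mathbb F$-algebra with two idempotents $i_0,i_1$ such that $i_0\mathcal K i_0=\mathbb F[\mathscr U,\mathscr V]$, $i_1\mathcal K i_1=\mathbb F[\mathscr U,\mathscr V,\mathscr V^{-1}]$, $i_0\mathcal K i_1=0$, and $i_1\mathcal K i_0$ is the free left $i_1\mathcal Ki_1$-module on $\sigma,\tau$, with $\sigma f=I(f)\sigma$ and $\tau f=T(f)\tau$, where $I$ is the inclusion, $T(\mathscr U)=\mathscr V^{-1}$ and $T(\mathscr V)=\mathscr U\mathscr V^2$. **The modules.** Type-$D$, type-$A$, type-$DA$ and type-$AA$ modules and the box tensor product $\boxtimes$ are those of Lipshitz, Ozsváth and Thurston. * $\mathcal D_n^{\mathcal K}$ has generators $i_0,i_1$ and $\delta^1(i_0)=i_1\otimes(\sigma+\mathscr V^n\tau)$. * ${}_{\mathcal K}\mathcal D_n$ has $i_0\mathcal D_n=\mathbb F[\mathscr U,\mathscr V]$ and $i_1\mathcal D_n=\mathbb F[\mathscr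 U,\mathscr V,\mathscr V^{-1}]$; polynomials act by multiplication, $\sigma x=I(x)$ and $\tau x=\mathscr V^nT(x)$. With $U$ acting on the right as $\mathscr U\mathscr V$ it is a bimodule ${}_{\mathcal K}[\mathcal D_n]_{\mathbb F[U]}$. * The merge bimodule ${}_{\mathcal K\otimes\mathcal K}M_2^{\mathcal K}$ has generators $i_0,i_1$; $\delta^1_2(a\otimes b,i_\varepsilon)=i_\varepsilon\otimes ab$ for $a,b\in i_\varepsilon\mathcal Ki_\varepsilon$; $\delta^1_3(f\theta\otimes g,\,f'\otimes g'\theta,\,i_0)=i_1\otimes f\,\phi(f')\,g\,g'\,\theta$ for $(\theta,\phi)\in\{(\sigma,I),(\tau,T)\}$, $f,g,g'\in i_1\mathcal Ki_1$, $f'\in i_0\mathcal Ki_0$; all other operations vanish. * $\bar{\mathcal H}_{(\lambda_1,\lambda_2)}^{\mathcal K\otimes\mathcal K}$, the link surgery module of the negative Hopf link for one alpha-parallel and one beta-parallel arc, has generators $a,b,c,d$ in each of the four idempotents. Its $\delta^1$ encodes the differential $\partial b=\mathscr U_2a+\mathscr U_1d$, $\partial c=\mathscr V_1a+\mathscr V_2d$,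 $\partial a=\partial d=0$; the identity maps $\Phi^{K_i}$ with weight $\sigma$ in the $i$-th factor; the maps with weight $\tau$ in the $i$-th factor $$\Phi^{-K_1}:\ a\mapsto\mathscr V_1^{\lambda_1-1}d,\quad b\mapsto0,\quad c\mapsto\mathscr V_1^{\lambda_1+1}b+\mathscr V_1^{\lambda_1}\mathscr U_2c,\quad d\mapsto\mathscr V_1^{\lambda_1}\mathscr U_2d,$$ $$\Phi^{-K_2}:\ a\mapsto\mathscr U_1\mathscr V_2^{\lambda_2}a,\quad b\mapsto0,\quad c\mapsto\mathscr V_2^{\lambda_2+1}b+\mathscr U_1\mathscr V_2^{\lambda_2}c,\quad d\mapsto\mathscr V_2^{\lambda_2-1}a;$$ and the map with weight $\tau\otimes\tau$ given by $a\mapsto\mathscr V_1^{\lambda_1-2}\mathscr V_2^{\lambda_2-1}c$, $d\mapsto\mathscr V_1^{\lambda_1-1}\mathscr V_2^{\lambda_2-2}c$, $b,c\mapsto0$. * ${}_{\mathcal K}\bar{\mathcal H}_\Lambda^{\mathcal K}=\bar{\mathcal H}_\Lambda^{\mathcal K\otimes\mathcal K}\boxtimes(M_2\boxtimes\mathcal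 D_0)$, tensored along the first algebra factor of $\bar{\mathcal H}_\Lambda$. **The complex $\tilde{\mathcal C}_\Lambda(G)$.** Every rooted tree is obtained by a sequence of the following moves: start with a single vertex; join two rooted trees at their roots; attach a new vertex to the root and make it the new root. For such a sequence producing $(G,v_0)$ define a type-$D$ module over $\mathcal K$ recursively: $\mathcal D_0^{\mathcal K}$ for a single vertex; $(X_1\otimes_{\mathbb F}X_2)\boxtimes M_2$ for joining two trees with modules $X_1,X_2$; $X\boxtimes{}_{\mathcal K}\bar{\mathcal H}_{(w(v),0)}^{\mathcal K}$ for attaching a new root to the old root $v$ of a tree with module $X$. Finally tensor with ${}_{\mathcal K}[\mathcal D_{w(v_0)}]_{\mathbb F[U]}$ and complete, allowing arbitrary infinite sums of the monomial basis elements. The result $\tilde{\mathcal C}_\Lambda(G)$ is an $\mathbb F[[U]]$-module with an $\mathbb F[[U]]$-linear endomorphism $\partial$. **The lattice complex.** Let $\mathbb Z^V$ carry the intersection form with $v\cdot v=w(v)$, and $u\cdot v=1$ or $0$ for $u\neq v$ adjacent or not. Let $\mathrm{Char}(G)$ be the set of $K\in\mathrm{Hom}(\mathbb Z^V,\mathbb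 Z)$ with $K(\Sigma)+\Sigma^2$ even for all $\Sigma$, and let $v^*=v\cdot(-)$. For $I\subseteq E\subseteq V$ put $2f(K,I)=K(\Sigma_I)+\Sigma_I^2$ with $\Sigma_I=\sum_{v\in I}v$, $g(K,E)=\min_{I\subseteq E}f(K,I)$, and for $v\in E$ put $a_v(K,E)=g(K,E-v)-g(K,E)$ and $b_v(K,E)=\min_{v\in I\subseteq E}f(K,I)-g(K,E)$. Then $$\mathbb{CF}(G)=\prod_{K\in\mathrm{Char}(G),\,E\subseteq V}\mathbb F[[U]]\cdot[K,E],\qquad \partial[K,E]=\sum_{v\in E}U^{a_v(K,E)}[K,E-v]+\sum_{v\in E}U^{b_v(K,E)}[K+2v^*,E-v].$$ **Statement.** Every $(G,v_0)$ is produced by some sequence of the moves above. For every such sequence, $\partial^2=0$ on $\tilde{\mathcal C}_\Lambda(G)$ and on $\mathbb{CF}(G)$, and $\tilde{\mathcal C}_\Lambda(G)$ is homotopy equivalent to $\mathbb{CF}(G)$ over $\mathbb F[[U]]$: there are $\mathbb F[[U]]$-linear chain maps in both directions whose two composites are homotopic to the identity through $\mathbb F[[U]]$-linear homotopies. -/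

import Mathlib

namespace PlumbingLattice

/-! ## The surgery algebra `K`

`K` is an algebra over the idempotent ring `I₀ ⊕ I₁` (`false` is `I₀`, `true` is `I₁`) over the field
`F` with two elements.  It has an `F`-basis of monomials, and a product of two monomials is a monomial
or zero; so it is given by this basis and the multiplication table. -/

/-- The field with two elements. -/
abbrev F2 := ZMod 2

/-- The monomial basis of `K`.  Here `U`, `V` stand for the script letters. -/
inductive KMon
  /-- `U^i V^j` in `I₀ K I₀ = F[U,V]` -/
  | poly (i j : ℕ)
  /-- `U^i V^j` in `I₁ K I₁ = F[U,V,V⁻¹]` -/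
  | laur (i : ℕ) (j : ℤ)
  /-- `U^i V^j σ` in `I₁ K I₀` -/
  | sig (i : ℕ) (j : ℤ)
  /-- `U^i V^j τ` in `I₁ K I₀` -/
  | tau (i : ℕ) (j : ℤ)
  deriving DecidableEq

namespace KMon

/-- The product of two monomials, `none` meaning zero.  The relations are `σ f = I(f) σ` and
`τ f = T(f) τ`, with `I` the inclusion and `T(U) = V⁻¹`, `T(V) = U V²`, so that
`T(U^k V^l) = U^l V^(2l-k)`. -/
def mul : KMon → KMon → Option KMon
  | poly i j, poly k l => some (poly (i + k) (j + l))
  | laur i j, laur k l => some (laur (i + k) (j + l))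
  | laur i j, sig k l => some (sig (i + k) (j + l))
  | laur i j, tau k l => some (tau (i + k) (j + l))
  | sig i j, poly k l => some (sig (i + k) (j + l))
  | tau i j, poly k l => some (tau (i + l) (j + (2 * l - k)))
  | _, _ => none

/-- The idempotents `i₀` and `i₁`. -/
def one : Bool → KMon
  | false => poly 0 0
  | true => laur 0 0

/-- The element `U` in the given idempotent. -/
def U : Bool → KMon
  | false => poly 1 0
  | true => laur 1 0

/-- The element `V` in the given idempotent. -/
def V : Bool → KMon
  | false => poly 0 1
  | true => laur 0 1

/-- The left idempotent of a monomial. -/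
def left : KMon → Bool
  | poly _ _ => false
  | _ => true

/-- The product of a list of monomials, to be read as acting from the idempotent `ε` on. -/
def prod (ε : Bool) (l : List KMon) : Option KMon :=
  l.foldr (fun b acc => acc.bind (mul b)) (some (one ε))

end KMon

/-! ## Modules

A vector space with a chosen basis `B`; finite formal sums over `F` are written as lists.  The labels
`A` are a monomial basis of the algebra: `KMon` for `K`, and `KMon × KMon` for `K ⊗ K` (the pair `(a, b)`
is `a ⊗ b`); `J` is the set of idempotents.  Each structure operation is required to be continuous for
the cofinite basis topology, in the form: each basis element is hit by finitely many basis elements.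
Only the operations are recorded in these structures, not the quadratic relations they satisfy. -/

/-- The data of a right type-`D` module: `δ x` lists the summands `y ⊗ a` of `δ¹(x)`. -/
structure TypeD (A J : Type) where
  B : Type
  idem : B → J
  δ : B → List (B × A)
  fin : ∀ y, {x | ∃ a, (y, a) ∈ δ x}.Finite

/-- The iterated operation `δ^j = (δ¹ ⊗ id) ∘ δ^(j-1)`: the pair `(y, [a_j, …, a_1])` is the summand
`y ⊗ a_j ⊗ ⋯ ⊗ a_1`. -/
def TypeD.iter {A J : Type} (X : TypeD A J) : ℕ → X.B → List (X.B × List A)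
  | 0, x => [(x, [])]
  | j + 1, x => (X.iter j x).flatMap fun p => (X.δ p.1).map fun q => (q.1, q.2 :: p.2)

/-- The data of a type-`DA` bimodule: `δ [a_j, …, a_1] m` lists the summands `n ⊗ b` of
`δ¹_{j+1}(a_j, …, a_1, m)`, which vanishes for `j > N`. -/
structure TypeDA (A J A' J' : Type) where
  B : Type
  lidem : B → J
  ridem : B → J'
  N : ℕ
  δ : List A → B → List (B × A')
  bound : ∀ l m, N < l.length → δ l m = []
  fin : ∀ l n, {m | ∃ b, (n, b) ∈ δ l m}.Finite

/-- The data of a left type-`A` module: `m [a_j, …, a_1] x` lists the summands of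
`m_{j+1}(a_j, …, a_1, x)`, which vanishes for `j > N`. -/
structure TypeA (A J : Type) where
  B : Type
  idem : B → J
  N : ℕ
  m : List A → B → List B
  bound : ∀ l x, N < l.length → m l x = []
  fin : ∀ l y, {x | y ∈ m l x}.Finite

theorem TypeD.iter_fin {A J : Type} (X : TypeD A J) (j : ℕ) (y : X.B) :
    {p : X.B × List A | (y, p.2) ∈ X.iter j p.1}.Finite := by
  induction j generalizing y with
  | zero =>
    refine (Set.finite_singleton ((y, []) : X.B × List A)).subset ?_
    rintro ⟨x, l⟩ h
    simp only [TypeD.iter, List.mem_singleton, Set.mem_ofPred_eq, Prod.mk.injEq] at h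
    simp [h.1, h.2]
  | succ j ih =>
    refine ((X.fin y).biUnion fun z _ => (ih z).biUnion fun p _ =>
      ((X.δ z).map fun q => (p.1, q.2 :: p.2)).finite_toSet).subset ?_
    rintro ⟨x, l⟩ h
    simp only [TypeD.iter, Set.mem_ofPred_eq, List.mem_flatMap, List.mem_map, Prod.mk.injEq] at h
    obtain ⟨⟨z, l'⟩, hz, ⟨y', a⟩, ha, rfl, rfl⟩ := h
    simp only [Set.mem_iUnion, Set.mem_ofPred_eq, List.mem_map, Prod.exists]
    exact ⟨z, ⟨a, ha⟩, x, l', hz, y', a, ha, rfl⟩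

/-- The box tensor product of a type-`D` module and a type-`DA` bimodule:
`δ¹ = ∑_j (id ⊗ δ¹_{j+1}) ∘ (δ^j ⊗ id)` on the tensor product over the idempotents. -/
def TypeD.box {A J A' J' : Type} [DecidableEq J] (X : TypeD A J) (M : TypeDA A J A' J') :
    TypeD A' J' where
  B := {p : X.B × M.B // X.idem p.1 = M.lidem p.2}
  idem p := M.ridem p.1.2
  δ p := (List.range (M.N + 1)).flatMap fun j => (X.iter j p.1.1).flatMap fun q =>
    (M.δ q.2 p.1.2).filterMap fun r =>
      if h : X.idem q.1 = M.lidem r.1 then some (⟨(q.1, r.1), h⟩, r.2) else none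
  fin := by
    rintro ⟨⟨y, n⟩, hyn⟩
    refine Set.Finite.of_finite_image (f := Subtype.val) ?_ Subtype.val_injective.injOn
    refine ((Set.finite_lt_nat (M.N + 1)).biUnion fun j _ => (X.iter_fin j y).biUnion fun p _ =>
      (M.fin p.2 n).image fun m => (p.1, m)).subset ?_
    rintro _ ⟨⟨⟨x, m⟩, hxm⟩, ⟨b, hb⟩, rfl⟩
    simp only [List.mem_flatMap, List.mem_range, List.mem_filterMap] at hb
    obtain ⟨j, hj, ⟨y', l⟩, hy, ⟨n', b'⟩, hn, heq⟩ := hb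
    split_ifs at heq with hc
    simp only [Option.some.injEq, Prod.mk.injEq, Subtype.mk.injEq] at heq
    obtain ⟨⟨rfl, rfl⟩, rfl⟩ := heq
    simp only [Set.mem_iUnion, Set.mem_ofPred_eq, Set.mem_image, Prod.exists, Prod.mk.injEq]
    exact ⟨j, hj, x, l, hy, m, ⟨b', hn⟩, rfl, rfl⟩

/-- The external tensor product of two type-`D` modules over `K`, a type-`D` module over `K ⊗ K`, with
`δ¹ = δ¹ ⊗ (id ⊗ 1) + (id ⊗ 1) ⊗ δ¹`. -/
def TypeD.tensor (X Y : TypeD KMon Bool) : TypeD (KMon × KMon) (Bool × Bool) where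
  B := X.B × Y.B
  idem p := (X.idem p.1, Y.idem p.2)
  δ p := ((X.δ p.1).map fun q => ((q.1, p.2), (q.2, KMon.one (Y.idem p.2)))) ++
    ((Y.δ p.2).map fun q => ((p.1, q.1), (KMon.one (X.idem p.1), q.2)))
  fin := by
    rintro ⟨y₁, y₂⟩
    refine (((X.fin y₁).image fun x => (x, y₂)).union
      ((Y.fin y₂).image fun x => (y₁, x))).subset ?_
    rintro ⟨x₁, x₂⟩ ⟨a, ha⟩
    simp only [List.mem_append, List.mem_map, Prod.mk.injEq] at ha
    rcases ha with ⟨⟨z, b⟩, hz, ⟨rfl, rfl⟩, -⟩ | ⟨⟨z, b⟩, hz, ⟨rfl, rfl⟩, -⟩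
    · exact Or.inl ⟨x₁, ⟨b, hz⟩, rfl⟩
    · exact Or.inr ⟨x₂, ⟨b, hz⟩, rfl⟩

/-! ## Solid tori -/

/-- The type-`D` module of the `n`-framed solid torus: generators `i₀`, `i₁` and
`δ¹(i₀) = i₁ ⊗ (σ + V^n τ)`. -/
def solidTorusD (n : ℤ) : TypeD KMon Bool where
  B := Bool
  idem := id
  δ
    | false => [(true, .sig 0 0), (true, .tau 0 n)]
    | true => []
  fin _ := Set.toFinite _

/-- The monomial basis of the type-`A` module `D_n`: `I₀ D_n = F[U,V]`, `I₁ D_n = F[U,V,V⁻¹]`. -/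
inductive DMon
  | poly (i j : ℕ)
  | laur (i : ℕ) (j : ℤ)
  deriving DecidableEq

namespace DMon

/-- The idempotent of a monomial. -/
def idem : DMon → Bool
  | poly _ _ => false
  | laur _ _ => true

/-- The action of `K` on the type-`A` module `D_n` (its only operation `m₂`; `none` means zero):
`σ x = I(x)` and `τ x = V^n T(x)`. -/
def act (n : ℤ) : KMon → DMon → Option DMon
  | .poly i j, poly k l => some (poly (i + k) (j + l))
  | .laur i j, laur k l => some (laur (i + k) (j + l))
  | .sig i j, poly k l => some (laur (i + k) (j + l))
  | .tau i j, poly k l => some (laur (i + l) (j + n + (2 * l - k)))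
  | _, _ => none

theorem act_inj (n : ℤ) (a : KMon) {x x' y : DMon} (h : act n a x = some y)
    (h' : act n a x' = some y) : x = x' := by
  cases a <;> cases x <;> cases x' <;> simp_all only [act, Option.some.injEq, reduceCtorEq] <;>
    cases y <;> simp_all <;> omega

/-- The Alexander grading of a monomial. -/
def alex : DMon → ℤ
  | poly i j => j - i
  | laur i j => j - i

/-- The largest power of `UV` that divides a monomial. -/
def upow : DMon → ℕ
  | poly i j => min i j
  | laur i _ => i

/-- The monomial of Alexander grading `s` which generates that grading over `F[UV]`. -/
def gen : Bool → ℤ → DMon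
  | false, s => poly (-s).toNat s.toNat
  | true, s => laur 0 s

/-- Multiplication by `(UV)^k`. -/
def mulU (k : ℕ) : DMon → DMon
  | poly i j => poly (k + i) (k + j)
  | laur i j => laur (k + i) (k + j)

theorem mulU_gen (q : DMon) : mulU q.upow (gen q.idem q.alex) = q := by
  cases q <;> simp only [mulU, gen, idem, alex, upow, poly.injEq, laur.injEq] <;> omega

/-- How a monomial of `K` shifts the Alexander grading of `D_n`. -/
def shift (n : ℤ) : KMon → ℤ
  | .poly i j => j - i
  | .laur i j => j - i
  | .sig i j => j - i
  | .tau i j => j + n - i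

theorem alex_act (n : ℤ) (a : KMon) {x y : DMon} (h : act n a x = some y) :
    y.alex = x.alex + shift n a := by
  cases a <;> cases x <;> simp only [act, Option.some.injEq, reduceCtorEq] at h <;>
    subst h <;> simp only [alex, shift] <;> push_cast <;> ring

theorem alex_gen (ε : Bool) (s : ℤ) : (gen ε s).alex = s := by
  cases ε <;> simp only [gen, alex] <;> omega

end DMon

/-! ## The merge bimodule and the type-`AA` identity bimodule -/

/-- The operations of the merge bimodule: `δ¹_2(a ⊗ b, i_ε) = i_ε ⊗ ab` for `a`, `b` in the idempotent
`ε`, and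
`δ¹_3(f σ ⊗ g, f' ⊗ g' σ, i₀) = i₁ ⊗ f I(f') g g' σ`,
`δ¹_3(f τ ⊗ g, f' ⊗ g' τ, i₀) = i₁ ⊗ f T(f') g g' τ`,
which is the extension of `δ¹_3(σ ⊗ 1, 1 ⊗ σ, i₀) = i₁ ⊗ σ` and
`δ¹_3(τ ⊗ 1, 1 ⊗ τ, i₀) = i₁ ⊗ τ` that the bimodule relations force. -/
def mergeδ : List (KMon × KMon) → Bool → List (Bool × KMon)
  | [(.poly i j, .poly k l)], false => [(false, .poly (i + k) (j + l))]
  | [(.laur i j, .laur k l)], true => [(true, .laur (i + k) (j + l))]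
  | [(.sig i j, .laur k l), (.poly p q, .sig r s)], false =>
      [(true, .sig (i + p + k + r) (j + q + l + s))]
  | [(.tau i j, .laur k l), (.poly p q, .tau r s)], false =>
      [(true, .tau (i + q + k + r) (j + (2 * q - p) + l + s))]
  | _, _ => []

/-- The merge bimodule `M₂`, a type-`DA` bimodule over `(K ⊗ K, K)`. -/
def merge : TypeDA (KMon × KMon) (Bool × Bool) KMon Bool where
  B := Bool
  lidem ε := (ε, ε)
  ridem := id
  N := 2
  δ := mergeδ
  bound l m h := by
    unfold mergeδ
    split <;> simp_all
  fin _ _ := Set.toFinite _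

/-- The box tensor product of a type-`DA` bimodule over `(A, K)` with the type-`A` module `D_n` (which
has only the operation `m₂`, so that exactly one output of the bimodule is consumed). -/
def TypeDA.boxSolidTorus {A J : Type} (M : TypeDA A J KMon Bool) (n : ℤ) : TypeA A J where
  B := {p : M.B × DMon // M.ridem p.1 = p.2.idem}
  idem p := M.lidem p.1.1
  N := M.N
  m l p := (M.δ l p.1.1).filterMap fun q => (DMon.act n q.2 p.1.2).bind fun y =>
    if h : M.ridem q.1 = y.idem then some ⟨(q.1, y), h⟩ else none
  bound l p h := by simp [M.bound l p.1.1 h]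
  fin := by
    rintro l ⟨⟨m', y⟩, hy⟩
    refine Set.Finite.of_finite_image (f := Subtype.val) ?_ Subtype.val_injective.injOn
    have key : ∀ a : KMon, {x | DMon.act n a x = some y}.Finite := fun a =>
      Set.Subsingleton.finite fun x hx x' hx' => DMon.act_inj n a hx hx'
    refine ((M.fin l m').biUnion fun m _ => ((M.δ l m).finite_toSet).biUnion fun q _ =>
      (key q.2).image fun x => (m, x)).subset ?_
    rintro _ ⟨⟨⟨m, x⟩, hx⟩, hmem, rfl⟩
    simp only [Set.mem_ofPred_eq, List.mem_filterMap, Option.bind_eq_some_iff] at hmem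
    obtain ⟨⟨m'', a⟩, hq, y', hact, heq⟩ := hmem
    split_ifs at heq with hc
    simp only [Option.some.injEq, Subtype.mk.injEq, Prod.mk.injEq] at heq
    obtain ⟨rfl, rfl⟩ := heq
    simp only [Set.mem_iUnion, Set.mem_ofPred_eq, Set.mem_image, Prod.exists, Prod.mk.injEq]
    exact ⟨m, ⟨a, hq⟩, m'', a, hq, x, hact, rfl, rfl⟩

/-- The type-`AA` identity bimodule: the merge bimodule tensored with `D_0`. -/
def identityAA : TypeA (KMon × KMon) (Bool × Bool) := merge.boxSolidTorus 0

/-- All ways to merge the sequences of inputs `c_1, c_2, …` and `a_1, a_2, …` (in order of application)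
into one sequence of elements `c ⊗ 1` and `1 ⊗ a` of `K ⊗ K`, written with the last applied element
first; `i` and `j` are the current idempotents. -/
def shuffles : Bool → Bool → List KMon → List KMon → List (List (KMon × KMon))
  | _, _, [], [] => [[]]
  | _, j, c :: cs, [] => (shuffles c.left j cs []).map (· ++ [(c, KMon.one j)])
  | i, _, [], a :: as => (shuffles i a.left [] as).map (· ++ [(KMon.one i, a)])
  | i, j, c :: cs, a :: as =>
      ((shuffles c.left j cs (a :: as)).map (· ++ [(c, KMon.one j)])) ++
      ((shuffles i a.left (c :: cs) as).map (· ++ [(KMon.one i, a)]))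
  termination_by _ _ cs as => cs.length + as.length

theorem length_of_mem_shuffles (i j : Bool) (cs as : List KMon) :
    ∀ l ∈ shuffles i j cs as, l.length = cs.length + as.length := by
  induction i, j, cs, as using shuffles.induct with
  | case1 => simp [shuffles]
  | case2 i j c cs ih =>
    intro l hl
    simp only [shuffles, List.mem_map] at hl
    obtain ⟨l', hl', rfl⟩ := hl
    have := ih l' hl'
    simp at this ⊢
    omega
  | case3 i j a as ih =>
    intro l hl
    simp only [shuffles, List.mem_map] at hl
    obtain ⟨l', hl', rfl⟩ := hl
    have := ih l' hl'
    simp at this ⊢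
    omega
  | case4 i j c cs a as ih₁ ih₂ =>
    intro l hl
    simp only [shuffles, List.mem_append, List.mem_map] at hl
    rcases hl with ⟨l', hl', rfl⟩ | ⟨l', hl', rfl⟩
    · have := ih₁ l' hl'
      simp at this ⊢
      omega
    · have := ih₂ l' hl'
      simp at this ⊢
      omega

/-- The box tensor product, along the first algebra factor, of a type-`D` module `H` over `K ⊗ K` with
a type-`A` module `N` over `K ⊗ K` (its second algebra factor).  The result is a type-`DA` bimodule:
its inputs go into the first algebra factor of `N`, and the elements of the second algebra factor of
`H` are multiplied to form the output. -/
def TypeD.boxOne (H : TypeD (KMon × KMon) (Bool × Bool)) (N : TypeA (KMon × KMon) (Bool × Bool)) :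
    TypeDA KMon Bool KMon Bool where
  B := {p : H.B × N.B // (H.idem p.1).1 = (N.idem p.2).2}
  lidem p := (N.idem p.1.2).1
  ridem p := (H.idem p.1.1).2
  N := N.N
  δ cs p := (List.range (N.N + 1)).flatMap fun k => (H.iter k p.1.1).flatMap fun q =>
    (shuffles (N.idem p.1.2).1 (N.idem p.1.2).2 cs.reverse (q.2.map Prod.fst).reverse).flatMap
      fun l => (N.m l p.1.2).filterMap fun y =>
        if h : (H.idem q.1).1 = (N.idem y).2 then
          (KMon.prod (H.idem p.1.1).2 (q.2.map Prod.snd)).map fun b => (⟨(q.1, y), h⟩, b)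
        else none
  bound cs p h := by
    refine List.eq_nil_iff_forall_not_mem.2 fun r hr => ?_
    simp only [List.mem_flatMap, List.mem_filterMap] at hr
    obtain ⟨k, -, q, -, l, hl, y, hy, -⟩ := hr
    have hlen := length_of_mem_shuffles _ _ _ _ l hl
    rw [N.bound l p.1.2 (by simp at hlen; omega)] at hy
    simp at hy
  fin := by
    rintro cs ⟨⟨h', y⟩, hy⟩
    refine Set.Finite.of_finite_image (f := Subtype.val) ?_ Subtype.val_injective.injOn
    refine ((Set.finite_lt_nat (N.N + 1)).biUnion fun k _ => (H.iter_fin k h').biUnion fun p _ =>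
      (Set.finite_univ (α := Bool × Bool)).biUnion fun e _ =>
      ((shuffles e.1 e.2 cs.reverse (p.2.map Prod.fst).reverse).finite_toSet).biUnion fun l _ =>
      (N.fin l y).image fun x => (p.1, x)).subset ?_
    rintro _ ⟨⟨⟨h, x⟩, hx⟩, ⟨b, hb⟩, rfl⟩
    simp only [List.mem_flatMap, List.mem_range, List.mem_filterMap] at hb
    obtain ⟨k, hk, ⟨h'', w⟩, hw, l, hl, y', hy', heq⟩ := hb
    split_ifs at heq with hc
    simp only [Option.map_eq_some_iff, Prod.mk.injEq, Subtype.mk.injEq] at heq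
    obtain ⟨b', -, ⟨rfl, rfl⟩, rfl⟩ := heq
    simp only [Set.mem_iUnion, Set.mem_ofPred_eq, Set.mem_image, Prod.exists, Prod.mk.injEq]
    exact ⟨k, hk, h, w, hw, (N.idem x).1, (N.idem x).2, Set.mem_univ _, l, hl, x, hy', rfl, rfl⟩

/-! ## The Hopf link -/

/-- The generators of the link Floer complex of the negative Hopf link. -/
inductive HopfGen
  | a | b | c | d
  deriving DecidableEq

instance : Finite HopfGen :=
  Finite.of_surjective (fun n : Fin 4 => match n with
    | 0 => HopfGen.a | 1 => .b | 2 => .c | 3 => .d)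
    (fun g => match g with
      | .a => ⟨0, rfl⟩ | .b => ⟨1, rfl⟩ | .c => ⟨2, rfl⟩ | .d => ⟨3, rfl⟩)

namespace HopfGen

/-- The differential: `∂b = U₂ a + U₁ d`, `∂c = V₁ a + V₂ d`, `∂a = ∂d = 0`; `e₁`, `e₂` are the
idempotents. -/
def diff (e₁ e₂ : Bool) : HopfGen → List (HopfGen × KMon × KMon)
  | b => [(a, .one e₁, .U e₂), (d, .U e₁, .one e₂)]
  | c => [(a, .V e₁, .one e₂), (d, .one e₁, .V e₂)]
  | _ => []

/-- The map for the reversed first component, with framing `n`. -/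
def neg₁ (n : ℤ) (e₂ : Bool) : HopfGen → List (HopfGen × KMon × KMon)
  | a => [(d, .tau 0 (n - 1), .one e₂)]
  | b => []
  | c => [(b, .tau 0 (n + 1), .one e₂), (c, .tau 0 n, .U e₂)]
  | d => [(d, .tau 0 n, .U e₂)]

/-- The map for the reversed second component, with framing `n`. -/
def neg₂ (n : ℤ) (e₁ : Bool) : HopfGen → List (HopfGen × KMon × KMon)
  | a => [(a, .U e₁, .tau 0 n)]
  | b => []
  | c => [(b, .one e₁, .tau 0 (n + 1)), (c, .U e₁, .tau 0 n)]
  | d => [(a, .one e₁, .tau 0 (n - 1))]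

/-- The length two map for both components reversed, for the system of arcs with one alpha-parallel
and one beta-parallel arc. -/
def neg₁₂ (n₁ n₂ : ℤ) : HopfGen → List (HopfGen × KMon × KMon)
  | a => [(c, .tau 0 (n₁ - 2), .tau 0 (n₂ - 1))]
  | d => [(c, .tau 0 (n₁ - 1), .tau 0 (n₂ - 2))]
  | _ => []

end HopfGen

/-- The link surgery complex of the negative Hopf link with framings `n₁`, `n₂`, as a type-`D` module
over `K ⊗ K`, for the system of arcs with one alpha-parallel and one beta-parallel arc. -/
def hopfD (n₁ n₂ : ℤ) : TypeD (KMon × KMon) (Bool × Bool) where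
  B := HopfGen × Bool × Bool
  idem x := x.2
  δ
    | (g, e₁, e₂) =>
      ((g.diff e₁ e₂).map fun q => ((q.1, e₁, e₂), q.2)) ++
      (if e₁ = false then
        ((g, true, e₂), (.sig 0 0, .one e₂)) :: ((g.neg₁ n₁ e₂).map fun q => ((q.1, true, e₂), q.2))
        else []) ++
      (if e₂ = false then
        ((g, e₁, true), (.one e₁, .sig 0 0)) :: ((g.neg₂ n₂ e₁).map fun q => ((q.1, e₁, true), q.2))
        else []) ++
      (if e₁ = false ∧ e₂ = false then (g.neg₁₂ n₁ n₂).map fun q => ((q.1, true, true), q.2) else [])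
  fin _ := Set.toFinite _

/-- The type-`DA` bimodule of the negative Hopf link: the type-`D` module over `K ⊗ K` tensored with the
type-`AA` identity bimodule along its first algebra factor. -/
def hopfDA (n₁ n₂ : ℤ) : TypeDA KMon Bool KMon Bool := (hopfD n₁ n₂).boxOne identityAA

/-! ## Complexes over `F[[U]]` -/

/-- A direct product `∏ F[[U]]` over a set `Idx` of generators with a continuous `F[[U]]`-linear
endomorphism, given by its values on the generators; it is continuous if each generator occurs in
finitely many of these values. -/
structure ProductComplex where
  Idx : Type*
  bd : Idx → Idx →₀ PowerSeries F2
  fin : ∀ q, {p | bd p q ≠ 0}.Finite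

namespace ProductComplex

/-- The underlying `F[[U]]`-module, a direct product. -/
abbrev Carrier (C : ProductComplex) : Type _ := C.Idx → PowerSeries F2

/-- The endomorphism of the direct product. -/
noncomputable def d (C : ProductComplex) : C.Carrier →ₗ[PowerSeries F2] C.Carrier where
  toFun f q := ∑ p ∈ (C.fin q).toFinset, f p * C.bd p q
  map_add' f g := by
    ext1 q
    simp [add_mul, Finset.sum_add_distrib]
  map_smul' r f := by
    ext1 q
    simp [mul_assoc, Finset.mul_sum]

/-- The endomorphism is a differential. -/
def IsComplex (C : ProductComplex) : Prop := C.d ∘ₗ C.d = 0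

/-- Homotopy equivalence over `F[[U]]`. -/
def HomotopyEquivalent (C D : ProductComplex) : Prop :=
  ∃ (f : C.Carrier →ₗ[PowerSeries F2] D.Carrier) (g : D.Carrier →ₗ[PowerSeries F2] C.Carrier)
    (h : C.Carrier →ₗ[PowerSeries F2] C.Carrier) (k : D.Carrier →ₗ[PowerSeries F2] D.Carrier),
    D.d ∘ₗ f = f ∘ₗ C.d ∧ C.d ∘ₗ g = g ∘ₗ D.d ∧
    g ∘ₗ f = LinearMap.id + (C.d ∘ₗ h + h ∘ₗ C.d) ∧
    f ∘ₗ g = LinearMap.id + (D.d ∘ₗ k + k ∘ₗ D.d)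

end ProductComplex

open Classical in
/-- The completed box tensor product of a type-`D` module over `K` with the bimodule `D_n` over
`(K, F[U])`, on which `U` acts as the product of the two variables.  The basis of `D_n` in each
idempotent is `(UV)^k` times the generator of Alexander grading `s`; so the completion for the
cofinite basis topology, which allows all infinite sums of basis elements, is the direct product of
copies of `F[[U]]` over all pairs `(x, s)`. -/
noncomputable def TypeD.boxFinal (X : TypeD KMon Bool) (n : ℤ) : ProductComplex where
  Idx := X.B × ℤ
  bd p := ((X.δ p.1).filterMap fun q => (DMon.act n q.2 (DMon.gen (X.idem p.1) p.2)).map fun y =>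
    Finsupp.single (q.1, y.alex) ((PowerSeries.X : PowerSeries F2) ^ y.upow)).sum
  fin := by
    rintro ⟨y, t⟩
    refine ((X.fin y).biUnion fun x _ => ((X.δ x).finite_toSet).biUnion fun q _ =>
      Set.finite_singleton (x, t - DMon.shift n q.2)).subset ?_
    rintro ⟨x, s⟩ hne
    by_contra hcon
    apply hne
    simp only [Set.mem_iUnion, Set.mem_ofPred_eq, Set.mem_singleton_iff, Prod.mk.injEq, not_exists]
      at hcon
    have key : ∀ l : List ((X.B × ℤ) →₀ PowerSeries F2), (∀ z ∈ l, z (y, t) = 0) →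
        l.sum (y, t) = 0 := by
      intro l
      induction l with
      | nil => simp
      | cons z l ih =>
        intro h
        simp only [List.mem_cons, forall_eq_or_imp] at h
        simp [h.1, ih h.2]
    refine key _ fun z hz => ?_
    simp only [List.mem_filterMap, Option.map_eq_some_iff] at hz
    obtain ⟨⟨y', a⟩, hq, r, hr, rfl⟩ := hz
    refine Finsupp.single_eq_of_ne fun heq => ?_
    simp only [Prod.mk.injEq] at heq
    obtain ⟨rfl, rfl⟩ := heq
    have := DMon.alex_act n a hr
    rw [DMon.alex_gen] at this
    exact hcon x ⟨a, hq⟩ (y, a) hq ⟨rfl, by dsimp only; omega⟩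

/-! ## Rooted trees and the complex obtained by iterated tensor products -/

/-- A recipe for building a rooted tree: start with a single vertex, join two rooted trees at their
roots, or attach a new vertex to the root and make it the new root.  In the last case the weight `n` of
the old root is recorded; the root of a recipe carries no weight. -/
inductive TreeRecipe
  | vertex
  | join (S T : TreeRecipe)
  | grow (n : ℤ) (T : TreeRecipe)

namespace TreeRecipe

/-- The vertices other than the root. -/
def NonRoot : TreeRecipe → Type
  | vertex => Empty
  | join S T => S.NonRoot ⊕ T.NonRoot
  | grow _ T => Option T.NonRoot

/-- All vertices; `none` is the root. -/
abbrev Vertex (T : TreeRecipe) : Type := Option T.NonRoot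

/-- The neighbor in the direction of the root. -/
def parent : (T : TreeRecipe) → T.NonRoot → T.Vertex
  | vertex, x => nomatch x
  | join S _, .inl x => (S.parent x).map .inl
  | join _ T, .inr x => (T.parent x).map .inr
  | grow _ _, none => none
  | grow _ T, some x => some (T.parent x)

/-- The weights of the vertices other than the root. -/
def weight : (T : TreeRecipe) → T.NonRoot → ℤ
  | vertex, x => nomatch x
  | join S _, .inl x => S.weight x
  | join _ T, .inr x => T.weight x
  | grow n _, none => n
  | grow _ T, some x => T.weight x

/-- Adjacency of vertices. -/
def Adj (T : TreeRecipe) (u v : T.Vertex) : Prop :=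
  (∃ x, u = some x ∧ v = T.parent x) ∨ (∃ x, v = some x ∧ u = T.parent x)

/-- The recipe builds the graph `G` with root `v₀` and weights `w`. -/
def Builds {V : Type*} (T : TreeRecipe) (G : SimpleGraph V) (w : V → ℤ) (v₀ : V) : Prop :=
  ∃ φ : T.Vertex ≃ V, φ none = v₀ ∧ (∀ x y, G.Adj (φ x) (φ y) ↔ T.Adj x y) ∧
    ∀ x, w (φ (some x)) = T.weight x

/-- The type-`D` module over `K` of a rooted tree: the `0`-framed solid torus for a single vertex, the
merge bimodule for joining two trees, and the Hopf link bimodule with framings `(n, 0)` for attaching a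
new root to an old root of weight `n`. -/
def typeD : TreeRecipe → TypeD KMon Bool
  | vertex => solidTorusD 0
  | join S T => (S.typeD.tensor T.typeD).box merge
  | grow n T => T.typeD.box (hopfDA n 0)

/-- The complex over `F[[U]]` obtained by iterated tensor products, where the root has weight `n`. -/
noncomputable def complex (T : TreeRecipe) (n : ℤ) : ProductComplex := T.typeD.boxFinal n

end TreeRecipe

/-! ## The lattice complex -/

section Lattice

variable {V : Type*} [Fintype V] [DecidableEq V] (G : SimpleGraph V) [DecidableRel G.Adj] (w : V → ℤ)

/-- The intersection form of the plumbing on `H₂ = ℤ^V`: `v · v = w v`, and `u · v` is `1` or `0`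
according to whether `u ≠ v` are adjacent. -/
def interForm : (V → ℤ) →ₗ[ℤ] (V → ℤ) →ₗ[ℤ] ℤ :=
  Matrix.toLinearMap₂' ℤ (Matrix.diagonal w + G.adjMatrix ℤ)

/-- Characteristic vectors: `K` in `H² = Hom(H₂, ℤ)` with `K(Σ) + Σ²` even for every `Σ` in `H₂`. -/
def Char : Type _ := {K : (V → ℤ) →ₗ[ℤ] ℤ // ∀ x, Even (K x + interForm G w x x)}

variable {G w}

/-- `K + 2 v^*`, where `v^*` is the Poincaré dual of `v`, that is, the functional `v · -`. -/
def Char.shift (K : Char G w) (v : V) : Char G w :=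
  ⟨K.1 + 2 • interForm G w (Pi.single v 1), fun x => by
    have := (K.2 x).add (even_two_mul (interForm G w (Pi.single v 1) x))
    rw [LinearMap.add_apply, LinearMap.smul_apply]
    simpa only [nsmul_eq_mul, Nat.cast_ofNat, add_right_comm] using this⟩

theorem Char.shift_injective (v : V) : Function.Injective fun K : Char G w => K.shift v := by
  intro K K' h
  exact Subtype.ext (add_right_cancel (congrArg Subtype.val h))

/-- The class of the sum of the vertices in `I`. -/
def classOf (I : Finset V) : V → ℤ := fun v => if v ∈ I then 1 else 0

/-- `f(K,I) = (K(Σ) + Σ²) / 2`, where `Σ` is the sum of the vertices in `I`. -/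
def Char.f (K : Char G w) (I : Finset V) : ℤ :=
  (K.1 (classOf I) + interForm G w (classOf I) (classOf I)) / 2

/-- `g(K,E)`, the minimum of `f(K,I)` over all `I ⊆ E`. -/
def Char.g (K : Char G w) (E : Finset V) : ℤ :=
  E.powerset.inf' ⟨∅, Finset.empty_mem_powerset E⟩ K.f

/-- `a_v(K,E) = g(K, E - v) - g(K,E)`, for `v` in `E`. -/
def Char.a (K : Char G w) (E : Finset V) (v : V) : ℕ := (K.g (E.erase v) - K.g E).toNat

/-- `b_v(K,E) = min {f(K,I) : v ∈ I ⊆ E} - g(K,E)`, for `v` in `E`. -/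
def Char.b (K : Char G w) (E : Finset V) (v : V) : ℕ :=
  ((E.erase v).powerset.inf' ⟨∅, Finset.empty_mem_powerset _⟩ (fun I => K.f (insert v I)) -
    K.g E).toNat

variable (G w)

open Classical in
/-- The lattice complex, with
`∂[K,E] = ∑_{v ∈ E} U^{a_v(K,E)} [K, E - v] + ∑_{v ∈ E} U^{b_v(K,E)} [K + 2 v^*, E - v]`. -/
noncomputable def latticeComplex : ProductComplex where
  Idx := Char G w × Finset V
  bd p :=
    ∑ v ∈ p.2, Finsupp.single (p.1, p.2.erase v)
      ((PowerSeries.X : PowerSeries F2) ^ p.1.a p.2 v) +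
    ∑ v ∈ p.2, Finsupp.single (p.1.shift v, p.2.erase v)
      ((PowerSeries.X : PowerSeries F2) ^ p.1.b p.2 v)
  fin := by
    rintro ⟨K, E⟩
    have h1 : {p : Char G w × Finset V | p.1 = K}.Finite :=
      ((Set.finite_univ (α := Finset V)).image fun E => (K, E)).subset
        (by rintro ⟨K', E'⟩ rfl; exact ⟨E', Set.mem_univ _, rfl⟩)
    have h2 : ∀ v : V, {p : Char G w × Finset V | p.1.shift v = K}.Finite := fun v => by
      have hs : {K' : Char G w | K'.shift v = K}.Finite :=
        Set.Subsingleton.finite fun x hx y hy =>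
          Char.shift_injective v (Eq.trans hx (Eq.symm hy))
      exact (hs.prod (Set.finite_univ (α := Finset V))).subset
        fun p hp => ⟨hp, Set.mem_univ _⟩
    refine (h1.union ((Set.finite_univ (α := V)).biUnion fun v _ => h2 v)).subset ?_
    rintro ⟨K', E'⟩ hne
    by_contra hcon
    simp only [Set.mem_union, Set.mem_iUnion, Set.mem_ofPred_eq, Set.mem_univ, exists_prop,
      true_and, not_or, not_exists] at hcon
    apply hne
    rw [Finsupp.add_apply, Finsupp.finsetSum_apply, Finsupp.finsetSum_apply,
      Finset.sum_eq_zero, Finset.sum_eq_zero, add_zero]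
    · intro v _
      exact Finsupp.single_eq_of_ne fun h => hcon.2 v (congrArg Prod.fst h).symm
    · intro v _
      exact Finsupp.single_eq_of_ne fun h => hcon.1 (congrArg Prod.fst h).symm

end Lattice

end PlumbingLattice

namespace PlumbingLattice

/-! ## Linear operators on spaces with a chosen basis -/

/-! Split the operation of the type-D module of a recipe by weight: a part `d` without `σ` and `τ`,
the identity in weight `σ`, and a `T`-semilinear map `t` in weight `τ`. Tensoring with the solid
torus of framing n turns this into the cone of 1 + V^n t from root idempotent zero to root
idempotent one (`cone`). It is convenient to let all exponents be arbitrary integers; the actual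
complex is then the span of certain basis elements ("honest" ones), and an operator restricts to it
when it preserves these.

A cell records, for each vertex other than the root, an idempotent (zero means that the vertex lies
in E) and an integer. Let `d0` be the part of `d` that changes no idempotent. For a single edge of
the tree, fixing the cell and the absolute exponents leaves a line: the monomial multiples of a and
d are its vertices, those of b and c its edges, and the Hopf differential sends an edge to its two
ends. A line contracts to any of its vertices (`line_htpy`). The honest positions start at a first
admissible one, so contracting towards that one preserves honesty. Contractions pass to tensor
products (`Good.join`) and compose with the contraction of a new line (`Good.grow`), so every recipe
has a contraction of `d0` onto its cells.

The rest of the differential strictly lowers the number of vertices in idempotent zero. The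
augmentation onto cells is a strict chain map for the whole differential; in particular it kills the
length two map of the Hopf link, so the cells carry no higher terms. The contraction fails for the
whole differential by a nilpotent operator only, and a finite geometric series corrects it
(`homotopyEquivalent_of_contraction`). All operators involved commute with U and have finite fibres
on the basis, so they extend to the completed products of power series (`hat`).

It remains to recognise the cells as the lattice complex. The differential on cells has two summands
for each vertex in E (`dL_cell`, `cone_state`). The least honest exponents of a cell are minus the
minimum of a quadratic function over subsets of E (`low_cell`): the maximum of two bounds at the
start of a line is the choice whether the old root belongs to the subset. This is the function
f(K,I) except that edges enter with the opposite sign. A tree is bipartite; negating coordinates on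
one side F and replacing I by its symmetric difference with E ∩ F repairs the sign
(`two_mul_sum_flip`), at the price of interchanging the two summands of the differential at vertices
of F.

That every rooted tree has a recipe follows by splitting off the branch of a child of the root
(`exists_of_parent`). -/

/-- Linear maps between vector spaces with chosen bases. -/
abbrev Op (α β : Type*) := (α →₀ F2) →ₗ[F2] (β →₀ F2)

/-- The basis vectors. -/
noncomputable abbrev bv {α : Type*} (a : α) : α →₀ F2 := Finsupp.single a 1

theorem add_self_zero {M : Type*} [AddCommGroup M] [Module F2 M] (x : M) : x + x = 0 :=
  ZModModule.add_self x

theorem eq_of_add_eq_zero' {M : Type*} [AddCommGroup M] [Module F2 M] {x y : M} (h : x + y = 0) :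
    x = y := by
  have := ZModModule.neg_eq_self y
  rw [← this]; exact eq_neg_of_add_eq_zero_left h

theorem add_eq_iff {M : Type*} [AddCommGroup M] [Module F2 M] {x y z : M} :
    x + y = z ↔ x = z + y := by
  constructor
  · rintro rfl; rw [add_assoc, add_self_zero, add_zero]
  · rintro rfl; rw [add_assoc, add_self_zero, add_zero]

namespace Op

variable {α β γ δ α' β' γ' : Type*}

/-- The operator with given values on the basis. -/
noncomputable def ofBasis (f : α → β →₀ F2) : Op α β := Finsupp.linearCombination F2 f

@[simp] theorem ofBasis_bv (f : α → β →₀ F2) (a : α) : ofBasis f (bv a) = f a := by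
  simp [ofBasis]

theorem ext_bv {M : Type*} [AddCommGroup M] [Module F2 M] {A B : (α →₀ F2) →ₗ[F2] M}
    (h : ∀ a, A (bv a) = B (bv a)) : A = B := by
  refine Finsupp.lhom_ext' fun a => LinearMap.ext_ring ?_
  simpa using h a

theorem eq_of_bv {M : Type*} [AddCommGroup M] [Module F2 M] {A B : (α →₀ F2) →ₗ[F2] M}
    (h : ∀ a, A (bv a) = B (bv a)) (x : α →₀ F2) : A x = B x := by rw [ext_bv h]

/-- The operator which relabels basis vectors. -/
noncomputable def map (f : α → β) : Op α β := Finsupp.lmapDomain F2 F2 f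

@[simp] theorem map_bv (f : α → β) (a : α) : map f (bv a) = bv (f a) := by simp [map]

theorem map_map (f : α → β) (g : β → γ) (x : α →₀ F2) : map g (map f x) = map (fun a => g (f a)) x := by
  refine eq_of_bv (A := map g ∘ₗ map f) (fun a => ?_) x
  simp

/-- `A ⊗ id`. -/
noncomputable def onFst (γ : Type*) (A : Op α β) : Op (α × γ) (β × γ) :=
  ofBasis fun p => map (fun b => (b, p.2)) (A (bv p.1))

@[simp] theorem onFst_bv (A : Op α β) (a : α) (c : γ) :
    onFst γ A (bv (a, c)) = map (fun b => (b, c)) (A (bv a)) := by simp [onFst]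

theorem onFst_map (A : Op α β) (c : γ) (x : α →₀ F2) :
    onFst γ A (map (fun a => (a, c)) x) = map (fun b => (b, c)) (A x) := by
  refine eq_of_bv (A := onFst γ A ∘ₗ map (fun a => (a, c))) (B := map (fun b => (b, c)) ∘ₗ A)
    (fun a => ?_) x
  simp only [LinearMap.comp_apply, map_bv, onFst_bv]

theorem onFst_comp (A : Op α β) (B : Op β δ) : onFst γ (B ∘ₗ A) = onFst γ B ∘ₗ onFst γ A := by
  refine ext_bv fun ⟨a, c⟩ => ?_
  simp only [LinearMap.comp_apply, onFst_bv, onFst_map]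

theorem onFst_add (A B : Op α β) : onFst γ (A + B) = onFst γ A + onFst γ B := by
  refine ext_bv fun ⟨a, c⟩ => ?_
  simp only [LinearMap.add_apply, onFst_bv, map_add]

@[simp] theorem onFst_id : onFst γ (LinearMap.id : Op α α) = LinearMap.id := by
  refine ext_bv fun ⟨a, c⟩ => ?_
  simp [onFst_bv]

@[simp] theorem onFst_zero : onFst γ (0 : Op α β) = 0 := by
  refine ext_bv fun ⟨a, c⟩ => ?_
  simp [onFst_bv]

/-! ### Supports -/

/-- Every basis vector in the image of `a` is related to `a`. -/
def Supp (A : Op α β) (R : α → β → Prop) : Prop := ∀ a b, A (bv a) b ≠ 0 → R a b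

theorem apply_eq_sum (A : Op α β) (x : α →₀ F2) (b : β) : A x b = x.sum fun a c => c * A (bv a) b := by
  induction x using Finsupp.induction_linear with
  | zero => simp
  | add x y hx hy =>
    rw [map_add, Finsupp.add_apply, hx, hy, Finsupp.sum_add_index'] <;> simp [add_mul]
  | single a c =>
    rw [Finsupp.sum_single_index (by simp)]
    have : Finsupp.single a c = c • bv a := by simp
    rw [this, map_smul]; simp

theorem exists_of_apply_ne {A : Op α β} {x : α →₀ F2} {b : β} (h : A x b ≠ 0) :
    ∃ a, x a ≠ 0 ∧ A (bv a) b ≠ 0 := by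
  rw [apply_eq_sum] at h
  obtain ⟨a, ha, hne⟩ := Finset.exists_ne_zero_of_sum_ne_zero h
  exact ⟨a, Finsupp.mem_support_iff.1 ha, right_ne_zero_of_mul hne⟩

theorem ne_of_bv_ne {a b : α} (h : bv a b ≠ 0) : b = a := by
  by_contra hne; exact h (by simp [Ne.symm hne])

theorem map_ne {f : α → β} {x : α →₀ F2} {b : β} (h : map f x b ≠ 0) : ∃ a, x a ≠ 0 ∧ f a = b := by
  obtain ⟨a, ha, hne⟩ := exists_of_apply_ne h
  rw [map_bv] at hne
  exact ⟨a, ha, (ne_of_bv_ne hne).symm⟩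

theorem add_ne {x y : α →₀ F2} {a : α} (h : (x + y) a ≠ 0) : x a ≠ 0 ∨ y a ≠ 0 := by
  by_contra! hc
  exact h (by rw [Finsupp.add_apply, hc.1, hc.2, add_zero])

theorem Supp.comp {A : Op α β} {B : Op β γ} {R : α → β → Prop} {S : β → γ → Prop}
    (hA : Supp A R) (hB : Supp B S) : Supp (B ∘ₗ A) fun a c => ∃ b, R a b ∧ S b c := by
  intro a c h
  obtain ⟨b, hb, hc⟩ := exists_of_apply_ne (A := B) h
  exact ⟨b, hA a b hb, hB b c hc⟩

theorem Supp.add {A B : Op α β} {R : α → β → Prop} (hA : Supp A R) (hB : Supp B R) :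
    Supp (A + B) R := fun a b h => (add_ne h).elim (hA a b) (hB a b)

theorem Supp.mono {A : Op α β} {R S : α → β → Prop} (hA : Supp A R) (h : ∀ a b, R a b → S a b) :
    Supp A S := fun a b hab => h a b (hA a b hab)

theorem Supp.onFst {A : Op α β} {R : α → β → Prop} (hA : Supp A R) :
    Supp (onFst γ A) fun p q => R p.1 q.1 ∧ p.2 = q.2 := by
  rintro ⟨a, c⟩ q h
  rw [onFst_bv] at h
  obtain ⟨b, hb, rfl⟩ := map_ne h
  exact ⟨hA a b hb, rfl⟩

theorem Supp.of_map (f : α → β) : Supp (map f) fun a b => b = f a := by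
  intro a b h
  rw [map_bv] at h
  exact ne_of_bv_ne h

theorem Supp.zero (R : α → β → Prop) : Supp (0 : Op α β) R := fun a b h => by simp at h

end Op

/-! ### Exponents -/

/-- Exponents of monomials in two variables. -/
abbrev Z2 := ℤ × ℤ

/-- The effect of `T` on exponents. -/
def tw : Z2 →+ Z2 where
  toFun m := (m.2, 2 * m.2 - m.1)
  map_zero' := rfl
  map_add' m m' := by apply Prod.ext <;> simp; ring

/-- The inverse of `tw`. -/
def twInv : Z2 →+ Z2 where
  toFun m := (2 * m.1 - m.2, m.1)
  map_zero' := rfl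
  map_add' m m' := by apply Prod.ext <;> simp; ring

theorem tw_apply (m : Z2) : tw m = (m.2, 2 * m.2 - m.1) := rfl
theorem twInv_apply (m : Z2) : twInv m = (2 * m.1 - m.2, m.1) := rfl
@[simp] theorem tw_twInv (m : Z2) : tw (twInv m) = m := by ext <;> simp [tw_apply, twInv_apply]
@[simp] theorem twInv_tw (m : Z2) : twInv (tw m) = m := by ext <;> simp [tw_apply, twInv_apply]

namespace Op

variable {α β γ δ α' β' γ' : Type*}

/-- Multiplication by a monomial. -/
noncomputable def sh (μ : Z2) : Op (α × Z2) (α × Z2) := map fun p => (p.1, p.2 + μ)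

/-- A group homomorphism applied to exponents. -/
noncomputable def onExp (θ : Z2 →+ Z2) : Op (α × Z2) (α × Z2) := map fun p => (p.1, θ p.2)

@[simp] theorem sh_bv (μ : Z2) (a : α) (m : Z2) : sh μ (bv (a, m)) = bv (a, m + μ) := by simp [sh]
@[simp] theorem onExp_bv (θ : Z2 →+ Z2) (a : α) (m : Z2) :
    onExp θ (bv (a, m)) = bv (a, θ m) := by simp [onExp]

theorem onExp_id (x : α × Z2 →₀ F2) : onExp (AddMonoidHom.id Z2) x = x :=
  eq_of_bv (B := LinearMap.id) (fun ⟨a, m⟩ => by simp) x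

theorem onExp_twInv_tw : (onExp twInv : Op (α × Z2) _) ∘ₗ onExp tw = LinearMap.id :=
  ext_bv fun ⟨a, m⟩ => by simp only [LinearMap.comp_apply, onExp_bv, twInv_tw, LinearMap.id_apply]

/-- Semilinearity with respect to multiplication by monomials. -/
def Semi (θ : Z2 →+ Z2) (A : Op (α × Z2) (β × Z2)) : Prop := ∀ μ, A ∘ₗ sh μ = sh (θ μ) ∘ₗ A

/-- Linearity with respect to multiplication by monomials. -/
abbrev Lin (A : Op (α × Z2) (β × Z2)) : Prop := Semi (AddMonoidHom.id Z2) A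

theorem Semi.apply {θ : Z2 →+ Z2} {A : Op (α × Z2) (β × Z2)} (h : Semi θ A) (μ : Z2) (x) :
    A (sh μ x) = sh (θ μ) (A x) := LinearMap.congr_fun (h μ) x

theorem Lin.comm {A : Op (α × Z2) (β × Z2)} (h : Lin A) (μ : Z2) : A ∘ₗ sh μ = sh μ ∘ₗ A := h μ

theorem Lin.apply {A : Op (α × Z2) (β × Z2)} (h : Lin A) (μ : Z2) (x) :
    A (sh μ x) = sh μ (A x) := LinearMap.congr_fun (h.comm μ) x

theorem lin_of_comm {A : Op (α × Z2) (β × Z2)} (h : ∀ μ, A ∘ₗ sh μ = sh μ ∘ₗ A) : Lin A := h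

theorem semi_of_bv {θ : Z2 →+ Z2} {A : Op (α × Z2) (β × Z2)}
    (h : ∀ μ a m, A (bv (a, m + μ)) = sh (θ μ) (A (bv (a, m)))) : Semi θ A := fun μ =>
  ext_bv fun ⟨a, m⟩ => by simp only [LinearMap.comp_apply, sh_bv, h]

theorem Semi.bv {θ : Z2 →+ Z2} {A : Op (α × Z2) (β × Z2)} (h : Semi θ A) (a : α) (m m' : Z2) :
    A (bv (a, m)) = sh (θ (m - m')) (A (bv (a, m'))) := by
  rw [← h.apply, sh_bv, add_sub_cancel]

theorem Semi.add {θ : Z2 →+ Z2} {A B : Op (α × Z2) (β × Z2)} (hA : Semi θ A) (hB : Semi θ B) :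
    Semi θ (A + B) := fun μ => by
  rw [LinearMap.add_comp, LinearMap.comp_add, hA, hB]

theorem Semi.zero {θ : Z2 →+ Z2} : Semi θ (0 : Op (α × Z2) (β × Z2)) := fun μ => by simp

theorem semi_onExp (θ : Z2 →+ Z2) : Semi θ (onExp θ : Op (α × Z2) (α × Z2)) :=
  semi_of_bv fun μ a m => by simp

theorem lin_of_bv {A : Op (α × Z2) (β × Z2)}
    (h : ∀ μ a m, A (PlumbingLattice.bv (a, m + μ)) = sh μ (A (PlumbingLattice.bv (a, m)))) : Lin A :=
  lin_of_comm fun μ => ext_bv fun ⟨a, m⟩ => by simp only [LinearMap.comp_apply, sh_bv, h]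

theorem Lin.comp {A : Op (α × Z2) (β × Z2)} {B : Op (β × Z2) (γ × Z2)}
    (hA : Lin A) (hB : Lin B) : Lin (B ∘ₗ A) := lin_of_comm fun μ => by
  rw [LinearMap.comp_assoc, hA.comm, ← LinearMap.comp_assoc, hB.comm, LinearMap.comp_assoc]

/-- Insertion of a right factor. -/
def insR (c : γ) (q : α × Z2) : (α × γ) × Z2 := ((q.1, c), q.2)

/-- Insertion of a left factor. -/
def insL (c : γ) (q : α × Z2) : (γ × α) × Z2 := ((c, q.1), q.2)

/-- An operator on the left factor of a tensor product over the ring of monomials. -/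
noncomputable def onLeft (γ : Type*) (A : Op (α × Z2) (β × Z2)) : Op ((α × γ) × Z2) ((β × γ) × Z2) :=
  ofBasis fun p => map (insR p.1.2) (A (bv (p.1.1, p.2)))

/-- An operator on the right factor of a tensor product over the ring of monomials. -/
noncomputable def onRight (γ : Type*) (A : Op (α × Z2) (β × Z2)) :
    Op ((γ × α) × Z2) ((γ × β) × Z2) :=
  ofBasis fun p => map (insL p.1.1) (A (bv (p.1.2, p.2)))

theorem onLeft_bv (A : Op (α × Z2) (β × Z2)) (a : α) (c : γ) (m : Z2) :
    onLeft γ A (bv ((a, c), m)) = map (insR c) (A (bv (a, m))) := by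
  simp [onLeft]

theorem onRight_bv (A : Op (α × Z2) (β × Z2)) (a : α) (c : γ) (m : Z2) :
    onRight γ A (bv ((c, a), m)) = map (insL c) (A (bv (a, m))) := by
  simp [onRight]

theorem onLeft_map (A : Op (α × Z2) (β × Z2)) (c : γ) (x) :
    onLeft γ A (map (insR c) x) = map (insR c) (A x) := by
  refine eq_of_bv (A := onLeft γ A ∘ₗ map (insR c))
    (B := map (insR c) ∘ₗ A) (fun a => ?_) x
  simp only [LinearMap.comp_apply, map_bv]; exact onLeft_bv A a.1 c a.2

theorem onRight_map (A : Op (α × Z2) (β × Z2)) (c : γ) (x) :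
    onRight γ A (map (insL c) x) = map (insL c) (A x) := by
  refine eq_of_bv (A := onRight γ A ∘ₗ map (insL c))
    (B := map (insL c) ∘ₗ A) (fun a => ?_) x
  simp only [LinearMap.comp_apply, map_bv]; exact onRight_bv A a.1 c a.2

theorem onLeft_comp (A : Op (α × Z2) (β × Z2)) (B : Op (β × Z2) (δ × Z2)) :
    onLeft γ (B ∘ₗ A) = onLeft γ B ∘ₗ onLeft γ A := by
  refine ext_bv fun ⟨⟨a, c⟩, m⟩ => ?_
  simp only [LinearMap.comp_apply, onLeft_bv, onLeft_map]

theorem onRight_comp (A : Op (α × Z2) (β × Z2)) (B : Op (β × Z2) (δ × Z2)) :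
    onRight γ (B ∘ₗ A) = onRight γ B ∘ₗ onRight γ A := by
  refine ext_bv fun ⟨⟨c, a⟩, m⟩ => ?_
  simp only [LinearMap.comp_apply, onRight_bv, onRight_map]

theorem onLeft_add (A B : Op (α × Z2) (β × Z2)) : onLeft γ (A + B) = onLeft γ A + onLeft γ B := by
  refine ext_bv fun ⟨⟨a, c⟩, m⟩ => ?_
  simp only [LinearMap.add_apply, onLeft_bv, map_add]

theorem onRight_add (A B : Op (α × Z2) (β × Z2)) :
    onRight γ (A + B) = onRight γ A + onRight γ B := by
  refine ext_bv fun ⟨⟨c, a⟩, m⟩ => ?_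
  simp only [LinearMap.add_apply, onRight_bv, map_add]

@[simp] theorem onLeft_id : onLeft γ (LinearMap.id : Op (α × Z2) _) = LinearMap.id := by
  refine ext_bv fun ⟨⟨a, c⟩, m⟩ => ?_
  simp [onLeft_bv, insR]

@[simp] theorem onRight_id : onRight γ (LinearMap.id : Op (α × Z2) _) = LinearMap.id := by
  refine ext_bv fun ⟨⟨a, c⟩, m⟩ => ?_
  simp [onRight_bv, insL]

@[simp] theorem onLeft_zero : onLeft γ (0 : Op (α × Z2) (β × Z2)) = 0 := by
  refine ext_bv fun ⟨⟨a, c⟩, m⟩ => ?_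
  simp [onLeft_bv]

@[simp] theorem onRight_zero : onRight γ (0 : Op (α × Z2) (β × Z2)) = 0 := by
  refine ext_bv fun ⟨⟨a, c⟩, m⟩ => ?_
  simp [onRight_bv]

theorem Semi.onLeft {θ : Z2 →+ Z2} {A : Op (α × Z2) (β × Z2)} (h : Semi θ A) :
    Semi θ (onLeft γ A) := semi_of_bv fun μ ⟨a, c⟩ m => by
  rw [onLeft_bv, onLeft_bv, h.bv a (m + μ) m, add_sub_cancel_left, sh, sh, map_map, map_map]
  rfl

theorem Semi.onRight {θ : Z2 →+ Z2} {A : Op (α × Z2) (β × Z2)} (h : Semi θ A) :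
    Semi θ (onRight γ A) := semi_of_bv fun μ ⟨c, a⟩ m => by
  rw [onRight_bv, onRight_bv, h.bv a (m + μ) m, add_sub_cancel_left, sh, sh, map_map, map_map]
  rfl

theorem Supp.onLeft {A : Op (α × Z2) (β × Z2)} {R : α × Z2 → β × Z2 → Prop} (hA : Supp A R) :
    Supp (onLeft γ A) fun p q => R (p.1.1, p.2) (q.1.1, q.2) ∧ p.1.2 = q.1.2 := by
  rintro ⟨⟨a, c⟩, m⟩ q h
  rw [onLeft_bv] at h
  obtain ⟨b, hb, rfl⟩ := map_ne h
  exact ⟨hA _ b hb, rfl⟩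

theorem Supp.onRight {A : Op (α × Z2) (β × Z2)} {R : α × Z2 → β × Z2 → Prop} (hA : Supp A R) :
    Supp (onRight γ A) fun p q => R (p.1.2, p.2) (q.1.2, q.2) ∧ p.1.1 = q.1.1 := by
  rintro ⟨⟨a, c⟩, m⟩ q h
  rw [onRight_bv] at h
  obtain ⟨b, hb, rfl⟩ := map_ne h
  exact ⟨hA _ b hb, rfl⟩

/-- Operators on the two factors commute, up to the semilinearity of one of them. -/
theorem onLeft_onRight {θ : Z2 →+ Z2} {A A' : Op (α × Z2) (α' × Z2)} {B : Op (β × Z2) (β' × Z2)}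
    (hA : Lin A) (hB : Semi θ B) (hA' : A ∘ₗ onExp θ = onExp θ ∘ₗ A') :
    onLeft β' A ∘ₗ onRight α B = onRight α' B ∘ₗ onLeft β A' := by
  refine ext_bv fun ⟨⟨a, b⟩, m⟩ => ?_
  simp only [LinearMap.comp_apply, onLeft_bv, onRight_bv]
  -- Both composites are brought to the same bilinear expression in x = A'(a, m) and y = B(b, m): a
  -- term p of x and a term q of y give the exponent θ p + q - θ m. They differ only in which
  -- argument is expanded first, and `h4` exchanges the two.
  have h1 : ∀ y, onLeft β' A (map (insL a) y) =
      ofBasis (fun q => map (fun p => ((p.1, q.1), θ p.2 + q.2 - θ m)) (A' (bv (a, m)))) y := by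
    intro y
    refine eq_of_bv (A := onLeft β' A ∘ₗ map (insL a)) (fun ⟨b', m'⟩ => ?_) y
    have h2 : A (bv (a, θ m)) = onExp θ (A' (bv (a, m))) := by
      rw [← LinearMap.comp_apply, ← hA', LinearMap.comp_apply, onExp_bv]
    rw [LinearMap.comp_apply, map_bv, insL, onLeft_bv, hA.bv a m' (θ m), h2, ofBasis_bv, sh, onExp,
      map_map, map_map]
    congr 1; congr 1; funext p; simp [insR, add_sub_assoc]
  have h3 : ∀ x, onRight α' B (map (insR b) x) =
      ofBasis (fun p => map (fun q => ((p.1, q.1), θ p.2 + q.2 - θ m)) (B (bv (b, m)))) x := by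
    intro x
    refine eq_of_bv (A := onRight α' B ∘ₗ map (insR b)) (fun ⟨a', m'⟩ => ?_) x
    rw [LinearMap.comp_apply, map_bv, insR, onRight_bv, hB.bv b m' m, ofBasis_bv, sh, map_map]
    congr 1; congr 1; funext p; simp only [insL, AddMonoidHom.map_sub, Prod.mk.injEq, true_and]; abel
  rw [h1, h3]
  generalize A' (bv (a, m)) = x
  generalize B (bv (b, m)) = y
  have h4 : ∀ y, ofBasis (fun q => map (fun p => ((p.1, q.1), θ p.2 + q.2 - θ m)) x) y =
      ofBasis (fun p : α' × Z2 => map (fun q : β' × Z2 => ((p.1, q.1), θ p.2 + q.2 - θ m)) y) x := by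
    intro y
    induction x using Finsupp.induction_linear with
    | zero => 
      rw [map_zero]
      exact eq_of_bv (B := 0) (fun q => by simp) y
    | add x x' hx hx' =>
      rw [map_add, ← hx, ← hx', ← LinearMap.add_apply]
      exact eq_of_bv (fun q => by simp only [ofBasis_bv, map_add, LinearMap.add_apply]) y
    | single p c =>
      have hp : Finsupp.single p c = c • bv p := by simp
      rw [hp, map_smul, ofBasis_bv, ← LinearMap.smul_apply]
      exact eq_of_bv (fun q => by
        simp only [ofBasis_bv, map_smul, LinearMap.smul_apply, map_bv]) y
  exact h4 y

theorem onLeft_onRight_lin {A : Op (α × Z2) (α' × Z2)} {B : Op (β × Z2) (β' × Z2)}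
    (hA : Lin A) (hB : Lin B) :
    onLeft β' A ∘ₗ onRight α B = onRight α' B ∘ₗ onLeft β A :=
  onLeft_onRight hA hB (by
    refine ext_bv fun ⟨a, m⟩ => ?_
    rw [LinearMap.comp_apply, onExp_bv, LinearMap.comp_apply, onExp_id]; rfl)

end Op

end PlumbingLattice

namespace PlumbingLattice
open Op

/-! ## Models of the type-`D` modules

All exponents are allowed to be negative here; the honest module is spanned by the basis elements which
are `Val`.  The operators `d0` (keeping all idempotents) and `d1` together are the part of `δ¹` with
values in the polynomials, the part with weight `σ` is the identity, and `t` is the part with weight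
`τ`.  The lattice side is the space with basis `C`. -/

/-- The data of a model of a type-`D` module over `K` and of its comparison with a module of lattice
cells. -/
structure Mdl where
  B : Type
  C : Type
  d0 : Op (B × Z2) (B × Z2)
  d1 : Op (B × Z2) (B × Z2)
  t : Op (B × Z2) (B × Z2)
  h : Op (B × Z2) (B × Z2)
  dL : Op (C × Z2) (C × Z2)
  tL : Op (C × Z2) (C × Z2)
  /-- the lattice cell of a generator -/
  cell : B → C
  /-- the absolute exponents of a generator -/
  off : B → Z2
  /-- generators of homological degree zero -/
  low : B → Bool
  /-- the minimal generator of a cell -/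
  gen : C → B
  Val : B → Prop
  /-- the number of vertices in idempotent zero -/
  nf : C → ℕ

namespace Mdl

variable (X : Mdl)

/-- The differential. -/
noncomputable def d : Op (X.B × Z2) (X.B × Z2) := X.d0 + X.d1

/-- The augmentation to the module of lattice cells. -/
noncomputable def aug : Op (X.B × Z2) (X.C × Z2) :=
  ofBasis fun p => if X.low p.1 then bv (X.cell p.1, X.off p.1 + p.2) else 0

/-- The inclusion of the minimal generators. -/
noncomputable def lift : Op (X.C × Z2) (X.B × Z2) :=
  map fun p => (X.gen p.1, p.2 - X.off (X.gen p.1))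

theorem aug_bv (l : X.B) (m : Z2) :
    X.aug (bv (l, m)) = if X.low l then bv (X.cell l, X.off l + m) else 0 := by simp [aug]

theorem lift_bv (κ : X.C) (m : Z2) : X.lift (bv (κ, m)) = bv (X.gen κ, m - X.off (X.gen κ)) := by
  simp [lift]

theorem lin_aug : Lin X.aug := lin_of_bv fun μ l m => by
  rw [aug_bv, aug_bv]
  split_ifs <;> simp [add_assoc]

theorem lin_lift : Lin X.lift := lin_of_bv fun μ l m => by
  rw [lift_bv, lift_bv, sh_bv, add_sub_right_comm]

/-- The properties of the data. -/
structure Good : Prop where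
  lin_d0 : Lin X.d0
  lin_d1 : Lin X.d1
  lin_h : Lin X.h
  lin_dL : Lin X.dL
  semi_t : Semi tw X.t
  semi_tL : Semi tw X.tL
  dd : X.d ∘ₗ X.d = 0
  dt : X.d ∘ₗ X.t = X.t ∘ₗ X.d
  -- Together with `aug_d1` and `aug_t` this makes the augmentation a strict chain map of cones. The
  -- lift is only asked to land in the cycles of `d0`.
  aug_d0 : X.aug ∘ₗ X.d0 = 0
  aug_d1 : X.aug ∘ₗ X.d1 = X.dL ∘ₗ X.aug
  aug_t : X.aug ∘ₗ X.t = X.tL ∘ₗ X.aug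
  cell_gen : ∀ κ, X.cell (X.gen κ) = κ
  low_gen : ∀ κ, X.low (X.gen κ) = true
  val_gen : ∀ κ, X.Val (X.gen κ)
  d0_lift : X.d0 ∘ₗ X.lift = 0
  aug_h : X.aug ∘ₗ X.h = 0
  htpy : X.d0 ∘ₗ X.h + X.h ∘ₗ X.d0 = LinearMap.id + X.lift ∘ₗ X.aug
  -- The last clause keeps the contraction among honest basis elements; the first two confine it to
  -- one cell and one absolute exponent, which gives finite fibres.
  supp_h : Supp X.h fun p q => X.cell q.1 = X.cell p.1 ∧ X.off q.1 + q.2 = X.off p.1 + p.2 ∧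
    (X.Val p.1 → X.Val q.1 ∧ p.2 ≤ q.2)
  -- This strict drop, with `supp_t` for the root map, is what makes the perturbation nilpotent.
  supp_d1 : Supp X.d1 fun p q => X.nf (X.cell q.1) < X.nf (X.cell p.1)
  supp_t : Supp X.t fun p q => X.nf (X.cell q.1) ≤ X.nf (X.cell p.1)
  off_ge : ∀ l, X.Val l → X.off (X.gen (X.cell l)) ≤ X.off l
  fin : ∀ κ a, {l | X.Val l ∧ X.cell l = κ ∧ (X.off l).1 ≤ a}.Finite

variable {X}

theorem Good.lin_d (hX : X.Good) : Lin X.d := hX.lin_d0.add hX.lin_d1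

theorem Good.aug_lift (hX : X.Good) : X.aug ∘ₗ X.lift = LinearMap.id := ext_bv fun ⟨κ, m⟩ => by
  simp [lift_bv, aug_bv, hX.cell_gen, hX.low_gen]

theorem Good.aug_d (hX : X.Good) : X.aug ∘ₗ X.d = X.dL ∘ₗ X.aug := by
  rw [d, LinearMap.comp_add, hX.aug_d0, hX.aug_d1, zero_add]

/-! ### A single vertex -/

/-- The model for a single vertex. -/
noncomputable abbrev vertex : Mdl where
  B := Unit
  C := Unit
  d0 := 0
  d1 := 0
  t := onExp tw
  h := 0
  dL := 0
  tL := onExp tw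
  cell := id
  off _ := 0
  low _ := true
  gen := id
  Val _ := True
  nf _ := 0

theorem good_vertex : vertex.Good where
  lin_d0 := Semi.zero
  lin_d1 := Semi.zero
  lin_h := Semi.zero
  lin_dL := Semi.zero
  semi_t := semi_onExp tw
  semi_tL := semi_onExp tw
  dd := by simp [d, vertex]
  dt := by simp [d, vertex]
  aug_d0 := by simp [vertex]
  aug_d1 := by simp [vertex]
  aug_t := ext_bv fun ⟨l, m⟩ => by
    change aug _ (onExp tw _) = onExp tw (aug _ _)
    rw [onExp_bv, aug_bv, aug_bv]; simp [vertex]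
  cell_gen _ := rfl
  low_gen _ := rfl
  val_gen _ := trivial
  d0_lift := by simp [vertex]
  aug_h := by simp [vertex]
  htpy := ext_bv fun ⟨l, m⟩ => by
    change 0 = bv _ + lift _ (aug _ _)
    rw [aug_bv]
    change _ = _ + lift _ (bv _)
    rw [lift_bv]
    simp [vertex, add_self_zero]
  supp_h := Supp.zero _
  supp_d1 := Supp.zero _
  supp_t := fun _ _ _ => le_rfl
  off_ge _ _ := le_rfl
  fin _ _ := Set.toFinite (α := Unit) _

/-! ### The tensor product over the ring of monomials -/

/-- The model for two trees joined at their roots. -/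
noncomputable abbrev join (X Y : Mdl) : Mdl where
  B := X.B × Y.B
  C := X.C × Y.C
  d0 := onLeft Y.B X.d0 + onRight X.B Y.d0
  d1 := onLeft Y.B X.d1 + onRight X.B Y.d1
  t := onLeft Y.B (X.t ∘ₗ onExp twInv) ∘ₗ onRight X.B Y.t
  h := onLeft Y.B X.h + onLeft Y.B (X.lift ∘ₗ X.aug) ∘ₗ onRight X.B Y.h
  dL := onLeft Y.C X.dL + onRight X.C Y.dL
  tL := onLeft Y.C (X.tL ∘ₗ onExp twInv) ∘ₗ onRight X.C Y.tL
  cell l := (X.cell l.1, Y.cell l.2)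
  off l := X.off l.1 + Y.off l.2
  low l := X.low l.1 && Y.low l.2
  gen κ := (X.gen κ.1, Y.gen κ.2)
  Val l := X.Val l.1 ∧ Y.Val l.2
  nf κ := X.nf κ.1 + Y.nf κ.2

variable {Y : Mdl}

theorem join_d : (join X Y).d = onLeft Y.B X.d + onRight X.B Y.d := by
  simp only [d, join, onLeft_add, onRight_add]; abel

theorem join_aug : (join X Y).aug = onLeft Y.C X.aug ∘ₗ onRight X.B Y.aug := ext_bv fun ⟨⟨l, k⟩, m⟩ => by
  rw [LinearMap.comp_apply, onRight_bv, aug_bv, aug_bv]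
  by_cases h2 : Y.low k = true
  · rw [if_pos h2, map_bv, insL, onLeft_bv, aug_bv]
    by_cases h1 : X.low l = true
    · rw [if_pos h1, if_pos (by simp [h1, h2]), map_bv]
      simp [join, insR, add_assoc]
    · rw [if_neg h1, if_neg (by simp [h1, h2]), map_zero]
  · rw [if_neg h2, if_neg (by simp [h2]), map_zero, map_zero]

theorem join_lift : (join X Y).lift = onLeft Y.B X.lift ∘ₗ onRight X.C Y.lift :=
  ext_bv fun ⟨⟨l, k⟩, m⟩ => by
    rw [LinearMap.comp_apply, onRight_bv, lift_bv, lift_bv, map_bv, insL, onLeft_bv, lift_bv, map_bv]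
    simp only [join, insR, sub_sub]
    rw [add_comm]

/-- Undoing `tw` on exponents first cancels the semilinearity. So t ⊗ t can be written as a linear
operator on the left factor applied after a semilinear one on the right factor; the scalars, which
the factors share, are then twisted only once. -/
theorem lin_comp_twInv {α β : Type*} {A : Op (α × Z2) (β × Z2)} (hA : Semi tw A) :
    Lin (A ∘ₗ onExp twInv) := lin_of_bv fun μ l m => by
  rw [LinearMap.comp_apply, LinearMap.comp_apply, onExp_bv, onExp_bv, map_add,
    ← sh_bv, hA.apply, tw_twInv]

end Mdl
end PlumbingLattice

namespace PlumbingLattice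
open Op
namespace Mdl
variable {X Y : Mdl}

/-- The two factors share their monomials, so a linear operator on the left crosses a
`tw`-semilinear operator on the right only after conjugation by `tw`; the conjugate is again linear.
-/
theorem lin_conj {α β : Type*} {A : Op (α × Z2) (β × Z2)} (hA : Lin A) :
    Lin (onExp tw ∘ₗ A ∘ₗ onExp twInv) := lin_of_bv fun μ l m => by
  simp only [LinearMap.comp_apply, onExp_bv, map_add]
  rw [← sh_bv, hA.apply, (semi_onExp tw).apply, tw_twInv]

theorem conj_comp_tw {α β : Type*} (A : Op (α × Z2) (β × Z2)) :
    (onExp tw ∘ₗ A ∘ₗ onExp twInv) ∘ₗ onExp tw = onExp tw ∘ₗ A := by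
  rw [LinearMap.comp_assoc, LinearMap.comp_assoc, onExp_twInv_tw, LinearMap.comp_id]

theorem comp_twInv_comp_conj {α β γ : Type*} (A : Op (α × Z2) (β × Z2)) (B : Op (β × Z2) (γ × Z2)) :
    (B ∘ₗ onExp twInv) ∘ₗ (onExp tw ∘ₗ A ∘ₗ onExp twInv) = (B ∘ₗ A) ∘ₗ onExp twInv := by
  rw [LinearMap.comp_assoc, LinearMap.comp_assoc, ← LinearMap.comp_assoc (_ ∘ₗ _) (onExp tw),
    onExp_twInv_tw, LinearMap.id_comp]

theorem Good.join_lin_d0 (hX : X.Good) (hY : Y.Good) :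
    Lin (Mdl.join X Y).d0 := hX.lin_d0.onLeft.add hY.lin_d0.onRight

theorem Good.join_lin_d1 (hX : X.Good) (hY : Y.Good) :
    Lin (Mdl.join X Y).d1 := hX.lin_d1.onLeft.add hY.lin_d1.onRight

theorem Good.join_lin_h (hX : X.Good) (hY : Y.Good) :
    Lin (Mdl.join X Y).h := hX.lin_h.onLeft.add (Lin.comp hY.lin_h.onRight (Lin.comp X.lin_aug X.lin_lift).onLeft)

theorem Good.join_lin_dL (hX : X.Good) (hY : Y.Good) :
    Lin (Mdl.join X Y).dL := hX.lin_dL.onLeft.add hY.lin_dL.onRight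

theorem semi_tensor {α β γ δ : Type*} {A : Op (α × Z2) (β × Z2)} {B : Op (γ × Z2) (δ × Z2)}
    (hA : Semi tw A) (hB : Semi tw B) :
    Semi tw (onLeft δ (A ∘ₗ onExp twInv) ∘ₗ onRight α B) := fun μ => by
  rw [LinearMap.comp_assoc, hB.onRight, ← LinearMap.comp_assoc,
    Lin.comm (lin_comp_twInv hA).onLeft, LinearMap.comp_assoc]

theorem Good.join_dd (hX : X.Good) (hY : Y.Good) :
    (Mdl.join X Y).d ∘ₗ (Mdl.join X Y).d = 0 := by
  rw [join_d]
  simp only [LinearMap.add_comp, LinearMap.comp_add, ← onLeft_comp, ← onRight_comp, hX.dd, hY.dd,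
    onLeft_onRight_lin hX.lin_d hY.lin_d, onLeft_zero, onRight_zero, zero_add, add_zero]
  exact add_self_zero (onRight X.B Y.d ∘ₗ onLeft Y.B X.d)

theorem Good.join_dt (hX : X.Good) (hY : Y.Good) :
    (Mdl.join X Y).d ∘ₗ (Mdl.join X Y).t = (Mdl.join X Y).t ∘ₗ (Mdl.join X Y).d := by
  rw [join_d]
  have h1 : onLeft Y.B X.d ∘ₗ onLeft Y.B (X.t ∘ₗ onExp twInv) ∘ₗ onRight X.B Y.t =
      (onLeft Y.B (X.t ∘ₗ onExp twInv) ∘ₗ onRight X.B Y.t) ∘ₗ onLeft Y.B X.d := by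
    rw [LinearMap.comp_assoc, ← onLeft_onRight (lin_conj hX.lin_d) hY.semi_t (conj_comp_tw _),
      ← LinearMap.comp_assoc, ← LinearMap.comp_assoc, ← onLeft_comp, ← onLeft_comp,
      comp_twInv_comp_conj, ← hX.dt, LinearMap.comp_assoc]
  have h2 : onRight X.B Y.d ∘ₗ onLeft Y.B (X.t ∘ₗ onExp twInv) ∘ₗ onRight X.B Y.t =
      (onLeft Y.B (X.t ∘ₗ onExp twInv) ∘ₗ onRight X.B Y.t) ∘ₗ onRight X.B Y.d := by
    rw [← LinearMap.comp_assoc, ← onLeft_onRight_lin (lin_comp_twInv hX.semi_t) hY.lin_d,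
      LinearMap.comp_assoc, LinearMap.comp_assoc, ← onRight_comp, ← onRight_comp, hY.dt]
  rw [LinearMap.add_comp, LinearMap.comp_add, h1, h2]

theorem Good.join_aug_d0 (hX : X.Good) (hY : Y.Good) :
    (Mdl.join X Y).aug ∘ₗ (Mdl.join X Y).d0 = 0 := by
  rw [join_aug, LinearMap.comp_add, LinearMap.comp_assoc, LinearMap.comp_assoc,
    ← onLeft_onRight_lin hX.lin_d0 Y.lin_aug, ← LinearMap.comp_assoc, ← onLeft_comp, hX.aug_d0,
    ← onRight_comp, hY.aug_d0]
  simp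

theorem Good.join_aug_d1 (hX : X.Good) (hY : Y.Good) :
    (Mdl.join X Y).aug ∘ₗ (Mdl.join X Y).d1 = (Mdl.join X Y).dL ∘ₗ (Mdl.join X Y).aug := by
  rw [join_aug, LinearMap.comp_add, LinearMap.add_comp, LinearMap.comp_assoc,
    LinearMap.comp_assoc, ← onLeft_onRight_lin hX.lin_d1 Y.lin_aug, ← LinearMap.comp_assoc,
    ← onLeft_comp, hX.aug_d1, ← onRight_comp, hY.aug_d1, onLeft_comp, onRight_comp,
    ← LinearMap.comp_assoc, ← LinearMap.comp_assoc,
    onLeft_onRight_lin X.lin_aug hY.lin_dL, LinearMap.comp_assoc, LinearMap.comp_assoc]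

/-- Linear operators on different factors commute. Moving A past the semilinear S' conjugates it by
`tw`, and the conjugation is absorbed by the `twInv` that accompanies T'. -/
theorem tensor_intertwine {α β α' β' : Type*} {A : Op (α × Z2) (α' × Z2)} {B : Op (β × Z2) (β' × Z2)}
    {T : Op (α × Z2) (α × Z2)} {S : Op (β × Z2) (β × Z2)} {T' : Op (α' × Z2) (α' × Z2)}
    {S' : Op (β' × Z2) (β' × Z2)} (hA : Lin A) (hB : Lin B) (hT : Semi tw T) (hS : Semi tw S')
    (hAT : A ∘ₗ T = T' ∘ₗ A) (hBS : B ∘ₗ S = S' ∘ₗ B) :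
    (onLeft β' A ∘ₗ onRight α B) ∘ₗ (onLeft β (T ∘ₗ onExp twInv) ∘ₗ onRight α S) =
      (onLeft β' (T' ∘ₗ onExp twInv) ∘ₗ onRight α' S') ∘ₗ (onLeft β' A ∘ₗ onRight α B) := by
  have h1 : (onLeft β' A ∘ₗ onRight α B) ∘ₗ (onLeft β (T ∘ₗ onExp twInv) ∘ₗ onRight α S) =
      onLeft β' A ∘ₗ (onRight α B ∘ₗ onLeft β (T ∘ₗ onExp twInv)) ∘ₗ onRight α S := by
    rw [LinearMap.comp_assoc, LinearMap.comp_assoc]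
  have h2 : (onLeft β' (T' ∘ₗ onExp twInv) ∘ₗ onRight α' S') ∘ₗ (onLeft β' A ∘ₗ onRight α B) =
      onLeft β' (T' ∘ₗ onExp twInv) ∘ₗ (onRight α' S' ∘ₗ onLeft β' A) ∘ₗ onRight α B := by
    rw [LinearMap.comp_assoc, LinearMap.comp_assoc]
  rw [h1, h2, ← onLeft_onRight_lin (lin_comp_twInv hT) hB,
    ← onLeft_onRight (lin_conj hA) hS (conj_comp_tw _), LinearMap.comp_assoc, ← LinearMap.comp_assoc,
    ← onLeft_comp, ← onRight_comp, LinearMap.comp_assoc (onRight α B),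
    ← onRight_comp, ← LinearMap.comp_assoc (onRight α (S' ∘ₗ B)), ← onLeft_comp, comp_twInv_comp_conj, ← LinearMap.comp_assoc, hAT, hBS]

theorem Good.join_aug_t (hX : X.Good) (hY : Y.Good) :
    (Mdl.join X Y).aug ∘ₗ (Mdl.join X Y).t = (Mdl.join X Y).tL ∘ₗ (Mdl.join X Y).aug := by
  rw [join_aug]
  exact tensor_intertwine X.lin_aug Y.lin_aug hX.semi_t hY.semi_tL hX.aug_t hY.aug_t

theorem Good.join_d0_lift (hX : X.Good) (hY : Y.Good) :
    (Mdl.join X Y).d0 ∘ₗ (Mdl.join X Y).lift = 0 := by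
  rw [join_lift, LinearMap.add_comp, ← LinearMap.comp_assoc, ← onLeft_comp, hX.d0_lift,
    ← LinearMap.comp_assoc, ← onLeft_onRight_lin X.lin_lift hY.lin_d0, LinearMap.comp_assoc,
    ← onRight_comp, hY.d0_lift]
  simp

theorem Good.join_aug_h (hX : X.Good) (hY : Y.Good) :
    (Mdl.join X Y).aug ∘ₗ (Mdl.join X Y).h = 0 := by
  have h1 : (onLeft Y.C X.aug ∘ₗ onRight X.B Y.aug) ∘ₗ onLeft Y.B X.h = 0 := by
    rw [LinearMap.comp_assoc, ← onLeft_onRight_lin hX.lin_h Y.lin_aug, ← LinearMap.comp_assoc,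
      ← onLeft_comp, hX.aug_h]; simp
  have h2 : (onLeft Y.C X.aug ∘ₗ onRight X.B Y.aug) ∘ₗ
      (onLeft Y.B (X.lift ∘ₗ X.aug) ∘ₗ onRight X.B Y.h) = 0 := by
    rw [LinearMap.comp_assoc, ← LinearMap.comp_assoc (onRight X.B Y.h),
      ← onLeft_onRight_lin (Lin.comp X.lin_aug X.lin_lift) Y.lin_aug, LinearMap.comp_assoc,
      ← onRight_comp, hY.aug_h]; simp
  rw [join_aug, LinearMap.comp_add, h1, h2, add_zero]

/-- Bookkeeping for the contraction h ⊗ 1 + e ⊗ h' of a tensor product, with e = `lift ∘ aug`: p + q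
comes from the left contraction, x + y is e times the right one, and the mixed term s occurs twice
and cancels. -/
theorem htpy_add {M : Type*} [AddCommGroup M] [Module F2 M] {p q r s e x y I : M}
    (h1 : p + q = I + e) (h2 : x + y = e + r) : p + s + (0 + x) + (q + 0 + (s + y)) = I + r := by
  have h3 := add_self_zero s
  have h4 := add_self_zero e
  linear_combination (norm := module) h1 + h2 + h3 + h4

theorem Good.join_htpy (hX : X.Good) (hY : Y.Good) :
    (Mdl.join X Y).d0 ∘ₗ (Mdl.join X Y).h + (Mdl.join X Y).h ∘ₗ (Mdl.join X Y).d0 =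
      LinearMap.id + (Mdl.join X Y).lift ∘ₗ (Mdl.join X Y).aug := by
  have he : Lin (X.lift ∘ₗ X.aug) := Lin.comp X.lin_aug X.lin_lift
  have h1 : onLeft Y.B X.d0 ∘ₗ onLeft Y.B (X.lift ∘ₗ X.aug) = 0 := by
    rw [← onLeft_comp, ← LinearMap.comp_assoc, hX.d0_lift]; simp
  have h2 : onLeft Y.B (X.lift ∘ₗ X.aug) ∘ₗ onLeft Y.B X.d0 = 0 := by
    rw [← onLeft_comp, LinearMap.comp_assoc, hX.aug_d0]; simp
  have h3 : onRight X.B Y.d0 ∘ₗ onLeft Y.B X.h = onLeft Y.B X.h ∘ₗ onRight X.B Y.d0 :=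
    (onLeft_onRight_lin hX.lin_h hY.lin_d0).symm
  have h4 : onRight X.B Y.d0 ∘ₗ onLeft Y.B (X.lift ∘ₗ X.aug) =
      onLeft Y.B (X.lift ∘ₗ X.aug) ∘ₗ onRight X.B Y.d0 :=
    (onLeft_onRight_lin he hY.lin_d0).symm
  have h5 : onRight X.B Y.h ∘ₗ onLeft Y.B X.d0 = onLeft Y.B X.d0 ∘ₗ onRight X.B Y.h :=
    (onLeft_onRight_lin hX.lin_d0 hY.lin_h).symm
  have h6 : (Mdl.join X Y).lift ∘ₗ (Mdl.join X Y).aug =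
      onLeft Y.B (X.lift ∘ₗ X.aug) ∘ₗ onRight X.B (Y.lift ∘ₗ Y.aug) := by
    rw [join_aug, join_lift, LinearMap.comp_assoc, ← LinearMap.comp_assoc (onRight X.B Y.aug),
      ← onLeft_onRight_lin X.lin_aug Y.lin_lift, LinearMap.comp_assoc, onLeft_comp, onRight_comp,
      LinearMap.comp_assoc]
  have h7 := congrArg (onLeft Y.B) hX.htpy
  have h8 := congrArg (fun A => onLeft Y.B (X.lift ∘ₗ X.aug) ∘ₗ onRight X.B A) hY.htpy
  simp only [onLeft_add, onRight_add, LinearMap.comp_add, onLeft_id, onRight_id,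
    LinearMap.comp_id] at h7 h8
  rw [onLeft_comp, onLeft_comp] at h7
  rw [onRight_comp, onRight_comp, ← LinearMap.comp_assoc, ← LinearMap.comp_assoc, ← h4] at h8
  rw [h6]
  simp only [LinearMap.add_comp, LinearMap.comp_add]
  have h9 : onLeft Y.B X.d0 ∘ₗ onLeft Y.B (X.lift ∘ₗ X.aug) ∘ₗ onRight X.B Y.h = 0 := by
    rw [← LinearMap.comp_assoc, h1, LinearMap.zero_comp]
  have h10 : (onLeft Y.B (X.lift ∘ₗ X.aug) ∘ₗ onRight X.B Y.h) ∘ₗ onLeft Y.B X.d0 = 0 := by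
    rw [LinearMap.comp_assoc, h5, ← LinearMap.comp_assoc, h2, LinearMap.zero_comp]
  rw [h9, h10, h3, ← LinearMap.comp_assoc]
  exact LinearMap.ext fun v => htpy_add (LinearMap.congr_fun h7 v) (LinearMap.congr_fun h8 v)

theorem Good.join_supp_h (hX : X.Good) (hY : Y.Good) :
    Supp (Mdl.join X Y).h fun p q => (Mdl.join X Y).cell q.1 = (Mdl.join X Y).cell p.1 ∧
      (Mdl.join X Y).off q.1 + q.2 = (Mdl.join X Y).off p.1 + p.2 ∧
      ((Mdl.join X Y).Val p.1 → (Mdl.join X Y).Val q.1 ∧ p.2 ≤ q.2) := by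
  refine Supp.add ?_ ?_
  · refine hX.supp_h.onLeft.mono ?_
    rintro ⟨⟨l, k⟩, m⟩ ⟨⟨l', k'⟩, m'⟩ ⟨⟨h1, h2, h3⟩, rfl : k = k'⟩
    refine ⟨by simpa using h1, ?_, fun hv => ⟨⟨(h3 hv.1).1, hv.2⟩, (h3 hv.1).2⟩⟩
    dsimp only at h2 ⊢
    rw [add_right_comm, h2, add_right_comm]
  -- The projection `lift ∘ aug` satisfies the conditions required of h: it moves within the cell to
  -- the minimal generator, whose smaller offset is compensated by a larger exponent.
  · have hs : Supp (X.lift ∘ₗ X.aug) fun p q => X.cell q.1 = X.cell p.1 ∧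
        X.off q.1 + q.2 = X.off p.1 + p.2 ∧ (X.Val p.1 → X.Val q.1 ∧ p.2 ≤ q.2) := by
      rintro ⟨l, m⟩ q h
      rw [LinearMap.comp_apply, aug_bv] at h
      split_ifs at h with hl
      · rw [lift_bv] at h
        obtain rfl := ne_of_bv_ne h
        refine ⟨hX.cell_gen _, by simp, fun hv => ⟨hX.val_gen _, ?_⟩⟩
        have := hX.off_ge l hv
        dsimp only
        rw [le_sub_iff_add_le, add_comm]
        exact add_le_add_left this m
      · simp at h
    refine (hY.supp_h.onRight.comp hs.onLeft).mono ?_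
    rintro ⟨⟨l, k⟩, m⟩ ⟨⟨l'', k''⟩, m''⟩ ⟨⟨⟨l', k'⟩, m'⟩, ⟨⟨h1, h2, h3⟩, h0⟩, ⟨h4, h5, h6⟩, h0'⟩
    dsimp only at *
    subst h0 h0'
    refine ⟨by simp [h1, h4], ?_, fun hv => ⟨⟨(h6 hv.1).1, (h3 hv.2).1⟩, (h3 hv.2).2.trans (h6 hv.1).2⟩⟩
    rw [add_right_comm, h5, add_assoc, add_comm m', h2, ← add_assoc]

theorem Good.join_supp_d1 (hX : X.Good) (hY : Y.Good) :
    Supp (Mdl.join X Y).d1 fun p q =>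
      (Mdl.join X Y).nf ((Mdl.join X Y).cell q.1) < (Mdl.join X Y).nf ((Mdl.join X Y).cell p.1) := by
  refine Supp.add ?_ ?_
  · refine hX.supp_d1.onLeft.mono ?_
    rintro ⟨⟨l, k⟩, m⟩ ⟨⟨l', k'⟩, m'⟩ ⟨h1, rfl : k = k'⟩
    dsimp only at *; omega
  · refine hY.supp_d1.onRight.mono ?_
    rintro ⟨⟨l, k⟩, m⟩ ⟨⟨l', k'⟩, m'⟩ ⟨h1, rfl : l = l'⟩
    dsimp only at *; omega

theorem Good.join_supp_t (hX : X.Good) (hY : Y.Good) :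
    Supp (Mdl.join X Y).t fun p q =>
      (Mdl.join X Y).nf ((Mdl.join X Y).cell q.1) ≤ (Mdl.join X Y).nf ((Mdl.join X Y).cell p.1) := by
  have : Supp (X.t ∘ₗ onExp twInv) fun p q => X.nf (X.cell q.1) ≤ X.nf (X.cell p.1) := by
    rintro ⟨l, m⟩ q h
    rw [LinearMap.comp_apply, onExp_bv] at h
    exact hX.supp_t (l, twInv m) q h
  refine (hY.supp_t.onRight.comp this.onLeft).mono ?_
  rintro ⟨⟨l, k⟩, m⟩ ⟨⟨l'', k''⟩, m''⟩ ⟨⟨⟨l', k'⟩, m'⟩, ⟨h1, h0⟩, h2, h0'⟩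
  dsimp only at *
  subst h0 h0'
  exact add_le_add h2 h1

theorem Good.join (hX : X.Good) (hY : Y.Good) : (join X Y).Good where
  lin_d0 := hX.join_lin_d0 hY
  lin_d1 := hX.join_lin_d1 hY
  lin_h := hX.join_lin_h hY
  lin_dL := hX.join_lin_dL hY
  semi_t := semi_tensor hX.semi_t hY.semi_t
  semi_tL := semi_tensor hX.semi_tL hY.semi_tL
  dd := hX.join_dd hY
  dt := hX.join_dt hY
  aug_d0 := hX.join_aug_d0 hY
  aug_d1 := hX.join_aug_d1 hY
  aug_t := hX.join_aug_t hY
  cell_gen κ := by simp [hX.cell_gen, hY.cell_gen]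
  low_gen κ := by simp [hX.low_gen, hY.low_gen]
  val_gen κ := ⟨hX.val_gen _, hY.val_gen _⟩
  d0_lift := hX.join_d0_lift hY
  aug_h := hX.join_aug_h hY
  htpy := hX.join_htpy hY
  supp_h := hX.join_supp_h hY
  supp_d1 := hX.join_supp_d1 hY
  supp_t := hX.join_supp_t hY
  off_ge l hl := add_le_add (hX.off_ge _ hl.1) (hY.off_ge _ hl.2)
  fin κ a := by
    refine ((hX.fin κ.1 (a - (Y.off (Y.gen κ.2)).1)).prod
      (hY.fin κ.2 (a - (X.off (X.gen κ.1)).1))).subset ?_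
    rintro ⟨l, k⟩ ⟨⟨hl, hk⟩, rfl, ha⟩
    -- A bound on the sum of the two offsets bounds each one, since the other is at least that of
    -- its minimal generator.
    have h1 := (hX.off_ge l hl).1
    have h2 := (hY.off_ge k hk).1
    simp only [Prod.fst_add] at ha
    exact ⟨⟨hl, rfl, by simp only; omega⟩, ⟨hk, rfl, by simp only; omega⟩⟩

end Mdl
end PlumbingLattice

namespace PlumbingLattice
open Op

/-! ### Attaching a new root -/

/-- The idempotent of the old root together with a generator of the Hopf link complex. -/
abbrev BG := Bool × HopfGen

/-- An operator on a tensor factor. -/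
noncomputable abbrev Op.ext2 {α β : Type*} (A : Op α β) : Op ((α × BG) × Z2) ((β × BG) × Z2) :=
  onFst Z2 (onFst BG A)

/-- Insertion into the first factor. -/
def ins2 {α : Type*} (g : BG) (m : Z2) (z : α) : (α × BG) × Z2 := ((z, g), m)

theorem Op.ext2_bv {α β : Type*} (A : Op α β) (z : α) (g : BG) (m : Z2) :
    ext2 A (bv ((z, g), m)) = map (ins2 g m) (A (bv z)) := by
  rw [ext2, onFst_bv, onFst_bv, map_map]; rfl

theorem Op.ext2_comp {α β γ : Type*} (A : Op α β) (B : Op β γ) :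
    ext2 (B ∘ₗ A) = ext2 B ∘ₗ ext2 A := by
  rw [ext2, onFst_comp, onFst_comp]

theorem Op.ext2_add {α β : Type*} (A B : Op α β) : ext2 (A + B) = ext2 A + ext2 B := by
  rw [ext2, onFst_add, onFst_add]

theorem Op.ext2_id {α : Type*} : ext2 (LinearMap.id : Op α α) = LinearMap.id := by
  rw [ext2, onFst_id, onFst_id]

theorem Op.ext2_zero {α β : Type*} : ext2 (0 : Op α β) = 0 := by
  rw [ext2, onFst_zero, onFst_zero]

theorem Op.lin_onFst {α β : Type*} (A : Op α β) : Lin (onFst Z2 A) := lin_of_bv fun μ z m => by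
  rw [onFst_bv, onFst_bv, sh, map_map]

theorem Op.Supp.ext2 {α β : Type*} {A : Op α β} {R : α → β → Prop} (hA : Supp A R) :
    Supp (ext2 A) fun p q => R p.1.1 q.1.1 ∧ p.1.2 = q.1.2 ∧ p.2 = q.2 :=
  hA.onFst.onFst.mono fun _ _ h => ⟨h.1.1, h.1.2, h.2⟩

/-- A description of an operator by finitely many terms, which multiply the first factor by a monomial
and change the other two factors. -/
abbrev Terms := BG → Z2 → List (Z2 × BG × Z2)

/-- The effect of a single term on the first factor. -/
noncomputable def termOp {β : Type*} (q : Z2 × BG × Z2) : Op (β × Z2) (((β × Z2) × BG) × Z2) :=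
  map fun z => (((z.1, z.2 + q.1), q.2.1), q.2.2)

/-- The operator with given terms. -/
noncomputable def loc {β : Type*} (f : Terms) : Op (((β × Z2) × BG) × Z2) (((β × Z2) × BG) × Z2) :=
  ofBasis fun p => ((f p.1.2 p.2).map fun q => termOp q (bv p.1.1)).sum

/-- Twisting the monomials of the terms. -/
def Terms.twist (θ : Z2 →+ Z2) (f : Terms) : Terms := fun g m => (f g m).map fun q => (θ q.1, q.2)

theorem loc_bv {β : Type*} (f : Terms) (z : β × Z2) (g : BG) (m : Z2) :
    loc f (bv ((z, g), m)) = ((f g m).map fun q => termOp q (bv z)).sum := by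
  simp [loc]

theorem termOp_bv {β : Type*} (q : Z2 × BG × Z2) (l : β) (μ : Z2) :
    termOp q (bv (l, μ)) = bv (((l, μ + q.1), q.2.1), q.2.2) := by simp [termOp]

theorem list_sum_apply {M N ι : Type*} [AddCommMonoid M] [AddCommMonoid N] [Module F2 M] [Module F2 N]
    (L : List ι) (F : ι → M →ₗ[F2] N) (x : M) :
    (L.map fun q => F q x).sum = (L.map F).sum x := by
  induction L with
  | nil => simp
  | cons a L ih => simp [ih]

theorem loc_map {β : Type*} (f : Terms) (g : BG) (m : Z2) (x : β × Z2 →₀ F2) :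
    loc f (map (ins2 g m) x) = ((f g m).map fun q => termOp q x).sum := by
  rw [list_sum_apply]
  refine eq_of_bv (A := loc f ∘ₗ map (ins2 g m)) (fun z => ?_) x
  rw [LinearMap.comp_apply, map_bv, ← list_sum_apply]
  exact loc_bv f z g m

/-- A term touches the first factor only through multiplication by a monomial, so A passes it,
replacing the monomial by its image under θ. -/
theorem ext2_loc {β γ : Type*} {θ : Z2 →+ Z2} {A : Op (β × Z2) (γ × Z2)} (hA : Semi θ A) (f : Terms) :
    ext2 A ∘ₗ loc f = loc (f.twist θ) ∘ₗ ext2 A := by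
  refine ext_bv fun ⟨⟨⟨l, μ⟩, g⟩, m⟩ => ?_
  rw [LinearMap.comp_apply, LinearMap.comp_apply, loc_bv, ext2_bv, loc_map, map_list_sum,
    Terms.twist, List.map_map, List.map_map]
  congr 2
  funext q
  simp only [Function.comp_apply, termOp_bv]
  rw [ext2_bv, ← sh_bv, hA.apply, sh, map_map, termOp]
  rfl

theorem twist_id (f : Terms) : f.twist (AddMonoidHom.id Z2) = f := by
  funext g m; simp [Terms.twist]

theorem ext2_loc_lin {β γ : Type*} {A : Op (β × Z2) (γ × Z2)} (hA : Lin A) (f : Terms) :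
    ext2 A ∘ₗ loc f = loc f ∘ₗ ext2 A := by
  rw [ext2_loc hA, twist_id]

theorem semi_loc {β : Type*} {θ : Z2 →+ Z2} {f : Terms}
    (hf : ∀ g m μ, f g (m + μ) = (f g m).map fun q => (q.1, q.2.1, q.2.2 + θ μ)) :
    Semi θ (loc (β := β) f) := semi_of_bv fun μ ⟨⟨l, ν⟩, g⟩ m => by
  rw [loc_bv, loc_bv, hf, map_list_sum, List.map_map, List.map_map]
  congr 2
  funext q
  simp only [Function.comp_apply, termOp_bv, sh_bv]

/-! ### Relations between the maps of the Hopf link -/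

namespace Hopf
open HopfGen

/-- The terms of the differential. -/
def fD : Terms
  | (ε, b), m => [((0, 0), (ε, a), m + (1, 0)), ((1, 0), (ε, d), m)]
  | (ε, c), m => [((0, 1), (ε, a), m), ((0, 0), (ε, d), m + (0, 1))]
  | _, _ => []

/-- The terms of the identity map changing the idempotent. -/
def fE : Terms
  | (false, g), m => [((0, 0), (true, g), m)]
  | _, _ => []

/-- The terms of the map for the first component reversed. -/
def fP (n : ℤ) : Terms
  | (false, a), m => [((0, n - 1), (true, d), m)]
  | (false, c), m => [((0, n + 1), (true, b), m), ((0, n), (true, c), m + (1, 0))]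
  | (false, d), m => [((0, n), (true, d), m + (1, 0))]
  | _, _ => []

/-- The terms of the map for the second component reversed. -/
def fS : Terms
  | (ε, a), m => [((1, 0), (ε, a), tw m)]
  | (ε, c), m => [((0, 0), (ε, b), tw m + (0, 1)), ((1, 0), (ε, c), tw m)]
  | (ε, d), m => [((0, 0), (ε, a), tw m + (0, -1))]
  | _, _ => []

/-- The terms of the length two map. -/
def fT (n : ℤ) : Terms
  | (false, a), m => [((0, n - 2), (true, c), tw m + (0, -1))]
  | (false, d), m => [((0, n - 1), (true, c), tw m + (0, -2))]
  | _, _ => []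

variable {β : Type*} (n : ℤ)

theorem dd : loc (β := β) fD ∘ₗ loc fD = 0 := by
  refine ext_bv fun ⟨⟨⟨l, i, j⟩, ⟨ε, g⟩⟩, p, q⟩ => ?_
  rcases g <;> simp [loc_bv, termOp_bv, fD]

theorem dE : loc (β := β) fD ∘ₗ loc fE = loc fE ∘ₗ loc fD := by
  refine ext_bv fun ⟨⟨⟨l, i, j⟩, ⟨ε, g⟩⟩, p, q⟩ => ?_
  rcases ε <;> rcases g <;> simp [loc_bv, termOp_bv, fD, fE]

theorem EE : loc (β := β) fE ∘ₗ loc fE = 0 := by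
  refine ext_bv fun ⟨⟨⟨l, i, j⟩, ⟨ε, g⟩⟩, p, q⟩ => ?_
  rcases ε <;> rcases g <;> simp [loc_bv, termOp_bv, fE]

theorem EP : loc (β := β) fE ∘ₗ loc (fP n) = 0 := by
  refine ext_bv fun ⟨⟨⟨l, i, j⟩, ⟨ε, g⟩⟩, p, q⟩ => ?_
  rcases ε <;> rcases g <;> simp [loc_bv, termOp_bv, fE, fP]

theorem PE : loc (β := β) (fP n) ∘ₗ loc (fE.twist tw) = 0 := by
  refine ext_bv fun ⟨⟨⟨l, i, j⟩, ⟨ε, g⟩⟩, p, q⟩ => ?_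
  rcases ε <;> rcases g <;> simp [loc_bv, termOp_bv, fE, fP, Terms.twist]

theorem PP : loc (β := β) (fP n) ∘ₗ loc ((fP n).twist tw) = 0 := by
  refine ext_bv fun ⟨⟨⟨l, i, j⟩, ⟨ε, g⟩⟩, p, q⟩ => ?_
  rcases ε <;> rcases g <;> simp [loc_bv, termOp_bv, fP, Terms.twist]

/-- The map `fP` is always applied after `t` on the old module, since a `τ` of the Hopf module must
be matched there. Operators that have been moved past `t` carry the twist. -/
theorem dP : loc (β := β) fD ∘ₗ loc (fP n) = loc (fP n) ∘ₗ loc (fD.twist tw) := by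
  refine ext_bv fun ⟨⟨⟨l, i, j⟩, ⟨ε, g⟩⟩, p, q⟩ => ?_
  rcases ε <;> rcases g <;> simp [loc_bv, termOp_bv, fP, fD, Terms.twist, tw_apply]
  all_goals
    -- With everything on one side each basis vector collects the coefficient 2, which vanishes.
    refine eq_of_add_eq_zero' ?_
    ring_nf
    abel_nf
    simp [CharTwo.two_eq_zero]

theorem Sd : loc (β := β) fD ∘ₗ loc fS = loc fS ∘ₗ loc fD := by
  refine ext_bv fun ⟨⟨⟨l, i, j⟩, ⟨ε, g⟩⟩, p, q⟩ => ?_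
  rcases g <;> simp [loc_bv, termOp_bv, fS, fD, tw_apply]
  all_goals
    refine eq_of_add_eq_zero' ?_
    ring_nf
    abel_nf
    simp [CharTwo.two_eq_zero]

theorem SE : loc (β := β) fE ∘ₗ loc fS = loc fS ∘ₗ loc fE := by
  refine ext_bv fun ⟨⟨⟨l, i, j⟩, ⟨ε, g⟩⟩, p, q⟩ => ?_
  rcases ε <;> rcases g <;> simp [loc_bv, termOp_bv, fS, fE]

theorem TE : loc (β := β) (fT n) ∘ₗ loc (fE.twist tw) = 0 := by
  refine ext_bv fun ⟨⟨⟨l, i, j⟩, ⟨ε, g⟩⟩, p, q⟩ => ?_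
  rcases ε <;> rcases g <;> simp [loc_bv, termOp_bv, fE, fT, Terms.twist]

theorem ET : loc (β := β) fE ∘ₗ loc (fT n) = 0 := by
  refine ext_bv fun ⟨⟨⟨l, i, j⟩, ⟨ε, g⟩⟩, p, q⟩ => ?_
  rcases ε <;> rcases g <;> simp [loc_bv, termOp_bv, fE, fT]

theorem TP : loc (β := β) (fT n) ∘ₗ loc ((fP n).twist tw) = 0 := by
  refine ext_bv fun ⟨⟨⟨l, i, j⟩, ⟨ε, g⟩⟩, p, q⟩ => ?_
  rcases ε <;> rcases g <;> simp [loc_bv, termOp_bv, fP, fT, Terms.twist]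

theorem PT : loc (β := β) (fP n) ∘ₗ loc ((fT n).twist tw) = 0 := by
  refine ext_bv fun ⟨⟨⟨l, i, j⟩, ⟨ε, g⟩⟩, p, q⟩ => ?_
  rcases ε <;> rcases g <;> simp [loc_bv, termOp_bv, fP, fT, Terms.twist]

/-- The maps for the two reversed components commute only up to homotopy, and the length two map is
that homotopy. -/
theorem square : loc (β := β) fD ∘ₗ loc (fT n) + loc fS ∘ₗ loc (fP n) =
    loc (fT n) ∘ₗ loc (fD.twist tw) + loc (fP n) ∘ₗ loc (fS.twist tw) := by
  refine ext_bv fun ⟨⟨⟨l, i, j⟩, ⟨ε, g⟩⟩, p, q⟩ => ?_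
  rcases ε <;> rcases g <;> simp [loc_bv, termOp_bv, fP, fT, fS, fD, Terms.twist, tw_apply]
  all_goals
    refine eq_of_add_eq_zero' ?_
    ring_nf
    abel_nf
    simp [CharTwo.two_eq_zero]

end Hopf

end PlumbingLattice

/-! ### The line formed by the Hopf link complex, and its contraction -/

namespace PlumbingLattice
open Op

namespace Mdl

variable (X : Mdl)

/-- The absolute exponents of the minimal generator of a cell. -/
abbrev lo (κ : X.C) : Z2 := X.off (X.gen κ)

/-- The first admissible position on the line formed by the Hopf link complex in a given cell. -/
def start (κ : X.C) (ε : Bool) (c : ℤ) : ℤ :=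
  -- Position P is admissible when `posExp c P` is at least the offset of the minimal generator,
  -- where the second coordinate counts only in idempotent zero. Solving floor(P/2) ≥ lo₁ and
  -- ceil(P/2) + c - 1 ≥ lo₂ for P gives the two bounds.
  if ε then 2 * (X.lo κ).1 else max (2 * (X.lo κ).1) (2 * ((X.lo κ).2 - c) + 1)

/-- The contribution of a generator of the Hopf link complex to the framing coordinate. -/
def cOff : HopfGen → ℤ
  | .a => 0
  | .b => 0
  | .c => 1
  | .d => 1

/-- The contribution of a generator of the Hopf link complex to the absolute exponents. -/
def eOff : HopfGen → Z2
  | .a => (0, 1)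
  | .b => (1, 1)
  | .c => (0, 1)
  | .d => (0, 0)

/-- Whether a generator of the Hopf link complex has homological degree zero. -/
def isLow : HopfGen → Bool
  | .a => true
  | .d => true
  | _ => false

/-- The generator of the Hopf link complex at a vertex of the line. -/
def vGen (P : ℤ) : HopfGen := if P % 2 = 0 then .d else .a

/-- The generator of the Hopf link complex at an edge of the line. -/
def eGen (P : ℤ) : HopfGen := if P % 2 = 0 then .c else .b

/-- The exponents of the old root at a position of the line. -/
def posExp (n : ℤ) (P : ℤ) : Z2 := (P / 2, P / 2 + n - 1 + P % 2)

variable {κ : Type}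

/-- A vertex of the line. -/
def vS (κ₀ : κ) (ε : Bool) (n : ℤ) (M : Z2) (P : ℤ) : ((κ × Z2) × BG) × Z2 :=
  (((κ₀, posExp n P), (ε, vGen P)), M - (P / 2, P / 2 + P % 2))

/-- An edge of the line. -/
def eS (κ₀ : κ) (ε : Bool) (n : ℤ) (M : Z2) (P : ℤ) : ((κ × Z2) × BG) × Z2 :=
  (((κ₀, posExp n P), (ε, eGen P)), M - ((P + 1) / 2, P / 2 + 1))

/-- Fixing the cell, the idempotent, the framing coordinate and the absolute exponents leaves a line
indexed by ℤ: d and a are the even and odd vertices, c and b the even and odd edges. The witnesses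
solve for these invariants. -/
theorem exists_vS_or_eS (s : ((κ × Z2) × BG) × Z2) :
    (∃ ε n M P, s = vS s.1.1.1 ε n M P) ∨ ∃ ε n M P, s = eS s.1.1.1 ε n M P := by
  obtain ⟨⟨⟨l, i, j⟩, ε, g⟩, p, q⟩ := s
  have h0 : (2 * i) % 2 = 0 := by omega
  have h1 : ¬ (2 * i + 1) % 2 = 0 := by omega
  rcases g with _ | _ | _ | _
  · refine Or.inl ⟨ε, j - i, (i + p, i + 1 + q), 2 * i + 1, ?_⟩
    simp only [vS, posExp, vGen, if_neg h1, Prod.mk.injEq, true_and, Prod.mk_sub_mk, and_true]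
    omega
  · refine Or.inr ⟨ε, j - i, (i + 1 + p, i + 1 + q), 2 * i + 1, ?_⟩
    simp only [eS, posExp, eGen, if_neg h1, Prod.mk.injEq, true_and, Prod.mk_sub_mk, and_true]
    omega
  · refine Or.inr ⟨ε, j - i + 1, (i + p, i + 1 + q), 2 * i, ?_⟩
    simp only [eS, posExp, eGen, if_pos h0, Prod.mk.injEq, true_and, Prod.mk_sub_mk, and_true]
    omega
  · refine Or.inl ⟨ε, j - i + 1, (i + p, i + q), 2 * i, ?_⟩
    simp only [vS, posExp, vGen, if_pos h0, Prod.mk.injEq, true_and, Prod.mk_sub_mk, and_true]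
    omega

theorem fD_vS (κ₀ : κ) (ε n M P) : loc Hopf.fD (bv (vS κ₀ ε n M P)) = 0 := by
  rw [vS, loc_bv, vGen]
  split_ifs <;> simp [Hopf.fD]

/-- The coefficients U₁, U₂, V₁, V₂ of the Hopf differential are exactly the shifts that lead from
an edge to its two ends without changing the framing coordinate or the absolute exponents. -/
theorem fD_eS (κ₀ : κ) (ε n M P) :
    loc Hopf.fD (bv (eS κ₀ ε n M P)) = bv (vS κ₀ ε n M P) + bv (vS κ₀ ε n M (P + 1)) := by
  rw [eS, loc_bv, eGen]
  obtain ⟨x, y⟩ := M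
  split_ifs with h
  · have h1 : ¬ (P + 1) % 2 = 0 := by omega
    simp only [Hopf.fD, List.map_cons, List.map_nil, List.sum_cons, List.sum_nil, add_zero]
    simp only [posExp, termOp_bv, vS, vGen, if_pos h, if_neg h1, Prod.mk_add_mk, Prod.mk_sub_mk,
      add_zero]
    rw [add_comm]
    congr 3 <;> simp only [Prod.mk.injEq, true_and, and_true] <;> omega
  · have h1 : (P + 1) % 2 = 0 := by omega
    simp only [Hopf.fD, List.map_cons, List.map_nil, List.sum_cons, List.sum_nil, add_zero]
    simp only [posExp, termOp_bv, vS, vGen, if_neg h, if_pos h1, Prod.mk_add_mk, Prod.mk_sub_mk,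
      add_zero]
    congr 3 <;> simp only [Prod.mk.injEq, true_and, and_true] <;> omega

/-- The path from the first admissible position to a given position. -/
noncomputable def path (κ₀ : X.C) (ε : Bool) (n : ℤ) (M : Z2) (P : ℤ) :
    ((X.C × Z2) × BG) × Z2 →₀ F2 :=
  ∑ Q ∈ Finset.Ico (X.start κ₀ ε n) P, bv (eS κ₀ ε n M Q) +
    ∑ Q ∈ Finset.Ico P (X.start κ₀ ε n), bv (eS κ₀ ε n M Q)

/-- Modulo 2 the orientation of a path does not matter, so one formula serves on both sides of the
start: a further edge is added or an old one cancelled. -/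
theorem path_succ (κ₀ : X.C) (ε n M P) :
    X.path κ₀ ε n M (P + 1) = X.path κ₀ ε n M P + bv (eS κ₀ ε n M P) := by
  rw [path, path]
  rcases le_or_gt (X.start κ₀ ε n) P with h | h
  · rw [Finset.Ico_eq_empty_of_le h, Finset.Ico_eq_empty_of_le (h.trans (by omega : P ≤ P + 1)),
      ← Finset.insert_Ico_right_eq_Ico_add_one h, Finset.sum_insert (by simp)]
    simp only [Finset.sum_empty, add_zero]
    rw [add_comm]
  · rw [Finset.Ico_eq_empty_of_le h.le, Finset.Ico_eq_empty_of_le (Int.add_one_le_iff.2 h),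
      ← Finset.insert_Ico_add_one_left_eq_Ico h, Finset.sum_insert (by simp)]
    have := add_self_zero (bv (eS κ₀ ε n M P))
    simp only [Finset.sum_empty, zero_add]
    linear_combination (norm := module) -this

theorem path_start (κ₀ : X.C) (ε n M) : X.path κ₀ ε n M (X.start κ₀ ε n) = 0 := by
  simp [path]

/-- The boundary telescopes to the two ends. The induction runs in both directions from the start,
where the path is empty, so the step is stated as an equivalence. -/
theorem fD_path (κ₀ : X.C) (ε n M P) :
    loc Hopf.fD (X.path κ₀ ε n M P) =
      bv (vS κ₀ ε n M P) + bv (vS κ₀ ε n M (X.start κ₀ ε n)) := by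
  have key : ∀ P, loc Hopf.fD (X.path κ₀ ε n M P) =
      bv (vS κ₀ ε n M P) + bv (vS κ₀ ε n M (X.start κ₀ ε n)) ↔
      loc Hopf.fD (X.path κ₀ ε n M (P + 1)) =
      bv (vS κ₀ ε n M (P + 1)) + bv (vS κ₀ ε n M (X.start κ₀ ε n)) := by
    intro P
    rw [path_succ, map_add, fD_eS, ← add_left_inj (bv (vS κ₀ ε n M P) + bv (vS κ₀ ε n M (P + 1)))]
    have : bv (vS κ₀ ε n M P) + bv (vS κ₀ ε n M (X.start κ₀ ε n)) +
        (bv (vS κ₀ ε n M P) + bv (vS κ₀ ε n M (P + 1))) =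
        bv (vS κ₀ ε n M (P + 1)) + bv (vS κ₀ ε n M (X.start κ₀ ε n)) := by
      have := add_self_zero (bv (vS κ₀ ε n M P))
      linear_combination (norm := module) this
    rw [this]
  induction P using Int.inductionOn' (b := X.start κ₀ ε n) with
  | zero => rw [path_start, map_zero, add_self_zero]
  | succ k _ ih => exact (key k).1 ih
  | pred k _ ih => exact (key (k - 1)).2 (by rwa [sub_add_cancel])

/-- The contraction of the line. -/
noncomputable def hH : Op (((X.C × Z2) × BG) × Z2) (((X.C × Z2) × BG) × Z2) :=
  ofBasis fun s => if isLow s.1.2.2 then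
    X.path s.1.1.1 s.1.2.1 (s.1.1.2.2 - s.1.1.2.1 + cOff s.1.2.2)
      ((s.1.1.2.1, s.1.1.2.1) + eOff s.1.2.2 + s.2)
      (if s.1.2.2 = .d then 2 * s.1.1.2.1 else 2 * s.1.1.2.1 + 1) else 0

theorem hH_vS (κ₀ : X.C) (ε n M P) : X.hH (bv (vS κ₀ ε n M P)) = X.path κ₀ ε n M P := by
  obtain ⟨x, y⟩ := M
  rw [hH, ofBasis_bv]
  by_cases h : P % 2 = 0
  · simp only [vS, vGen, if_pos h, isLow, posExp, cOff, eOff, if_true]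
    congr 1
    · omega
    · simp only [Prod.mk_add_mk, Prod.mk_sub_mk, Prod.mk.injEq]; omega
    · omega
  · simp only [vS, vGen, if_neg h, isLow, posExp, cOff, eOff, if_true]
    rw [if_neg (by simp)]
    congr 1
    · omega
    · simp only [Prod.mk_add_mk, Prod.mk_sub_mk, Prod.mk.injEq]; omega
    · omega

theorem hH_eS (κ₀ : X.C) (ε n M P) : X.hH (bv (eS κ₀ ε n M P)) = 0 := by
  rw [hH, ofBasis_bv, if_neg]
  simp only [eS, eGen]
  split_ifs <;> simp [isLow]

/-- The map from the line to a point. -/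
noncomputable def collapse {κ : Type} : Op (((κ × Z2) × BG) × Z2) ((κ × (Bool × ℤ)) × Z2) :=
  ofBasis fun s => if isLow s.1.2.2 then
    bv ((s.1.1.1, (s.1.2.1, s.1.1.2.2 - s.1.1.2.1 + cOff s.1.2.2)),
      (s.1.1.2.1, s.1.1.2.1) + eOff s.1.2.2 + s.2) else 0

theorem collapse_vS (κ₀ : κ) (ε n M P) :
    collapse (bv (vS κ₀ ε n M P)) = bv ((κ₀, (ε, n)), M) := by
  obtain ⟨x, y⟩ := M
  rw [collapse, ofBasis_bv]
  by_cases h : P % 2 = 0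
  · simp only [vS, vGen, if_pos h, isLow, posExp, cOff, eOff, if_true]
    congr 2
    · simp only [Prod.mk.injEq, true_and]; omega
    · simp only [Prod.mk_add_mk, Prod.mk_sub_mk, Prod.mk.injEq]; omega
  · simp only [vS, vGen, if_neg h, isLow, posExp, cOff, eOff, if_true]
    congr 2
    · simp only [Prod.mk.injEq, true_and]; omega
    · simp only [Prod.mk_add_mk, Prod.mk_sub_mk, Prod.mk.injEq]; omega

theorem collapse_eS (κ₀ : κ) (ε n M P) : collapse (bv (eS κ₀ ε n M P)) = 0 := by
  rw [collapse, ofBasis_bv, if_neg]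
  simp only [eS, eGen]
  split_ifs <;> simp [isLow]

/-- The inclusion of the first admissible position. -/
noncomputable def lH : Op ((X.C × (Bool × ℤ)) × Z2) (((X.C × Z2) × BG) × Z2) :=
  map fun p => vS p.1.1 p.1.2.1 p.1.2.2 p.2 (X.start p.1.1 p.1.2.1 p.1.2.2)

theorem lH_bv (κ₀ : X.C) (ε n M) :
    X.lH (bv ((κ₀, (ε, n)), M)) = bv (vS κ₀ ε n M (X.start κ₀ ε n)) := by simp [lH]

/-- On a vertex this is the boundary of the path to the start; on an edge, the paths to its two ends
differ by that edge, and both ends collapse to the same point. -/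
theorem line_htpy : loc Hopf.fD ∘ₗ X.hH + X.hH ∘ₗ loc Hopf.fD = LinearMap.id + X.lH ∘ₗ collapse := by
  refine ext_bv fun s => ?_
  simp only [LinearMap.add_apply, LinearMap.comp_apply, LinearMap.id_apply]
  rcases exists_vS_or_eS s with ⟨ε, n, M, P, h⟩ | ⟨ε, n, M, P, h⟩ <;> rw [h]
  · rw [hH_vS, fD_vS, fD_path, collapse_vS, lH_bv, map_zero, add_zero]
  · rw [hH_eS, fD_eS, collapse_eS, map_add, hH_vS, hH_vS, path_succ, map_zero, map_zero, add_zero,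
      zero_add, ← add_assoc, add_self_zero, zero_add]

theorem collapse_fD : collapse (κ := κ) ∘ₗ loc Hopf.fD = 0 := by
  refine ext_bv fun s => ?_
  rw [LinearMap.comp_apply, LinearMap.zero_apply]
  rcases exists_vS_or_eS s with ⟨ε, n, M, P, h⟩ | ⟨ε, n, M, P, h⟩ <;> rw [h]
  · rw [fD_vS, map_zero]
  · rw [fD_eS, map_add, collapse_vS, collapse_vS, add_self_zero]

theorem collapse_hH : collapse ∘ₗ X.hH = 0 := by
  refine ext_bv fun s => ?_
  rw [LinearMap.comp_apply]
  rcases exists_vS_or_eS s with ⟨ε, n, M, P, h⟩ | ⟨ε, n, M, P, h⟩ <;> rw [h]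
  · rw [hH_vS, path, map_add, map_sum, map_sum]
    simp [collapse_eS]
  · rw [hH_eS, map_zero]; rfl

theorem fD_lH : loc Hopf.fD ∘ₗ X.lH = 0 := by
  refine ext_bv fun ⟨⟨κ₀, ε, n⟩, M⟩ => ?_
  rw [LinearMap.comp_apply, lH_bv, fD_vS]; rfl

end Mdl

end PlumbingLattice

/-! ### The model with a new root and its augmentation -/

namespace PlumbingLattice
open Op
theorem Op.ofBasis_map {α β γ : Type*} (f : β → γ →₀ F2) (g : α → β) (x : α →₀ F2) :
    ofBasis f (map g x) = ofBasis (fun a => f (g a)) x := by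
  refine eq_of_bv (A := ofBasis f ∘ₗ map g) (fun a => ?_) x
  rw [LinearMap.comp_apply, map_bv, ofBasis_bv, ofBasis_bv]

theorem Op.map_eq_ofBasis {α β : Type*} (f : α → β) (x : α →₀ F2) :
    map f x = ofBasis (fun a => bv (f a)) x :=
  eq_of_bv (fun a => by rw [map_bv, ofBasis_bv]) x

namespace Mdl

variable (X : Mdl) (n : ℤ)

/-- The part of the lattice differential that comes from the old differential. -/
noncomputable def slide {κ : Type} (A : Op (κ × Z2) (κ × Z2)) :
    Op ((κ × (Bool × ℤ)) × Z2) ((κ × (Bool × ℤ)) × Z2) :=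
  ofBasis fun p => map (fun q => ((q.1, (p.1.2.1, q.2.2 - q.2.1)), p.2 + (q.2.1, q.2.1)))
    (A (bv (p.1.1, (0, p.1.2.2))))

/-- The lattice differential at the old root, first summand. -/
noncomputable def sigL {κ : Type} : Op ((κ × (Bool × ℤ)) × Z2) ((κ × (Bool × ℤ)) × Z2) :=
  ofBasis fun p => if p.1.2.1 then 0 else bv ((p.1.1, (true, p.1.2.2)), p.2)

/-- The lattice differential at the old root, second summand. -/
noncomputable def tauL {κ : Type} (A : Op (κ × Z2) (κ × Z2)) :
    Op ((κ × (Bool × ℤ)) × Z2) ((κ × (Bool × ℤ)) × Z2) :=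
  ofBasis fun p => if p.1.2.1 then 0 else
    map (fun q => ((q.1, (true, q.2.2 - q.2.1 + n)), p.2 + (q.2.1, q.2.1 - 1)))
      (A (bv (p.1.1, (0, p.1.2.2))))

/-- The effect of the new root on lattice cells. -/
noncomputable def turnL {κ : Type} : Op ((κ × (Bool × ℤ)) × Z2) ((κ × (Bool × ℤ)) × Z2) :=
  map fun p => ((p.1.1, (p.1.2.1, p.1.2.2 - 1)), tw p.2)

/-- The model for a tree with a new root attached to an old root of framing `n`. -/
noncomputable abbrev grow : Mdl where
  B := (X.B × Z2) × BG
  C := X.C × (Bool × ℤ)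
  d0 := ext2 X.d0 + loc Hopf.fD
  d1 := ext2 X.d1 + loc Hopf.fE + loc (Hopf.fP n) ∘ₗ ext2 X.t
  t := loc Hopf.fS + loc (Hopf.fT n) ∘ₗ ext2 X.t
  h := ext2 X.h + ext2 X.lift ∘ₗ X.hH ∘ₗ ext2 X.aug
  dL := slide X.dL + sigL + tauL n X.tL
  tL := turnL
  cell l := (X.cell l.1.1, (l.2.1, (X.off l.1.1).2 + l.1.2.2 - ((X.off l.1.1).1 + l.1.2.1) + cOff l.2.2))
  off l := ((X.off l.1.1).1 + l.1.2.1, (X.off l.1.1).1 + l.1.2.1) + eOff l.2.2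
  low l := X.low l.1.1 && isLow l.2.2
  gen κ := ((X.gen κ.1, posExp κ.2.2 (X.start κ.1 κ.2.1 κ.2.2) - X.lo κ.1),
    (κ.2.1, vGen (X.start κ.1 κ.2.1 κ.2.2)))
  Val l := X.Val l.1.1 ∧ 0 ≤ l.1.2.1 ∧ (l.2.1 = false → 0 ≤ l.1.2.2)
  nf κ := X.nf κ.1 + if κ.2.1 then 0 else 1

theorem collapse_bv {κ : Type} (κ₀ : κ) (ν : Z2) (ε : Bool) (g : HopfGen) (m : Z2) :
    collapse (bv (((κ₀, ν), (ε, g)), m)) = if isLow g then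
      bv ((κ₀, (ε, ν.2 - ν.1 + cOff g)), (ν.1, ν.1) + eOff g + m) else 0 := by
  rw [collapse, ofBasis_bv]

/-- The augmentation first forgets the old generators in favour of their cells, then the position on
the line. -/
theorem grow_aug : (grow X n).aug = collapse ∘ₗ ext2 X.aug := by
  refine ext_bv fun ⟨⟨⟨l, μ⟩, ε, g⟩, m⟩ => ?_
  rw [LinearMap.comp_apply, ext2_bv, aug_bv, aug_bv]
  by_cases h : X.low l = true
  · rw [if_pos h, map_bv, ins2, collapse_bv]
    simp only [h, Bool.true_and, Prod.fst_add, Prod.snd_add]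
  · rw [if_neg h, map_zero, map_zero, if_neg (by simp [h])]

theorem vS_exp (P : ℤ) : (P / 2, P / 2 + P % 2) = (P / 2, P / 2) + eOff (vGen P) := by
  rw [vGen]
  split_ifs with h
  · simp [eOff, h]
  · have : P % 2 = 1 := by omega
    simp [eOff, this]

theorem eS_exp (P : ℤ) : ((P + 1) / 2, P / 2 + 1) = (P / 2, P / 2) + eOff (eGen P) := by
  rw [eGen]
  split_ifs with h <;> ext <;> simp [eOff] <;> omega

theorem grow_lift : (grow X n).lift = ext2 X.lift ∘ₗ X.lH := by
  refine ext_bv fun ⟨⟨κ, ε, c⟩, m⟩ => ?_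
  rw [LinearMap.comp_apply, lH_bv, vS, ext2_bv, lift_bv, lift_bv, map_bv, vS_exp]
  simp only [ins2, add_sub_cancel, Prod.fst_sub, posExp]

/-- The collapse sees old exponents (i, j) only through j - i, which enters the framing coordinate,
and i, which enters the absolute exponents. By linearity A may be evaluated at the normal form (0,
c) and the result translated. -/
theorem slide_collapse {A : Op (X.C × Z2) (X.C × Z2)} (hA : Lin A) :
    slide A ∘ₗ collapse = collapse ∘ₗ ext2 A := by
  refine ext_bv fun ⟨⟨⟨κ, ν⟩, ε, g⟩, m⟩ => ?_
  rw [LinearMap.comp_apply, LinearMap.comp_apply, ext2_bv, collapse_bv]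
  by_cases h : isLow g = true
  · have : ∀ x, collapse (map (ins2 (ε, g) m) x) = map (fun q : X.C × Z2 =>
        ((q.1, (ε, q.2.2 - q.2.1 + cOff g)), (q.2.1, q.2.1) + eOff g + m)) x := fun x => by
      refine eq_of_bv (A := collapse ∘ₗ map (ins2 (ε, g) m)) (fun q => ?_) x
      rw [LinearMap.comp_apply, map_bv, map_bv, ins2]
      exact (collapse_bv _ _ _ _ _).trans (if_pos h)
    rw [if_pos h, slide, ofBasis_bv, this, hA.bv κ ν (0, ν.2 - ν.1 + cOff g), sh, map_map]
    congr 2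
    funext ⟨κ', i, j⟩
    simp only [AddMonoidHom.id_apply, Prod.fst_add, Prod.snd_add, Prod.fst_sub, Prod.snd_sub,
      Prod.mk.injEq, true_and]
    refine ⟨by omega, ?_⟩
    ext <;> simp <;> ring
  · have : ∀ x, collapse (map (ins2 (ε, g) m) x) = (0 : Op (X.C × Z2) _) x := fun x => by
      refine eq_of_bv (A := collapse ∘ₗ map (ins2 (ε, g) m)) (fun q => ?_) x
      rw [LinearMap.comp_apply, map_bv, ins2]
      exact (collapse_bv _ _ _ _ _).trans (if_neg h)
    rw [if_neg h, this, map_zero]; rfl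

theorem sigL_collapse {κ : Type} : sigL ∘ₗ collapse (κ := κ) = collapse ∘ₗ loc Hopf.fE := by
  refine ext_bv fun ⟨⟨⟨κ, ν⟩, ε, g⟩, m⟩ => ?_
  rw [LinearMap.comp_apply, LinearMap.comp_apply, loc_bv, collapse_bv]
  rcases ε with _ | _
  · simp only [Hopf.fE, List.map_cons, List.map_nil, List.sum_cons, List.sum_nil, add_zero, termOp_bv,
      collapse_bv, Prod.mk_zero_zero]
    split_ifs
    · simp [sigL]
    · rw [map_zero]
  · simp only [Hopf.fE, List.map_nil, List.sum_nil, map_zero]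
    split_ifs
    · simp [sigL]
    · rw [map_zero]

theorem collapse_fP (ν : Z2) (κ₀ : X.C) (g : HopfGen) (m : Z2) :
    collapse (loc (Hopf.fP n) (bv (((κ₀, ν), (false, g)), m))) =
      if isLow g then bv ((κ₀, (true, ν.2 - ν.1 + n + cOff g)), (ν.1, ν.1) + (cOff g, 0) + m) else 0 := by
  obtain ⟨x, y⟩ := m
  rw [loc_bv]
  rcases g <;> simp only [Hopf.fP, List.map_cons, List.map_nil, List.sum_cons, List.sum_nil, add_zero,
    termOp_bv, collapse_bv, map_add, map_zero, isLow, cOff, eOff, if_true, if_false, Bool.false_eq_true]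
  · congr 2
    · simp; ring
    · simp
  · congr 2
    · simp; ring
    · simp; ring

/-- The normalisation to old exponents (0, c) again, now by semilinearity; afterwards `fP` shifts
the framing coordinate by n. -/
theorem tauL_collapse {A : Op (X.C × Z2) (X.C × Z2)} (hA : Semi tw A) :
    tauL n A ∘ₗ collapse = collapse ∘ₗ loc (Hopf.fP n) ∘ₗ ext2 A := by
  refine ext_bv fun ⟨⟨⟨κ, ν⟩, ε, g⟩, m⟩ => ?_
  simp only [LinearMap.comp_apply]
  rw [ext2_bv, collapse_bv]
  rcases ε with _ | _
  · have : ∀ x, collapse (loc (Hopf.fP n) (map (ins2 (false, g) m) x)) =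
        ofBasis (fun q : X.C × Z2 => if isLow g then
        bv ((q.1, (true, q.2.2 - q.2.1 + n + cOff g)), (q.2.1, q.2.1) + (cOff g, 0) + m) else 0) x := fun x => by
      refine eq_of_bv (A := collapse ∘ₗ loc (Hopf.fP n) ∘ₗ map (ins2 (false, g) m)) (fun q => ?_) x
      rw [LinearMap.comp_apply, LinearMap.comp_apply, map_bv, ofBasis_bv, ins2]
      exact collapse_fP X n q.2 q.1 g m
    rw [this]
    by_cases h : isLow g = true
    · simp only [h, if_true]
      rw [tauL, ofBasis_bv, hA.bv κ ν (0, ν.2 - ν.1 + cOff g), sh]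
      simp only [Bool.false_eq_true, if_false]
      rw [ofBasis_map, map_eq_ofBasis]
      congr 2
      funext ⟨κ', i, j⟩
      obtain ⟨x, y⟩ := m
      -- On a and d the two offsets determine one another, so both generators are treated at once.
      have hg : eOff g = (0, 1 - cOff g) := by
        rcases g <;> simp_all [isLow, eOff, cOff]
      rw [hg]
      congr 2
      · simp [tw_apply]; ring
      · simp [tw_apply]
        constructor <;> ring
    · simp only [h]
      refine (map_zero (tauL n A)).trans (Eq.symm (eq_of_bv (B := 0) (fun q => ?_) _))
      rw [ofBasis_bv]; rfl
  · have : ∀ x : X.C × Z2 →₀ F2, loc (Hopf.fP n) (map (ins2 (true, g) m) x) = 0 := fun x => by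
      rw [loc_map]; simp [Hopf.fP]
    rw [this, map_zero]
    split_ifs
    · simp [tauL]
    · rw [map_zero]

theorem turnL_collapse {κ : Type} : turnL ∘ₗ collapse (κ := κ) = collapse ∘ₗ loc Hopf.fS := by
  refine ext_bv fun ⟨⟨⟨κ, ν⟩, ε, g⟩, x, y⟩ => ?_
  rw [LinearMap.comp_apply, LinearMap.comp_apply, loc_bv, collapse_bv]
  rcases g <;> simp only [Hopf.fS, List.map_cons, List.map_nil, List.sum_cons, List.sum_nil, add_zero,
    termOp_bv, collapse_bv, map_add, map_zero, isLow, cOff, eOff, if_true, if_false, Bool.false_eq_true]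
  · rw [turnL, map_bv]
    simp [tw_apply]
    congr 2
    · simp; ring
    · simp; ring
  · rw [turnL, map_bv]
    simp [tw_apply]
    congr 2
    simp; ring

/-- All values of the length two map are multiples of c, an edge of the line. Thus the root acts on
cells by a single relabelling, without a homotopy term. -/
theorem collapse_fT {κ : Type} : collapse (κ := κ) ∘ₗ loc (Hopf.fT n) = 0 := by
  refine ext_bv fun ⟨⟨⟨κ, ν⟩, ε, g⟩, m⟩ => ?_
  rw [LinearMap.comp_apply, loc_bv]
  rcases ε <;> rcases g <;> simp [Hopf.fT, termOp_bv, collapse_bv, isLow]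

end Mdl
end PlumbingLattice

/-! ### Relations in the model with a new root -/

namespace PlumbingLattice
open Op
namespace Mdl

section Algebra
variable {M : Type*} [AddCommGroup M] [Module F2 M]

/-- The hypotheses bring every product of two summands into a fixed order, after which each
surviving product occurs twice. Primes denote the operators twisted by being moved past t. -/
theorem square_zero_of_terms {d D E P t D' E' P' : M →ₗ[F2] M}
    (h1 : d ∘ₗ d = 0) (h2 : d ∘ₗ D = D ∘ₗ d) (h3 : d ∘ₗ E = E ∘ₗ d) (h4 : d ∘ₗ P = P ∘ₗ d)
    (h5 : d ∘ₗ t = t ∘ₗ d) (h6 : D ∘ₗ D = 0) (h7 : D ∘ₗ E = E ∘ₗ D) (h8 : E ∘ₗ E = 0)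
    (h9 : t ∘ₗ D = D' ∘ₗ t) (h10 : t ∘ₗ E = E' ∘ₗ t) (h11 : t ∘ₗ P = P' ∘ₗ t)
    (h12 : D ∘ₗ P = P ∘ₗ D') (h13 : E ∘ₗ P = 0) (h14 : P ∘ₗ E' = 0) (h15 : P ∘ₗ P' = 0) :
    (d + D + E + P ∘ₗ t) ∘ₗ (d + D + E + P ∘ₗ t) = 0 := by
  refine LinearMap.ext fun x => ?_
  simp only [LinearMap.ext_iff, LinearMap.comp_apply, LinearMap.zero_apply] at *
  simp only [LinearMap.add_apply, LinearMap.comp_apply, map_add, LinearMap.zero_apply,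
    h1, h2, h3, h4, h5, h6, h7, h8, h9, h10, h11, h12, h13, h14, h15]
  have e1 := add_self_zero (D (d x))
  have e2 := add_self_zero (E (d x))
  have e3 := add_self_zero (E (D x))
  have e4 := add_self_zero (P (t (d x)))
  have e5 := add_self_zero (P (D' (t x)))
  linear_combination (norm := module) e1 + e2 + e3 + e4 + e5

/-- All relations but the last are commutations or vanishing products; `h18` says that S and P
commute up to the homotopy T, and this is what the term `T ∘ t` corrects. -/
theorem commute_of_terms {d D E P t S T D' E' P' S' T' : M →ₗ[F2] M}
    (h3 : d ∘ₗ T = T ∘ₗ d) (h4 : d ∘ₗ S = S ∘ₗ d)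
    (h5 : d ∘ₗ t = t ∘ₗ d) (h6 : D ∘ₗ S = S ∘ₗ D) (h7 : E ∘ₗ S = S ∘ₗ E) 
    (h9 : t ∘ₗ D = D' ∘ₗ t) (h10 : t ∘ₗ E = E' ∘ₗ t) (h11 : t ∘ₗ P = P' ∘ₗ t)
    (h12 : t ∘ₗ S = S' ∘ₗ t) (h13 : t ∘ₗ T = T' ∘ₗ t) (h14 : E ∘ₗ T = 0) (h15 : P ∘ₗ T' = 0)
    (h16 : T ∘ₗ E' = 0) (h17 : T ∘ₗ P' = 0) (h18 : D ∘ₗ T + S ∘ₗ P = T ∘ₗ D' + P ∘ₗ S') :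
    (d + D + E + P ∘ₗ t) ∘ₗ (S + T ∘ₗ t) = (S + T ∘ₗ t) ∘ₗ (d + D + E + P ∘ₗ t) := by
  refine LinearMap.ext fun x => ?_
  simp only [LinearMap.ext_iff, LinearMap.comp_apply, LinearMap.zero_apply,
    LinearMap.add_apply] at *
  simp only [LinearMap.add_apply, LinearMap.comp_apply, map_add, LinearMap.zero_apply,
    h3, h4, h5, h6, h7, h9, h10, h11, h12, h13, h14, h15, h16, h17]
  have e1 := h18 (t x)
  have e2 := add_self_zero (P (S' (t x)))
  have e3 := add_self_zero (S (P (t x)))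
  linear_combination (norm := module) e1 + e2 - e3

/-- Composition of two contractions: h retracts onto the image of l, and H then contracts what
remains. The cross terms cancel because h commutes with D while l and a intertwine D with D'. -/
theorem homotopy_of_terms {N : Type*} [AddCommGroup N] [Module F2 N] {d h D : M →ₗ[F2] M}
    {D' H K : N →ₗ[F2] N} {l : N →ₗ[F2] M} {a : M →ₗ[F2] N}
    (h1 : d ∘ₗ h + h ∘ₗ d = LinearMap.id + l ∘ₗ a) (h2 : h ∘ₗ D = D ∘ₗ h) (h3 : d ∘ₗ l = 0)
    (h4 : a ∘ₗ d = 0) (h5 : l ∘ₗ D' = D ∘ₗ l) (h6 : a ∘ₗ D = D' ∘ₗ a)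
    (h7 : D' ∘ₗ H + H ∘ₗ D' = LinearMap.id + K) :
    (d + D) ∘ₗ (h + l ∘ₗ H ∘ₗ a) + (h + l ∘ₗ H ∘ₗ a) ∘ₗ (d + D) =
      LinearMap.id + l ∘ₗ K ∘ₗ a := by
  refine LinearMap.ext fun x => ?_
  simp only [LinearMap.ext_iff, LinearMap.comp_apply, LinearMap.zero_apply,
    LinearMap.add_apply, LinearMap.id_apply] at *
  simp only [map_add, h2, h3, h4, h6, map_zero, ← h5]
  have e1 := congrArg l (h7 (a x))
  simp only [map_add] at e1
  have e2 := add_self_zero (D (h x))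
  have e3 := add_self_zero (l (a x))
  linear_combination (norm := module) h1 x + e1 + e2 + e3

end Algebra

variable {X : Mdl} (n : ℤ)

theorem grow_d : (grow X n).d =
    ext2 X.d + loc Hopf.fD + loc Hopf.fE + loc (Hopf.fP n) ∘ₗ ext2 X.t := by
  rw [d, d, ext2_add]
  change ext2 X.d0 + loc Hopf.fD + (ext2 X.d1 + loc Hopf.fE + loc (Hopf.fP n) ∘ₗ ext2 X.t) = _
  abel

theorem Good.grow_dd (hX : X.Good) : (grow X n).d ∘ₗ (grow X n).d = 0 := by
  rw [grow_d]
  refine square_zero_of_terms (D' := loc (Hopf.fD.twist tw)) (E' := loc (Hopf.fE.twist tw))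
    (P' := loc ((Hopf.fP n).twist tw)) ?_ (ext2_loc_lin hX.lin_d _) (ext2_loc_lin hX.lin_d _)
    (ext2_loc_lin hX.lin_d _) ?_ Hopf.dd Hopf.dE Hopf.EE (ext2_loc hX.semi_t _)
    (ext2_loc hX.semi_t _) (ext2_loc hX.semi_t _) (Hopf.dP n) (Hopf.EP n) (Hopf.PE n) (Hopf.PP n)
  · rw [← ext2_comp, hX.dd, ext2_zero]
  · rw [← ext2_comp, hX.dt, ext2_comp]

theorem Good.grow_dt (hX : X.Good) : (grow X n).d ∘ₗ (grow X n).t = (grow X n).t ∘ₗ (grow X n).d := by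
  rw [grow_d]
  refine commute_of_terms (D' := loc (Hopf.fD.twist tw)) (E' := loc (Hopf.fE.twist tw))
    (P' := loc ((Hopf.fP n).twist tw)) (S' := loc (Hopf.fS.twist tw))
    (T' := loc ((Hopf.fT n).twist tw)) (ext2_loc_lin hX.lin_d _) (ext2_loc_lin hX.lin_d _) ?_
    Hopf.Sd Hopf.SE (ext2_loc hX.semi_t _) (ext2_loc hX.semi_t _) (ext2_loc hX.semi_t _)
    (ext2_loc hX.semi_t _) (ext2_loc hX.semi_t _) (Hopf.ET n) (Hopf.PT n) (Hopf.TE n) (Hopf.TP n)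
    (Hopf.square n)
  rw [← ext2_comp, hX.dt, ext2_comp]

theorem Good.grow_aug_d0 (hX : X.Good) : (grow X n).aug ∘ₗ (grow X n).d0 = 0 := by
  rw [grow_aug, LinearMap.comp_add, LinearMap.comp_assoc, LinearMap.comp_assoc, ← ext2_comp,
    hX.aug_d0, ext2_loc_lin X.lin_aug, ← LinearMap.comp_assoc (ext2 X.aug), collapse_fD, ext2_zero]
  simp

theorem Good.grow_aug_d1 (hX : X.Good) :
    (grow X n).aug ∘ₗ (grow X n).d1 = (grow X n).dL ∘ₗ (grow X n).aug := by
  have h1 : ext2 X.aug ∘ₗ (ext2 X.d1 + loc Hopf.fE + loc (Hopf.fP n) ∘ₗ ext2 X.t) =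
      (ext2 X.dL + loc Hopf.fE + loc (Hopf.fP n) ∘ₗ ext2 X.tL) ∘ₗ ext2 X.aug := by
    rw [LinearMap.comp_add, LinearMap.comp_add, LinearMap.add_comp, LinearMap.add_comp,
      ← ext2_comp, hX.aug_d1, ext2_comp X.aug, ext2_loc_lin X.lin_aug, ← LinearMap.comp_assoc (ext2 X.t),
      ext2_loc_lin X.lin_aug, LinearMap.comp_assoc (ext2 X.t), ← ext2_comp X.t, hX.aug_t, ext2_comp X.aug,
      LinearMap.comp_assoc]
  rw [grow_aug, LinearMap.comp_assoc, h1, ← LinearMap.comp_assoc, ← LinearMap.comp_assoc,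
    LinearMap.comp_add, LinearMap.comp_add, ← slide_collapse X hX.lin_dL, ← sigL_collapse,
    ← tauL_collapse X n hX.semi_tL, ← LinearMap.add_comp, ← LinearMap.add_comp, LinearMap.comp_assoc]

theorem Good.grow_aug_t (hX : X.Good) :
    (grow X n).aug ∘ₗ (grow X n).t = (grow X n).tL ∘ₗ (grow X n).aug := by
  have h1 : ext2 X.aug ∘ₗ (loc Hopf.fS + loc (Hopf.fT n) ∘ₗ ext2 X.t) =
      loc Hopf.fS ∘ₗ ext2 X.aug + loc (Hopf.fT n) ∘ₗ ext2 X.aug ∘ₗ ext2 X.t := by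
    rw [LinearMap.comp_add, ext2_loc_lin X.lin_aug, ← LinearMap.comp_assoc (ext2 X.t),
      ext2_loc_lin X.lin_aug, LinearMap.comp_assoc (ext2 X.t)]
  rw [grow_aug, LinearMap.comp_assoc, h1, LinearMap.comp_add, ← LinearMap.comp_assoc,
    ← LinearMap.comp_assoc (ext2 X.aug ∘ₗ ext2 X.t), collapse_fT, LinearMap.zero_comp, add_zero,
    ← turnL_collapse, LinearMap.comp_assoc]

theorem Good.grow_d0_lift (hX : X.Good) : (grow X n).d0 ∘ₗ (grow X n).lift = 0 := by
  rw [grow_lift, LinearMap.add_comp, ← LinearMap.comp_assoc, ← LinearMap.comp_assoc, ← ext2_comp,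
    hX.d0_lift, ← ext2_loc_lin X.lin_lift, LinearMap.comp_assoc X.lH, fD_lH, ext2_zero]
  simp

theorem Good.grow_aug_h (hX : X.Good) : (grow X n).aug ∘ₗ (grow X n).h = 0 := by
  have h1 : ext2 X.aug ∘ₗ (ext2 X.h + ext2 X.lift ∘ₗ X.hH ∘ₗ ext2 X.aug) = X.hH ∘ₗ ext2 X.aug := by
    rw [LinearMap.comp_add, ← ext2_comp, hX.aug_h, ← LinearMap.comp_assoc, ← ext2_comp, hX.aug_lift,
      ext2_zero, ext2_id, zero_add, LinearMap.id_comp]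
  rw [grow_aug, LinearMap.comp_assoc, h1, ← LinearMap.comp_assoc, collapse_hH, LinearMap.zero_comp]

theorem Good.grow_htpy (hX : X.Good) :
    (grow X n).d0 ∘ₗ (grow X n).h + (grow X n).h ∘ₗ (grow X n).d0 =
      LinearMap.id + (grow X n).lift ∘ₗ (grow X n).aug := by
  rw [grow_lift, grow_aug, LinearMap.comp_assoc, ← LinearMap.comp_assoc _ collapse]
  refine homotopy_of_terms ?_ (ext2_loc_lin hX.lin_h _) ?_ ?_ (ext2_loc_lin X.lin_lift _)
    (ext2_loc_lin X.lin_aug _) X.line_htpy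
  · rw [← ext2_comp, ← ext2_comp, ← ext2_comp, ← ext2_add, hX.htpy, ext2_add, ext2_id]
  · rw [← ext2_comp, hX.d0_lift, ext2_zero]
  · rw [← ext2_comp, hX.aug_d0, ext2_zero]

end Mdl
end PlumbingLattice

/-! ### Linearity, supports and finiteness in the model with a new root -/

namespace PlumbingLattice
open Op
namespace Mdl
variable {X : Mdl} (n : ℤ)

theorem supp_loc {β : Type*} {f : Terms} {R : ((β × Z2) × BG) × Z2 → ((β × Z2) × BG) × Z2 → Prop}
    (h : ∀ l μ g m, ∀ q ∈ f g m, R (((l, μ), g), m) (((l, μ + q.1), q.2.1), q.2.2)) :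
    Supp (PlumbingLattice.loc f) R := by
  rintro ⟨⟨⟨l, μ⟩, g⟩, m⟩ s hs
  rw [loc_bv] at hs
  have key : ∀ L : List (Z2 × BG × Z2), (L.map fun q => termOp q (bv (l, μ))).sum s ≠ 0 →
      ∃ q ∈ L, s = (((l, μ + q.1), q.2.1), q.2.2) := by
    intro L
    induction L with
    | nil => simp
    | cons q L ih =>
      intro h
      rw [List.map_cons, List.sum_cons] at h
      rcases add_ne h with h | h
      · rw [termOp_bv] at h
        exact ⟨q, List.mem_cons_self, ne_of_bv_ne h⟩
      · obtain ⟨q', hq', h⟩ := ih h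
        exact ⟨q', List.mem_cons_of_mem _ hq', h⟩
  obtain ⟨q, hq, rfl⟩ := key _ hs
  exact h l μ g m q hq

theorem semi_turnL {κ : Type} : Semi tw (turnL (κ := κ)) := semi_of_bv fun μ κ m => by
  rw [turnL, map_bv, map_bv, sh_bv, map_add]

theorem lin_sigL {κ : Type} : Lin (sigL (κ := κ)) := lin_of_bv fun μ κ m => by
  simp only [sigL, ofBasis_bv]
  split_ifs
  · simp
  · rw [sh_bv]

theorem lin_slide {κ : Type} (A : Op (κ × Z2) (κ × Z2)) : Lin (slide A) := lin_of_bv fun μ κ m => by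
  simp only [slide, ofBasis_bv, sh, map_map, add_right_comm]

theorem lin_tauL {κ : Type} (A : Op (κ × Z2) (κ × Z2)) : Lin (tauL n A) := lin_of_bv fun μ κ m => by
  simp only [tauL, ofBasis_bv]
  split_ifs
  · rw [map_zero]
  · simp only [sh, map_map, add_right_comm]

theorem lin_fD {β : Type*} : Lin (loc (β := β) Hopf.fD) := semi_loc fun ⟨ε, g⟩ m μ => by
  rcases g <;> simp [Hopf.fD, add_right_comm]

theorem lin_fE {β : Type*} : Lin (loc (β := β) Hopf.fE) := semi_loc fun ⟨ε, g⟩ m μ => by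
  rcases ε <;> simp [Hopf.fE]

theorem lin_fP {β : Type*} : Lin (loc (β := β) (Hopf.fP n)) := semi_loc fun ⟨ε, g⟩ m μ => by
  rcases ε <;> rcases g <;> simp [Hopf.fP, add_right_comm]

theorem semi_fS {β : Type*} : Semi tw (loc (β := β) Hopf.fS) := semi_loc fun ⟨ε, g⟩ m μ => by
  rcases g <;> simp [Hopf.fS, add_right_comm]

theorem semi_fT {β : Type*} : Semi tw (loc (β := β) (Hopf.fT n)) := semi_loc fun ⟨ε, g⟩ m μ => by
  rcases ε <;> rcases g <;> simp [Hopf.fT, add_right_comm]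

theorem semi_ext2_loc {α : Type} {θ : Z2 →+ Z2} {A : Op (α × Z2) (α × Z2)} {f : Terms}
    (hf : Semi θ (loc (β := α) f)) : Semi θ (loc f ∘ₗ ext2 A) := fun μ => by
  rw [LinearMap.comp_assoc, (Op.lin_onFst _).comm, ← LinearMap.comp_assoc, hf, LinearMap.comp_assoc]

theorem vS_sh {κ : Type} (κ₀ : κ) (ε n M P) (μ : Z2) :
    sh μ (bv (vS κ₀ ε n M P)) = bv (vS κ₀ ε n (M + μ) P) := by
  rw [vS, vS, sh_bv, add_sub_right_comm]

theorem eS_sh {κ : Type} (κ₀ : κ) (ε n M P) (μ : Z2) :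
    sh μ (bv (eS κ₀ ε n M P)) = bv (eS κ₀ ε n (M + μ) P) := by
  rw [eS, eS, sh_bv, add_sub_right_comm]

theorem lin_hH (X : Mdl) : Lin X.hH := lin_of_comm fun μ => ext_bv fun s => by
  rw [LinearMap.comp_apply, LinearMap.comp_apply]
  rcases exists_vS_or_eS s with ⟨ε, n, M, P, h⟩ | ⟨ε, n, M, P, h⟩ <;> rw [h]
  · rw [vS_sh, hH_vS, hH_vS, path, path, map_add, map_sum, map_sum]
    simp only [eS_sh]
  · rw [eS_sh, hH_eS, hH_eS, map_zero]

theorem hH_supp (X : Mdl) : Supp X.hH fun s s' => ∃ ε n M P Q, s = vS s.1.1.1 ε n M P ∧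
    s' = eS s.1.1.1 ε n M Q ∧
    (X.start s.1.1.1 ε n ≤ Q ∧ Q < P ∨ P ≤ Q ∧ Q < X.start s.1.1.1 ε n) := by
  intro s s' hs
  rcases exists_vS_or_eS s with ⟨ε, n, M, P, h⟩ | ⟨ε, n, M, P, h⟩
  · refine ⟨ε, n, M, P, ?_⟩
    rw [h, hH_vS, path] at hs
    rcases add_ne hs with hs | hs <;> rw [Finsupp.finsetSum_apply] at hs <;>
      obtain ⟨Q, hQ, hs⟩ := Finset.exists_ne_zero_of_sum_ne_zero hs <;>
      rw [Finset.mem_Ico] at hQ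
    · exact ⟨Q, h, ne_of_bv_ne hs, Or.inl hQ⟩
    · exact ⟨Q, h, ne_of_bv_ne hs, Or.inr hQ⟩
  · rw [h, hH_eS] at hs
    simp at hs

end Mdl
end PlumbingLattice

namespace PlumbingLattice
open Op
namespace Mdl
variable {X : Mdl} (n : ℤ)

theorem lt_mod (P : ℤ) : P % 2 = 0 ∨ P % 2 = 1 := by omega

theorem Good.grow_supp_h (hX : X.Good) :
    Supp (grow X n).h fun p q => (grow X n).cell q.1 = (grow X n).cell p.1 ∧
      (grow X n).off q.1 + q.2 = (grow X n).off p.1 + p.2 ∧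
      ((grow X n).Val p.1 → (grow X n).Val q.1 ∧ p.2 ≤ q.2) := by
  refine Supp.add ?_ ?_
  · refine hX.supp_h.ext2.mono ?_
    rintro ⟨⟨⟨l, μ⟩, ε, g⟩, m⟩ ⟨⟨⟨l', μ'⟩, ε', g'⟩, m'⟩ ⟨⟨h1, h2, h3⟩, h4, rfl : m = m'⟩
    obtain ⟨rfl, rfl⟩ : ε = ε' ∧ g = g' := by simpa using h4
    have h5 : (X.off l').1 + μ'.1 = (X.off l).1 + μ.1 := congrArg Prod.fst h2
    have h6 : (X.off l').2 + μ'.2 = (X.off l).2 + μ.2 := congrArg Prod.snd h2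
    dsimp only at *
    refine ⟨by rw [h1, h5, h6], by rw [h5], fun ⟨hv, h7, h8⟩ => ⟨⟨(h3 hv).1, ?_, fun hε => ?_⟩, le_rfl⟩⟩
    · exact h7.trans (h3 hv).2.1
    · exact (h8 hε).trans (h3 hv).2.2
  · rintro ⟨⟨⟨l, μ⟩, ε, g⟩, m⟩ s hs
    rw [LinearMap.comp_apply, LinearMap.comp_apply, ext2_bv, aug_bv] at hs
    split_ifs at hs with hl
    swap
    · simp at hs
    rw [map_bv, ins2] at hs
    obtain ⟨s', hs', hs⟩ := exists_of_apply_ne hs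
    obtain ⟨ε', n', M, P, Q, h1, rfl, h2⟩ := hH_supp X _ _ hs'
    rw [eS, ext2_bv, lift_bv, map_bv] at hs
    obtain rfl := ne_of_bv_ne hs
    rw [vS] at h1
    simp only [Prod.mk.injEq, true_and] at h1
    obtain ⟨⟨h3, rfl, rfl⟩, rfl⟩ := h1
    have hi : (X.off l).1 + μ.1 = P / 2 := congrArg Prod.fst h3
    have hj : (X.off l).2 + μ.2 = P / 2 + n' - 1 + P % 2 := congrArg Prod.snd h3
    have ho := hX.cell_gen (X.cell l)
    dsimp only [ins2] at *
    rw [ho, hi, hj]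
    simp only [Prod.fst_sub, Prod.snd_sub, add_sub_cancel, posExp]
    refine ⟨?_, ?_, ?_⟩
    · have : Q / 2 + n' - 1 + Q % 2 - Q / 2 + cOff (eGen Q) = P / 2 + n' - 1 + P % 2 - P / 2 + cOff (vGen P) := by
        rcases lt_mod P with hP | hP <;> rcases lt_mod Q with hQ | hQ <;>
          simp [vGen, eGen, hP, hQ, cOff] <;> ring
      rw [this]
    · rw [eS_exp, vS_exp, add_sub_cancel, add_sub_cancel]
    · rintro ⟨hv, h4, h5⟩
      obtain ⟨h6, h7⟩ : X.lo (X.cell l) ≤ X.off l := hX.off_ge l hv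
      -- A valid vertex lies at or beyond the start, so its path consists of edges Q with start ≤ Q
      -- < P. These are valid, and their offsets do not exceed that of the vertex, so the exponent
      -- of the new root does not decrease.
      have h8 : X.start (X.cell l) ε n' ≤ P := by
        rw [start]
        split_ifs with hε
        · omega
        · have := h5 (by simpa using hε)
          rw [max_le_iff]; constructor <;> omega
      have h9 : X.start (X.cell l) ε n' ≤ Q ∧ Q < P := by omega
      refine ⟨⟨hX.val_gen _, ?_, fun hε => ?_⟩, ?_⟩
      · have : 2 * (X.off (X.gen (X.cell l))).1 ≤ X.start (X.cell l) ε n' := by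
          rw [start]; split_ifs
          · rfl
          · exact le_max_left _ _
        omega
      · have : 2 * ((X.off (X.gen (X.cell l))).2 - n') + 1 ≤ X.start (X.cell l) ε n' := by
          rw [start, if_neg (by simp [hε])]; exact le_max_right _ _
        omega
      · refine sub_le_sub_left ?_ M
        constructor <;> dsimp only <;> omega

theorem Good.grow_supp_d1 (hX : X.Good) :
    Supp (grow X n).d1 fun p q =>
      (grow X n).nf ((grow X n).cell q.1) < (grow X n).nf ((grow X n).cell p.1) := by
  refine Supp.add (Supp.add ?_ ?_) ?_
  · refine hX.supp_d1.ext2.mono ?_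
    rintro ⟨⟨⟨l, μ⟩, ε, g⟩, m⟩ ⟨⟨⟨l', μ'⟩, ε', g'⟩, m'⟩ ⟨h1, h4, h5⟩
    obtain ⟨rfl, rfl⟩ : ε = ε' ∧ g = g' := by simpa using h4
    dsimp only at *
    omega
  · refine supp_loc fun l μ g m q hq => ?_
    obtain ⟨ε, g⟩ := g
    rcases ε <;> simp [Hopf.fE] at hq
    subst hq
    simp
  · refine (hX.supp_t.ext2.comp (supp_loc (R := fun p q => X.nf (X.cell q.1.1.1) = X.nf (X.cell p.1.1.1) ∧
      p.1.2.1 = false ∧ q.1.2.1 = true) fun l μ g m q hq => ?_)).mono ?_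
    · obtain ⟨ε, g⟩ := g
      refine ⟨rfl, ?_⟩
      rcases ε <;> rcases g <;> simp [Hopf.fP] at hq
      · simp [hq]
      · rcases hq with hq | hq <;> simp [hq]
      · simp [hq]
    · rintro p q ⟨r, ⟨h1, h2, h3⟩, h4, h5, h6⟩
      dsimp only at *
      rw [h2, h5, h6, h4]
      simp; omega

theorem Good.grow_supp_t (hX : X.Good) :
    Supp (grow X n).t fun p q =>
      (grow X n).nf ((grow X n).cell q.1) ≤ (grow X n).nf ((grow X n).cell p.1) := by
  refine Supp.add ?_ ?_
  · refine supp_loc fun l μ g m q hq => ?_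
    obtain ⟨ε, g⟩ := g
    rcases g <;> simp [Hopf.fS] at hq
    · simp [hq]
    · rcases hq with hq | hq <;> simp [hq]
    · simp [hq]
  · refine (hX.supp_t.ext2.comp (supp_loc (R := fun p q => X.nf (X.cell q.1.1.1) = X.nf (X.cell p.1.1.1) ∧
      p.1.2.1 = false ∧ q.1.2.1 = true) fun l μ g m q hq => ?_)).mono ?_
    · obtain ⟨ε, g⟩ := g
      refine ⟨rfl, ?_⟩
      rcases ε <;> rcases g <;> simp [Hopf.fT] at hq
      · simp [hq]
      · simp [hq]
    · rintro p q ⟨r, ⟨h1, h2, h3⟩, h4, h5, h6⟩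
      dsimp only at *
      rw [h2, h5, h6, h4]
      simp; omega

/-- The right-hand side is the position of the generator on its line: with i the first absolute
exponent of the old factor it is 2i + 1 for a and b, and 2i for c and d. -/
theorem start_le_of_val (hX : X.Good) {l : X.B} {μ : Z2} {ε : Bool} (hl : X.Val l) (h1 : 0 ≤ μ.1)
    (h2 : ε = false → 0 ≤ μ.2) (g : HopfGen) :
    X.start (X.cell l) ε ((X.off l).2 + μ.2 - ((X.off l).1 + μ.1) + cOff g) ≤
      2 * ((X.off l).1 + μ.1) + 1 - cOff g := by
  obtain ⟨h3, h4⟩ : X.lo (X.cell l) ≤ X.off l := hX.off_ge l hl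
  have h5 : cOff g = 0 ∨ cOff g = 1 := by rcases g <;> simp [cOff]
  rw [start]
  split_ifs with hε
  · omega
  · have := h2 (by simpa using hε)
    rw [max_le_iff]; constructor <;> omega

/-- The vertex at position P has offset (P/2, P/2 + P%2), which increases with P, and an edge has
offset at least that of its left end. -/
theorem Good.grow_off_ge (hX : X.Good) (l : (grow X n).B) (hl : (grow X n).Val l) :
    (grow X n).off ((grow X n).gen ((grow X n).cell l)) ≤ (grow X n).off l := by
  obtain ⟨⟨l, μ⟩, ε, g⟩ := l
  obtain ⟨hv, h1, h2⟩ := hl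
  have h3 := start_le_of_val hX hv h1 h2 g
  dsimp only at *
  generalize X.start (X.cell l) ε ((X.off l).2 + μ.2 - ((X.off l).1 + μ.1) + cOff g) = P at h3 ⊢
  rw [Prod.fst_sub, add_sub_cancel]
  change (P / 2, P / 2) + eOff (vGen P) ≤ _
  rw [← vS_exp]
  rcases g <;> simp only [cOff, eOff] at h3 ⊢ <;> constructor <;> simp <;> omega

/-- The framing coordinate determines the second exponent from the rest. The first exponent is
nonnegative and the old offset is bounded below in its cell, so the bound on their sum leaves
finitely many choices. -/
theorem Good.grow_fin (hX : X.Good) (κ : (grow X n).C) (a : ℤ) :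
    {l | (grow X n).Val l ∧ (grow X n).cell l = κ ∧ ((grow X n).off l).1 ≤ a}.Finite := by
  obtain ⟨κ, ε, c⟩ := κ
  refine (((hX.fin κ a).prod ((Set.finite_Icc (0 : ℤ) (a - (X.lo κ).1)).prod
    (Set.finite_univ (α := HopfGen)))).image fun p => (((p.1, (p.2.1,
      c - cOff p.2.2 + (X.off p.1).1 + p.2.1 - (X.off p.1).2)), (ε, p.2.2)) : (X.B × Z2) × BG)).subset ?_
  rintro ⟨⟨l, μ⟩, ε', g⟩ ⟨⟨hv, h1, h2⟩, h3, h4⟩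
  simp only [Prod.mk.injEq] at h3
  obtain ⟨rfl, rfl, rfl⟩ := h3
  have h5 : (X.lo (X.cell l)).1 ≤ (X.off l).1 := (hX.off_ge l hv).1
  have h6 : 0 ≤ (eOff g).1 := by rcases g <;> simp [eOff]
  simp only [Prod.fst_add] at h4 h1
  refine ⟨(l, (μ.1, g)), ⟨⟨hv, rfl, ?_⟩, ⟨h1, ?_⟩, trivial⟩, ?_⟩
  · change (X.off l).1 ≤ a
    omega
  · dsimp only; omega
  · ext <;> simp <;> ring

theorem Good.grow_val_gen (hX : X.Good) (κ : (grow X n).C) : (grow X n).Val ((grow X n).gen κ) := by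
  obtain ⟨κ, ε, c⟩ := κ
  refine ⟨hX.val_gen κ, ?_, fun hε => ?_⟩
  · have : 2 * (X.lo κ).1 ≤ X.start κ ε c := by
      rw [start]; split_ifs
      · rfl
      · exact le_max_left _ _
    simp only [Prod.fst_sub, posExp]; omega
  · have : 2 * ((X.lo κ).2 - c) + 1 ≤ X.start κ ε c := by
      rw [start, if_neg (by simp only at hε; simp [hε])]; exact le_max_right _ _
    simp only [Prod.snd_sub, posExp]; omega

theorem Good.grow (hX : X.Good) : (grow X n).Good where
  lin_d0 := (Op.lin_onFst _).add lin_fD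
  lin_d1 := ((Op.lin_onFst _).add lin_fE).add (semi_ext2_loc (lin_fP n))
  lin_h := (Op.lin_onFst _).add (Lin.comp (Lin.comp (Op.lin_onFst _) (lin_hH X)) (Op.lin_onFst _))
  lin_dL := ((lin_slide _).add lin_sigL).add (lin_tauL n _)
  semi_t := semi_fS.add (semi_ext2_loc (semi_fT n))
  semi_tL := semi_turnL
  dd := hX.grow_dd n
  dt := hX.grow_dt n
  aug_d0 := hX.grow_aug_d0 n
  aug_d1 := hX.grow_aug_d1 n
  aug_t := Good.grow_aug_t n hX
  cell_gen κ := by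
    obtain ⟨κ, ε, c⟩ := κ
    have : ∀ P c, posExp c P = (P / 2, P / 2 + c - 1 + P % 2) := fun _ _ => rfl
    simp only [hX.cell_gen, Prod.mk.injEq, true_and, Prod.fst_sub, Prod.snd_sub, add_sub_cancel, this]
    generalize X.start κ ε c = P
    rcases lt_mod P with h | h <;> simp [vGen, h, cOff] <;> ring
  low_gen κ := by
    simp only [hX.low_gen, Bool.true_and, vGen]; split_ifs <;> rfl
  val_gen := hX.grow_val_gen n
  d0_lift := hX.grow_d0_lift n
  aug_h := hX.grow_aug_h n
  htpy := hX.grow_htpy n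
  supp_h := hX.grow_supp_h n
  supp_d1 := hX.grow_supp_d1 n
  supp_t := hX.grow_supp_t n
  off_ge := hX.grow_off_ge n
  fin := hX.grow_fin n

end Mdl
end PlumbingLattice

namespace PlumbingLattice
open Op

/-! ## Completion -/

namespace Op
variable {α β γ δ : Type*}

/-- Each basis element is hit by finitely many basis elements. -/
def Proper (A : Op α β) : Prop := ∀ b, {a | A (bv a) b ≠ 0}.Finite

theorem Proper.add {A B : Op α β} (hA : Proper A) (hB : Proper B) : Proper (A + B) := fun b =>
  ((hA b).union (hB b)).subset fun _ h => add_ne h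

theorem Proper.comp {A : Op α β} {B : Op β γ} (hB : Proper B) (hA : Proper A) :
    Proper (B ∘ₗ A) := fun c =>
  ((hB c).biUnion fun b _ => hA b).subset fun a h => by
    obtain ⟨b, hb, hc⟩ := exists_of_apply_ne (A := B) h
    exact Set.mem_biUnion hc hb

theorem Proper.id : Proper (LinearMap.id : Op α α) := fun b =>
  (Set.finite_singleton b).subset fun _ h => (ne_of_bv_ne h).symm

theorem Proper.zero : Proper (0 : Op α β) := fun b => by simp

/-- The value of a function, extended linearly. -/
noncomputable def pair (f : α → F2) : (α →₀ F2) →ₗ[F2] F2 := Finsupp.linearCombination F2 f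

@[simp] theorem pair_bv (f : α → F2) (a : α) : pair f (bv a) = f a := by simp [pair]

theorem pair_add (f g : α → F2) : pair (f + g) = pair f + pair g := ext_bv fun a => by simp

open Classical in
/-- The transpose of a proper operator. -/
noncomputable def tr (A : Op α β) : Op β α := ofBasis fun b =>
  if h : {a | A (bv a) b ≠ 0}.Finite then Finsupp.ofSupportFinite (fun a => A (bv a) b) h else 0

theorem tr_bv {A : Op α β} (hA : Proper A) (b : β) (a : α) : tr A (bv b) a = A (bv a) b := by
  rw [tr, ofBasis_bv, dif_pos (hA b)]; rfl

theorem apply_eq_pair (x : α →₀ F2) (a : α) : x a = pair (bv a : α →₀ F2) x := by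
  induction x using Finsupp.induction_linear with
  | zero => simp
  | add x y hx hy => rw [map_add, ← hx, ← hy, Finsupp.add_apply]
  | single b c =>
    have hp : Finsupp.single b c = c • bv b := by simp
    classical
    rw [hp, map_smul, pair_bv]
    simp [Finsupp.single_apply, eq_comm]

theorem pair_comm (x y : α →₀ F2) : pair (x : α → F2) y = pair (y : α → F2) x := by
  induction x using Finsupp.induction_linear with
  | zero =>
    rw [map_zero, show ((0 : α →₀ F2) : α → F2) = 0 from rfl]
    exact LinearMap.congr_fun (ext_bv (B := 0) fun a => by simp) y
  | add x x' hx hx' =>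
    rw [map_add, ← hx, ← hx', Finsupp.coe_add, pair_add]; rfl
  | single b c =>
    have hp : Finsupp.single b c = c • bv b := by simp
    have : pair ((c • bv b : α →₀ F2) : α → F2) = c • pair (bv b : α →₀ F2) :=
      ext_bv fun a => by rw [pair_bv, LinearMap.smul_apply, pair_bv]; rfl
    rw [hp, map_smul, this, LinearMap.smul_apply, ← apply_eq_pair, pair_bv]

/-- Finite vectors pair with arbitrary functions on the basis, and the transpose is the adjoint for
this pairing. Both sides are linear in each argument, so comparing matrix entries suffices. -/
theorem pair_tr {A : Op α β} (hA : Proper A) (x : α →₀ F2) (y : β →₀ F2) :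
    pair (tr A y : α → F2) x = pair (y : β → F2) (A x) := by
  have h1 : pair (x : α → F2) ∘ₗ tr A = pair (A x : β → F2) := ext_bv fun b => by
    rw [LinearMap.comp_apply, pair_bv, pair_comm]
    rw [show A x b = (pair (bv b : β →₀ F2) ∘ₗ A) x by rw [LinearMap.comp_apply, ← apply_eq_pair]]
    refine LinearMap.congr_fun (ext_bv fun a => ?_) x
    rw [pair_bv, tr_bv hA, LinearMap.comp_apply, ← apply_eq_pair]
  rw [pair_comm, pair_comm (y)]
  exact LinearMap.congr_fun h1 y

theorem tr_comp {A : Op α β} {B : Op β γ} (hA : Proper A) (hB : Proper B) :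
    tr (B ∘ₗ A) = tr A ∘ₗ tr B := LinearMap.ext fun y => Finsupp.ext fun a => by
  rw [LinearMap.comp_apply, ← pair_bv (tr (B ∘ₗ A) y), ← pair_bv (tr A (tr B y)), pair_tr hA,
    pair_tr hB, pair_tr (hB.comp hA)]
  rfl

theorem tr_add {A B : Op α β} (hA : Proper A) (hB : Proper B) :
    tr (A + B) = tr A + tr B := ext_bv fun b => Finsupp.ext fun a => by
  rw [tr_bv (hA.add hB), LinearMap.add_apply, Finsupp.add_apply, LinearMap.add_apply,
    Finsupp.add_apply, tr_bv hA, tr_bv hB]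

theorem tr_id : tr (LinearMap.id : Op α α) = LinearMap.id := ext_bv fun b => Finsupp.ext fun a => by
  classical
  rw [tr_bv Proper.id, LinearMap.id_apply, LinearMap.id_apply, Finsupp.single_apply,
    Finsupp.single_apply]
  simp only [eq_comm]

theorem tr_zero : tr (0 : Op α β) = 0 := ext_bv fun b => Finsupp.ext fun a => by
  rw [tr_bv Proper.zero]; rfl

end Op

/-! ### Extension of operators to families of power series -/

section Series
open Op PowerSeries
variable {I J K : Type*}

/-- Multiplication by the formal variable. -/
noncomputable def up (I : Type*) : Op (I × ℕ) (I × ℕ) := map fun p => (p.1, p.2 + 1)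

/-- Division by the formal variable. -/
noncomputable def down (I : Type*) : Op (I × ℕ) (I × ℕ) := ofBasis fun p =>
  match p with
  | (_, 0) => 0
  | (i, k + 1) => bv (i, k)

theorem proper_up : Proper (up I) := fun b => Set.Subsingleton.finite fun a ha a' ha' => by
  simp only [up, map_bv] at ha ha'
  have h := (ne_of_bv_ne ha).symm.trans (ne_of_bv_ne ha')
  simp only [Prod.mk.injEq, Nat.add_right_cancel_iff] at h
  exact Prod.ext h.1 h.2

/-- On coefficient functionals, precomposition with `down` is multiplication of the series by the
variable. Hence commutation of an operator with `up` becomes linearity over the variable for its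
extension. -/
theorem tr_up : tr (up I) = down I := by
  classical
  refine ext_bv fun ⟨i, k⟩ => Finsupp.ext fun ⟨j, n⟩ => ?_
  rw [tr_bv proper_up, up, map_bv, down, ofBasis_bv]
  cases k with
  | zero => simp
  | succ k => simp only [Finsupp.single_apply, Prod.mk.injEq, Nat.add_right_cancel_iff]; simp [eq_comm]

/-- Commutation with multiplication by the formal variable. -/
def Equivariant (A : Op (I × ℕ) (J × ℕ)) : Prop := A ∘ₗ up I = up J ∘ₗ A

theorem Equivariant.add {A B : Op (I × ℕ) (J × ℕ)} (hA : Equivariant A) (hB : Equivariant B) :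
    Equivariant (A + B) := by
  rw [Equivariant, LinearMap.add_comp, LinearMap.comp_add, hA, hB]

theorem Equivariant.comp {A : Op (I × ℕ) (J × ℕ)} {B : Op (J × ℕ) (K × ℕ)} (hB : Equivariant B)
    (hA : Equivariant A) : Equivariant (B ∘ₗ A) := by
  rw [Equivariant, LinearMap.comp_assoc, hA, ← LinearMap.comp_assoc, hB, LinearMap.comp_assoc]

theorem Equivariant.id : Equivariant (LinearMap.id : Op (I × ℕ) (I × ℕ)) := by
  rw [Equivariant, LinearMap.id_comp, LinearMap.comp_id]

theorem Equivariant.zero : Equivariant (0 : Op (I × ℕ) (J × ℕ)) := by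
  rw [Equivariant, LinearMap.zero_comp, LinearMap.comp_zero]

/-- The coefficients of a family of power series. -/
noncomputable def coeffs (f : I → PowerSeries F2) (p : I × ℕ) : F2 := coeff p.2 (f p.1)

theorem pair_coeffs_down (f : I → PowerSeries F2) :
    pair (coeffs f) ∘ₗ down I = pair (coeffs ((X : PowerSeries F2) • f)) := ext_bv fun ⟨i, k⟩ => by
  rw [LinearMap.comp_apply, down, ofBasis_bv, pair_bv]
  cases k with
  | zero => simp [coeffs]
  | succ k => simp [coeffs, coeff_succ_X_mul]

theorem pair_coeffs_smul (f : I → PowerSeries F2) (r : F2) :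
    pair (coeffs (C r • f)) = r • pair (coeffs f) := ext_bv fun ⟨i, k⟩ => by
  simp [coeffs]

theorem pair_coeffs_add (f g : I → PowerSeries F2) :
    pair (coeffs (f + g)) = pair (coeffs f) + pair (coeffs g) := ext_bv fun ⟨i, k⟩ => by
  simp [coeffs]

/-- The continuous extension of a proper operator to families of power series. -/
noncomputable def hatFun (A : Op (I × ℕ) (J × ℕ)) (f : I → PowerSeries F2) (j : J) : PowerSeries F2 :=
  PowerSeries.mk fun n => pair (coeffs f) (tr A (bv (j, n)))

/-- In terms of coefficient functionals the extension is precomposition with the transpose;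
additivity and functoriality of `hat` are read off from this. -/
theorem pair_hatFun (A : Op (I × ℕ) (J × ℕ)) (f : I → PowerSeries F2) :
    pair (coeffs (hatFun A f)) = pair (coeffs f) ∘ₗ tr A := ext_bv fun ⟨j, n⟩ => by
  rw [pair_bv, coeffs, hatFun, coeff_mk]; rfl

theorem ext_coeffs {f g : I → PowerSeries F2} (h : pair (coeffs f) = pair (coeffs g)) : f = g := by
  funext i
  ext n
  have := LinearMap.congr_fun h (bv (i, n))
  rwa [pair_bv, pair_bv] at this

theorem hatFun_add (A : Op (I × ℕ) (J × ℕ)) (f g : I → PowerSeries F2) :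
    hatFun A (f + g) = hatFun A f + hatFun A g := ext_coeffs (by
  rw [pair_coeffs_add, pair_hatFun, pair_hatFun, pair_hatFun, pair_coeffs_add, LinearMap.add_comp])

theorem hatFun_X {A : Op (I × ℕ) (J × ℕ)} (hA : Proper A) (hu : Equivariant A)
    (f : I → PowerSeries F2) :
    hatFun A ((X : PowerSeries F2) • f) = (X : PowerSeries F2) • hatFun A f := ext_coeffs (by
  rw [← pair_coeffs_down, pair_hatFun, pair_hatFun, ← pair_coeffs_down, LinearMap.comp_assoc,
    LinearMap.comp_assoc, ← tr_up, ← tr_up, ← tr_comp proper_up hA, ← tr_comp hA proper_up, hu])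

theorem hatFun_C (A : Op (I × ℕ) (J × ℕ)) (f : I → PowerSeries F2) (r : F2) :
    hatFun A (C r • f) = C r • hatFun A f := ext_coeffs (by
  rw [pair_coeffs_smul, pair_hatFun, pair_hatFun, pair_coeffs_smul, LinearMap.smul_comp])

theorem hatFun_X_pow {A : Op (I × ℕ) (J × ℕ)} (hA : Proper A) (hu : Equivariant A)
    (f : I → PowerSeries F2) (N : ℕ) :
    hatFun A ((X : PowerSeries F2) ^ N • f) = (X : PowerSeries F2) ^ N • hatFun A f := by
  induction N with
  | zero => simp
  | succ N ih => rw [pow_succ', mul_smul, hatFun_X hA hu, ih, mul_smul]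

theorem hatFun_poly {A : Op (I × ℕ) (J × ℕ)} (hA : Proper A) (hu : Equivariant A)
    (f : I → PowerSeries F2) (r : Polynomial F2) :
    hatFun A ((r : PowerSeries F2) • f) = (r : PowerSeries F2) • hatFun A f := by
  induction r using Polynomial.induction_on with
  | C a => rw [Polynomial.coe_C, hatFun_C]
  | add p q hp hq => rw [Polynomial.coe_add, add_smul, hatFun_add, hp, hq, add_smul]
  | monomial n a _ =>
    rw [Polynomial.coe_mul, Polynomial.coe_C, Polynomial.coe_pow, Polynomial.coe_X, mul_smul, hatFun_C,
      hatFun_X_pow hA hu, mul_smul]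

/-- Linearity over polynomials is algebraic. The coefficient of degree n does not see multiples of
X^(n+1), so a series may be replaced by a truncation. -/
theorem hatFun_smul {A : Op (I × ℕ) (J × ℕ)} (hA : Proper A) (hu : Equivariant A)
    (f : I → PowerSeries F2) (r : PowerSeries F2) : hatFun A (r • f) = r • hatFun A f := by
  funext j
  ext n
  obtain ⟨s, hs⟩ : ∃ s, r = X ^ (n + 1) * s + (trunc (n + 1) r : PowerSeries F2) :=
    ⟨_, eq_X_pow_mul_shift_add_trunc (n + 1) r⟩
  have h1 : ∀ g : PowerSeries F2, coeff n (X ^ (n + 1) * g) = 0 := fun g =>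
    X_pow_dvd_iff.1 (Dvd.intro g rfl) n (Nat.lt_succ_self n)
  rw [hs, add_smul, hatFun_add, mul_smul, hatFun_X_pow hA hu, hatFun_poly hA hu, add_smul, mul_smul]
  simp only [Pi.add_apply, Pi.smul_apply, smul_eq_mul, map_add, h1]

/-- The continuous extension as a linear map. -/
noncomputable def hat (A : Op (I × ℕ) (J × ℕ)) (hA : Proper A) (hu : Equivariant A) :
    (I → PowerSeries F2) →ₗ[PowerSeries F2] (J → PowerSeries F2) where
  toFun := hatFun A
  map_add' := hatFun_add A
  map_smul' r f := hatFun_smul hA hu f r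

variable {A A' : Op (I × ℕ) (J × ℕ)} {B : Op (J × ℕ) (K × ℕ)}

theorem hat_congr (h : A = A') (hA : Proper A) (hu : Equivariant A) (hA' : Proper A')
    (hu' : Equivariant A') : hat A hA hu = hat A' hA' hu' := by
  subst h; rfl

theorem hat_comp (hA : Proper A) (hu : Equivariant A) (hB : Proper B) (hv : Equivariant B) :
    hat (B ∘ₗ A) (hB.comp hA) (hv.comp hu) = hat B hB hv ∘ₗ hat A hA hu :=
  LinearMap.ext fun f => ext_coeffs (by
    change pair (coeffs (hatFun (B ∘ₗ A) f)) = pair (coeffs (hatFun B (hatFun A f)))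
    rw [pair_hatFun, pair_hatFun, pair_hatFun, tr_comp hA hB, LinearMap.comp_assoc])

theorem hat_add (hA : Proper A) (hu : Equivariant A) (hA' : Proper A') (hu' : Equivariant A') :
    hat (A + A') (hA.add hA') (hu.add hu') = hat A hA hu + hat A' hA' hu' :=
  LinearMap.ext fun f => ext_coeffs (by
    change pair (coeffs (hatFun (A + A') f)) = pair (coeffs (hatFun A f + hatFun A' f))
    rw [pair_coeffs_add, pair_hatFun, pair_hatFun, pair_hatFun, tr_add hA hA', LinearMap.comp_add])

theorem hat_id : hat (LinearMap.id : Op (I × ℕ) _) Proper.id Equivariant.id = LinearMap.id :=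
  LinearMap.ext fun f => ext_coeffs (by
    change pair (coeffs (hatFun LinearMap.id f)) = pair (coeffs f)
    rw [pair_hatFun, tr_id, LinearMap.comp_id])

theorem hat_zero : hat (0 : Op (I × ℕ) (J × ℕ)) Proper.zero Equivariant.zero = 0 :=
  LinearMap.ext fun f => ext_coeffs (by
    change pair (coeffs (hatFun (0 : Op (I × ℕ) (J × ℕ)) f)) = pair (coeffs 0)
    rw [pair_hatFun, tr_zero, LinearMap.comp_zero]
    exact ext_bv fun p => by simp [coeffs])

/-- The finite combination of generators given by its monomials. -/
noncomputable def ser (I : Type*) : (I × ℕ →₀ F2) →ₗ[F2] (I →₀ PowerSeries F2) :=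
  Finsupp.linearCombination F2 fun p => Finsupp.single p.1 ((X : PowerSeries F2) ^ p.2)

theorem ser_bv (p : I × ℕ) : ser I (bv p) = Finsupp.single p.1 ((X : PowerSeries F2) ^ p.2) := by
  simp [ser]

theorem coeff_ser (x : I × ℕ →₀ F2) (q : I) (n : ℕ) : coeff n (ser I x q) = x (q, n) := by
  classical
  induction x using Finsupp.induction_linear with
  | zero => simp
  | add x y hx hy => rw [map_add, Finsupp.add_apply, map_add, hx, hy, Finsupp.add_apply]
  | single p c =>
    have hp : Finsupp.single p c = c • bv p := by simp
    rw [hp, map_smul, ser_bv]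
    simp only [Finsupp.smul_apply, Finsupp.single_apply, Prod.ext_iff, map_smul]
    by_cases h : p.1 = q
    · simp [h, coeff_X_pow, eq_comm]
    · simp [h]

theorem up_pow_bv (i : I) (k : ℕ) : (bv (i, k + 1) : I × ℕ →₀ F2) = up I (bv (i, k)) := by
  rw [up, map_bv]

theorem up_apply_succ (x : I × ℕ →₀ F2) (i : I) (n : ℕ) : up I x (i, n + 1) = x (i, n) := by
  classical
  induction x using Finsupp.induction_linear with
  | zero => simp
  | add x y hx hy => rw [map_add, Finsupp.add_apply, hx, hy, Finsupp.add_apply]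
  | single p c =>
    have hp : Finsupp.single p c = c • bv p := by simp
    rw [hp, map_smul, up, map_bv]
    simp [Finsupp.single_apply, Prod.ext_iff]

theorem up_apply_zero (x : I × ℕ →₀ F2) (i : I) : up I x (i, 0) = 0 := by
  classical
  induction x using Finsupp.induction_linear with
  | zero => simp
  | add x y hx hy => rw [map_add, Finsupp.add_apply, hx, hy, add_zero]
  | single p c =>
    have hp : Finsupp.single p c = c • bv p := by simp
    rw [hp, map_smul, up, map_bv]
    simp [Prod.ext_iff]

/-- An equivariant operator is determined by its values in degree zero, and it never lowers the
power of the variable. -/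
theorem Equivariant.apply {A : Op (I × ℕ) (J × ℕ)} (hA : Equivariant A) (i : I) (k : ℕ) (j : J) (n : ℕ) :
    A (bv (i, k)) (j, n) = if k ≤ n then A (bv (i, 0)) (j, n - k) else 0 := by
  induction k generalizing n with
  | zero => simp
  | succ k ih =>
    have : A (bv (i, k + 1)) = up J (A (bv (i, k))) := by
      rw [up_pow_bv, ← LinearMap.comp_apply, hA, LinearMap.comp_apply]
    rw [this]
    cases n with
    | zero => rw [up_apply_zero, if_neg (by omega)]
    | succ n => rw [up_apply_succ, ih]; simp

namespace ProductComplex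
variable (P : ProductComplex)

/-- The operator on monomials underlies the endomorphism of the product complex. -/
def Represents (A : Op (P.Idx × ℕ) (P.Idx × ℕ)) : Prop :=
  Equivariant A ∧ ∀ p, P.bd p = ser _ (A (bv (p, 0)))

variable {P} {A : Op (P.Idx × ℕ) (P.Idx × ℕ)}

theorem Represents.proper (h : P.Represents A) : Proper A := by
  rintro ⟨q, n⟩
  refine ((P.fin q).prod (Set.finite_le_nat n)).subset ?_
  rintro ⟨p, k⟩ hne
  rw [Set.mem_ofPred_eq, h.1.apply] at hne
  split_ifs at hne with hk
  · refine ⟨fun h0 => hne ?_, hk⟩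
    rw [← coeff_ser, ← h.2, h0, map_zero]
  · exact absurd rfl hne

theorem Represents.d_eq (h : P.Represents A) : P.d = hat A h.proper h.1 := by
  refine LinearMap.ext fun f => ext_coeffs ?_
  change _ = pair (coeffs (hatFun A f))
  rw [pair_hatFun]
  refine ext_bv fun ⟨q, n⟩ => ?_
  rw [pair_bv, LinearMap.comp_apply, coeffs]
  have h1 : P.d f q = ∑ p ∈ (P.fin q).toFinset, f p * P.bd p q := rfl
  have h2 : (tr A (bv (q, n))).support ⊆ (P.fin q).toFinset ×ˢ Finset.range (n + 1) := by
    rintro ⟨p, k⟩ hne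
    rw [Finsupp.mem_support_iff, tr_bv h.proper, h.1.apply] at hne
    split_ifs at hne with hk
    · refine Finset.mem_product.2 ⟨(Set.Finite.mem_toFinset _).2 fun h0 => hne ?_, Finset.mem_range.2 (by dsimp only; omega)⟩
      rw [← coeff_ser, ← h.2, h0, map_zero]
    · exact absurd rfl hne
  rw [h1, pair, Finsupp.linearCombination_apply, Finsupp.sum_of_support_subset _ h2 _ (by simp),
    Finset.sum_product, map_sum]
  refine Finset.sum_congr rfl fun p _ => ?_
  rw [coeff_mul, Finset.Nat.sum_antidiagonal_eq_sum_range_succ (fun i j => coeff i (f p) * coeff j (P.bd p q))]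
  refine Finset.sum_congr rfl fun k hk => ?_
  rw [tr_bv h.proper, h.1.apply, if_pos (by have := Finset.mem_range.1 hk; omega), ← coeff_ser, ← h.2, coeffs,
    smul_eq_mul, mul_comm]

end ProductComplex

end Series
end PlumbingLattice

/-! ### Homological perturbation -/

namespace PlumbingLattice
open Op

section Algebra
variable {M N : Type*} [AddCommGroup M] [Module F2 M] [AddCommGroup N] [Module F2 N]

/-- The partial geometric series of an endomorphism. -/
def geom (ν : M →ₗ[F2] M) : ℕ → M →ₗ[F2] M
  | 0 => 0
  | k + 1 => LinearMap.id + ν ∘ₗ geom ν k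

theorem comp_geom (ν : M →ₗ[F2] M) (k : ℕ) : ν ∘ₗ geom ν k = geom ν k ∘ₗ ν := by
  induction k with
  | zero => rw [geom, LinearMap.comp_zero, LinearMap.zero_comp]
  | succ k ih =>
    rw [geom, LinearMap.comp_add, LinearMap.add_comp, LinearMap.comp_assoc, ← ih, LinearMap.comp_id,
      LinearMap.id_comp]

/-- In characteristic two 1 + ν is 1 - ν, and the series telescopes; for nilpotent ν the partial sum
is therefore the inverse of 1 + ν. -/
theorem geom_add (ν : M →ₗ[F2] M) (k : ℕ) (x : M) : geom ν k x + ν (geom ν k x) = x + (ν ^ k) x := by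
  induction k with
  | zero => simp [geom, add_self_zero]
  | succ k ih =>
    have e1 := congrArg ν ih
    have e2 := add_self_zero (ν x)
    rw [map_add, map_add] at e1
    rw [geom, LinearMap.add_apply, LinearMap.id_apply, LinearMap.comp_apply, pow_succ',
      Module.End.mul_apply, map_add]
    linear_combination (norm := module) e1 + e2

variable {d h ν w : M →ₗ[F2] M} {dL : N →ₗ[F2] N} {a : M →ₗ[F2] N} {i : N →ₗ[F2] M}

/-- The operator ν measures how far h is from a contraction for the full differential. Since the
augmentation is already exact, ν takes values in its kernel. -/
theorem contraction_comp_zero (had : a ∘ₗ d = dL ∘ₗ a) (hah : a ∘ₗ h = 0) (hai : a ∘ₗ i = LinearMap.id)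
    (hν : ν = d ∘ₗ h + h ∘ₗ d + LinearMap.id + i ∘ₗ a) : a ∘ₗ ν = 0 := by
  refine LinearMap.ext fun x => ?_
  simp only [LinearMap.ext_iff, LinearMap.comp_apply, LinearMap.zero_apply, LinearMap.id_apply] at *
  simp only [hν, LinearMap.add_apply, LinearMap.comp_apply, map_add, LinearMap.id_apply, had, hah, hai,
    map_zero, zero_add, add_self_zero]

/-- With w the inverse of 1 + ν, the commutator of d and w is w (dν + νd) w. In dν + νd everything
cancels except (d i + i dL) a, the failure of i to be a chain map. -/
theorem contraction_d_comm (hdd : d ∘ₗ d = 0) (had : a ∘ₗ d = dL ∘ₗ a)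
    (hν : ν = d ∘ₗ h + h ∘ₗ d + LinearMap.id + i ∘ₗ a) (h1 : ∀ x, w (x + ν x) = x)
    (h2 : ∀ x, w x + ν (w x) = x) (x : M) :
    d (w x) + w (d x) = w ((d ∘ₗ i + i ∘ₗ dL) (a (w x))) := by
  have hcom : ∀ x, d (ν x) + ν (d x) = (d ∘ₗ i + i ∘ₗ dL) (a x) := fun x => by
    simp only [LinearMap.ext_iff, LinearMap.comp_apply, LinearMap.zero_apply] at hdd had
    simp only [hν, LinearMap.add_apply, LinearMap.comp_apply, map_add, LinearMap.id_apply, had, hdd,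
      map_zero, zero_add]
    linear_combination (norm := module) add_self_zero (d (h (d x))) + add_self_zero (d x)
  rw [← hcom, ← add_zero (w _), ← map_zero w, ← map_add, add_zero]
  have h3 : d (ν (w x)) = d x + d (w x) := by
    have := h2 x
    rw [← map_add]
    congr 1
    rw [add_comm] at this
    exact add_eq_iff.1 this
  have h4 := h1 (d (w x))
  rw [map_add] at h4
  rw [map_add, h3, map_add]
  rw [add_comm (d (w x)), add_assoc, ← map_add, map_add, h4]

/-- Put μ = d i + i dL. Then a μ = 0 and d μ = μ dL, so d and w commute on the image of μ. There d h
+ h d = 1 + ν, which is inverted by w; hence the correction h w μ supplies exactly the missing term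
μ. -/
theorem contraction_chain (hdd : d ∘ₗ d = 0) (had : a ∘ₗ d = dL ∘ₗ a) 
    (hai : a ∘ₗ i = LinearMap.id) 
    (hν : ν = d ∘ₗ h + h ∘ₗ d + LinearMap.id + i ∘ₗ a) (h1 : ∀ x, w (x + ν x) = x)
    (h2 : ∀ x, w x + ν (w x) = x) (haw : ∀ x, a (w x) = a x) (hdLL : dL ∘ₗ dL = 0) :
    d ∘ₗ (h ∘ₗ w ∘ₗ (d ∘ₗ i + i ∘ₗ dL) + i) = (h ∘ₗ w ∘ₗ (d ∘ₗ i + i ∘ₗ dL) + i) ∘ₗ dL := by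
  refine LinearMap.ext fun x => ?_
  set μ := d ∘ₗ i + i ∘ₗ dL with hμ
  have haμ : ∀ x, a (μ x) = 0 := fun x => by
    simp only [LinearMap.ext_iff, LinearMap.comp_apply, LinearMap.zero_apply, LinearMap.id_apply] at *
    simp only [hμ, LinearMap.add_apply, LinearMap.comp_apply, map_add, had, hai, add_self_zero]
  have hdμ : d (μ x) = μ (dL x) := by
    simp only [LinearMap.ext_iff, LinearMap.comp_apply, LinearMap.zero_apply, LinearMap.id_apply] at *
    simp only [hμ, LinearMap.add_apply, LinearMap.comp_apply, map_add, hdd, hdLL, map_zero, zero_add, add_zero]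
  have hdw := contraction_d_comm hdd had hν h1 h2 (μ x)
  rw [haw, haμ, map_zero, map_zero] at hdw
  have h3 := h2 (μ x)
  have h4 := LinearMap.congr_fun hν (w (μ x))
  simp only [LinearMap.add_apply, LinearMap.comp_apply, LinearMap.id_apply, haw, haμ, map_zero,
    add_zero] at h4
  have h5 : h (d (w (μ x))) = h (w (d (μ x))) := by rw [eq_of_add_eq_zero' hdw]
  have h6 : μ x = d (i x) + i (dL x) := rfl
  simp only [LinearMap.add_apply, LinearMap.comp_apply, map_add]
  change d (h (w (μ x))) + d (i x) = h (w (μ (dL x))) + i (dL x)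
  rw [← hdμ, ← h5]
  rw [h4] at h3
  have e1 := add_self_zero (w (μ x))
  have e2 := add_self_zero (h (d (w (μ x))))
  have e3 := add_self_zero (d (i x))
  linear_combination (norm := module) h3.trans h6 - e1 - e2 + e3

/-- From d w + w d = w μ a w and a w = a one gets d h w + h w d = (d h + h d) w + h w μ a.
Substituting d h + h d = ν + 1 + i a and w + ν w = 1 leaves 1 plus the composite. -/
theorem contraction_htpy (hdd : d ∘ₗ d = 0) (had : a ∘ₗ d = dL ∘ₗ a) 
    (hν : ν = d ∘ₗ h + h ∘ₗ d + LinearMap.id + i ∘ₗ a) (h1 : ∀ x, w (x + ν x) = x)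
    (h2 : ∀ x, w x + ν (w x) = x) (haw : ∀ x, a (w x) = a x) :
    (h ∘ₗ w ∘ₗ (d ∘ₗ i + i ∘ₗ dL) + i) ∘ₗ a =
      LinearMap.id + (d ∘ₗ (h ∘ₗ w) + (h ∘ₗ w) ∘ₗ d) := by
  refine LinearMap.ext fun x => ?_
  set μ := d ∘ₗ i + i ∘ₗ dL with hμ
  have hdw := contraction_d_comm hdd had hν h1 h2 x
  rw [haw] at hdw
  have h3 := h2 x
  have h4 := LinearMap.congr_fun hν (w x)
  simp only [LinearMap.add_apply, LinearMap.comp_apply, LinearMap.id_apply, haw] at h4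
  simp only [LinearMap.add_apply, LinearMap.comp_apply, LinearMap.id_apply]
  change h (w (μ (a x))) + i (a x) = _
  rw [← hdw, map_add]
  rw [h4] at h3
  have e1 := add_self_zero (w x)
  have e2 := add_self_zero (d (h (w x)))
  have e3 := add_self_zero x
  linear_combination (norm := module) h3 - e1 - e2

end Algebra

theorem geom_proper {α : Type*} {ν : Op α α} (hν : Proper ν) (k : ℕ) : Proper (geom ν k) := by
  induction k with
  | zero => exact Proper.zero
  | succ k ih => exact Proper.id.add (hν.comp ih)

theorem geom_equivariant {I : Type*} {ν : Op (I × ℕ) (I × ℕ)} (hν : Equivariant ν) (k : ℕ) :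
    Equivariant (geom ν k) := by
  induction k with
  | zero => exact Equivariant.zero
  | succ k ih => exact Equivariant.id.add (hν.comp ih)

/-- A perturbed contraction gives a homotopy equivalence of the completions. -/
theorem homotopyEquivalent_of_contraction {P Q : ProductComplex} {d h : Op (P.Idx × ℕ) (P.Idx × ℕ)}
    {dL : Op (Q.Idx × ℕ) (Q.Idx × ℕ)} {a : Op (P.Idx × ℕ) (Q.Idx × ℕ)}
    {i : Op (Q.Idx × ℕ) (P.Idx × ℕ)} (hd : P.Represents d) (hdL : Q.Represents dL)
    (pa : Proper a) (ua : Equivariant a) (pi : Proper i) (ui : Equivariant i) (ph : Proper h)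
    (uh : Equivariant h) (hdd : d ∘ₗ d = 0) (had : a ∘ₗ d = dL ∘ₗ a) (hah : a ∘ₗ h = 0)
    (hai : a ∘ₗ i = LinearMap.id) {k : ℕ}
    (hk : (d ∘ₗ h + h ∘ₗ d + LinearMap.id + i ∘ₗ a) ^ k = 0) :
    P.IsComplex ∧ Q.IsComplex ∧ P.HomotopyEquivalent Q := by
  -- The square of dL vanishes because a is a chain map with the right inverse i.
  have hdLL : dL ∘ₗ dL = 0 := by
    have : (dL ∘ₗ dL) ∘ₗ (a ∘ₗ i) = (a ∘ₗ (d ∘ₗ d)) ∘ₗ i := by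
      refine LinearMap.ext fun x => ?_
      have h3 : ∀ y, a (d y) = dL (a y) := LinearMap.congr_fun had
      simp only [LinearMap.comp_apply, h3]
    rw [hai, hdd, LinearMap.comp_id, LinearMap.comp_zero, LinearMap.zero_comp] at this
    exact this
  obtain ⟨ν, hν⟩ : ∃ ν, ν = d ∘ₗ h + h ∘ₗ d + LinearMap.id + i ∘ₗ a := ⟨_, rfl⟩
  have pν : Proper ν := hν ▸ (((hd.proper.comp ph).add (ph.comp hd.proper)).add Proper.id).add (pi.comp pa)
  have uν : Equivariant ν := hν ▸ (((hd.1.comp uh).add (uh.comp hd.1)).add Equivariant.id).add (ui.comp ua)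
  rw [← hν] at hk
  obtain ⟨w, hw⟩ : ∃ w, w = geom ν k := ⟨_, rfl⟩
  have pw : Proper w := hw ▸ geom_proper pν k
  have uw : Equivariant w := hw ▸ geom_equivariant uν k
  have h2 : ∀ x, w x + ν (w x) = x := fun x => by rw [hw, geom_add, hk]; simp
  have h1 : ∀ x, w (x + ν x) = x := fun x => by
    have : w (ν x) = ν (w x) := by rw [hw]; exact (LinearMap.congr_fun (comp_geom ν k) x).symm
    rw [map_add, this, h2]
  have haν := contraction_comp_zero had hah hai hν
  have haw : ∀ x, a (w x) = a x := fun x => by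
    have h3 := congrArg a (h2 x)
    have h4 : a (ν (w x)) = 0 := LinearMap.congr_fun haν (w x)
    rwa [map_add, h4, add_zero] at h3
  obtain ⟨g, hg⟩ : ∃ g, g = h ∘ₗ w ∘ₗ (d ∘ₗ i + i ∘ₗ dL) + i := ⟨_, rfl⟩
  have pg : Proper g := hg ▸ (ph.comp (pw.comp ((hd.proper.comp pi).add (pi.comp hdL.proper)))).add pi
  have ug : Equivariant g := hg ▸ (uh.comp (uw.comp ((hd.1.comp ui).add (ui.comp hdL.1)))).add ui
  have e1 : d ∘ₗ g = g ∘ₗ dL := hg ▸ contraction_chain hdd had hai hν h1 h2 haw hdLL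
  have e2 : g ∘ₗ a = LinearMap.id + (d ∘ₗ (h ∘ₗ w) + (h ∘ₗ w) ∘ₗ d) :=
    hg ▸ contraction_htpy hdd had hν h1 h2 haw
  have e3 : a ∘ₗ g = LinearMap.id := by
    refine LinearMap.ext fun x => ?_
    have h3 : ∀ y, a (h y) = 0 := LinearMap.congr_fun hah
    have h4 : ∀ y, a (i y) = y := LinearMap.congr_fun hai
    simp only [hg, LinearMap.comp_apply, LinearMap.add_apply, map_add, h3, h4, zero_add,
      LinearMap.id_apply]
  -- The homotopy on the side of the cells is zero, because a ∘ g is the identity on the nose.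
  refine ⟨?_, ?_, hat a pa ua, hat g pg ug, hat (h ∘ₗ w) (ph.comp pw) (uh.comp uw), 0, ?_, ?_, ?_, ?_⟩
  · rw [ProductComplex.IsComplex, hd.d_eq, ← hat_comp, ← hat_zero]
    exact hat_congr hdd _ _ _ _
  · rw [ProductComplex.IsComplex, hdL.d_eq, ← hat_comp, ← hat_zero]
    exact hat_congr hdLL _ _ _ _
  · rw [hd.d_eq, hdL.d_eq, ← hat_comp, ← hat_comp]
    exact hat_congr had.symm _ _ _ _
  · rw [hd.d_eq, hdL.d_eq, ← hat_comp, ← hat_comp]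
    exact hat_congr e1 _ _ _ _
  · rw [hd.d_eq, ← hat_comp, ← hat_comp, ← hat_comp, ← hat_add, ← hat_id, ← hat_add]
    exact hat_congr e2 _ _ _ _
  · rw [hdL.d_eq, ← hat_comp, LinearMap.comp_zero, LinearMap.zero_comp, add_zero, add_zero, ← hat_id]
    exact hat_congr e3 _ _ _ _

end PlumbingLattice

/-! ### Restriction of operators to part of a basis -/

namespace PlumbingLattice
open Op

namespace Op
variable {α β γ : Type*}

theorem map_injective {f : α → β} (hf : Function.Injective f) : Function.Injective (map f) :=
  Finsupp.mapDomain_injective hf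

theorem map_apply {f : α → β} (hf : Function.Injective f) (x : α →₀ F2) (a : α) :
    map f x (f a) = x a := Finsupp.mapDomain_apply hf x a

theorem exists_map_eq {f : α → β} (hf : Function.Injective f) {x : β →₀ F2}
    (hx : ∀ b, x b ≠ 0 → b ∈ Set.range f) : ∃ y, x = map f y :=
  ⟨x.comapDomain f hf.injOn, (Finsupp.mapDomain_comapDomain f hf x fun b hb =>
    hx b (Finsupp.mem_support_iff.1 hb)).symm⟩

theorem comp_map_injective {f : β → γ} (hf : Function.Injective f) {A B : Op α β}
    (h : map f ∘ₗ A = map f ∘ₗ B) : A = B :=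
  LinearMap.ext fun x => map_injective hf (LinearMap.congr_fun h x)

/-- An operator whose values on a part of the basis are supported in another part restricts to these
parts. In this way operators with all exponents allowed yield operators on the honest monomials. -/
theorem exists_restrict {α' β' : Type*} (A : Op α β) {f : α' → α} {g : β' → β} (hg : Function.Injective g)
    (h : ∀ a b, A (bv (f a)) b ≠ 0 → b ∈ Set.range g) :
    ∃ A' : Op α' β', A ∘ₗ map f = map g ∘ₗ A' := by
  choose y hy using fun a => exists_map_eq hg (h a)
  exact ⟨ofBasis y, ext_bv fun a => by rw [LinearMap.comp_apply, LinearMap.comp_apply, map_bv, ofBasis_bv, hy]⟩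

theorem proper_of_restrict {α' β' : Type*} {A : Op α β} {f : α' → α} {g : β' → β}
    (hg : Function.Injective g) {A' : Op α' β'} (hA : A ∘ₗ map f = map g ∘ₗ A')
    (h : ∀ b, {a | A (bv (f a)) (g b) ≠ 0}.Finite) : Proper A' := fun b => by
  refine (h b).subset fun a ha => ?_
  have := LinearMap.congr_fun hA (bv a)
  rw [LinearMap.comp_apply, LinearMap.comp_apply, map_bv] at this
  rw [Set.mem_ofPred_eq, this, map_apply hg]
  exact ha

theorem equivariant_of_restrict {I J : Type*} {A : Op α β} {u : Op α α} {v : Op β β} {f : I × ℕ → α}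
    {g : J × ℕ → β} (hg : Function.Injective g) {A' : Op (I × ℕ) (J × ℕ)}
    (hA : A ∘ₗ map f = map g ∘ₗ A') (hf : map f ∘ₗ up I = u ∘ₗ map f)
    (hg' : map g ∘ₗ up J = v ∘ₗ map g) (hAu : A ∘ₗ u = v ∘ₗ A) : Equivariant A' :=
  comp_map_injective hg (by
    rw [← LinearMap.comp_assoc, ← hA, LinearMap.comp_assoc, hf, ← LinearMap.comp_assoc,
      ← LinearMap.comp_assoc, hg', hAu, LinearMap.comp_assoc, LinearMap.comp_assoc, hA])

end Op

/-! ### The cone over the root -/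

section Cone
variable {α β : Type*}

/-- The change of the idempotent of the root. -/
noncomputable def lower (β : Type*) : Op (β × Bool) (β × Bool) :=
  ofBasis fun s => if s.2 then 0 else bv (s.1, true)

theorem lower_false (z : β) : lower β (bv (z, false)) = bv (z, true) := by simp [lower]
theorem lower_true (z : β) : lower β (bv (z, true)) = 0 := by simp [lower]

theorem lower_lower : lower β ∘ₗ lower β = 0 := ext_bv fun ⟨z, ε⟩ => by
  rcases ε <;> simp [lower_false, lower_true]

theorem lower_onFst {γ : Type*} (A : Op β γ) : onFst Bool A ∘ₗ lower β = lower γ ∘ₗ onFst Bool A :=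
  ext_bv fun ⟨z, ε⟩ => by
    rw [LinearMap.comp_apply, LinearMap.comp_apply, onFst_bv]
    rcases ε
    · rw [lower_false, onFst_bv]
      refine eq_of_bv (A := map _) (B := lower γ ∘ₗ map _) (fun y => ?_) (A (bv z))
      rw [LinearMap.comp_apply, map_bv, map_bv, lower_false]
    · rw [lower_true, map_zero]
      refine eq_of_bv (A := 0) (B := lower γ ∘ₗ map _) (fun y => ?_) (A (bv z))
      rw [LinearMap.comp_apply, map_bv, lower_true]; rfl

/-- The operator `1 + V^n t`. -/
noncomputable def turn (n : ℤ) (t : Op (α × Z2) (α × Z2)) : Op (α × Z2) (α × Z2) :=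
  LinearMap.id + sh (0, n) ∘ₗ t

/-- The endomorphism of the box tensor product with the solid torus of framing `n`. -/
noncomputable def cone (n : ℤ) (d t : Op (α × Z2) (α × Z2)) :
    Op ((α × Z2) × Bool) ((α × Z2) × Bool) :=
  onFst Bool d + onFst Bool (turn n t) ∘ₗ lower _

theorem turn_intertwine {n : ℤ} {A : Op (α × Z2) (β × Z2)} (hA : Lin A) {t : Op (α × Z2) (α × Z2)}
    {t' : Op (β × Z2) (β × Z2)} (h : A ∘ₗ t = t' ∘ₗ A) : A ∘ₗ turn n t = turn n t' ∘ₗ A := by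
  rw [turn, turn, LinearMap.comp_add, LinearMap.add_comp, LinearMap.comp_id, LinearMap.id_comp,
    ← LinearMap.comp_assoc, hA.comm, LinearMap.comp_assoc, h, LinearMap.comp_assoc]

theorem cone_intertwine {n : ℤ} {A : Op (α × Z2) (β × Z2)} (hA : Lin A) {d t : Op (α × Z2) (α × Z2)}
    {d' t' : Op (β × Z2) (β × Z2)} (hd : A ∘ₗ d = d' ∘ₗ A) (h : A ∘ₗ t = t' ∘ₗ A) :
    onFst Bool A ∘ₗ cone n d t = cone n d' t' ∘ₗ onFst Bool A := by
  rw [cone, cone, LinearMap.comp_add, LinearMap.add_comp, ← onFst_comp, hd, ← LinearMap.comp_assoc,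
    ← onFst_comp, turn_intertwine hA h, onFst_comp, onFst_comp, LinearMap.comp_assoc _ (onFst Bool A),
    lower_onFst, LinearMap.comp_assoc]

/-- The map 1 + V^n t commutes with d, so the mixed terms occur twice; two changes of the root
idempotent compose to zero. -/
theorem cone_cone {n : ℤ} {d t : Op (α × Z2) (α × Z2)} (hd : Lin d) (hdd : d ∘ₗ d = 0)
    (h : d ∘ₗ t = t ∘ₗ d) : cone n d t ∘ₗ cone n d t = 0 := by
  have h1 := turn_intertwine (n := n) hd h
  have e1 : onFst Bool d ∘ₗ onFst Bool d = 0 := by rw [← onFst_comp, hdd, onFst_zero]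
  have e2 : onFst Bool d ∘ₗ onFst Bool (turn n t) ∘ₗ lower _ =
      (onFst Bool (turn n t) ∘ₗ lower _) ∘ₗ onFst Bool d := by
    rw [← LinearMap.comp_assoc, ← onFst_comp, h1, onFst_comp, LinearMap.comp_assoc, lower_onFst,
      LinearMap.comp_assoc]
  have e3 : (onFst Bool (turn n t) ∘ₗ lower _) ∘ₗ (onFst Bool (turn n t) ∘ₗ lower _) = 0 := by
    rw [LinearMap.comp_assoc, ← LinearMap.comp_assoc (lower _), ← lower_onFst, LinearMap.comp_assoc,
      lower_lower, LinearMap.comp_zero, LinearMap.comp_zero]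
  rw [cone, LinearMap.add_comp, LinearMap.comp_add, LinearMap.comp_add, e1, e2, e3, zero_add, add_zero]
  exact add_self_zero (((onFst Bool (turn n t) ∘ₗ lower _) ∘ₗ onFst Bool d : Op _ _))

/-- Multiplication by the formal variable. -/
noncomputable def ush (α : Type*) : Op ((α × Z2) × Bool) ((α × Z2) × Bool) := onFst Bool (sh (1, 1))

theorem onFst_ush {A : Op (α × Z2) (β × Z2)} (hA : Lin A) : onFst Bool A ∘ₗ ush α = ush β ∘ₗ onFst Bool A := by
  rw [ush, ush, ← onFst_comp, hA.comm, onFst_comp]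

/-- The monomial UV is fixed by T, that is, `tw` fixes (1, 1), so even the semilinear t commutes
with the action of U. -/
theorem cone_ush {n : ℤ} {d t : Op (α × Z2) (α × Z2)} (hd : Lin d) (ht : Semi tw t) :
    cone n d t ∘ₗ ush α = ush α ∘ₗ cone n d t := by
  refine (cone_intertwine (A := sh (1, 1)) ?_ ?_ ?_).symm
  · refine lin_of_bv fun μ a m => ?_
    rw [sh_bv, sh_bv, sh_bv, add_right_comm]
  · exact (hd.comm _).symm
  · exact (ht (1, 1)).symm

end Cone

/-! ### Honest monomials and nilpotency of the deviation -/

namespace Mdl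
variable {X : Mdl}

/-- The basis elements of the completed complex. -/
def Honest (X : Mdl) (s : (X.B × Z2) × Bool) : Prop :=
  X.Val s.1.1 ∧ 0 ≤ s.1.2.1 ∧ (s.2 = false → 0 ≤ s.1.2.2)

/-- The basis elements of the lattice complex. -/
def HonestL (X : Mdl) (s : (X.C × Z2) × Bool) : Prop :=
  (X.lo s.1.1).1 ≤ s.1.2.1 ∧ (s.2 = false → (X.lo s.1.1).2 ≤ s.1.2.2)

theorem Good.aug_honest (hX : X.Good) {s : (X.B × Z2) × Bool} (hs : X.Honest s) {s'}
    (h : onFst Bool X.aug (bv s) s' ≠ 0) : X.HonestL s' := by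
  obtain ⟨⟨l, m⟩, ε⟩ := s
  rw [onFst_bv, aug_bv] at h
  split_ifs at h with hl
  · rw [map_bv] at h
    obtain rfl := ne_of_bv_ne h
    obtain ⟨h1, h2, h3⟩ := hs
    obtain ⟨h4, h5⟩ : X.lo (X.cell l) ≤ X.off l := hX.off_ge l h1
    refine ⟨?_, fun hε => ?_⟩
    · simp only [Prod.fst_add] at *; omega
    · have := h3 hε
      simp only [Prod.snd_add] at *; omega
  · simp at h

theorem Good.lift_honest (hX : X.Good) {s : (X.C × Z2) × Bool} (hs : X.HonestL s) {s'}
    (h : onFst Bool X.lift (bv s) s' ≠ 0) : X.Honest s' := by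
  obtain ⟨⟨κ, m⟩, ε⟩ := s
  rw [onFst_bv, lift_bv, map_bv] at h
  obtain rfl := ne_of_bv_ne h
  refine ⟨hX.val_gen κ, ?_, fun hε => ?_⟩
  · have : (X.off (X.gen κ)).1 ≤ m.1 := hs.1
    simp only [Prod.fst_sub] at *; omega
  · have : (X.off (X.gen κ)).2 ≤ m.2 := hs.2 hε
    simp only [Prod.snd_sub] at *; omega

theorem Good.h_honest (hX : X.Good) {s : (X.B × Z2) × Bool} (hs : X.Honest s) {s'}
    (h : onFst Bool X.h (bv s) s' ≠ 0) : X.Honest s' := by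
  obtain ⟨⟨h1, h2, h3⟩, h4⟩ := hX.supp_h.onFst s s' h
  obtain ⟨h5, h6⟩ := h3 hs.1
  exact ⟨h5, hs.2.1.trans h6.1, fun hε => (hs.2.2 (h4.trans hε)).trans h6.2⟩

/-- With the total exponent fixed, the generator determines the monomial, and nonnegativity of the
first exponent bounds the first offset; then `fin` applies. -/
theorem Good.finite_honest (hX : X.Good) (κ : X.C) (M : Z2) (ε : Bool) :
    {s | X.Honest s ∧ X.cell s.1.1 = κ ∧ X.off s.1.1 + s.1.2 = M ∧ s.2 = ε}.Finite := by
  refine ((hX.fin κ M.1).image fun l => ((l, M - X.off l), ε)).subset ?_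
  rintro ⟨⟨l, m⟩, ε⟩ ⟨h1, rfl, rfl, rfl⟩
  have := h1.2.1
  refine ⟨l, ⟨h1.1, rfl, ?_⟩, by simp⟩
  simp only [Prod.fst_add] at *; omega

/-- The deviation of the contraction from being a contraction of the cone lowers the number of vertices in
idempotent zero. -/
theorem Good.supp_deviation (hX : X.Good) (n : ℤ) :
    Supp (cone n X.d X.t ∘ₗ onFst Bool X.h + onFst Bool X.h ∘ₗ cone n X.d X.t + LinearMap.id +
      onFst Bool X.lift ∘ₗ onFst Bool X.aug) fun s s' =>
        X.nf (X.cell s'.1.1) + (if s'.2 then 0 else 1) < X.nf (X.cell s.1.1) + if s.2 then 0 else 1 := by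
  -- The `d0` part is contracted exactly by `htpy`. What remains are commutators with `d1` and with
  -- the root map, and each of them removes a vertex from idempotent zero.
  have h1 : cone n X.d X.t ∘ₗ onFst Bool X.h + onFst Bool X.h ∘ₗ cone n X.d X.t + LinearMap.id +
      onFst Bool X.lift ∘ₗ onFst Bool X.aug =
      onFst Bool (X.d1 ∘ₗ X.h + X.h ∘ₗ X.d1) + onFst Bool (turn n X.t ∘ₗ X.h + X.h ∘ₗ turn n X.t) ∘ₗ lower _ := by
    have h2 := congrArg (onFst Bool) hX.htpy
    rw [onFst_add, onFst_add, onFst_comp, onFst_comp, onFst_comp, onFst_id] at h2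
    have h3 : onFst Bool X.h ∘ₗ lower _ = lower _ ∘ₗ onFst Bool X.h := lower_onFst X.h
    refine LinearMap.ext fun x => ?_
    have h4 := LinearMap.congr_fun h2 x
    have h5 := LinearMap.congr_fun h3 x
    simp only [cone, d, onFst_add, onFst_comp, LinearMap.add_apply, LinearMap.comp_apply, map_add,
      LinearMap.id_apply] at h4 h5 ⊢
    rw [h5]
    have e1 := add_self_zero x
    have e2 := add_self_zero (onFst Bool X.lift (onFst Bool X.aug x))
    linear_combination (norm := module) h4 + e1 + e2
  have hh : Supp X.h fun p q => X.nf (X.cell q.1) ≤ X.nf (X.cell p.1) :=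
    hX.supp_h.mono fun _ _ h => h.1 ▸ le_rfl
  have ht : Supp (turn n X.t) fun p q => X.nf (X.cell q.1) ≤ X.nf (X.cell p.1) := by
    refine Supp.add (fun p q h => ?_) ?_
    · rw [LinearMap.id_apply] at h
      rw [ne_of_bv_ne h]
    · refine (hX.supp_t.comp (Supp.of_map _)).mono ?_
      rintro p _ ⟨q, h, rfl⟩
      exact h
  rw [h1]
  refine Supp.add ?_ ?_
  · have h2 : Supp (X.d1 ∘ₗ X.h + X.h ∘ₗ X.d1) fun p q => X.nf (X.cell q.1) < X.nf (X.cell p.1) :=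
      Supp.add ((hh.comp hX.supp_d1).mono fun p q ⟨r, h1, h2⟩ => h2.trans_le h1)
        ((hX.supp_d1.comp hh).mono fun p q ⟨r, h1, h2⟩ => h2.trans_lt h1)
    refine h2.onFst.mono ?_
    rintro ⟨p, ε⟩ ⟨q, ε'⟩ ⟨h1, rfl : ε = ε'⟩
    dsimp only at *; omega
  · have h2 : Supp (turn n X.t ∘ₗ X.h + X.h ∘ₗ turn n X.t) fun p q =>
        X.nf (X.cell q.1) ≤ X.nf (X.cell p.1) :=
      Supp.add ((hh.comp ht).mono fun p q ⟨r, h1, h2⟩ => h2.trans h1)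
        ((ht.comp hh).mono fun p q ⟨r, h1, h2⟩ => h2.trans h1)
    rintro ⟨p, ε⟩ ⟨q, ε'⟩ h
    rw [LinearMap.comp_apply] at h
    rcases ε
    · rw [lower_false] at h
      obtain ⟨h3, rfl : true = ε'⟩ := h2.onFst _ _ h
      simp; simp at h3; omega
    · rw [lower_true] at h
      simp at h

/-- Each application lowers the natural number m by at least one, and m is bounded. -/
theorem pow_eq_zero_of_supp {α : Type*} {A : Op α α} {m : α → ℕ} (hA : Supp A fun a b => m b < m a)
    {N : ℕ} (hN : ∀ a, m a ≤ N) : A ^ (N + 1) = 0 := by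
  have key : ∀ k, Supp (A ^ k : Op α α) fun a b => m b + k ≤ m a := by
    intro k
    induction k with
    | zero =>
      intro a b h
      rw [pow_zero, Module.End.one_apply] at h
      rw [ne_of_bv_ne h]; rfl
    | succ k ih =>
      rw [pow_succ', Module.End.mul_eq_comp]
      refine (ih.comp hA).mono ?_
      rintro a c ⟨b, h1, h2⟩; omega
  refine ext_bv fun a => Finsupp.ext fun b => ?_
  by_contra h
  have := key (N + 1) a b h
  have := hN a
  omega

end Mdl
end PlumbingLattice

/-! ### Charts, and the equivalence between a model and its cells -/

namespace PlumbingLattice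
open Op

/-- A chart identifies the monomials of a product complex with basis elements of a larger module, such that
its endomorphism is the restriction of an operator. -/
structure ProductComplex.Chart (P : ProductComplex) {α : Type} (D : Op ((α × Z2) × Bool) ((α × Z2) × Bool))
    (H : (α × Z2) × Bool → Prop) where
  e : P.Idx × ℕ → (α × Z2) × Bool
  inj : Function.Injective e
  mem : ∀ p, H (e p)
  surj : ∀ s, H s → ∃ p, e p = s
  succ : ∀ p k, e (p, k + 1) = (((e (p, k)).1.1, (e (p, k)).1.2 + (1, 1)), (e (p, k)).2)
  bd : ∀ p, ∃ x, P.bd p = ser _ x ∧ D (bv (e (p, 0))) = map e x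

namespace ProductComplex.Chart
variable {P : ProductComplex} {α : Type} {D : Op ((α × Z2) × Bool) ((α × Z2) × Bool)}
  {H : (α × Z2) × Bool → Prop}

theorem map_up (E : P.Chart D H) : map E.e ∘ₗ up _ = ush α ∘ₗ map E.e := ext_bv fun ⟨p, k⟩ => by
  rw [LinearMap.comp_apply, LinearMap.comp_apply, up, map_bv, map_bv, map_bv, E.succ, ush]
  exact (by rw [onFst_bv, sh_bv, map_bv] : onFst Bool (sh (1, 1)) (bv (((E.e (p, k)).1.1,
    (E.e (p, k)).1.2), (E.e (p, k)).2)) = _).symm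

/-- The values on generators are extended to all powers of the variable by shifting, which is
consistent because the large operator commutes with the shift. -/
theorem exists_represents (E : P.Chart D H) (hD : D ∘ₗ ush α = ush α ∘ₗ D) :
    ∃ A, P.Represents A ∧ D ∘ₗ map E.e = map E.e ∘ₗ A := by
  choose x hx1 hx2 using E.bd
  obtain ⟨A, hA⟩ : ∃ A : Op (P.Idx × ℕ) (P.Idx × ℕ), A = ofBasis fun p => (up _ ^ p.2) (x p.1) := ⟨_, rfl⟩
  have h1 : D ∘ₗ map E.e = map E.e ∘ₗ A := ext_bv fun ⟨p, k⟩ => by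
    rw [LinearMap.comp_apply, LinearMap.comp_apply, map_bv, hA, ofBasis_bv]
    induction k with
    | zero => rw [hx2]; rfl
    | succ k ih =>
      have h2 : bv (E.e (p, k + 1)) = ush α (bv (E.e (p, k))) := by
        have := LinearMap.congr_fun E.map_up (bv (p, k))
        rwa [LinearMap.comp_apply, LinearMap.comp_apply, map_bv, ← up_pow_bv, map_bv] at this
      have h3 := LinearMap.congr_fun hD (bv (E.e (p, k)))
      rw [LinearMap.comp_apply, LinearMap.comp_apply] at h3
      have h4 := LinearMap.congr_fun E.map_up ((up _ ^ k) (x p))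
      rw [LinearMap.comp_apply, LinearMap.comp_apply] at h4
      rw [h2, h3, ih, pow_succ', Module.End.mul_apply, h4]
  refine ⟨A, ⟨equivariant_of_restrict E.inj h1 E.map_up E.map_up hD, fun p => ?_⟩, h1⟩
  rw [hA, ofBasis_bv, hx1]; rfl

end ProductComplex.Chart

namespace Mdl
variable {X : Mdl}

/-- The augmentation, the lift and the contraction preserve honesty, have finite fibres on honest
basis elements and commute with U. Their restrictions through the two charts are the data of a
perturbed contraction, and every relation is checked in the large module, where the charts are
injective. -/
theorem Good.homotopyEquivalent (hX : X.Good) (n : ℤ) {N : ℕ} (hN : ∀ κ, X.nf κ ≤ N)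
    {P Q : ProductComplex} (E : P.Chart (cone n X.d X.t) X.Honest)
    (F : Q.Chart (cone n X.dL X.tL) X.HonestL) :
    P.IsComplex ∧ Q.IsComplex ∧ P.HomotopyEquivalent Q := by
  obtain ⟨d, hd, ed⟩ := E.exists_represents (cone_ush hX.lin_d hX.semi_t)
  obtain ⟨dL, hdL, edL⟩ := F.exists_represents (cone_ush hX.lin_dL hX.semi_tL)
  obtain ⟨a, ea⟩ := exists_restrict (onFst Bool X.aug) (f := E.e) F.inj
    fun p s h => F.surj s (hX.aug_honest (E.mem p) h)
  obtain ⟨i, ei⟩ := exists_restrict (onFst Bool X.lift) (f := F.e) E.inj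
    fun p s h => E.surj s (hX.lift_honest (F.mem p) h)
  obtain ⟨h, eh⟩ := exists_restrict (onFst Bool X.h) (f := E.e) E.inj
    fun p s h => E.surj s (hX.h_honest (E.mem p) h)
  have ua := equivariant_of_restrict F.inj ea E.map_up F.map_up (onFst_ush X.lin_aug)
  have ui := equivariant_of_restrict E.inj ei F.map_up E.map_up (onFst_ush X.lin_lift)
  have uh := equivariant_of_restrict E.inj eh E.map_up E.map_up (onFst_ush hX.lin_h)
  have pa : Proper a := proper_of_restrict F.inj ea fun q => by
    refine ((hX.finite_honest (F.e q).1.1 (F.e q).1.2 (F.e q).2).preimage E.inj.injOn).subset ?_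
    intro p hp
    refine ⟨E.mem p, ?_⟩
    rw [Set.mem_ofPred_eq] at hp
    generalize F.e q = s' at hp ⊢
    generalize E.e p = s at hp ⊢
    obtain ⟨⟨l, m⟩, ε⟩ := s
    rw [onFst_bv, aug_bv] at hp
    split_ifs at hp
    · rw [map_bv] at hp
      obtain rfl := ne_of_bv_ne hp
      exact ⟨rfl, rfl, rfl⟩
    · simp at hp
  have pi : Proper i := proper_of_restrict E.inj ei fun q => by
    -- The lift is injective on basis elements, since the cell is recovered from its minimal
    -- generator.
    refine Set.Subsingleton.finite fun p hp p' hp' => F.inj ?_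
    rw [Set.mem_ofPred_eq] at hp hp'
    generalize E.e q = s' at hp hp'
    generalize F.e p = s at hp ⊢
    generalize F.e p' = s₁ at hp' ⊢
    obtain ⟨⟨l, m⟩, ε⟩ := s
    obtain ⟨⟨l', m'⟩, ε'⟩ := s₁
    rw [onFst_bv, lift_bv, map_bv] at hp hp'
    have h1 := (ne_of_bv_ne hp).symm.trans (ne_of_bv_ne hp')
    simp only [Prod.mk.injEq] at h1
    obtain ⟨⟨h1, h2⟩, rfl⟩ := h1
    have h3 := congrArg X.cell h1
    rw [hX.cell_gen, hX.cell_gen] at h3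
    subst h3
    rw [sub_left_inj] at h2
    rw [h2]
  have ph : Proper h := proper_of_restrict E.inj eh fun q => by
    refine ((hX.finite_honest (X.cell (E.e q).1.1) (X.off (E.e q).1.1 + (E.e q).1.2) (E.e q).2).preimage
      E.inj.injOn).subset ?_
    intro p hp
    obtain ⟨⟨h1, h2, -⟩, h3⟩ := hX.supp_h.onFst _ _ hp
    exact ⟨E.mem p, h1.symm, h2.symm, h3⟩
  refine homotopyEquivalent_of_contraction hd hdL pa ua pi ui ph uh
    (comp_map_injective E.inj ?_) (comp_map_injective F.inj ?_) (comp_map_injective F.inj ?_)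
    (comp_map_injective F.inj ?_) (k := N + 1 + 1) (comp_map_injective E.inj ?_)
  · rw [← LinearMap.comp_assoc, ← ed, LinearMap.comp_assoc, ← ed, ← LinearMap.comp_assoc,
      cone_cone hX.lin_d hX.dd hX.dt, LinearMap.zero_comp, LinearMap.comp_zero]
  · rw [← LinearMap.comp_assoc, ← ea, LinearMap.comp_assoc, ← ed, ← LinearMap.comp_assoc,
      cone_intertwine X.lin_aug hX.aug_d hX.aug_t, LinearMap.comp_assoc, ea, ← LinearMap.comp_assoc,
      edL, LinearMap.comp_assoc]
  · rw [← LinearMap.comp_assoc, ← ea, LinearMap.comp_assoc, ← eh, ← LinearMap.comp_assoc,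
      ← onFst_comp, hX.aug_h, onFst_zero, LinearMap.zero_comp, LinearMap.comp_zero]
  · rw [← LinearMap.comp_assoc, ← ea, LinearMap.comp_assoc, ← ei, ← LinearMap.comp_assoc,
      ← onFst_comp, hX.aug_lift, onFst_id, LinearMap.id_comp, LinearMap.comp_id]
  · have e1 : (cone n X.d X.t ∘ₗ onFst Bool X.h + onFst Bool X.h ∘ₗ cone n X.d X.t + LinearMap.id +
        onFst Bool X.lift ∘ₗ onFst Bool X.aug) ∘ₗ map E.e =
        map E.e ∘ₗ (d ∘ₗ h + h ∘ₗ d + LinearMap.id + i ∘ₗ a) := by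
      have c1 : (cone n X.d X.t ∘ₗ onFst Bool X.h) ∘ₗ map E.e = map E.e ∘ₗ (d ∘ₗ h) := by
        rw [LinearMap.comp_assoc, eh, ← LinearMap.comp_assoc, ed, LinearMap.comp_assoc]
      have c2 : (onFst Bool X.h ∘ₗ cone n X.d X.t) ∘ₗ map E.e = map E.e ∘ₗ (h ∘ₗ d) := by
        rw [LinearMap.comp_assoc, ed, ← LinearMap.comp_assoc, eh, LinearMap.comp_assoc]
      have c3 : (onFst Bool X.lift ∘ₗ onFst Bool X.aug) ∘ₗ map E.e = map E.e ∘ₗ (i ∘ₗ a) := by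
        rw [LinearMap.comp_assoc, ea, ← LinearMap.comp_assoc, ei, LinearMap.comp_assoc]
      rw [LinearMap.add_comp, LinearMap.add_comp, LinearMap.add_comp, c1, c2, c3, LinearMap.comp_add,
        LinearMap.comp_add, LinearMap.comp_add, LinearMap.id_comp, LinearMap.comp_id]
    have e2 : ∀ k : ℕ, map E.e ∘ₗ ((d ∘ₗ h + h ∘ₗ d + LinearMap.id + i ∘ₗ a) ^ k : Op _ _) =
        ((cone n X.d X.t ∘ₗ onFst Bool X.h + onFst Bool X.h ∘ₗ cone n X.d X.t + LinearMap.id +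
        onFst Bool X.lift ∘ₗ onFst Bool X.aug) ^ k : Op _ _) ∘ₗ map E.e := by
      intro k
      induction k with
      | zero => rfl
      | succ k ih =>
        rw [pow_succ, pow_succ, Module.End.mul_eq_comp, Module.End.mul_eq_comp, ← LinearMap.comp_assoc,
          ih, LinearMap.comp_assoc, ← e1, LinearMap.comp_assoc]
    -- The measure is at most N + 1: at most N for the vertices other than the root and one for the
    -- root. Hence the power N + 2.
    rw [e2, pow_eq_zero_of_supp (hX.supp_deviation n) (N := N + 1), LinearMap.zero_comp, LinearMap.comp_zero]
    intro s
    have := hN (X.cell s.1.1)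
    split_ifs <;> omega

end Mdl
end PlumbingLattice

namespace PlumbingLattice
open Op

/-! ## The type-`D` modules of recipes and their models -/

section ListSums
variable {ι κ W W' : Type*} [AddCommMonoid W] [AddCommMonoid W']

/-- The sum of the values of a function over a list. -/
def lsum (L : List ι) (f : ι → W) : W := (L.map f).sum

@[simp] theorem lsum_nil (f : ι → W) : lsum [] f = 0 := rfl

@[simp] theorem lsum_cons (a : ι) (L : List ι) (f : ι → W) : lsum (a :: L) f = f a + lsum L f := by
  simp [lsum]

@[simp] theorem lsum_append (L L' : List ι) (f : ι → W) : lsum (L ++ L') f = lsum L f + lsum L' f := by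
  simp [lsum]

@[simp] theorem lsum_map (L : List κ) (g : κ → ι) (f : ι → W) :
    lsum (L.map g) f = lsum L fun a => f (g a) := by
  simp [lsum, Function.comp_def]

theorem lsum_flatMap (L : List κ) (g : κ → List ι) (f : ι → W) :
    lsum (L.flatMap g) f = lsum L fun a => lsum (g a) f := by
  induction L with
  | nil => rfl
  | cons a L ih => simp [ih]

theorem lsum_filterMap (L : List κ) (g : κ → Option ι) (f : ι → W) :
    lsum (L.filterMap g) f = lsum L fun a => (g a).elim 0 f := by
  induction L with
  | nil => rfl
  | cons a L ih =>
    rw [List.filterMap_cons]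
    cases h : g a <;> simp [h, ih]

theorem lsum_congr {L : List ι} {f g : ι → W} (h : ∀ a ∈ L, f a = g a) : lsum L f = lsum L g := by
  rw [lsum, lsum, List.map_congr_left h]

@[simp] theorem lsum_zero (L : List ι) : lsum L (fun _ => (0 : W)) = 0 := by
  simp [lsum]

theorem lsum_eq_zero {L : List ι} {f : ι → W} (h : ∀ a ∈ L, f a = 0) : lsum L f = 0 := by
  rw [lsum_congr h, lsum_zero]

theorem lsum_add (L : List ι) (f g : ι → W) : lsum L (fun a => f a + g a) = lsum L f + lsum L g := by
  induction L with
  | nil => simp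
  | cons a L ih => simp [ih, add_add_add_comm]

theorem map_lsum {F : Type*} [FunLike F W W'] [AddMonoidHomClass F W W'] (A : F) (L : List ι) (f : ι → W) :
    A (lsum L f) = lsum L fun a => A (f a) := by
  induction L with
  | nil => simp
  | cons a L ih => simp [ih]

theorem lsum_comm (L : List ι) (L' : List κ) (f : ι → κ → W) :
    lsum L (fun a => lsum L' (f a)) = lsum L' fun b => lsum L fun a => f a b := by
  induction L with
  | nil => simp
  | cons a L ih => simp [ih, lsum_add]

/-- Lets a formula for sums over `δ` speak about single summands, by summing an indicator with
values in ℕ. -/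
theorem eq_zero_of_lsum {L : List ι} {f : ι → ℕ} (h : lsum L f = 0) : ∀ a ∈ L, f a = 0 := by
  induction L with
  | nil => simp
  | cons a L ih =>
    rw [lsum_cons, Nat.add_eq_zero_iff] at h
    simpa [h.1] using ih h.2

end ListSums

namespace KMon

/-- The right idempotent of a monomial. -/
def right : KMon → Bool
  | laur _ _ => true
  | _ => false

/-- The summands of an element of a type-`D` module without `σ` and `τ`. -/
noncomputable def encI {β : Type*} (l : β) : KMon → (β × Z2 →₀ F2)
  | poly i j => bv (l, (i, j))
  | laur i j => bv (l, (i, j))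
  | _ => 0

/-- The summands of an element of a type-`D` module with weight `σ`. -/
noncomputable def encS {β : Type*} (l : β) : KMon → (β × Z2 →₀ F2)
  | sig i j => bv (l, (i, j))
  | _ => 0

/-- The summands of an element of a type-`D` module with weight `τ`. -/
noncomputable def encT {β : Type*} (l : β) : KMon → (β × Z2 →₀ F2)
  | tau i j => bv (l, (i, j))
  | _ => 0

end KMon

/-- A type-`D` module over `K` is described by a model. -/
structure TypeD.Models (X : TypeD KMon Bool) (M : Mdl) where
  lab : X.B → M.B
  inj : ∀ x y, X.idem x = X.idem y → lab x = lab y → x = y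
  val : ∀ x, M.Val (lab x)
  surj : ∀ ε l, M.Val l → ∃ x, X.idem x = ε ∧ lab x = l
  wf : ∀ x, ∀ q ∈ X.δ x, q.2.right = X.idem x ∧ q.2.left = X.idem q.1
  sumI : ∀ x, (lsum (X.δ x) fun q => q.2.encI (lab q.1)) = M.d (bv (lab x, 0))
  sumS : ∀ x, (lsum (X.δ x) fun q => q.2.encS (lab q.1)) =
    if X.idem x then 0 else bv (lab x, 0)
  sumT : ∀ x, (lsum (X.δ x) fun q => q.2.encT (lab q.1)) =
    if X.idem x then 0 else M.t (bv (lab x, 0))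

namespace DMon

/-- The exponents of a monomial. -/
def expo : DMon → Z2
  | poly i j => (i, j)
  | laur i j => (i, j)

theorem expo_succ (k : ℕ) (r : DMon) : (mulU (k + 1) r).expo = (mulU k r).expo + (1, 1) := by
  cases r <;> simp only [mulU, expo, Prod.mk_add_mk, Prod.mk.injEq] <;> push_cast <;> omega

theorem idem_mulU (k : ℕ) (r : DMon) : (mulU k r).idem = r.idem := by cases r <;> rfl

theorem idem_gen (ε : Bool) (s : ℤ) : (gen ε s).idem = ε := by cases ε <;> rfl

theorem mulU_zero (r : DMon) : mulU 0 r = r := by cases r <;> simp [mulU]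

theorem expo_inj {r r' : DMon} (h : r.idem = r'.idem) (h' : r.expo = r'.expo) : r = r' := by
  cases r <;> cases r' <;> simp_all [idem, expo]

theorem mulU_gen_inj {ε : Bool} {k k' : ℕ} {s s' : ℤ} (h : mulU k (gen ε s) = mulU k' (gen ε s')) :
    s = s' ∧ k = k' := by
  cases ε <;> simp only [gen, mulU, poly.injEq, laur.injEq] at h <;> omega

theorem expo_nonneg (r : DMon) : 0 ≤ r.expo.1 ∧ (r.idem = false → 0 ≤ r.expo.2) := by
  cases r <;> simp [expo, idem]

theorem exists_expo (ε : Bool) (m : Z2) (h : 0 ≤ m.1) (h' : ε = false → 0 ≤ m.2) :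
    ∃ r : DMon, r.idem = ε ∧ r.expo = m := by
  cases ε
  · refine ⟨poly m.1.toNat m.2.toNat, rfl, ?_⟩
    have := h' rfl
    ext <;> simp [expo] <;> omega
  · refine ⟨laur m.1.toNat m.2, rfl, ?_⟩
    ext <;> simp [expo]; omega

end DMon

theorem cone_bv {α : Type*} (n : ℤ) {d t : Op (α × Z2) (α × Z2)} (hd : Lin d) (ht : Semi tw t) (l : α) (m : Z2)
    (ε : Bool) : cone n d t (bv ((l, m), ε)) = map (fun z => (z, ε)) (sh m (d (bv (l, 0)))) +
      if ε then 0 else map (fun z => (z, true)) (bv (l, m) + sh (tw m + (0, n)) (t (bv (l, 0)))) := by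
  rw [cone, LinearMap.add_apply, onFst_bv, hd.bv l m 0, sub_zero, LinearMap.comp_apply,
    AddMonoidHom.id_apply]
  congr 1
  rcases ε
  · rw [lower_false, onFst_bv, turn, LinearMap.add_apply, LinearMap.id_apply, LinearMap.comp_apply,
      ht.bv l m 0, sub_zero]
    simp only [Bool.false_eq_true, if_false]
    rw [sh, sh, sh, map_map]
    simp only [add_assoc]
  · rw [lower_true, map_zero]; rfl

theorem TypeD.boxFinal_bd (X : TypeD KMon Bool) (n : ℤ) (x : X.B) (s : ℤ) :
    (X.boxFinal n).bd (x, s) = ser (X.B × ℤ) (lsum (X.δ x) fun q =>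
      (DMon.act n q.2 (DMon.gen (X.idem x) s)).elim 0 fun y => bv ((q.1, y.alex), y.upow)) := by
  have : ∀ L : List ((X.B × ℤ) →₀ PowerSeries F2), L.sum = lsum L id := fun L => by simp [lsum]
  rw [map_lsum]
  refine (this _).trans ?_
  rw [lsum_filterMap]
  refine lsum_congr fun q _ => ?_
  cases DMon.act n q.2 (DMon.gen (X.idem x) s) with
  | none => simp
  | some y => simp only [Option.map_some, Option.elim_some, id, ser_bv]

namespace TypeD.Models
variable {X : TypeD KMon Bool} {M : Mdl} (E : X.Models M)

/-- The basis element of the model belonging to a monomial. -/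
noncomputable def chartMap (p : (X.B × ℤ) × ℕ) : (M.B × Z2) × Bool :=
  ((E.lab p.1.1, (DMon.mulU p.2 (DMon.gen (X.idem p.1.1) p.1.2)).expo), X.idem p.1.1)

theorem chartMap_alex (x : X.B) (y : DMon) (hy : y.idem = X.idem x) :
    E.chartMap ((x, y.alex), y.upow) = ((E.lab x, y.expo), X.idem x) := by
  rw [chartMap]; simp only; rw [← hy, DMon.mulU_gen]

theorem chartMap_zero (x : X.B) (s : ℤ) :
    E.chartMap ((x, s), 0) = ((E.lab x, (DMon.gen (X.idem x) s).expo), X.idem x) := by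
  rw [chartMap, DMon.mulU_zero]

/-- Each summand of `δ` has exactly one of the three weights. Acting on a monomial of the solid
torus, the first two kinds add exponents, and the third applies `tw` and adds the framing, just as
in the cone. -/
theorem cone_chartMap (hM : M.Good) (n : ℤ) (x : X.B) (s : ℤ) :
    cone n M.d M.t (bv (E.chartMap ((x, s), 0))) = map E.chartMap (lsum (X.δ x) fun q =>
      (DMon.act n q.2 (DMon.gen (X.idem x) s)).elim 0 fun y => bv ((q.1, y.alex), y.upow)) := by
  rw [chartMap_zero, cone_bv n hM.lin_d hM.semi_t, ← E.sumI, map_lsum]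
  have key : ∀ q ∈ X.δ x, map E.chartMap
      ((DMon.act n q.2 (DMon.gen (X.idem x) s)).elim 0 fun y => bv ((q.1, y.alex), y.upow)) =
      map (fun z => (z, X.idem x)) (sh (DMon.gen (X.idem x) s).expo (q.2.encI (E.lab q.1))) +
      (map (fun z => (z, true)) (sh (DMon.gen (X.idem x) s).expo (q.2.encS (E.lab q.1))) +
      map (fun z => (z, true)) (sh (tw (DMon.gen (X.idem x) s).expo + (0, n)) (q.2.encT (E.lab q.1)))) := by
    intro q hq
    obtain ⟨h2, h3⟩ := E.wf x q hq
    have h4 := DMon.idem_gen (X.idem x) s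
    generalize DMon.gen (X.idem x) s = r at h4 ⊢
    rw [← h4] at h2 ⊢
    cases hq2 : q.2 <;> rw [hq2] at h2 h3 <;> cases r <;>
      simp only [KMon.right, KMon.left, DMon.idem, reduceCtorEq] at h2 h3 <;>
      simp only [DMon.act, Option.elim_some, KMon.encI, KMon.encS, KMon.encT, map_zero, add_zero,
        zero_add] <;>
      rw [map_bv, chartMap_alex _ _ _ (by exact h3), sh_bv, map_bv, ← h3] <;>
      simp only [DMon.expo, DMon.idem, tw_apply]
    all_goals
      congr 3 <;> (simp only [Prod.mk_add_mk, Prod.mk.injEq]; push_cast; constructor <;> ring)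
  rw [map_lsum, map_lsum, lsum_congr key, lsum_add, lsum_add, ← map_lsum, ← map_lsum, ← map_lsum,
    ← map_lsum, ← map_lsum, ← map_lsum, E.sumI, E.sumS, E.sumT]
  split_ifs
  · simp
  · rw [map_add, sh_bv, zero_add]

/-- The chart of the completed box tensor product given by a model. -/
noncomputable def chart (hM : M.Good) (n : ℤ) :
    (X.boxFinal n).Chart (cone n M.d M.t) M.Honest where
  e := E.chartMap
  inj := by
    rintro ⟨⟨x, s⟩, k⟩ ⟨⟨x', s'⟩, k'⟩ h
    simp only [chartMap, Prod.mk.injEq] at h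
    obtain ⟨⟨h1, h2⟩, h3⟩ := h
    obtain rfl := E.inj x x' h3 h1
    obtain ⟨rfl, rfl⟩ := DMon.mulU_gen_inj (DMon.expo_inj (by rw [DMon.idem_mulU, DMon.idem_mulU,
      DMon.idem_gen, DMon.idem_gen]) h2)
    rfl
  mem p := ⟨E.val _, (DMon.expo_nonneg _).1, fun h => (DMon.expo_nonneg _).2 (by
    rw [DMon.idem_mulU, DMon.idem_gen]; exact h)⟩
  surj := by
    rintro ⟨⟨l, m⟩, ε⟩ ⟨h1, h2, h3⟩
    obtain ⟨x, rfl, rfl⟩ := E.surj ε l h1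
    obtain ⟨r, hr, rfl⟩ := DMon.exists_expo (X.idem x) m h2 h3
    exact ⟨((x, r.alex), r.upow), E.chartMap_alex x r hr⟩
  succ p k := by simp only [chartMap, DMon.expo_succ]
  bd p := ⟨_, X.boxFinal_bd n p.1 p.2, E.cone_chartMap hM n p.1 p.2⟩

end TypeD.Models

/-- The model of a single vertex describes the solid torus. -/
def solidTorusModels : (solidTorusD 0).Models Mdl.vertex where
  lab _ := ()
  inj _ _ h _ := h
  val _ := trivial
  surj ε _ _ := ⟨ε, rfl, rfl⟩
  wf x q hq := by
    rcases x with _ | _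
    · rcases List.mem_pair.1 hq with h | h <;> rw [h] <;> exact ⟨rfl, rfl⟩
    · exact absurd hq List.not_mem_nil
  sumI x := by
    cases x <;> simp [solidTorusD, KMon.encI, Mdl.d]
  sumS x := by
    cases x <;> simp [solidTorusD, KMon.encS]; rfl
  sumT x := by
    cases x <;> simp [solidTorusD, KMon.encT]; rfl

end PlumbingLattice

/-! ### Joins: the tensor product with the merge bimodule -/

namespace PlumbingLattice
open Op

section Box
variable {A J A' J' W : Type} [AddCommMonoid W]

theorem TypeD.lsum_box [DecidableEq J] (X : TypeD A J) (M : TypeDA A J A' J') (p : (X.box M).B)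
    (F : X.B × M.B → A' → W) : (lsum ((X.box M).δ p) fun r => F r.1.1 r.2) =
      lsum (List.range (M.N + 1)) fun j => lsum (X.iter j p.1.1) fun q => lsum (M.δ q.2 p.1.2) fun r =>
        if X.idem q.1 = M.lidem r.1 then F (q.1, r.1) r.2 else 0 := by
  simp only [TypeD.box, lsum_flatMap, lsum_filterMap]
  refine lsum_congr fun j _ => lsum_congr fun q _ => lsum_congr fun r _ => ?_
  split_ifs <;> rfl

theorem TypeD.lsum_iter_zero (X : TypeD A J) (x : X.B) (f : X.B × List A → W) :
    lsum (X.iter 0 x) f = f (x, []) := by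
  simp [TypeD.iter]

theorem TypeD.lsum_iter_succ (X : TypeD A J) (j : ℕ) (x : X.B) (f : X.B × List A → W) :
    lsum (X.iter (j + 1) x) f = lsum (X.iter j x) fun q => lsum (X.δ q.1) fun r => f (r.1, r.2 :: q.2) := by
  simp [TypeD.iter, lsum_flatMap]

theorem TypeD.lsum_tensor (X Y : TypeD KMon Bool) (p : (X.tensor Y).B)
    (f : (X.tensor Y).B × (KMon × KMon) → W) : lsum ((X.tensor Y).δ p) f =
      (lsum (X.δ p.1) fun q => f ((q.1, p.2), (q.2, KMon.one (Y.idem p.2)))) +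
      lsum (Y.δ p.2) fun q => f ((p.1, q.1), (KMon.one (X.idem p.1), q.2)) :=
  (lsum_append _ _ _).trans (congrArg₂ _ (lsum_map _ _ _) (lsum_map _ _ _))

theorem lsum_range_three (f : ℕ → W) : lsum (List.range 3) f = f 0 + f 1 + f 2 := by
  simp [List.range_succ, add_assoc]

end Box

/-- The monomials without `σ` and `τ`. -/
def KMon.even : KMon → Bool
  | poly _ _ => true
  | laur _ _ => true
  | _ => false

section Merge
variable {W : Type} [AddCommMonoid W]

/-- The product of two summands of weight `σ` or two summands of weight `τ`. -/
def KMon.both (F : KMon → W) : KMon → KMon → W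
  | sig i j, sig k l => F (sig (i + k) (j + l))
  | tau i j, tau k l => F (tau (i + k) (j + l))
  | _, _ => 0

theorem lsum_merge_left (a : KMon) (ε ε' : Bool) (h1 : a.right = ε) (h2 : a.left = ε')
    (G : Bool → KMon → W) :
    (lsum (mergeδ [(a, KMon.one ε)] ε) fun r => if (ε', ε) = (r.1, r.1) then G r.1 r.2 else 0) =
      if a.even then G ε a else 0 := by
  subst h1 h2
  cases a <;> simp [mergeδ, KMon.one, KMon.right, KMon.left, KMon.even]

theorem lsum_merge_right (a : KMon) (ε ε' : Bool) (h1 : a.right = ε) (h2 : a.left = ε')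
    (G : Bool → KMon → W) :
    (lsum (mergeδ [(KMon.one ε, a)] ε) fun r => if (ε, ε') = (r.1, r.1) then G r.1 r.2 else 0) =
      if a.even then G ε a else 0 := by
  subst h1 h2
  cases a <;> simp [mergeδ, KMon.one, KMon.right, KMon.left, KMon.even]

theorem lsum_merge_both (a b : KMon) (ε ε' ε'' : Bool) (h1 : a.right = ε) (h2 : a.left = ε') 
    (h3 : b.right = ε) (h4 : b.left = ε'') (G : Bool → KMon → W) :
    (lsum (mergeδ [(a, KMon.one ε''), (KMon.one ε, b)] ε) fun r =>
      if (ε', ε'') = (r.1, r.1) then G r.1 r.2 else 0) = KMon.both (G true) a b := by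
  subst h1 h2 h4
  cases a <;> cases b <;> simp_all [mergeδ, KMon.one, KMon.right, KMon.left, KMon.both]

/-- Lists carry the last input first. A nonzero operation with two inputs changes the idempotent of
the second factor first and that of the first factor last, so an identity in the first slot of the
last input excludes it. -/
theorem mergeδ_one_left (a b c : KMon) (ε ε' : Bool) : mergeδ [(KMon.one ε, a), (b, c)] ε' = [] := by
  cases ε <;> cases a <;> cases b <;> cases c <;> simp [mergeδ, KMon.one]

theorem mergeδ_one_right (a b c : KMon) (ε ε' : Bool) : mergeδ [(a, b), (c, KMon.one ε)] ε' = [] := by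
  cases ε <;> cases a <;> cases b <;> cases c <;> simp [mergeδ, KMon.one]

theorem mergeδ_nil (ε : Bool) : mergeδ [] ε = [] := by
  cases ε <;> simp [mergeδ]

variable {X Y : TypeD KMon Bool}

/-- Single steps survive only without `σ` and `τ`. Of the double steps only one survives, a step of
Y followed by a step of X, both of weight `σ` or both of weight `τ`. -/
theorem lsum_join (wX : ∀ x, ∀ q ∈ X.δ x, q.2.right = X.idem x ∧ q.2.left = X.idem q.1)
    (wY : ∀ x, ∀ q ∈ Y.δ x, q.2.right = Y.idem x ∧ q.2.left = Y.idem q.1) (z : (X.tensor Y).B) (ε : Bool)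
    (h : (X.tensor Y).idem z = merge.lidem ε) (F : X.B → Y.B → Bool → KMon → W) :
    (lsum (((X.tensor Y).box merge).δ ⟨(z, ε), h⟩) fun r => F r.1.1.1.1 r.1.1.1.2 r.1.1.2 r.2) =
      (lsum (X.δ z.1) fun q => if q.2.even then F q.1 z.2 ε q.2 else 0) +
      (lsum (Y.δ z.2) fun q => if q.2.even then F z.1 q.1 ε q.2 else 0) +
      lsum (Y.δ z.2) fun q => lsum (X.δ z.1) fun r => KMon.both (F r.1 q.1 true) r.2 q.2 := by
  refine (TypeD.lsum_box (X.tensor Y) merge ⟨(z, ε), h⟩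
    fun (p : (X.B × Y.B) × Bool) a => F p.1.1 p.1.2 p.2 a).trans ?_
  have hx : X.idem z.1 = ε := congrArg Prod.fst h
  have hy : Y.idem z.2 = ε := congrArg Prod.snd h
  change (lsum (List.range 3) fun j => lsum ((X.tensor Y).iter j z) fun q =>
    lsum (mergeδ q.2 ε) fun r : Bool × KMon =>
      if (X.idem q.1.1, Y.idem q.1.2) = (r.1, r.1) then F q.1.1 q.1.2 r.1 r.2 else 0) = _
  rw [lsum_range_three, TypeD.lsum_iter_zero, TypeD.lsum_iter_succ, TypeD.lsum_iter_zero,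
    TypeD.lsum_iter_succ, TypeD.lsum_iter_succ, TypeD.lsum_iter_zero]
  simp only [mergeδ_nil, lsum_nil, zero_add]
  rw [TypeD.lsum_tensor, TypeD.lsum_tensor, hx, hy]
  congr 1
  · congr 1
    · refine lsum_congr fun q hq => ?_
      have h1 := wX z.1 q hq
      refine Eq.trans (lsum_congr fun r _ => ?_) (lsum_merge_left q.2 ε (X.idem q.1) (h1.1.trans hx) h1.2
        fun ε' a => F q.1 z.2 ε' a)
      change (if (X.idem q.1, Y.idem z.2) = (r.1, r.1) then _ else _) = _
      rw [hy]
    · refine lsum_congr fun q hq => ?_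
      have h1 := wY z.2 q hq
      refine Eq.trans (lsum_congr fun r _ => ?_) (lsum_merge_right q.2 ε (Y.idem q.1) (h1.1.trans hy) h1.2
        fun ε' a => F z.1 q.1 ε' a)
      change (if (X.idem z.1, Y.idem q.1) = (r.1, r.1) then _ else _) = _
      rw [hx]
  · rw [lsum_eq_zero, zero_add]
    · refine lsum_congr fun q hq => ?_
      have h1 := wY z.2 q hq
      rw [TypeD.lsum_tensor]
      refine (congrArg₂ _ rfl (lsum_eq_zero fun r _ => ?_)).trans ((add_zero _).trans (lsum_congr fun r hr => ?_))
      · rw [mergeδ_one_left, lsum_nil]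
      · have h2 := wX z.1 r hr
        exact lsum_merge_both r.2 q.2 ε (X.idem r.1) (Y.idem q.1) (h2.1.trans hx) h2.2 (h1.1.trans hy) h1.2
          fun ε' a => F r.1 q.1 ε' a
    · intro q _
      rw [TypeD.lsum_tensor, lsum_eq_zero, lsum_eq_zero, zero_add]
      · intro r _
        rw [mergeδ_one_right, lsum_nil]
      · intro r _
        rw [mergeδ_one_right, lsum_nil]

end Merge

/-- The product of vectors over the ring of monomials. -/
noncomputable def tens {α β : Type} (x : α × Z2 →₀ F2) : Op (β × Z2) ((α × β) × Z2) :=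
  ofBasis fun q => map (fun p => ((p.1, q.1), p.2 + q.2)) x

theorem tens_add {α β : Type} (x x' : α × Z2 →₀ F2) (y : β × Z2 →₀ F2) :
    tens (x + x') y = tens x y + tens x' y :=
  eq_of_bv (A := tens (x + x')) (B := tens x + tens x') (fun q => by
    simp only [tens, ofBasis_bv, LinearMap.add_apply, map_add]) y

theorem tens_zero {α β : Type} (y : β × Z2 →₀ F2) : tens (0 : α × Z2 →₀ F2) y = 0 :=
  eq_of_bv (A := tens 0) (B := 0) (fun q => by
    simp only [tens, ofBasis_bv, map_zero, LinearMap.zero_apply]) y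

theorem lsum_tens {ι α β : Type} (L : List ι) (f : ι → (α × Z2 →₀ F2)) (y : β × Z2 →₀ F2) :
    (lsum L fun a => tens (f a) y) = tens (lsum L f) y := by
  induction L with
  | nil => rw [lsum_nil, lsum_nil, tens_zero]
  | cons a L ih => rw [lsum_cons, lsum_cons, tens_add, ih]

theorem tens_bv {α β : Type} (a : α) (b : β) (m m' : Z2) :
    tens (bv (a, m)) (bv (b, m')) = bv ((a, b), m + m') := by
  rw [tens, ofBasis_bv, map_bv]

/-- At exponent zero no monomial has to be carried across, so the composite is the plain product of
the two values. -/
theorem onLeft_onRight_bv {α α' β β' : Type} {A : Op (α × Z2) (α' × Z2)} (hA : Lin A)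
    (B : Op (β × Z2) (β' × Z2)) (a : α) (b : β) :
    onLeft β' A (onRight α B (bv ((a, b), 0))) = tens (A (bv (a, 0))) (B (bv (b, 0))) := by
  rw [onRight_bv]
  refine eq_of_bv (A := onLeft β' A ∘ₗ map (insL a)) (fun ⟨b', m⟩ => ?_) _
  rw [LinearMap.comp_apply, map_bv, insL, onLeft_bv, tens, ofBasis_bv, hA.bv a m 0, sub_zero, sh, map_map]
  rfl

theorem KMon.encI_even {β β' : Type} (f : β × Z2 → β' × Z2) (l : β) (l' : β') (a : KMon)
    (h : ∀ m, f (l, m) = (l', m)) : map f (a.encI l) = if a.even then a.encI l' else 0 := by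
  cases a <;> simp [encI, even, h]

/-- The model of a join. -/
noncomputable def TypeD.Models.join {X Y : TypeD KMon Bool} {M N : Mdl} (E : X.Models M) (F : Y.Models N)
    (hM : M.Good) : ((X.tensor Y).box merge).Models (Mdl.join M N) where
  lab p := (E.lab p.1.1.1, F.lab p.1.1.2)
  inj := by
    rintro ⟨⟨⟨x, y⟩, (ε : Bool)⟩, h⟩ ⟨⟨⟨x', y'⟩, ε'⟩, h'⟩ (rfl : ε = ε') h2
    have hx : X.idem x = ε := congrArg Prod.fst h
    have hy : Y.idem y = ε := congrArg Prod.snd h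
    have hx' : X.idem x' = ε := congrArg Prod.fst h'
    have hy' : Y.idem y' = ε := congrArg Prod.snd h'
    simp only [Prod.mk.injEq] at h2
    obtain rfl := E.inj x x' (hx.trans hx'.symm) h2.1
    obtain rfl := F.inj y y' (hy.trans hy'.symm) h2.2
    rfl
  val p := ⟨E.val _, F.val _⟩
  surj := by
    rintro ε ⟨l, k⟩ ⟨h1, h2⟩
    obtain ⟨x, hx, rfl⟩ := E.surj ε l h1
    obtain ⟨y, hy, rfl⟩ := F.surj ε k h2
    exact ⟨⟨((x, y), ε), Prod.ext hx hy⟩, rfl, rfl⟩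
  wf := by
    rintro ⟨⟨⟨x, y⟩, (ε : Bool)⟩, h⟩
    have hx : X.idem x = ε := congrArg Prod.fst h
    have hy : Y.idem y = ε := congrArg Prod.snd h
    -- Count the summands with wrong idempotents: the count vanishes by the explicit formula, so
    -- there are none.
    have key := lsum_join E.wf F.wf (x, y) ε h fun _ _ ε' a => if a.right = ε ∧ a.left = ε' then 0 else 1
    intro q hq
    have := eq_zero_of_lsum (key.trans ?_) q hq
    · by_contra hc
      exact one_ne_zero ((if_neg hc).symm.trans this)
    · clear key
      rw [lsum_eq_zero, lsum_eq_zero, lsum_eq_zero]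
      · rfl
      · intro q hq
        refine lsum_eq_zero fun r hr => ?_
        obtain ⟨h1, h2⟩ := F.wf y q hq
        rw [hy] at h1
        cases hr2 : r.2 <;> cases hq2 : q.2 <;> rw [hq2] at h1 <;>
          simp_all [KMon.both, KMon.right, KMon.left]
      · intro q hq
        obtain ⟨h1, h2⟩ := F.wf y q hq
        rw [hy] at h1
        cases hq2 : q.2 <;> rw [hq2] at h1 h2 <;> simp_all [KMon.even, KMon.right, KMon.left]
      · intro q hq
        obtain ⟨h1, h2⟩ := E.wf x q hq
        rw [hx] at h1
        cases hq2 : q.2 <;> rw [hq2] at h1 h2 <;> simp_all [KMon.even, KMon.right, KMon.left]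
  sumI := by
    rintro ⟨⟨⟨x, y⟩, (ε : Bool)⟩, h⟩
    rw [lsum_join E.wf F.wf (x, y) ε h fun x' y' _ a => a.encI (E.lab x', F.lab y'), Mdl.join_d,
      LinearMap.add_apply, onLeft_bv, onRight_bv, ← E.sumI, ← F.sumI, map_lsum, map_lsum,
      lsum_eq_zero (L := Y.δ y) (f := fun q => lsum (X.δ x) _), add_zero]
    · congr 1
      · refine lsum_congr fun q _ => ?_
        rw [KMon.encI_even _ _ (E.lab q.1, F.lab y) _ fun m => rfl]
      · refine lsum_congr fun q _ => ?_
        rw [KMon.encI_even _ _ (E.lab x, F.lab q.1) _ fun m => rfl]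
    · intro q _
      refine lsum_eq_zero fun r _ => ?_
      cases r.2 <;> cases q.2 <;> rfl
  sumS := by
    rintro ⟨⟨⟨x, y⟩, (ε : Bool)⟩, h⟩
    have hx : X.idem x = ε := congrArg Prod.fst h
    have hy : Y.idem y = ε := congrArg Prod.snd h
    rw [lsum_join E.wf F.wf (x, y) ε h fun x' y' _ a => a.encS (E.lab x', F.lab y'), lsum_eq_zero,
      lsum_eq_zero, zero_add, zero_add]
    · refine Eq.trans (lsum_congr fun q _ => Eq.trans (lsum_congr fun r _ => ?_) (lsum_tens (X.δ x)
        (fun r => r.2.encS (E.lab r.1)) (q.2.encS (F.lab q.1)))) ?_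
      · cases r.2 <;> cases q.2 <;> simp only [KMon.both, KMon.encS, tens_zero, map_zero, tens_bv] <;> simp
      · rw [← map_lsum, E.sumS, F.sumS, hx, hy]
        change _ = if ε = true then _ else _
        split_ifs
        · rw [map_zero]
        · rw [tens_bv]; rfl
    · intro q _
      cases q.2 <;> rfl
    · intro q _
      cases q.2 <;> rfl
  sumT := by
    rintro ⟨⟨⟨x, y⟩, (ε : Bool)⟩, h⟩
    have hx : X.idem x = ε := congrArg Prod.fst h
    have hy : Y.idem y = ε := congrArg Prod.snd h
    rw [lsum_join E.wf F.wf (x, y) ε h fun x' y' _ a => a.encT (E.lab x', F.lab y'), lsum_eq_zero,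
      lsum_eq_zero, zero_add, zero_add]
    · refine Eq.trans (lsum_congr fun q _ => Eq.trans (lsum_congr fun r _ => ?_) (lsum_tens (X.δ x)
        (fun r => r.2.encT (E.lab r.1)) (q.2.encT (F.lab q.1)))) ?_
      · cases r.2 <;> cases q.2 <;> simp only [KMon.both, KMon.encT, tens_zero, map_zero, tens_bv] <;> simp
      · rw [← map_lsum, E.sumT, F.sumT, hx, hy]
        change _ = if ε = true then _ else _
        split_ifs
        · rw [map_zero]
        · rw [LinearMap.comp_apply, onLeft_onRight_bv (Mdl.lin_comp_twInv hM.semi_t), LinearMap.comp_apply,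
            onExp_bv, map_zero]
    · intro q _
      cases q.2 <;> rfl
    · intro q _
      cases q.2 <;> rfl

end PlumbingLattice

/-! ### New roots: the tensor product with the Hopf link bimodule -/

namespace PlumbingLattice
open Op

section Grow
variable {W : Type} [AddCommMonoid W]

theorem TypeD.lsum_boxOne (H : TypeD (KMon × KMon) (Bool × Bool)) (N : TypeA (KMon × KMon) (Bool × Bool))
    (cs : List KMon) (v : (H.boxOne N).B) (F : H.B × N.B → KMon → W) :
    (lsum ((H.boxOne N).δ cs v) fun r => F r.1.1 r.2) =
      lsum (List.range (N.N + 1)) fun k => lsum (H.iter k v.1.1) fun q =>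
      lsum (shuffles (N.idem v.1.2).1 (N.idem v.1.2).2 cs.reverse (q.2.map Prod.fst).reverse) fun l =>
      lsum (N.m l v.1.2) fun y => if (H.idem q.1).1 = (N.idem y).2 then
        (KMon.prod (H.idem v.1.1).2 (q.2.map Prod.snd)).elim 0 fun b => F (q.1, y) b else 0 := by
  simp only [TypeD.boxOne, lsum_flatMap, lsum_filterMap]
  refine lsum_congr fun k _ => lsum_congr fun q _ => lsum_congr fun l _ => lsum_congr fun y _ => ?_
  split_ifs
  · cases KMon.prod (H.idem v.1.1).2 (q.2.map Prod.snd) <;> rfl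
  · rfl

theorem lsum_identityAA (l : List (KMon × KMon)) (z : identityAA.B) (F : Bool × DMon → W) :
    (lsum (identityAA.m l z) fun y => F y.1) = lsum (mergeδ l z.1.1) fun q =>
      (DMon.act 0 q.2 z.1.2).elim 0 fun y => if q.1 = y.idem then F (q.1, y) else 0 := by
  refine (lsum_filterMap _ _ _).trans (lsum_congr fun q _ => ?_)
  cases DMon.act 0 q.2 z.1.2 with
  | none => rfl
  | some y =>
    simp only [Option.bind_some, Option.elim_some]
    by_cases h : q.1 = y.idem
    · exact (congrArg (fun o : Option identityAA.B => o.elim 0 fun y => F y.1) (dif_pos h)).trans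
        (if_pos h).symm
    · exact (congrArg (fun o : Option identityAA.B => o.elim 0 fun y => F y.1) (dif_neg h)).trans
        (if_neg h).symm

/-- The identity bimodule takes at most two inputs, shared between X and H. If the counts (0,0),
(2,0) and (0,2) contribute nothing, only (1,0), (0,1) and (1,1) are left. -/
theorem lsum_iter_three {A J A' J' : Type} (X : TypeD A J) (H : TypeD A' J') (x : X.B) (h : H.B)
    (Φ : X.B × List A → H.B × List A' → W) (h0 : Φ (x, []) (h, []) = 0)
    (h20 : ∀ y a b, Φ (y, [a, b]) (h, []) = 0) (h02 : ∀ y a b, Φ (x, []) (y, [a, b]) = 0)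
    (h3 : ∀ q r, 2 < q.2.length + r.2.length → Φ q r = 0) :
    (lsum (List.range 3) fun j => lsum (X.iter j x) fun q => lsum (List.range 3) fun k =>
      lsum (H.iter k h) fun r => Φ q r) =
    (lsum (X.δ x) fun q => Φ (q.1, [q.2]) (h, [])) + (lsum (H.δ h) fun r => Φ (x, []) (r.1, [r.2])) +
      lsum (X.δ x) fun q => lsum (H.δ h) fun r => Φ (q.1, [q.2]) (r.1, [r.2]) := by
  simp only [lsum_range_three, TypeD.lsum_iter_succ, TypeD.lsum_iter_zero, h0, h20, h02, lsum_zero, add_zero,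
    zero_add]
  have e1 : ∀ y a y' a' b', Φ (y, [a]) (y', [a', b']) = 0 := fun _ _ _ _ _ => h3 _ _ (by simp)
  have e2 : ∀ y a b y' a', Φ (y, [a, b]) (y', [a']) = 0 := fun _ _ _ _ _ => h3 _ _ (by simp)
  have e3 : ∀ y a b y' a' b', Φ (y, [a, b]) (y', [a', b']) = 0 := fun _ _ _ _ _ _ => h3 _ _ (by simp)
  simp only [e1, e2, e3, lsum_zero, add_zero, lsum_add]
  abel

theorem KMon.mul_one_right (a : KMon) : mul a (one a.right) = some a := by
  cases a <;> simp [mul, one, right]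

theorem mergeδ_long (l : List (KMon × KMon)) (ε : Bool) (h : 2 < l.length) : mergeδ l ε = [] :=
  merge.bound l ε h

/-- The sum over the operations of the type-`AA` identity bimodule. -/
def innerSum (ε : Bool) (y : DMon) (Φ : Bool → DMon → W) (l : List (KMon × KMon)) : W :=
  lsum (mergeδ l ε) fun s => (DMon.act 0 s.2 y).elim 0 fun y => if s.1 = y.idem then Φ s.1 y else 0

theorem innerSum_left (c : KMon) (ε : Bool) (y : DMon) (Φ : Bool → DMon → W) (h : c.right = ε)
    (hy : y.idem = ε) : innerSum ε y Φ [(c, KMon.one ε)] =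
      if c.even then (DMon.act 0 c y).elim 0 (Φ ε) else 0 := by
  subst h
  cases c <;> cases y <;> simp_all [innerSum, mergeδ, KMon.one, KMon.right, KMon.even, DMon.idem, DMon.act]

theorem innerSum_right (c : KMon) (ε : Bool) (y : DMon) (Φ : Bool → DMon → W) (h : c.right = ε)
    (hy : y.idem = ε) : innerSum ε y Φ [(KMon.one ε, c)] =
      if c.even then (DMon.act 0 c y).elim 0 (Φ ε) else 0 := by
  subst h
  cases c <;> cases y <;> simp_all [innerSum, mergeδ, KMon.one, KMon.right, KMon.even, DMon.idem, DMon.act]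

theorem innerSum_both (c a : KMon) (ε : Bool) (y : DMon) (Φ : Bool → DMon → W) (h : c.right = ε)
    (h' : a.right = ε) (hy : y.idem = ε) :
    innerSum ε y Φ [(c, KMon.one a.left), (KMon.one ε, a)] =
      KMon.both (fun a => (DMon.act 0 a y).elim 0 (Φ true)) c a := by
  subst h
  cases c <;> cases a <;> cases y <;>
    simp_all [innerSum, mergeδ, KMon.one, KMon.right, KMon.left, KMon.both, DMon.idem, DMon.act]

theorem KMon.left_of_even {a : KMon} (h : a.even) : a.left = a.right := by
  cases a <;> simp_all [even, left, right]

theorem KMon.both_congr {F G : KMon → W} {a b : KMon} (h : a.left = true → b.left = true → F = G) :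
    both F a b = both G a b := by
  cases a <;> cases b <;> simp_all [both, left]

theorem elim_congr {ι : Type} {o : Option ι} {f g : ι → W} (h : ∀ a, f a = g a) : o.elim 0 f = o.elim 0 g := by
  rw [funext h]

variable {X : TypeD KMon Bool} {H : TypeD (KMon × KMon) (Bool × Bool)}

/-- The differential has three sources: a step of X without `σ` and `τ`; a step of H whose first
factor has neither; and a step of each, where the `σ` or `τ` of X is matched with the same letter in
the first factor of H. -/
theorem lsum_grow (wX : ∀ x, ∀ q ∈ X.δ x, q.2.right = X.idem x ∧ q.2.left = X.idem q.1)
    (wH : ∀ x, ∀ q ∈ H.δ x, (q.2.1.right = (H.idem x).1 ∧ q.2.2.right = (H.idem x).2) ∧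
      q.2.1.left = (H.idem q.1).1)
    (u : (X.box (H.boxOne identityAA)).B) (F : X.B → H.B → DMon → KMon → W) :
    (lsum ((X.box (H.boxOne identityAA)).δ u) fun r =>
      F r.1.1.1 r.1.1.2.1.1 r.1.1.2.1.2.1.2 r.2) =
    (lsum (X.δ u.1.1) fun q => if q.2.even then (DMon.act 0 q.2 u.1.2.1.2.1.2).elim 0 fun y =>
      F q.1 u.1.2.1.1 y (KMon.one (H.idem u.1.2.1.1).2) else 0) +
    (lsum (H.δ u.1.2.1.1) fun r => if r.2.1.even then (DMon.act 0 r.2.1 u.1.2.1.2.1.2).elim 0 fun y =>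
      F u.1.1 r.1 y r.2.2 else 0) +
    lsum (X.δ u.1.1) fun q => lsum (H.δ u.1.2.1.1) fun r =>
      KMon.both (fun a => (DMon.act 0 a u.1.2.1.2.1.2).elim 0 fun y => F q.1 r.1 y r.2.2) q.2 r.2.1 := by
  refine (TypeD.lsum_box X (H.boxOne identityAA) u
    fun p a => F p.1 p.2.1.1 p.2.1.2.1.2 a).trans ?_
  obtain ⟨⟨x, ⟨⟨h, ⟨⟨(ε : Bool), y⟩, hy⟩⟩, hh⟩⟩, hx⟩ := u
  change ε = y.idem at hy
  change (H.idem h).1 = ε at hh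
  change X.idem x = ε at hx
  have step : ∀ q : X.B × List KMon, (lsum ((H.boxOne identityAA).δ q.2 ⟨(h, ⟨(ε, y), hy⟩), hh⟩) fun r =>
      if X.idem q.1 = (H.boxOne identityAA).lidem r.1 then F q.1 r.1.1.1 r.1.1.2.1.2 r.2 else 0) =
      lsum (List.range 3) fun k => lsum (H.iter k h) fun r =>
      lsum (shuffles ε ε q.2.reverse (r.2.map Prod.fst).reverse) fun l =>
      innerSum ε y (fun s y => if (H.idem r.1).1 = s then
        (KMon.prod (H.idem h).2 (r.2.map Prod.snd)).elim 0 fun b =>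
          if X.idem q.1 = s then F q.1 r.1 y b else 0 else 0) l := by
    intro q
    refine (TypeD.lsum_boxOne H identityAA q.2 _ fun p a =>
      if X.idem q.1 = (id p.2.1.1 : Bool) then F q.1 p.1 p.2.1.2 a else 0).trans ?_
    refine lsum_congr fun k _ => lsum_congr fun r _ => lsum_congr fun l _ => ?_
    exact lsum_identityAA l ⟨(ε, y), hy⟩ fun p => if (H.idem r.1).1 = p.1 then
      (KMon.prod (H.idem h).2 (r.2.map Prod.snd)).elim 0 fun b =>
          if X.idem q.1 = p.1 then F q.1 r.1 p.2 b else 0 else 0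
  refine (lsum_congr fun j _ => lsum_congr fun q _ => step q).trans ?_
  clear step
  refine (lsum_iter_three X H x h _ ?_ ?_ ?_ ?_).trans ?_
  · simp [shuffles, innerSum, mergeδ_nil]
  · intro y' a b
    simp [shuffles, innerSum, mergeδ_one_right]
  · intro y' a b
    simp [shuffles, innerSum, mergeδ_one_left]
  · intro q r hqr
    refine lsum_eq_zero fun l hl => ?_
    rw [innerSum, mergeδ_long l ε, lsum_nil]
    rw [length_of_mem_shuffles _ _ _ _ l hl]
    simpa using hqr
  congr 1
  · congr 1
    · refine lsum_congr fun q hq => ?_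
      obtain ⟨h1, h2⟩ := wX x q hq
      rw [hx] at h1
      simp only [List.reverse_singleton, List.map_nil, List.reverse_nil, shuffles, List.nil_append,
        List.map_cons, lsum_cons, lsum_nil, add_zero]
      rw [innerSum_left _ _ _ _ h1 hy.symm]
      by_cases he : q.2.even
      · rw [if_pos he, if_pos he]
        rw [KMon.left_of_even he, h1] at h2
        refine elim_congr fun y' => ?_
        rw [if_pos hh]
        exact if_pos h2.symm
      · rw [if_neg he, if_neg he]
    · refine lsum_congr fun r hr => ?_
      obtain ⟨⟨h1, h3⟩, h2⟩ := wH h r hr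
      rw [hh] at h1
      have h4 := KMon.mul_one_right r.2.2
      rw [h3] at h4
      simp only [List.reverse_singleton, List.map_nil, List.reverse_nil, shuffles, List.nil_append,
        List.map_cons, lsum_cons, lsum_nil, add_zero]
      rw [innerSum_right _ _ _ _ h1 hy.symm]
      by_cases he : r.2.1.even
      · rw [if_pos he, if_pos he]
        rw [KMon.left_of_even he, h1] at h2
        refine elim_congr fun y' => ?_
        have h5 : KMon.prod (H.idem h).2 [r.2.2] = some r.2.2 := h4
        rw [if_pos h2.symm, h5, Option.elim_some, if_pos hx]
      · rw [if_neg he, if_neg he]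
  · refine lsum_congr fun q hq => lsum_congr fun r hr => ?_
    obtain ⟨h5, h6⟩ := wX x q hq
    rw [hx] at h5
    obtain ⟨⟨h1, h3⟩, h2⟩ := wH h r hr
    rw [hh] at h1
    have h4 := KMon.mul_one_right r.2.2
    rw [h3] at h4
    simp only [List.reverse_singleton, List.map_cons, List.map_nil, shuffles, List.nil_append,
      lsum_cons, lsum_nil, add_zero, List.cons_append]
    -- One input from each side has two shuffles; the bimodule kills the one in which the input from
    -- X comes first.
    rw [innerSum, mergeδ_one_left, lsum_nil, zero_add, innerSum_both _ _ _ _ _ h5 h1 hy.symm]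
    refine KMon.both_congr fun e1 e2 => funext fun a => elim_congr fun y' => ?_
    have h7 : KMon.prod (H.idem h).2 [r.2.2] = some r.2.2 := h4
    rw [if_pos (h2.symm.trans e2), h7, Option.elim_some, if_pos (h6.symm.trans e1)]

end Grow
end PlumbingLattice

namespace PlumbingLattice
open Op

namespace TypeD.Models
variable {X : TypeD KMon Bool} {M : Mdl} (E : X.Models M)

/-- The effect of an element of the first algebra factor of the Hopf link module. -/
noncomputable def image (x : X.B) (m : Z2) : KMon → (M.B × Z2 →₀ F2)
  | .poly i j => bv (E.lab x, m + (↑i, ↑j))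
  | .laur i j => bv (E.lab x, m + (↑i, j))
  | .sig i j => bv (E.lab x, m + (↑i, j))
  | .tau i j => sh (tw m + (↑i, j)) (M.t (bv (E.lab x, 0)))

theorem lsum_even (x : X.B) (y : DMon) (hy : y.idem = X.idem x) (g : BG) (m : Z2) :
    (lsum (X.δ x) fun q => if q.2.even then (DMon.act 0 q.2 y).elim 0 fun y' =>
      bv (((E.lab q.1, y'.expo), g), m) else 0) = map (ins2 g m) (sh y.expo (M.d (bv (E.lab x, 0)))) := by
  rw [← E.sumI, map_lsum, map_lsum]
  refine lsum_congr fun q hq => ?_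
  have h := (E.wf x q hq).1
  rw [← hy] at h
  cases hq2 : q.2 <;> rw [hq2] at h <;> cases y <;> simp only [KMon.right, DMon.idem, reduceCtorEq] at h <;>
    simp [KMon.even, DMon.act, KMon.encI, DMon.expo, ins2]

theorem lsum_both (x : X.B) (y : DMon) (hy : y.idem = X.idem x) (a : KMon) (ha : a.right = y.idem)
    (ho : a.even = false) (g : BG) (m : Z2) :
    (lsum (X.δ x) fun q => KMon.both (fun a => (DMon.act 0 a y).elim 0 fun y' =>
      bv (((E.lab q.1, y'.expo), g), m)) q.2 a) = map (ins2 g m) (E.image x y.expo a) := by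
  cases a with
  | poly i j => simp [KMon.even] at ho
  | laur i j => simp [KMon.even] at ho
  | sig i j =>
    have hy' : y.idem = false := ha.symm
    have h1 := congrArg (map (ins2 g m)) (congrArg (sh (y.expo + ((i : ℤ), j))) (E.sumS x))
    rw [← hy, hy', if_neg (by simp), map_lsum, map_lsum, sh_bv, zero_add] at h1
    refine Eq.trans (lsum_congr fun q hq => ?_) h1
    cases q.2 <;> cases y <;> simp only [DMon.idem, reduceCtorEq] at hy' <;>
      simp [KMon.both, DMon.act, KMon.encS, DMon.expo, ins2]
    congr 3
    simp only [Prod.mk.injEq, true_and]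
    constructor <;> ring
  | tau i j =>
    have hy' : y.idem = false := ha.symm
    have h1 := congrArg (map (ins2 g m)) (congrArg (sh (tw y.expo + ((i : ℤ), j))) (E.sumT x))
    rw [← hy, hy', if_neg (by simp), map_lsum, map_lsum] at h1
    refine Eq.trans (lsum_congr fun q hq => ?_) h1
    cases q.2 <;> cases y <;> simp only [DMon.idem, reduceCtorEq] at hy' <;>
      simp [KMon.both, DMon.act, KMon.encT, DMon.expo, tw_apply, ins2]
    congr 3
    simp only [Prod.mk.injEq, true_and]
    constructor <;> ring

end TypeD.Models

namespace HopfGen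

theorem diff_wf (e₁ e₂ : Bool) (g : HopfGen) : ∀ q ∈ g.diff e₁ e₂,
    (q.2.1.right = e₁ ∧ q.2.2.right = e₂) ∧ q.2.1.left = e₁ ∧ q.2.2.left = e₂ := by
  cases g <;> simp only [diff, List.forall_mem_cons, List.not_mem_nil, false_imp_iff, implies_true] <;>
    cases e₁ <;> cases e₂ <;> exact ⟨⟨⟨rfl, rfl⟩, rfl, rfl⟩, ⟨⟨rfl, rfl⟩, rfl, rfl⟩, trivial⟩

theorem neg₁_wf (n : ℤ) (e₂ : Bool) (g : HopfGen) : ∀ q ∈ g.neg₁ n e₂,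
    (q.2.1.right = false ∧ q.2.2.right = e₂) ∧ q.2.1.left = true ∧ q.2.2.left = e₂ := by
  cases g <;> simp only [neg₁, List.forall_mem_cons, List.not_mem_nil, false_imp_iff, implies_true] <;>
    cases e₂ <;> simp [KMon.right, KMon.left, KMon.one, KMon.U]

theorem neg₂_wf (n : ℤ) (e₁ : Bool) (g : HopfGen) : ∀ q ∈ g.neg₂ n e₁,
    (q.2.1.right = e₁ ∧ q.2.2.right = false) ∧ q.2.1.left = e₁ ∧ q.2.2.left = true := by
  cases g <;> simp only [neg₂, List.forall_mem_cons, List.not_mem_nil, false_imp_iff, implies_true] <;>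
    cases e₁ <;> simp [KMon.right, KMon.left, KMon.one, KMon.U]

theorem neg₁₂_wf (n₁ n₂ : ℤ) (g : HopfGen) : ∀ q ∈ g.neg₁₂ n₁ n₂,
    (q.2.1.right = false ∧ q.2.2.right = false) ∧ q.2.1.left = true ∧ q.2.2.left = true := by
  cases g <;> simp [neg₁₂, KMon.right, KMon.left]

end HopfGen

theorem KMon.right_one (ε : Bool) : (one ε).right = ε := by cases ε <;> rfl
theorem KMon.left_one (ε : Bool) : (one ε).left = ε := by cases ε <;> rfl

theorem hopfD_wf (n₁ n₂ : ℤ) (x : (hopfD n₁ n₂).B) : ∀ q ∈ (hopfD n₁ n₂).δ x,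
    (q.2.1.right = ((hopfD n₁ n₂).idem x).1 ∧ q.2.2.right = ((hopfD n₁ n₂).idem x).2) ∧
      q.2.1.left = ((hopfD n₁ n₂).idem q.1).1 ∧ q.2.2.left = ((hopfD n₁ n₂).idem q.1).2 := by
  obtain ⟨g, e₁, e₂⟩ := x
  intro q hq
  rcases List.mem_append.1 hq with h1 | h1
  · rcases List.mem_append.1 h1 with h2 | h2
    · rcases List.mem_append.1 h2 with h3 | h3
      · obtain ⟨r, hr, rfl⟩ := List.mem_map.1 h3
        exact HopfGen.diff_wf e₁ e₂ g r hr
      · by_cases h : e₁ = false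
        · rw [if_pos h] at h3
          clear hq h1 h2
          subst h
          rcases List.mem_cons.1 h3 with rfl | h4
          · exact ⟨⟨rfl, KMon.right_one _⟩, rfl, KMon.left_one _⟩
          · obtain ⟨r, hr, rfl⟩ := List.mem_map.1 h4
            exact HopfGen.neg₁_wf n₁ e₂ g r hr
        · rw [if_neg h] at h3
          exact absurd h3 List.not_mem_nil
    · by_cases h : e₂ = false
      · rw [if_pos h] at h2
        clear hq h1
        subst h
        rcases List.mem_cons.1 h2 with rfl | h4
        · exact ⟨⟨KMon.right_one _, rfl⟩, KMon.left_one _, rfl⟩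
        · obtain ⟨r, hr, rfl⟩ := List.mem_map.1 h4
          exact HopfGen.neg₂_wf n₂ e₁ g r hr
      · rw [if_neg h] at h2
        exact absurd h2 List.not_mem_nil
  · by_cases h : e₁ = false ∧ e₂ = false
    · rw [if_pos h] at h1
      clear hq
      obtain ⟨rfl, rfl⟩ := h
      obtain ⟨r, hr, rfl⟩ := List.mem_map.1 h1
      exact HopfGen.neg₁₂_wf n₁ n₂ g r hr
    · rw [if_neg h] at h1
      exact absurd h1 List.not_mem_nil

end PlumbingLattice

namespace PlumbingLattice
open Op

namespace TypeD.Models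
variable {X : TypeD KMon Bool} {M : Mdl} (E : X.Models M)

/-- The operation of the type-`D` module of the Hopf link. -/
def hopfδ (n₁ n₂ : ℤ) (x : HopfGen × Bool × Bool) : List ((HopfGen × Bool × Bool) × KMon × KMon) :=
  (hopfD n₁ n₂).δ x

theorem lsum_hopfδ {W : Type} [AddCommMonoid W] (n₁ n₂ : ℤ) (g : HopfGen) (e₁ e₂ : Bool)
    (f : (HopfGen × Bool × Bool) × KMon × KMon → W) : lsum (hopfδ n₁ n₂ (g, e₁, e₂)) f =
      (lsum (g.diff e₁ e₂) fun q => f ((q.1, e₁, e₂), q.2)) +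
      (if e₁ = false then f ((g, true, e₂), (.sig 0 0, .one e₂)) +
        lsum (g.neg₁ n₁ e₂) fun q => f ((q.1, true, e₂), q.2) else 0) +
      (if e₂ = false then f ((g, e₁, true), (.one e₁, .sig 0 0)) +
        lsum (g.neg₂ n₂ e₁) fun q => f ((q.1, e₁, true), q.2) else 0) +
      (if e₁ = false ∧ e₂ = false then lsum (g.neg₁₂ n₁ n₂) fun q => f ((q.1, true, true), q.2) else 0) := by
  have h : hopfδ n₁ n₂ (g, e₁, e₂) = ((g.diff e₁ e₂).map fun q => ((q.1, e₁, e₂), q.2)) ++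
      (if e₁ = false then
        ((g, true, e₂), (.sig 0 0, .one e₂)) :: ((g.neg₁ n₁ e₂).map fun q => ((q.1, true, e₂), q.2))
        else []) ++
      (if e₂ = false then
        ((g, e₁, true), (.one e₁, .sig 0 0)) :: ((g.neg₂ n₂ e₁).map fun q => ((q.1, e₁, true), q.2))
        else []) ++
      (if e₁ = false ∧ e₂ = false then (g.neg₁₂ n₁ n₂).map fun q => ((q.1, true, true), q.2) else []) := rfl
  rw [h, lsum_append, lsum_append, lsum_append, lsum_map]
  congr 1
  · congr 1
    · congr 1
      split_ifs <;> simp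
    · split_ifs <;> simp
  · split_ifs <;> simp

theorem both_zero {W : Type} [AddCommMonoid W] (a b : KMon) : KMon.both (fun _ => (0 : W)) a b = 0 := by
  cases a <;> cases b <;> rfl

theorem elim_zero {W ι : Type} [AddCommMonoid W] (o : Option ι) : (o.elim (0 : W) fun _ => 0) = 0 := by
  cases o <;> rfl

theorem both_even {W : Type} [AddCommMonoid W] (F : KMon → W) (a b : KMon) (h : b.even = true) :
    KMon.both F a b = 0 := by
  cases a <;> cases b <;> simp_all [KMon.both, KMon.even]

theorem elim_image (x : X.B) (y : DMon) (a : KMon) (ha : a.right = y.idem) (he : a.even = true) (g : BG) (m : Z2) :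
    ((DMon.act 0 a y).elim 0 fun y' => bv (((E.lab x, y'.expo), g), m)) =
      map (ins2 g m) (E.image x y.expo a) := by
  cases a <;> cases y <;> simp_all [KMon.even, KMon.right, DMon.idem, DMon.act, DMon.expo, image, ins2, add_comm]

/-- The predicate P selects the weight of the output and `expo` its exponents, so one computation
serves for all three weights of the new module. -/
theorem lsum_grow_model (n : ℤ) (x : X.B) (y : DMon) (hx : y.idem = X.idem x) (g : HopfGen) (e₂ : Bool)
    (P : KMon → Bool) (expo : KMon → Z2) :
    (lsum (X.δ x) fun q => if q.2.even then (DMon.act 0 q.2 y).elim 0 fun y' =>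
      if P (.one e₂) then bv (((E.lab q.1, y'.expo), (y.idem, g)), expo (.one e₂)) else 0 else 0) +
    (lsum (hopfδ n 0 (g, y.idem, e₂)) fun r => if r.2.1.even then (DMon.act 0 r.2.1 y).elim 0 fun y' =>
      if P r.2.2 then bv (((E.lab x, y'.expo), (r.1.2.1, r.1.1)), expo r.2.2) else 0 else 0) +
    (lsum (X.δ x) fun q => lsum (hopfδ n 0 (g, y.idem, e₂)) fun r =>
      KMon.both (fun a => (DMon.act 0 a y).elim 0 fun y' =>
        if P r.2.2 then bv (((E.lab q.1, y'.expo), (r.1.2.1, r.1.1)), expo r.2.2) else 0) q.2 r.2.1) =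
    (if P (.one e₂) then map (ins2 (y.idem, g) (expo (.one e₂))) (sh y.expo (M.d (bv (E.lab x, 0)))) else 0) +
    lsum (hopfδ n 0 (g, y.idem, e₂)) fun r => if P r.2.2 then
      map (ins2 (r.1.2.1, r.1.1) (expo r.2.2)) (E.image x y.expo r.2.1) else 0 := by
  rw [add_assoc]
  congr 1
  · split_ifs
    · exact E.lsum_even x y hx _ _
    · simp [elim_zero]
  -- Grouped by the Hopf summand: one without `σ` and `τ` in its first factor contributes alone, any
  -- other one only together with a matching step of X.
  · rw [lsum_comm, ← lsum_add]
    refine lsum_congr fun r hr => ?_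
    have h1 : r.2.1.right = y.idem := (hopfD_wf n 0 (g, y.idem, e₂) r hr).1.1
    split_ifs with h2 h3 h3
    · rw [E.elim_image x y _ h1 h2]
      refine (congrArg₂ _ rfl (lsum_eq_zero fun q _ => ?_)).trans (add_zero _)
      exact both_even _ _ _ h2
    · simp [elim_zero, both_zero]
    · rw [zero_add]
      exact E.lsum_both x y hx _ h1 (by simpa using h2) _ _
    · simp [elim_zero, both_zero]

end TypeD.Models
end PlumbingLattice

namespace PlumbingLattice
open Op

namespace KMon

/-- The exponents of a monomial. -/
def expo : KMon → Z2
  | poly i j => (i, j)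
  | laur i j => (i, j)
  | sig i j => (i, j)
  | tau i j => (i, j)

/-- The monomials of weight `σ`. -/
def isSig : KMon → Bool
  | sig _ _ => true
  | _ => false

/-- The monomials of weight `τ`. -/
def isTau : KMon → Bool
  | tau _ _ => true
  | _ => false

theorem encI_eq {β : Type} (l : β) (a : KMon) : a.encI l = if a.even then bv (l, a.expo) else 0 := by
  cases a <;> simp [encI, even, expo]

theorem encS_eq {β : Type} (l : β) (a : KMon) : a.encS l = if a.isSig then bv (l, a.expo) else 0 := by
  cases a <;> simp [encS, isSig, expo]

theorem encT_eq {β : Type} (l : β) (a : KMon) : a.encT l = if a.isTau then bv (l, a.expo) else 0 := by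
  cases a <;> simp [encT, isTau, expo]

end KMon

namespace TypeD.Models
variable {X : TypeD KMon Bool} {M : Mdl} (E : X.Models M)

/-- Linearity of d and semilinearity of t bring the monomial y to the front; what is left is a
comparison of the Hopf terms for each generator and each pair of idempotents. -/
theorem grow_sumI (hM : M.Good) (n : ℤ) (x : X.B) (y : DMon) (g : HopfGen) (e₂ : Bool) :
    (map (ins2 (y.idem, g) 0) (sh y.expo (M.d (bv (E.lab x, 0))))) +
    (lsum (hopfδ n 0 (g, y.idem, e₂)) fun r => if r.2.2.even then
      map (ins2 (r.1.2.1, r.1.1) r.2.2.expo) (E.image x y.expo r.2.1) else 0) =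
    (Mdl.grow M n).d (bv (((E.lab x, y.expo), (y.idem, g)), 0)) := by
  rw [Mdl.grow_d]
  simp only [LinearMap.add_apply, LinearMap.comp_apply, ext2_bv, loc_bv, loc_map]
  have hd : M.d (bv (E.lab x, y.expo)) = sh y.expo (M.d (bv (E.lab x, 0))) := by
    rw [hM.lin_d.bv _ _ 0, sub_zero]; rfl
  have ht : M.t (bv (E.lab x, y.expo)) = sh (tw y.expo) (M.t (bv (E.lab x, 0))) := by
    rw [hM.semi_t.bv _ _ 0, sub_zero]
  rw [hd, ht, add_assoc, add_assoc]
  congr 1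
  rw [lsum_hopfδ]
  generalize y.expo = m
  have h0 : ((0 : ℤ), (0 : ℤ)) = (0 : Z2) := rfl
  have h1 : ∀ g' μ (q : Z2), map (ins2 g' μ) (sh q (M.t (bv (E.lab x, 0)))) =
    map (fun z => (((z.1, z.2 + q), g'), μ)) (M.t (bv (E.lab x, 0))) := fun _ _ _ => by
      rw [sh, map_map]; rfl
  have h2 : ∀ g' μ (q q' : Z2), termOp (q', g', μ) (sh q (M.t (bv (E.lab x, 0)))) =
    map (fun z => (((z.1, z.2 + (q + q')), g'), μ)) (M.t (bv (E.lab x, 0))) := fun _ _ _ _ => by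
      rw [sh, termOp, map_map]; simp only [add_assoc]
  cases y.idem <;> cases e₂ <;> cases g <;>
    simp [HopfGen.diff, HopfGen.neg₁, HopfGen.neg₂, HopfGen.neg₁₂, KMon.one, KMon.U, KMon.V, KMon.even, ins2,
      image, KMon.expo, Hopf.fD, Hopf.fE, Hopf.fP, termOp_bv, h0, h1, h2, add_assoc]

theorem grow_sumS (n : ℤ) (x : X.B) (y : DMon) (g : HopfGen) (e₂ : Bool) :
    (lsum (hopfδ n 0 (g, y.idem, e₂)) fun r => if r.2.2.isSig then
      map (ins2 (r.1.2.1, r.1.1) r.2.2.expo) (E.image x y.expo r.2.1) else 0) =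
    if e₂ then 0 else bv (((E.lab x, y.expo), (y.idem, g)), 0) := by
  rw [lsum_hopfδ]
  generalize y.expo = m
  have h0 : ((0 : ℤ), (0 : ℤ)) = (0 : Z2) := rfl
  cases y.idem <;> cases e₂ <;> cases g <;>
    simp [HopfGen.diff, HopfGen.neg₁, HopfGen.neg₂, HopfGen.neg₁₂, KMon.one, KMon.U, KMon.V, KMon.isSig, ins2,
      image, KMon.expo, h0]

theorem grow_sumT (hM : M.Good) (n : ℤ) (x : X.B) (y : DMon) (g : HopfGen) (e₂ : Bool) :
    (lsum (hopfδ n 0 (g, y.idem, e₂)) fun r => if r.2.2.isTau then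
      map (ins2 (r.1.2.1, r.1.1) r.2.2.expo) (E.image x y.expo r.2.1) else 0) =
    if e₂ then 0 else (Mdl.grow M n).t (bv (((E.lab x, y.expo), (y.idem, g)), 0)) := by
  change _ = if e₂ = true then 0 else
    (loc Hopf.fS + loc (Hopf.fT n) ∘ₗ ext2 M.t : Op _ (((M.B × Z2) × BG) × Z2)) (bv (((E.lab x, y.expo), (y.idem, g)), 0))
  simp only [LinearMap.add_apply, LinearMap.comp_apply, ext2_bv, loc_bv, loc_map]
  have ht : M.t (bv (E.lab x, y.expo)) = sh (tw y.expo) (M.t (bv (E.lab x, 0))) := by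
    rw [hM.semi_t.bv _ _ 0, sub_zero]
  rw [ht]
  rw [lsum_hopfδ]
  generalize y.expo = m
  have h0 : ((0 : ℤ), (0 : ℤ)) = (0 : Z2) := rfl
  have h1 : ∀ g' μ (q : Z2), map (ins2 g' μ) (sh q (M.t (bv (E.lab x, 0)))) =
    map (fun z => (((z.1, z.2 + q), g'), μ)) (M.t (bv (E.lab x, 0))) := fun _ _ _ => by
      rw [sh, map_map]; rfl
  have h2 : ∀ g' μ (q q' : Z2), termOp (q', g', μ) (sh q (M.t (bv (E.lab x, 0)))) =
    map (fun z => (((z.1, z.2 + (q + q')), g'), μ)) (M.t (bv (E.lab x, 0))) := fun _ _ _ _ => by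
      rw [sh, termOp, map_map]; simp only [add_assoc]
  cases y.idem <;> cases e₂ <;> cases g <;>
    simp [HopfGen.diff, HopfGen.neg₁, HopfGen.neg₂, HopfGen.neg₁₂, KMon.one, KMon.U, KMon.V, KMon.isTau, ins2,
      image, KMon.expo, Hopf.fS, Hopf.fT, termOp_bv, h0, h1, h2]

/-- The model of a tree with a new root. -/
noncomputable def grow (hM : M.Good) (n : ℤ) : (X.box (hopfDA n 0)).Models (Mdl.grow M n) where
  lab u := ((E.lab u.1.1, u.1.2.1.2.1.2.expo), (u.1.2.1.1.2.1, u.1.2.1.1.1))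
  inj := by
    rintro ⟨⟨x, ⟨⟨⟨g, e₁, e₂⟩, ⟨⟨(ε : Bool), y⟩, hy⟩⟩, hh⟩⟩, hx⟩
      ⟨⟨x', ⟨⟨⟨g', e₁', e₂'⟩, ⟨⟨(ε' : Bool), y'⟩, hy'⟩⟩, hh'⟩⟩, hx'⟩ h h2
    change e₂ = e₂' at h
    change ε = y.idem at hy
    change e₁ = ε at hh
    change X.idem x = ε at hx
    change ε' = y'.idem at hy'
    change e₁' = ε' at hh'
    change X.idem x' = ε' at hx'
    simp only [Prod.mk.injEq] at h2
    obtain ⟨⟨h3, h4⟩, h5, h6⟩ := h2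
    subst hh hh' h h5 h6
    obtain rfl := DMon.expo_inj (hy.symm.trans hy') h4
    obtain rfl := E.inj x x' (hx.trans hx'.symm) h3
    rfl
  val := by
    rintro ⟨⟨x, ⟨⟨⟨g, e₁, e₂⟩, ⟨⟨(ε : Bool), y⟩, hy⟩⟩, hh⟩⟩, hx⟩
    change ε = y.idem at hy
    change e₁ = ε at hh
    exact ⟨E.val x, (DMon.expo_nonneg y).1, fun h => (DMon.expo_nonneg y).2 (hy.symm.trans (hh.symm.trans h))⟩
  surj := by
    rintro e₂ ⟨⟨l, m⟩, (e₁ : Bool), g⟩ ⟨h1, h2, h3⟩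
    obtain ⟨x, hx, rfl⟩ := E.surj e₁ l h1
    obtain ⟨y, hy, rfl⟩ := DMon.exists_expo e₁ m h2 h3
    exact ⟨⟨(x, ⟨((g, e₁, e₂), ⟨(e₁, y), hy.symm⟩), rfl⟩), hx⟩, rfl, rfl⟩
  wf := by
    intro u q hq
    have key := lsum_grow E.wf (fun x q hq => ⟨(hopfD_wf n 0 x q hq).1, (hopfD_wf n 0 x q hq).2.1⟩) u
      fun _ h _ a => if a.right = ((hopfD n 0).idem u.1.2.1.1).2 ∧ a.left = ((hopfD n 0).idem h).2 then 0 else 1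
    have := eq_zero_of_lsum (key.trans ?_) q hq
    · by_contra hc
      exact one_ne_zero ((if_neg hc).symm.trans this)
    · have h1 : ∀ r ∈ (hopfD n 0).δ u.1.2.1.1, (if r.2.2.right = ((hopfD n 0).idem u.1.2.1.1).2 ∧
          r.2.2.left = ((hopfD n 0).idem r.1).2 then 0 else 1) = 0 := fun r hr =>
        if_pos ⟨(hopfD_wf n 0 _ r hr).1.2, (hopfD_wf n 0 _ r hr).2.2⟩
      rw [lsum_eq_zero, lsum_eq_zero, lsum_eq_zero]
      · rfl
      · intro q hq
        refine lsum_eq_zero fun r hr => ?_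
        simp only [h1 r hr, elim_zero, both_zero]
      · intro r hr
        simp only [h1 r hr, elim_zero, ite_self]
      · intro q hq
        simp only [KMon.right_one, KMon.left_one, and_self, if_true, elim_zero, ite_self]
  sumI := by
    intro u
    refine (lsum_grow E.wf (fun x q hq => ⟨(hopfD_wf n 0 x q hq).1, (hopfD_wf n 0 x q hq).2.1⟩) u
      fun x' h y' a => a.encI ((E.lab x', y'.expo), (h.2.1, h.1))).trans ?_
    obtain ⟨⟨x, ⟨⟨⟨g, e₁, e₂⟩, ⟨⟨(ε : Bool), y⟩, hy⟩⟩, hh⟩⟩, hx⟩ := u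
    change ε = y.idem at hy
    change e₁ = ε at hh
    change X.idem x = ε at hx
    subst hh hy
    simp only [KMon.encI_eq]
    refine (E.lsum_grow_model n x y hx.symm g e₂ _ _).trans (Eq.trans ?_ (E.grow_sumI hM n x y g e₂))
    cases e₂ <;> rfl
  sumS := by
    intro u
    refine (lsum_grow E.wf (fun x q hq => ⟨(hopfD_wf n 0 x q hq).1, (hopfD_wf n 0 x q hq).2.1⟩) u
      fun x' h y' a => a.encS ((E.lab x', y'.expo), (h.2.1, h.1))).trans ?_
    obtain ⟨⟨x, ⟨⟨⟨g, e₁, e₂⟩, ⟨⟨(ε : Bool), y⟩, hy⟩⟩, hh⟩⟩, hx⟩ := u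
    change ε = y.idem at hy
    change e₁ = ε at hh
    change X.idem x = ε at hx
    subst hh hy
    simp only [KMon.encS_eq]
    refine (E.lsum_grow_model n x y hx.symm g e₂ _ _).trans (Eq.trans ?_ (E.grow_sumS n x y g e₂))
    cases e₂ <;> exact zero_add _
  sumT := by
    intro u
    refine (lsum_grow E.wf (fun x q hq => ⟨(hopfD_wf n 0 x q hq).1, (hopfD_wf n 0 x q hq).2.1⟩) u
      fun x' h y' a => a.encT ((E.lab x', y'.expo), (h.2.1, h.1))).trans ?_
    obtain ⟨⟨x, ⟨⟨⟨g, e₁, e₂⟩, ⟨⟨(ε : Bool), y⟩, hy⟩⟩, hh⟩⟩, hx⟩ := u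
    change ε = y.idem at hy
    change e₁ = ε at hh
    change X.idem x = ε at hx
    subst hh hy
    simp only [KMon.encT_eq]
    refine (E.lsum_grow_model n x y hx.symm g e₂ _ _).trans (Eq.trans ?_ (E.grow_sumT hM n x y g e₂))
    cases e₂ <;> exact zero_add _

end TypeD.Models
end PlumbingLattice

/-! ### The model of a recipe -/

namespace PlumbingLattice
open Op

namespace TreeRecipe

/-- The model of a recipe. -/
noncomputable def mdl : TreeRecipe → Mdl
  | vertex => Mdl.vertex
  | join S T => Mdl.join S.mdl T.mdl
  | grow n T => Mdl.grow T.mdl n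

theorem good_mdl : (T : TreeRecipe) → T.mdl.Good
  | vertex => Mdl.good_vertex
  | join S T => (good_mdl S).join (good_mdl T)
  | grow n T => (good_mdl T).grow n

theorem exists_nf_le : (T : TreeRecipe) → ∃ N, ∀ κ, T.mdl.nf κ ≤ N
  | vertex => ⟨0, fun _ => le_rfl⟩
  | join S T => by
    obtain ⟨N, hN⟩ := exists_nf_le S
    obtain ⟨N', hN'⟩ := exists_nf_le T
    exact ⟨N + N', fun κ => Nat.add_le_add (hN κ.1) (hN' κ.2)⟩
  | grow n T => by
    obtain ⟨N, hN⟩ := exists_nf_le T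
    refine ⟨N + 1, fun κ => Nat.add_le_add (hN κ.1) ?_⟩
    split_ifs <;> simp

/-- The type-`D` module of a recipe is described by its model. -/
noncomputable def models : (T : TreeRecipe) → T.typeD.Models T.mdl
  | vertex => solidTorusModels
  | join S T => S.models.join T.models S.good_mdl
  | grow n T => T.models.grow T.good_mdl n

end TreeRecipe
end PlumbingLattice

namespace PlumbingLattice
open Op

/-! ## The lattice side -/

namespace TreeRecipe

/-- The cell with given idempotents and framing coordinates. -/
noncomputable def cell : (T : TreeRecipe) → (T.NonRoot → Bool × ℤ) → T.mdl.C
  | vertex, _ => ()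
  | join S T, s => (S.cell fun x => s (.inl x), T.cell fun x => s (.inr x))
  | grow _ T, s => (T.cell fun x => s (some x), s none)

theorem cell_injective : (T : TreeRecipe) → Function.Injective T.cell
  | vertex => fun s s' _ => funext fun x => nomatch x
  | join S T => fun s s' h => by
    have h1 := S.cell_injective (congrArg Prod.fst h)
    have h2 := T.cell_injective (congrArg Prod.snd h)
    funext x
    rcases x with x | x
    · exact congrFun h1 x
    · exact congrFun h2 x
  | grow n T => fun s s' h => by
    have h1 := T.cell_injective (congrArg Prod.fst h)
    funext x
    rcases x with _ | x
    · exact congrArg Prod.snd h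
    · exact congrFun h1 x

theorem cell_surjective : (T : TreeRecipe) → Function.Surjective T.cell
  | vertex => fun _ => ⟨fun _ => (true, 0), rfl⟩
  | join S T => fun κ => by
    obtain ⟨s, hs⟩ := S.cell_surjective κ.1
    obtain ⟨s', hs'⟩ := T.cell_surjective κ.2
    exact ⟨Sum.elim s s', Prod.ext hs hs'⟩
  | grow n T => fun κ => by
    obtain ⟨s, hs⟩ := T.cell_surjective κ.1
    exact ⟨fun x => Option.elim x κ.2 s, Prod.ext hs rfl⟩

/-- The list of the vertices other than the root. -/
def verts : (T : TreeRecipe) → List T.NonRoot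
  | vertex => []
  | join S T => S.verts.map Sum.inl ++ T.verts.map Sum.inr
  | grow _ T => none :: T.verts.map some

theorem lsum_verts_join {W : Type} [AddCommMonoid W] (S T : TreeRecipe) (f : (join S T).NonRoot → W) :
    lsum (join S T).verts f = (lsum S.verts fun u => f (.inl u)) + lsum T.verts fun u => f (.inr u) :=
  (lsum_append _ _ _).trans (congrArg₂ _ (lsum_map _ _ _) (lsum_map _ _ _))

theorem lsum_verts_grow {W : Type} [AddCommMonoid W] (n : ℤ) (T : TreeRecipe) (f : (grow n T).NonRoot → W) :
    lsum (grow n T).verts f = f none + lsum T.verts fun u => f (some u) :=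
  (lsum_cons _ _ _).trans (congrArg₂ _ rfl (lsum_map _ _ _))

/-- Equality of vertices. -/
def same : (T : TreeRecipe) → T.NonRoot → T.NonRoot → Bool
  | vertex, x, _ => nomatch x
  | join S _, .inl u, .inl x => S.same u x
  | join _ T, .inr u, .inr x => T.same u x
  | join _ _, .inl _, .inr _ => false
  | join _ _, .inr _, .inl _ => false
  | grow _ _, none, none => true
  | grow _ T, some u, some x => T.same u x
  | grow _ _, some _, none => false
  | grow _ _, none, some _ => false

/-- The number of edges between a vertex and the root. -/
def top : (T : TreeRecipe) → T.NonRoot → ℤ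
  | vertex, x => nomatch x
  | join S _, .inl u => S.top u
  | join _ T, .inr u => T.top u
  | grow _ _, none => 1
  | grow _ _, some _ => 0

/-- The intersection form with the opposite sign off the diagonal. -/
def inc : (T : TreeRecipe) → T.NonRoot → T.NonRoot → ℤ
  | vertex, x, _ => nomatch x
  | join S _, .inl u, .inl x => S.inc u x
  | join _ T, .inr u, .inr x => T.inc u x
  | join _ _, .inl _, .inr _ => 0
  | join _ _, .inr _, .inl _ => 0
  | grow n _, none, none => n
  | grow _ T, some u, some x => T.inc u x
  | grow _ T, some u, none => -T.top u
  | grow _ T, none, some x => -T.top x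

/-- Changing the idempotent of a vertex. -/
def lower (T : TreeRecipe) (u : T.NonRoot) (s : T.NonRoot → Bool × ℤ) : T.NonRoot → Bool × ℤ :=
  fun x => ((s x).1 || T.same u x, (s x).2)

/-- Changing the idempotent of a vertex and the framing coordinates. -/
def push (T : TreeRecipe) (u : T.NonRoot) (s : T.NonRoot → Bool × ℤ) : T.NonRoot → Bool × ℤ :=
  fun x => ((s x).1 || T.same u x, (s x).2 + T.inc u x)

/-- Only the neighbours of the root feel it, each losing one from its framing coordinate. In a join
the twist of the left factor is undone before it is applied, so the common exponents are twisted
once. -/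
theorem tL_cell : (T : TreeRecipe) → (s : T.NonRoot → Bool × ℤ) → (m : Z2) →
    T.mdl.tL (bv (T.cell s, m)) = bv (T.cell fun x => ((s x).1, (s x).2 - T.top x), tw m)
  | vertex, _, m => onExp_bv tw () m
  | join S T, s, m => by
    change onLeft T.mdl.C (S.mdl.tL ∘ₗ onExp twInv) (onRight S.mdl.C T.mdl.tL
      (bv ((S.cell fun x => s (.inl x), T.cell fun x => s (.inr x)), m))) = _
    rw [onRight_bv, tL_cell T, map_bv, insL, onLeft_bv, LinearMap.comp_apply, onExp_bv, tL_cell S, map_bv,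
      insR, tw_twInv]
    rfl
  | grow n T, s, m => by
    change Mdl.turnL (bv ((T.cell fun x => s (some x), s none), m)) = _
    rw [Mdl.turnL, map_bv]
    change _ = bv ((T.cell fun x => ((s (some x)).1, (s (some x)).2 - 0), ((s none).1, (s none).2 - 1)), tw m)
    simp only [sub_zero, Prod.mk.eta]

/-- Induction on the recipe. In a join the sum splits over the two sides. For a new root, the old
root contributes the two summands `sigL` and `tauL`, while `slide` carries the others along and
converts the change of the old exponents into one of the old root's coordinate. -/
theorem dL_cell : (T : TreeRecipe) → (s : T.NonRoot → Bool × ℤ) → (m : Z2) →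
    T.mdl.dL (bv (T.cell s, m)) = lsum T.verts fun u => if (s u).1 then 0 else
      bv (T.cell (T.lower u s), m) + bv (T.cell (T.push u s), m + ((s u).2, (s u).2 - T.top u))
  | vertex, _, m => rfl
  | join S T, s, m => by
    change (onLeft T.mdl.C S.mdl.dL + onRight S.mdl.C T.mdl.dL)
      (bv ((S.cell fun x => s (.inl x), T.cell fun x => s (.inr x)), m)) = _
    rw [LinearMap.add_apply, onRight_bv, onLeft_bv, dL_cell T, dL_cell S, map_lsum, map_lsum]
    refine Eq.trans ?_ (lsum_verts_join S T _).symm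
    congr 1
    · refine lsum_congr fun u _ => ?_
      rw [apply_ite (map (insR _)), map_zero, map_add, map_bv, map_bv]
      have h1 : (T.cell fun x => s (.inr x)) = T.cell fun x => ((s (.inr x)).1 || false, (s (.inr x)).2) := by
        simp only [Bool.or_false, Prod.mk.eta]
      have h2 : (T.cell fun x => s (.inr x)) =
          T.cell fun x => ((s (.inr x)).1 || false, (s (.inr x)).2 + 0) := by
        simp only [Bool.or_false, add_zero, Prod.mk.eta]
      refine congrArg (fun z => if (s (.inl u)).1 = true then 0 else z) (congrArg₂ _ ?_ ?_)
      · rw [insR, h1]; rfl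
      · rw [insR, h2]; rfl
    · refine lsum_congr fun u _ => ?_
      rw [apply_ite (map (insL _)), map_zero, map_add, map_bv, map_bv]
      have h1 : (S.cell fun x => s (.inl x)) = S.cell fun x => ((s (.inl x)).1 || false, (s (.inl x)).2) := by
        simp only [Bool.or_false, Prod.mk.eta]
      have h2 : (S.cell fun x => s (.inl x)) =
          S.cell fun x => ((s (.inl x)).1 || false, (s (.inl x)).2 + 0) := by
        simp only [Bool.or_false, add_zero, Prod.mk.eta]
      refine congrArg (fun z => if (s (.inr u)).1 = true then 0 else z) (congrArg₂ _ ?_ ?_)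
      · rw [insL, h1]; rfl
      · rw [insL, h2]; rfl
  | grow n T, s, m => by
    change (Mdl.slide T.mdl.dL + Mdl.sigL + Mdl.tauL n T.mdl.tL : Op ((T.mdl.C × (Bool × ℤ)) × Z2) _)
      (bv ((T.cell fun x => s (some x), s none), m)) = _
    rw [LinearMap.add_apply, LinearMap.add_apply, Mdl.slide, Mdl.sigL, Mdl.tauL, ofBasis_bv, ofBasis_bv,
      ofBasis_bv]
    simp only
    rw [dL_cell T, tL_cell T, map_lsum, map_bv]
    refine Eq.trans ?_ (lsum_verts_grow n T _).symm
    rw [add_assoc, add_comm]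
    congr 1
    · have h1 : (T.cell fun x => s (some x)) = T.cell fun x => ((s (some x)).1 || false, (s (some x)).2) := by
        simp only [Bool.or_false, Prod.mk.eta]
      have h2 : (T.cell fun x => ((s (some x)).1, (s (some x)).2 - T.top x)) =
          T.cell fun x => ((s (some x)).1 || false, (s (some x)).2 + -T.top x) := by
        simp only [Bool.or_false, sub_eq_add_neg]
      cases h : (s none).1
      · simp only [Bool.false_eq_true, if_false, tw_apply]
        congr 1
        · rw [h1]
          refine congrArg (fun z => bv z) (Prod.ext (Prod.ext rfl (Prod.ext ?_ rfl)) rfl)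
          exact (Bool.or_true _).symm
        · rw [h2]
          refine congrArg (fun z => bv z) (Prod.ext (Prod.ext rfl (Prod.ext ?_ ?_)) rfl)
          · exact (Bool.or_true _).symm
          · change 2 * (s none).2 - 0 - (s none).2 + n = (s none).2 + n
            ring
      · simp only [if_true, add_zero]
        rfl
    · refine lsum_congr fun u _ => ?_
      rw [apply_ite (map _), map_zero, map_add, map_bv, map_bv]
      refine congrArg (fun z => if (s (some u)).1 = true then 0 else z) (congrArg₂ _ ?_ ?_)
      · refine congrArg (fun z => bv z) (Prod.ext (Prod.ext rfl (Prod.ext ?_ ?_)) ?_)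
        · exact (Bool.or_false _).symm
        · change (s none).2 - 0 = (s none).2
          ring
        · change m + (0, 0) = m
          exact add_zero m
      · refine congrArg (fun z => bv z) (Prod.ext (Prod.ext rfl (Prod.ext ?_ ?_)) ?_)
        · exact (Bool.or_false _).symm
        · change (s none).2 + ((s (some u)).2 - T.top u) - (0 + (s (some u)).2) = (s none).2 + -T.top u
          ring
        · change m + (0 + (s (some u)).2, 0 + (s (some u)).2) = m + ((s (some u)).2, (s (some u)).2 - 0)
          rw [zero_add, sub_zero]

end TreeRecipe
end PlumbingLattice

/-! ### Minimal exponents as minima of a quadratic function -/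

namespace PlumbingLattice
open Op Mdl

namespace TreeRecipe

/-- The quadratic function of a set of vertices other than the root, for a root which is or is not in the
set. -/
def quad : (T : TreeRecipe) → Bool → (T.NonRoot → Bool) → (T.NonRoot → Bool × ℤ) → ℤ
  | vertex, _, _, _ => 0
  | join S T, b, y, s => S.quad b (fun x => y (.inl x)) (fun x => s (.inl x)) +
      T.quad b (fun x => y (.inr x)) fun x => s (.inr x)
  | grow _ T, b, y, s => (if y none then (s none).2 - if b then 1 else 0 else 0) +
      T.quad (y none) (fun x => y (some x)) fun x => s (some x)

/-- The first or second minimal exponent of a cell. -/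
noncomputable def low (T : TreeRecipe) (κ : T.mdl.C) (b : Bool) : ℤ := if b then (T.mdl.lo κ).2 else (T.mdl.lo κ).1

theorem low_join (S T : TreeRecipe) (κ : S.mdl.C) (κ' : T.mdl.C) (b : Bool) :
    (join S T).low (κ, κ') b = S.low κ b + T.low κ' b := by
  cases b <;> rfl

/-- The minimal generator is the vertex at the start P, with offset (floor(P/2), ceil(P/2)). Halving
the two bounds in `start` accounts for the extra 1 in the second coordinate. -/
theorem low_grow (n : ℤ) (T : TreeRecipe) (κ : T.mdl.C) (ε : Bool) (c : ℤ) (b : Bool) :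
    (grow n T).low (κ, (ε, c)) b = if ε then T.low κ false else
      max (T.low κ false) (T.low κ true - c + if b then 1 else 0) := by
  have h1 : ((grow n T).mdl.lo (κ, (ε, c))).1 = (T.mdl.lo κ).1 +
      ((posExp c (T.mdl.start κ ε c)).1 - (T.mdl.lo κ).1) + (eOff (vGen (T.mdl.start κ ε c))).1 := rfl
  have h2 : ((grow n T).mdl.lo (κ, (ε, c))).2 = (T.mdl.lo κ).1 +
      ((posExp c (T.mdl.start κ ε c)).1 - (T.mdl.lo κ).1) + (eOff (vGen (T.mdl.start κ ε c))).2 := rfl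
  unfold low
  rw [h1, h2, Mdl.start]
  have h3 : ∀ P, (eOff (vGen P)).1 = 0 ∧ (eOff (vGen P)).2 = P % 2 := by
    intro P
    rcases Mdl.lt_mod P with h | h <;> simp [vGen, h, eOff]
  rw [(h3 _).1, (h3 _).2]
  simp only [posExp, if_true, Bool.false_eq_true, if_false]
  cases ε <;> cases b <;> simp only [if_true, Bool.false_eq_true, if_false] <;> omega

/-- The minimum of `quad` over sets of vertices in idempotent zero splits according to whether the
old root belongs to the set. The two cases are the two arguments of the maximum in `low_grow`, and b
records whether the new root belongs to the set. -/
theorem low_cell : (T : TreeRecipe) → (s : T.NonRoot → Bool × ℤ) → (b : Bool) →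
    (∀ y : T.NonRoot → Bool, (∀ x, y x = true → (s x).1 = false) → -T.low (T.cell s) b ≤ T.quad b y s) ∧
    ∃ y : T.NonRoot → Bool, (∀ x, y x = true → (s x).1 = false) ∧ T.quad b y s = -T.low (T.cell s) b
  | vertex, s, b => by
    have h : vertex.low (vertex.cell s) b = 0 := by cases b <;> rfl
    rw [h]
    exact ⟨fun y _ => le_rfl, fun _ => false, fun x h => absurd h (by simp), rfl⟩
  | join S T, s, b => by
    obtain ⟨h1, y1, h2, h3⟩ := low_cell S (fun x => s (.inl x)) b
    obtain ⟨h4, y2, h5, h6⟩ := low_cell T (fun x => s (.inr x)) b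
    have h : (join S T).low ((join S T).cell s) b = _ := low_join S T _ _ b
    rw [h]
    refine ⟨fun y hy => ?_, Sum.elim y1 y2, ?_, ?_⟩
    · have e1 := h1 _ fun x hx => hy (.inl x) hx
      have e2 := h4 _ fun x hx => hy (.inr x) hx
      change _ ≤ S.quad b _ _ + T.quad b _ _
      linarith
    · rintro (x | x) hx
      · exact h2 x hx
      · exact h5 x hx
    · change S.quad b y1 _ + T.quad b y2 _ = _
      rw [h3, h6]
      ring
  | grow n T, s, b => by
    obtain ⟨h1, y1, h2, h3⟩ := low_cell T (fun x => s (some x)) false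
    obtain ⟨h4, y2, h5, h6⟩ := low_cell T (fun x => s (some x)) true
    have h : (grow n T).low ((grow n T).cell s) b = _ := low_grow n T _ (s none).1 (s none).2 b
    rw [h]
    have hq : ∀ y, (grow n T).quad b y s = (if y none then (s none).2 - if b then 1 else 0 else 0) +
      T.quad (y none) (fun x => y (some x)) fun x => s (some x) := fun _ => rfl
    refine ⟨fun y hy => ?_, ?_⟩
    · rw [hq]
      cases hn : y none
      · have e1 := h1 _ fun x hx => hy (some x) hx
        simp only [Bool.false_eq_true, if_false, zero_add]
        refine le_trans ?_ e1
        cases (s none).1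
        · exact neg_le_neg (le_max_left _ _)
        · rfl
      · have e1 := h4 _ fun x hx => hy (some x) hx
        have e2 := hy none hn
        rw [e2]
        simp only [if_true, Bool.false_eq_true, if_false]
        refine (neg_le_neg (le_max_right _ _)).trans ?_
        linarith
    · have a1 : ∃ y : (grow n T).NonRoot → Bool, (∀ x, y x = true → (s x).1 = false) ∧
          (grow n T).quad b y s = -T.low (T.cell fun x => s (some x)) false := by
        refine ⟨fun x => Option.elim x false y1, ?_, ?_⟩
        · rintro (_ | x) hx
          · exact absurd hx (by simp)
          · exact h2 x hx
        · rw [hq, ← h3]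
          exact zero_add _
      cases hs : (s none).1
      · simp only [Bool.false_eq_true, if_false]
        -- If the maximum is the first argument, the minimum is attained without the old root,
        -- otherwise with it.
        rcases max_choice (T.low (T.cell fun x => s (some x)) false)
          (T.low (T.cell fun x => s (some x)) true - (s none).2 + if b then 1 else 0) with hm | hm
        · rw [hm]; exact a1
        · rw [hm]
          refine ⟨fun x => Option.elim x true y2, ?_, ?_⟩
          · rintro (_ | x) hx
            · exact hs
            · exact h5 x hx
          · rw [hq]
            change ((s none).2 - if b = true then 1 else 0) + T.quad true y2 _ = _
            rw [h6]
            ring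
      · simp only [if_true]
        exact a1

/-- The basis element of the cone with given idempotents, framing coordinates and first exponent. -/
noncomputable def state (T : TreeRecipe) (s : T.Vertex → Bool × ℤ) (i : ℤ) : (T.mdl.C × Z2) × Bool :=
  ((T.cell fun x => s (some x), (i, i + (s none).2)), (s none).1)

theorem state_injective (T : TreeRecipe) {s s' : T.Vertex → Bool × ℤ} {i i' : ℤ} (h : T.state s i = T.state s' i') :
    s = s' ∧ i = i' := by
  simp only [state, Prod.mk.injEq] at h
  obtain ⟨⟨h1, h2, h3⟩, h4⟩ := h
  have h5 := T.cell_injective h1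
  refine ⟨funext fun x => ?_, h2⟩
  rcases x with _ | x
  · exact Prod.ext h4 (by omega)
  · exact congrFun h5 x

theorem state_surjective (T : TreeRecipe) (z : (T.mdl.C × Z2) × Bool) : ∃ s i, T.state s i = z := by
  obtain ⟨⟨κ, m⟩, ε⟩ := z
  obtain ⟨s, rfl⟩ := T.cell_surjective κ
  refine ⟨fun x => Option.elim x (ε, m.2 - m.1) s, m.1, ?_⟩
  simp only [state, Option.elim_some, Option.elim_none, Prod.mk.injEq, and_true]
  exact ⟨trivial, Prod.ext rfl (by simp)⟩

/-- The two minima from `low_cell`, for sets without and with the root, bound the first and the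
second exponent; the second bound is present only when the root has idempotent zero. -/
theorem honestL_state (T : TreeRecipe) (s : T.Vertex → Bool × ℤ) (i : ℤ) : T.mdl.HonestL (T.state s i) ↔
    ∀ y : T.Vertex → Bool, (∀ x, y x = true → (s x).1 = false) →
      0 ≤ i + (if y none then (s none).2 else 0) + T.quad (y none) (fun x => y (some x)) fun x => s (some x) := by
  obtain ⟨h1, y1, h2, h3⟩ := T.low_cell (fun x => s (some x)) false
  obtain ⟨h4, y2, h5, h6⟩ := T.low_cell (fun x => s (some x)) true
  change ((T.mdl.lo (T.cell fun x => s (some x))).1 ≤ i ∧ ((s none).1 = false →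
    (T.mdl.lo (T.cell fun x => s (some x))).2 ≤ i + (s none).2)) ↔ _
  have e1 : T.low (T.cell fun x => s (some x)) false = (T.mdl.lo (T.cell fun x => s (some x))).1 := rfl
  have e2 : T.low (T.cell fun x => s (some x)) true = (T.mdl.lo (T.cell fun x => s (some x))).2 := rfl
  rw [← e1, ← e2]
  constructor
  · rintro ⟨h7, h8⟩ y hy
    cases hn : y none
    · have := h1 _ fun x hx => hy (some x) hx
      simp only [Bool.false_eq_true, if_false]
      linarith
    · have e3 := h4 _ fun x hx => hy (some x) hx
      have e4 := h8 (hy none hn)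
      simp only [if_true]
      linarith
  · intro h
    constructor
    · have := h (fun x => Option.elim x false y1) (by
        rintro (_ | x) hx
        · exact absurd hx (by simp)
        · exact h2 x hx)
      simp only [Option.elim_none, Option.elim_some, Bool.false_eq_true, if_false, h3] at this
      linarith
    · intro hs
      have := h (fun x => Option.elim x true y2) (by
        rintro (_ | x) hx
        · exact hs
        · exact h5 x hx)
      simp only [Option.elim_none, Option.elim_some, if_true, h6] at this
      linarith

/-- Equality of vertices. -/
def vsame (T : TreeRecipe) : T.Vertex → T.Vertex → Bool
  | none, none => true
  | some u, some x => T.same u x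
  | _, _ => false

/-- The intersection form with the opposite sign off the diagonal, where the root has weight `n`. -/
def vinc (T : TreeRecipe) (n : ℤ) : T.Vertex → T.Vertex → ℤ
  | none, none => n
  | some u, some x => T.inc u x
  | some u, none => -T.top u
  | none, some x => -T.top x

/-- Puts the root on the same footing as the other vertices: its two summands are 1 and V^n t in the
cone, and the framing n becomes its weight. -/
theorem cone_state (T : TreeRecipe) (n : ℤ) (s : T.Vertex → Bool × ℤ) (i : ℤ) :
    cone n T.mdl.dL T.mdl.tL (bv (T.state s i)) = lsum (none :: T.verts.map some) fun u => if (s u).1 then 0 else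
      bv (T.state (fun x => ((s x).1 || T.vsame u x, (s x).2)) i) +
      bv (T.state (fun x => ((s x).1 || T.vsame u x, (s x).2 + T.vinc n u x)) (i + (s u).2)) := by
  rw [state, cone_bv n T.good_mdl.lin_dL T.good_mdl.semi_tL, T.dL_cell, T.tL_cell, map_lsum, map_lsum, lsum_cons,
    lsum_map, add_comm]
  congr 1
  · cases hs : (s none).1
    · simp only [Bool.false_eq_true, if_false, map_add, map_bv, sh_bv]
      congr 1
      · refine congrArg (fun z => bv z) (Prod.ext (Prod.ext ?_ rfl) ?_)
        · simp only [state, vsame, Bool.or_false, Prod.mk.eta]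
        · exact (Bool.or_true _).symm
      · refine congrArg (fun z => bv z) (Prod.ext (Prod.ext ?_ ?_) ?_)
        · simp only [state, vsame, vinc, Bool.or_false, sub_eq_add_neg]
        · refine Prod.ext ?_ ?_
          · simp [state, tw_apply]
          · simp [state, tw_apply, vinc]; ring
        · exact (Bool.or_true _).symm
    · simp
  · refine lsum_congr fun u _ => ?_
    rw [apply_ite (sh _), apply_ite (map _), map_zero, map_zero, map_add, map_add, sh_bv, sh_bv, map_bv, map_bv]
    refine congrArg (fun z => if (s (some u)).1 = true then 0 else z) (congrArg₂ _ ?_ ?_)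
    · refine congrArg (fun z => bv z) (Prod.ext (Prod.ext rfl ?_) ?_)
      · exact zero_add _
      · exact (Bool.or_false _).symm
    · refine congrArg (fun z => bv z) (Prod.ext (Prod.ext rfl ?_) ?_)
      · refine Prod.ext ?_ ?_
        · simp [state]; ring
        · simp [state, vinc]; ring
      · exact (Bool.or_false _).symm

end TreeRecipe
end PlumbingLattice

/-! ### Recipes as graphs -/

namespace PlumbingLattice
open Op

namespace TreeRecipe

theorem mem_verts : (T : TreeRecipe) → (x : T.NonRoot) → x ∈ T.verts
  | join S _, .inl x => List.mem_append_left _ (List.mem_map_of_mem (S.mem_verts x))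
  | join _ T, .inr x => List.mem_append_right _ (List.mem_map_of_mem (T.mem_verts x))
  | grow _ _, none => List.mem_cons_self
  | grow _ T, some x => List.mem_cons_of_mem _ (List.mem_map_of_mem (T.mem_verts x))

theorem nodup_verts : (T : TreeRecipe) → T.verts.Nodup
  | vertex => List.nodup_nil
  | join S T => by
    refine List.Nodup.append (S.nodup_verts.map Sum.inl_injective) (T.nodup_verts.map Sum.inr_injective) ?_
    intro x h1 h2
    obtain ⟨u, -, rfl⟩ := List.mem_map.1 h1
    obtain ⟨v, -, h⟩ := List.mem_map.1 h2
    cases h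
  | grow n T => by
    refine List.nodup_cons.2 ⟨fun h => ?_, T.nodup_verts.map (Option.some_injective _)⟩
    obtain ⟨u, -, h⟩ := List.mem_map.1 h
    cases h

instance (T : TreeRecipe) : Fintype T.NonRoot := ⟨⟨(T.verts : Multiset T.NonRoot), T.nodup_verts⟩, T.mem_verts⟩

theorem lsum_verts {W : Type*} [AddCommMonoid W] (T : TreeRecipe) (f : T.NonRoot → W) :
    lsum T.verts f = ∑ x, f x := rfl

theorem lsum_vertices {W : Type*} [AddCommMonoid W] (T : TreeRecipe) (f : T.Vertex → W) :
    lsum (none :: T.verts.map some) f = ∑ x, f x := by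
  rw [lsum_cons, lsum_map, lsum_verts, Fintype.sum_option]

theorem same_iff : (T : TreeRecipe) → (u x : T.NonRoot) → (T.same u x = true ↔ u = x)
  | join S _, .inl u, .inl x => (S.same_iff u x).trans Sum.inl_injective.eq_iff.symm
  | join _ T, .inr u, .inr x => (T.same_iff u x).trans Sum.inr_injective.eq_iff.symm
  | join _ _, .inl _, .inr _ => ⟨fun h => absurd h Bool.false_ne_true, fun h => nomatch h⟩
  | join _ _, .inr _, .inl _ => ⟨fun h => absurd h Bool.false_ne_true, fun h => nomatch h⟩
  | grow _ _, none, none => ⟨fun _ => rfl, fun _ => rfl⟩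
  | grow _ T, some u, some x => (T.same_iff u x).trans (Option.some_injective _).eq_iff.symm
  | grow _ _, some _, none => ⟨fun h => absurd h Bool.false_ne_true, fun h => nomatch h⟩
  | grow _ _, none, some _ => ⟨fun h => absurd h Bool.false_ne_true, fun h => nomatch h⟩

theorem vsame_iff (T : TreeRecipe) (u x : T.Vertex) : T.vsame u x = true ↔ u = x := by
  rcases u with _ | u <;> rcases x with _ | x <;> simp [vsame, same_iff]

/-- The distance from the root. -/
def depth : (T : TreeRecipe) → T.NonRoot → ℕ
  | vertex, x => nomatch x
  | join S _, .inl u => S.depth u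
  | join _ T, .inr u => T.depth u
  | grow _ _, none => 1
  | grow _ T, some u => T.depth u + 1

/-- The distance from the root. -/
def vdepth (T : TreeRecipe) (x : T.Vertex) : ℕ := x.elim 0 T.depth

theorem depth_parent : (T : TreeRecipe) → (x : T.NonRoot) → T.depth x = T.vdepth (T.parent x) + 1
  | join S _, .inl u => by
    have h := S.depth_parent u
    change S.depth u = (join S _).vdepth ((S.parent u).map Sum.inl) + 1
    rw [h]
    cases S.parent u <;> rfl
  | join _ T, .inr u => by
    have h := T.depth_parent u
    change T.depth u = (join _ T).vdepth ((T.parent u).map Sum.inr) + 1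
    rw [h]
    cases T.parent u <;> rfl
  | grow _ _, none => rfl
  | grow _ T, some u => by
    have h := T.depth_parent u
    change T.depth u + 1 = (grow _ T).vdepth (some (T.parent u)) + 1
    rw [h]
    cases T.parent u <;> rfl

theorem parent_asymm (T : TreeRecipe) (x y : T.NonRoot) (h : T.parent x = some y) : T.parent y ≠ some x := by
  intro h'
  have h1 := T.depth_parent x
  have h2 := T.depth_parent y
  rw [h] at h1
  rw [h'] at h2
  change T.depth x = T.depth y + 1 at h1
  change T.depth y = T.depth x + 1 at h2
  omega

open Classical in
theorem top_eq : (T : TreeRecipe) → (x : T.NonRoot) → T.top x = if T.parent x = none then 1 else 0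
  | join S _, .inl u => by
    refine (S.top_eq u).trans (if_congr ?_ rfl rfl)
    change _ ↔ (S.parent u).map Sum.inl = none
    rw [Option.map_eq_none_iff]
  | join _ T, .inr u => by
    refine (T.top_eq u).trans (if_congr ?_ rfl rfl)
    change _ ↔ (T.parent u).map Sum.inr = none
    rw [Option.map_eq_none_iff]
  | grow _ _, none => (if_pos rfl).symm
  | grow _ T, some u => (if_neg (fun h : some (T.parent u) = none => by cases h)).symm

open Classical in
theorem inc_eq : (T : TreeRecipe) → (u x : T.NonRoot) → T.inc u x =
    if u = x then T.weight u else if T.parent u = some x ∨ T.parent x = some u then -1 else 0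
  | join S T, .inl u, .inl x => by
    refine (S.inc_eq u x).trans (if_congr Sum.inl_injective.eq_iff.symm rfl (if_congr ?_ rfl rfl))
    change _ ↔ (S.parent u).map Sum.inl = some (Sum.inl x) ∨ (S.parent x).map Sum.inl = some (Sum.inl u)
    simp [Option.map_eq_some_iff]
  | join S T, .inr u, .inr x => by
    refine (T.inc_eq u x).trans (if_congr Sum.inr_injective.eq_iff.symm rfl (if_congr ?_ rfl rfl))
    change _ ↔ (T.parent u).map Sum.inr = some (Sum.inr x) ∨ (T.parent x).map Sum.inr = some (Sum.inr u)
    simp [Option.map_eq_some_iff]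
  | join S T, .inl u, .inr x => by
    refine Eq.symm ((if_neg (fun h => by cases h)).trans (if_neg ?_))
    change ¬((S.parent u).map Sum.inl = some (Sum.inr x) ∨ (T.parent x).map Sum.inr = some (Sum.inl u))
    simp [Option.map_eq_some_iff]
  | join S T, .inr u, .inl x => by
    refine Eq.symm ((if_neg (fun h => by cases h)).trans (if_neg ?_))
    change ¬((T.parent u).map Sum.inr = some (Sum.inl x) ∨ (S.parent x).map Sum.inl = some (Sum.inr u))
    simp [Option.map_eq_some_iff]
  | grow _ _, none, none => (if_pos rfl).symm
  | grow _ T, some u, some x => by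
    refine (T.inc_eq u x).trans (if_congr (Option.some_injective _).eq_iff.symm rfl (if_congr ?_ rfl rfl))
    change _ ↔ some (T.parent u) = some (some x) ∨ some (T.parent x) = some (some u)
    simp
  | grow _ T, some u, none => by
    refine Eq.trans ?_ (if_neg (fun h => by cases h)).symm
    refine (congrArg Neg.neg (T.top_eq u)).trans ?_
    by_cases h : T.parent u = none
    · rw [if_pos h]
      exact (if_pos (Or.inl (congrArg some h))).symm
    · rw [if_neg h]
      exact (if_neg (not_or.2 ⟨fun e => h (Option.some_injective _ e), fun e => nomatch e⟩)).symm
  | grow _ T, none, some x => by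
    refine Eq.trans ?_ (if_neg (fun h => by cases h)).symm
    refine (congrArg Neg.neg (T.top_eq x)).trans ?_
    by_cases h : T.parent x = none
    · rw [if_pos h]
      exact (if_pos (Or.inr (congrArg some h))).symm
    · rw [if_neg h]
      exact (if_neg (not_or.2 ⟨fun e => (nomatch e), fun e => h (Option.some_injective _ e)⟩)).symm

/-- The weights of all vertices. -/
def vweight (T : TreeRecipe) (n : ℤ) (x : T.Vertex) : ℤ := x.elim n T.weight

theorem adj_none_none (T : TreeRecipe) : ¬T.Adj none none := by simp [Adj]

theorem adj_some_none (T : TreeRecipe) (x : T.NonRoot) : T.Adj (some x) none ↔ T.parent x = none := by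
  simp [Adj, eq_comm]

theorem adj_none_some (T : TreeRecipe) (x : T.NonRoot) : T.Adj none (some x) ↔ T.parent x = none := by
  simp [Adj, eq_comm]

theorem adj_some_some (T : TreeRecipe) (u x : T.NonRoot) :
    T.Adj (some u) (some x) ↔ T.parent u = some x ∨ T.parent x = some u := by
  simp [Adj, eq_comm]

open Classical in
-- Identifies the numbers that arise recursively in the differential with the weighted adjacency of
-- the tree, edges counting -1.
theorem vinc_eq (T : TreeRecipe) (n : ℤ) (u x : T.Vertex) : T.vinc n u x =
    if u = x then T.vweight n u else if T.Adj u x then -1 else 0 := by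
  rcases u with _ | u <;> rcases x with _ | x
  · simp [vinc, vweight]
  · simp only [vinc, top_eq, adj_none_some, reduceCtorEq, if_false]
    split_ifs <;> rfl
  · simp only [vinc, top_eq, adj_some_none, reduceCtorEq, if_false]
    split_ifs <;> rfl
  · simp only [vinc, inc_eq, adj_some_some, Option.some.injEq, vweight, Option.elim_some]

open Classical in
theorem quad_eq : (T : TreeRecipe) → (b : Bool) → (y : T.NonRoot → Bool) → (s : T.NonRoot → Bool × ℤ) →
    T.quad b y s = lsum T.verts fun x =>
      if y x then (s x).2 - if (T.parent x).elim b y = true then 1 else 0 else 0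
  | vertex, _, _, _ => rfl
  | join S T, b, y, s => by
    refine Eq.trans ?_ (lsum_verts_join S T _).symm
    refine congrArg₂ _ ((S.quad_eq _ _ _).trans (lsum_congr fun x _ => ?_))
      ((T.quad_eq _ _ _).trans (lsum_congr fun x _ => ?_))
    · have h : (join S T).parent (.inl x) = (S.parent x).map .inl := rfl
      rw [h]
      cases S.parent x <;> rfl
    · have h : (join S T).parent (.inr x) = (T.parent x).map .inr := rfl
      rw [h]
      cases T.parent x <;> rfl
  | grow n T, b, y, s => by
    refine Eq.trans ?_ (lsum_verts_grow n T _).symm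
    refine congrArg₂ _ rfl ((T.quad_eq _ _ _).trans (lsum_congr fun x _ => ?_))
    have h : (grow n T).parent (some x) = some (T.parent x) := rfl
    rw [h]
    cases T.parent x <;> rfl

open Classical in
-- Every edge joins exactly one vertex x to its parent. Since depth increases away from the root,
-- the two orientations of an edge are never confused.
theorem sum_adj (T : TreeRecipe) (h : T.Vertex → T.Vertex → ℤ) :
    (∑ u, ∑ v, if T.Adj u v then h u v else 0) = ∑ x, (h (some x) (T.parent x) + h (T.parent x) (some x)) := by
  have key : ∀ u v, (if T.Adj u v then h u v else 0) =
      (∑ x, if u = some x ∧ v = T.parent x then h (some x) (T.parent x) else 0) +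
      ∑ x, if v = some x ∧ u = T.parent x then h (T.parent x) (some x) else 0 := by
    intro u v
    rcases u with _ | u <;> rcases v with _ | v
    · simp [adj_none_none]
    · simp only [adj_none_some, ite_and, Option.some.injEq, Finset.sum_ite_eq, Finset.mem_univ, if_true,
        reduceCtorEq, if_false, Finset.sum_const_zero, zero_add, eq_comm (a := none)]
      split_ifs with h1 <;> simp [h1]
    · simp only [adj_some_none, ite_and, Option.some.injEq, Finset.sum_ite_eq, Finset.mem_univ, if_true,
        reduceCtorEq, if_false, Finset.sum_const_zero, add_zero, eq_comm (a := none)]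
      split_ifs with h1 <;> simp [h1]
    · rw [adj_some_some]
      simp only [Option.some.injEq, ite_and, Finset.sum_ite_eq, Finset.mem_univ, if_true]
      have h1 := T.parent_asymm u v
      by_cases h2 : T.parent u = some v
      · have h3 : ¬some u = T.parent v := fun e => h1 h2 e.symm
        simp [h2, h3]
      · have h2' : ¬some v = T.parent u := fun e => h2 e.symm
        by_cases h3 : T.parent v = some u
        · simp [h2, h2', h3]
        · have h3' : ¬some u = T.parent v := fun e => h3 e.symm
          simp [h2, h2', h3, h3']
  simp only [key, Finset.sum_add_distrib]
  congr 1
  · refine (Finset.sum_congr rfl fun u _ => Finset.sum_comm).trans (Finset.sum_comm.trans ?_)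
    refine Finset.sum_congr rfl fun x _ => ?_
    simp [ite_and]
  · refine (Finset.sum_congr rfl fun u _ => Finset.sum_comm).trans (Finset.sum_comm.trans ?_)
    refine Finset.sum_congr rfl fun x _ => ?_
    rw [Finset.sum_comm]
    simp [ite_and]

end TreeRecipe
end PlumbingLattice

/-! ### The cone in terms of the vertices of the graph -/

namespace PlumbingLattice
open Op

namespace TreeRecipe

open Classical in
-- `quad` subtracts one for each edge inside the set; the double sum counts each such edge in both
-- orders.
theorem two_mul_quad (T : TreeRecipe) (y : T.Vertex → Bool) (s : T.Vertex → Bool × ℤ) :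
    2 * ((if y none then (s none).2 else 0) + T.quad (y none) (fun x => y (some x)) fun x => s (some x)) =
    2 * (∑ u, if y u then (s u).2 else 0) - ∑ u, ∑ v, if T.Adj u v then if y u ∧ y v then 1 else 0 else 0 := by
  rw [T.sum_adj fun u v => if y u ∧ y v then 1 else 0, quad_eq, lsum_verts, Fintype.sum_option]
  have h : ∀ x, (if y (some x) then (s (some x)).2 -
      if (T.parent x).elim (y none) (fun x => y (some x)) = true then 1 else 0 else 0) =
      (if y (some x) then (s (some x)).2 else 0) - if y (some x) ∧ y (T.parent x) then 1 else 0 := by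
    intro x
    have : (T.parent x).elim (y none) (fun x => y (some x)) = y (T.parent x) := by cases T.parent x <;> rfl
    rw [this, ite_and]
    split_ifs <;> simp
  have h2 : ∀ x, ((if y (some x) ∧ y (T.parent x) then 1 else 0) +
      if y (T.parent x) ∧ y (some x) then 1 else 0 : ℤ) = 2 * if y (some x) ∧ y (T.parent x) then 1 else 0 := by
    intro x
    by_cases h3 : y (some x) = true <;> by_cases h4 : y (T.parent x) = true <;> simp [h3, h4]
  simp only [h, h2, Finset.sum_sub_distrib, ← Finset.mul_sum]
  ring

theorem _root_.Finset.sum_eq_sum_ite {V M : Type*} [Fintype V] [DecidableEq V] [AddCommMonoid M] (I : Finset V)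
    (f : V → M) : ∑ v ∈ I, f v = ∑ v, if v ∈ I then f v else 0 := by
  rw [Finset.sum_ite_mem, Finset.univ_inter]

section Graph
variable {V : Type*} [Fintype V] [DecidableEq V] (G : SimpleGraph V) [DecidableRel G.Adj] (w : V → ℤ)

/-- The intersection form with the opposite sign off the diagonal. -/
def negForm (v x : V) : ℤ := if v = x then w v else if G.Adj v x then -1 else 0

/-- The number of ordered pairs of adjacent vertices in a set. -/
def pairs (I : Finset V) : ℤ := ∑ u ∈ I, ∑ v ∈ I, if G.Adj u v then 1 else 0

variable {T : TreeRecipe} (φ : T.Vertex ≃ V)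

/-- The basis element of the cone with given idempotents, framing coordinates and first exponent. -/
noncomputable def vstate (E : Finset V) (c : V → ℤ) (i : ℤ) : (T.mdl.C × Z2) × Bool :=
  T.state (fun x => (!decide (φ x ∈ E), c (φ x))) i

omit [Fintype V] in
theorem vstate_injective {E E' : Finset V} {c c' : V → ℤ} {i i' : ℤ} (h : vstate φ E c i = vstate φ E' c' i') :
    E = E' ∧ c = c' ∧ i = i' := by
  obtain ⟨h1, h2⟩ := T.state_injective h
  refine ⟨?_, ?_, h2⟩
  · ext v
    have h3 := congrArg Prod.fst (congrFun h1 (φ.symm v))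
    simpa using h3
  · funext v
    have h3 := congrArg Prod.snd (congrFun h1 (φ.symm v))
    simpa using h3

theorem vstate_surjective (z : (T.mdl.C × Z2) × Bool) : ∃ E c i, vstate φ E c i = z := by
  obtain ⟨s, i, rfl⟩ := T.state_surjective z
  refine ⟨Finset.univ.filter fun v => (s (φ.symm v)).1 = false, fun v => (s (φ.symm v)).2, i, ?_⟩
  rw [vstate]
  congr 1
  funext x
  simp only [Finset.mem_filter, Finset.mem_univ, true_and, Equiv.symm_apply_apply]
  refine Prod.ext ?_ rfl
  cases h : (s x).1 <;> simp

variable {G w} {v₀ : V} (h0 : φ none = v₀) (hadj : ∀ x y, G.Adj (φ x) (φ y) ↔ T.Adj x y)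
  (hw : ∀ x, w (φ (some x)) = T.weight x)
include h0 hadj hw

omit [Fintype V] in
theorem vinc_eq_negForm (u x : T.Vertex) : T.vinc (w v₀) u x = negForm G w (φ u) (φ x) := by
  classical
  rw [vinc_eq, negForm]
  refine if_congr φ.injective.eq_iff.symm ?_ (if_congr (hadj u x).symm rfl rfl)
  rcases u with _ | u
  · rw [h0]; rfl
  · exact (hw u).symm

theorem cone_vstate (E : Finset V) (c : V → ℤ) (i : ℤ) :
    cone (w v₀) T.mdl.dL T.mdl.tL (bv (vstate φ E c i)) = ∑ v ∈ E, (bv (vstate φ (E.erase v) c i) +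
      bv (vstate φ (E.erase v) (fun x => c x + negForm G w v x) (i + c v))) := by
  rw [vstate, cone_state, lsum_vertices, Finset.sum_eq_sum_ite E]
  refine Fintype.sum_equiv φ _ _ fun u => ?_
  by_cases hu : φ u ∈ E
  · rw [if_pos hu, if_neg (by simpa using hu)]
    have h : ∀ x, (!decide (φ x ∈ E) || T.vsame u x) = !decide (φ x ∈ E.erase (φ u)) := by
      intro x
      have h2 := T.vsame_iff u x
      by_cases h3 : u = x
      · subst h3
        rw [h2.2 rfl]; simp
      · have h4 : T.vsame u x = false := by
          rw [← Bool.not_eq_true]; exact fun e => h3 (h2.1 e)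
        have h5 : φ x ≠ φ u := fun e => h3 (φ.injective e.symm)
        rw [h4]
        simp [h5]
    simp only [h, vinc_eq_negForm φ h0 hadj hw]
    rfl
  · rw [if_neg hu, if_pos (by simpa using hu)]

omit h0 hw in
theorem honestL_vstate (E : Finset V) (c : V → ℤ) (i : ℤ) : T.mdl.HonestL (vstate φ E c i) ↔
    ∀ I ⊆ E, 0 ≤ 2 * (i + ∑ v ∈ I, c v) - pairs G I := by
  classical
  rw [vstate, honestL_state]
  -- The inequality is doubled because `pairs` counts each edge in both orders.
  have key : ∀ (I : Finset V) (y : T.Vertex → Bool), (∀ x, y x = true ↔ φ x ∈ I) →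
      2 * (i + ∑ v ∈ I, c v) - pairs G I = 2 * (i + (if y none then c (φ none) else 0) +
        T.quad (y none) (fun x => y (some x)) fun x => (!decide (φ (some x) ∈ E), c (φ (some x)))) := by
    intro I y hy
    have h1 := T.two_mul_quad y fun x => (!decide (φ x ∈ E), c (φ x))
    have h2 : (∑ u, if y u then c (φ u) else 0) = ∑ v ∈ I, c v := by
      rw [Finset.sum_eq_sum_ite I]
      exact Fintype.sum_equiv φ _ _ fun u => by simp only [hy]
    have h3 : (∑ u, ∑ v, if T.Adj u v then if y u ∧ y v then (1 : ℤ) else 0 else 0) = pairs G I := by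
      rw [pairs, Finset.sum_eq_sum_ite I]
      refine Fintype.sum_equiv φ _ _ fun u => ?_
      by_cases hu : φ u ∈ I
      · rw [if_pos hu, Finset.sum_eq_sum_ite I]
        refine Fintype.sum_equiv φ _ _ fun v => ?_
        simp only [hy, hu, true_and, hadj]
        split_ifs <;> rfl
      · simp [hy, hu]
    simp only at h1
    rw [h2, h3] at h1
    linarith
  constructor
  · intro h I hI
    rw [key I (fun x => decide (φ x ∈ I)) fun x => by simp]
    have := h (fun x => decide (φ x ∈ I)) fun x hx => by
      have : φ x ∈ E := hI (by simpa using hx)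
      simpa using this
    simp only at this ⊢
    linarith
  · intro h y hy
    have := h (Finset.univ.filter fun v => y (φ.symm v) = true) fun v hv => by
      have := hy (φ.symm v) (Finset.mem_filter.1 hv).2
      simpa using this
    rw [key _ y fun x => by simp] at this
    simp only at this ⊢
    linarith

end Graph
end TreeRecipe
end PlumbingLattice

/-! ### Characteristic vectors in coordinates -/

namespace PlumbingLattice
open Op

section Lattice
variable {V : Type*} [Fintype V] [DecidableEq V] (G : SimpleGraph V) [DecidableRel G.Adj] (w : V → ℤ)

theorem interForm_apply (x y : V → ℤ) : interForm G w x y =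
    ∑ u, w u * x u * y u + ∑ u, ∑ v, if G.Adj u v then x u * y v else 0 := by
  rw [interForm, Matrix.toLinearMap₂'_apply, ← Finset.sum_add_distrib]
  refine Finset.sum_congr rfl fun u _ => ?_
  simp only [Matrix.add_apply, Matrix.diagonal_apply, SimpleGraph.adjMatrix_apply, smul_eq_mul, mul_add,
    Finset.sum_add_distrib]
  congr 1
  · simp only [mul_ite, mul_zero, Finset.sum_ite_eq, Finset.mem_univ, if_true]
    ring
  · refine Finset.sum_congr rfl fun v _ => ?_
    split_ifs <;> simp

theorem interForm_single (u v : V) : interForm G w (Pi.single u 1) (Pi.single v 1) =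
    if u = v then w u else if G.Adj u v then 1 else 0 := by
  rw [interForm_apply]
  have h : ∀ x y, (if G.Adj x y then (Pi.single u 1 : V → ℤ) x * (Pi.single v 1 : V → ℤ) y else 0) =
      if x = u then if y = v then if G.Adj x y then 1 else 0 else 0 else 0 := by
    intro x y
    simp only [Pi.single_apply]
    split_ifs <;> rfl
  simp only [h, Finset.sum_ite_irrel, Finset.sum_ite_eq', Finset.mem_univ, if_true, Finset.sum_const_zero]
  by_cases h2 : u = v
  · subst h2; simp [Pi.single_apply]
  · simp [Pi.single_apply, h2, Ne.symm h2]

omit [DecidableEq V] in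
-- The summands at (u, v) and (v, u) agree, and there are no loops.
theorem even_sum_adj (x : V → ℤ) : Even (∑ u, ∑ v, if G.Adj u v then x u * x v else 0) := by
  rw [← ZMod.intCast_eq_zero_iff_even]
  rw [← Finset.sum_product', Int.cast_sum]
  refine Finset.sum_involution (fun p _ => p.swap) ?_ ?_ (fun _ _ => Finset.mem_univ _) fun p _ => p.swap_swap
  · rintro ⟨u, v⟩ -
    simp only [Prod.fst_swap, Prod.snd_swap, G.adj_comm v u, mul_comm (x v)]
    exact CharTwo.add_self_eq_zero _
  · rintro ⟨u, v⟩ - h e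
    obtain rfl : v = u := congrArg Prod.fst e
    simp at h

omit [Fintype V] in
theorem classOf_eq (I : Finset V) : classOf I = ∑ v ∈ I, Pi.single v (1 : ℤ) := by
  funext u
  rw [Finset.sum_apply, classOf]
  simp [Pi.single_apply]

variable {G w}

/-- The coordinate `(K(v) + v²) / 2` of a characteristic vector. -/
def Char.coord (K : Char G w) (v : V) : ℤ := (K.1 (Pi.single v 1) + w v) / 2

namespace Char

theorem two_mul_coord (K : Char G w) (v : V) : 2 * K.coord v = K.1 (Pi.single v 1) + w v := by
  have h := K.2 (Pi.single v 1)
  rw [interForm_single, if_pos rfl] at h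
  exact Int.mul_ediv_cancel' h.two_dvd

theorem ext_coord {K L : Char G w} (h : K.coord = L.coord) : K = L := by
  refine Subtype.ext (LinearMap.pi_ext' fun v => LinearMap.ext_ring ?_)
  have h1 := K.two_mul_coord v
  have h2 := L.two_mul_coord v
  rw [h] at h1
  simp only [LinearMap.comp_apply, LinearMap.single_apply]
  linarith

variable (G w) in
-- With `ext_coord`, the coordinates identify characteristic vectors with ℤ^V. The parity condition
-- holds because the edge terms come in pairs and x (x - 1) is even.
theorem exists_coord_eq (c : V → ℤ) : ∃ K : Char G w, K.coord = c := by
  let L : (V → ℤ) →ₗ[ℤ] ℤ := ∑ v, (2 * c v - w v) • LinearMap.proj v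
  have hL : ∀ x, L x = ∑ v, (2 * c v - w v) * x v := fun x => by simp [L, LinearMap.sum_apply]
  have h2 : ∀ x, Even (L x + interForm G w x x) := fun x => by
    rw [hL, interForm_apply, ← add_assoc, ← Finset.sum_add_distrib]
    refine Even.add ?_ (even_sum_adj G x)
    refine Finset.sum_induction _ Even (fun _ _ => Even.add) (by simp) fun v _ => ?_
    have h : (2 * c v - w v) * x v + w v * x v * x v = 2 * (c v * x v) + w v * (x v * (x v - 1)) := by ring
    rw [h]
    exact (even_two_mul _).add ((Int.even_mul_pred_self _).mul_left _)
  refine ⟨⟨L, h2⟩, funext fun v => ?_⟩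
  have h := two_mul_coord (⟨L, h2⟩ : Char G w) v
  simp only [hL, Pi.single_apply, mul_ite, mul_one, mul_zero, Finset.sum_ite_eq', Finset.mem_univ, if_true] at h
  linarith

theorem coord_shift (K : Char G w) (v x : V) :
    (K.shift v).coord x = K.coord x + if v = x then w v else if G.Adj v x then 1 else 0 := by
  have h1 := K.two_mul_coord x
  have h2 := (K.shift v).two_mul_coord x
  have h3 : (K.shift v).1 (Pi.single x 1) = K.1 (Pi.single x 1) +
      2 * interForm G w (Pi.single v 1) (Pi.single x 1) := by
    simp [shift]
  rw [h3, interForm_single] at h2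
  linarith

open TreeRecipe in
theorem two_mul_f (K : Char G w) (I : Finset V) : 2 * K.f I = 2 * ∑ v ∈ I, K.coord v + pairs G I := by
  rw [f, Int.mul_ediv_cancel' (K.2 _).two_dvd, interForm_apply, classOf_eq, map_sum, Finset.mul_sum, pairs,
    ← add_assoc, ← classOf_eq]
  simp only [two_mul_coord, Finset.sum_add_distrib]
  congr 1
  · congr 1
    rw [Finset.sum_eq_sum_ite I w]
    exact Finset.sum_congr rfl fun v _ => by rw [classOf]; split_ifs <;> simp
  · rw [Finset.sum_eq_sum_ite I]
    refine Finset.sum_congr rfl fun u _ => ?_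
    by_cases hu : u ∈ I
    · rw [if_pos hu, Finset.sum_eq_sum_ite I]
      refine Finset.sum_congr rfl fun v _ => ?_
      simp only [classOf, hu, if_true, one_mul]
      split_ifs <;> rfl
    · simp [classOf, hu]

theorem le_g_iff (K : Char G w) (E : Finset V) (a : ℤ) : a ≤ K.g E ↔ ∀ I ⊆ E, a ≤ K.f I := by
  refine (Finset.le_inf'_iff _ _).trans ?_
  simp only [Finset.mem_powerset]

theorem g_mono (K : Char G w) {D E : Finset V} (h : D ⊆ E) : K.g E ≤ K.g D :=
  (K.le_g_iff D _).2 fun I hI => (K.le_g_iff E _).1 le_rfl I (hI.trans h)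

/-- Since f is quadratic, adding v contributes its own value and the pairing of v with the rest, and
the latter is absorbed by the shift of K by 2 v^*. -/
theorem f_insert (K : Char G w) {v : V} {I : Finset V} (h : v ∉ I) :
    K.f (insert v I) = K.coord v + (K.shift v).f I := by
  have h1 := K.two_mul_f (insert v I)
  have h2 := (K.shift v).two_mul_f I
  have h3 : ∑ x ∈ I, (if v = x then w v else if G.Adj v x then 1 else 0) =
      ∑ x ∈ I, (if G.Adj v x then (1 : ℤ) else 0) :=
    Finset.sum_congr rfl fun x hx => if_neg fun e : v = x => h (e ▸ hx)
  have h4 : TreeRecipe.pairs G (insert v I) = TreeRecipe.pairs G I +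
      2 * ∑ x ∈ I, if G.Adj v x then (1 : ℤ) else 0 := by
    have h5 : ∑ x ∈ I, (if G.Adj x v then (1 : ℤ) else 0) = ∑ x ∈ I, if G.Adj v x then (1 : ℤ) else 0 :=
      Finset.sum_congr rfl fun x _ => by simp only [G.adj_comm]
    simp only [TreeRecipe.pairs, Finset.sum_insert h, SimpleGraph.irrefl, if_false, zero_add,
      Finset.sum_add_distrib, h5]
    ring
  simp only [coord_shift, Finset.sum_add_distrib, h3] at h2
  rw [Finset.sum_insert h] at h1
  linarith

theorem coe_a (K : Char G w) (E : Finset V) (v : V) : (K.a E v : ℤ) = K.g (E.erase v) - K.g E :=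
  Int.toNat_of_nonneg (sub_nonneg.2 (K.g_mono (Finset.erase_subset v E)))

/-- By `f_insert`, a minimum over the sets containing v is the coordinate of v plus the minimum for
the shifted vector over subsets of E - v. -/
theorem coe_b (K : Char G w) {E : Finset V} {v : V} (hv : v ∈ E) :
    (K.b E v : ℤ) = K.coord v + (K.shift v).g (E.erase v) - K.g E := by
  have h : (E.erase v).powerset.inf' ⟨∅, Finset.empty_mem_powerset _⟩ (fun I => K.f (insert v I)) =
      K.coord v + (K.shift v).g (E.erase v) := by
    refine eq_of_forall_le_iff fun a => ?_
    refine (Finset.le_inf'_iff _ _).trans ?_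
    rw [← sub_le_iff_le_add', le_g_iff]
    refine forall_congr' fun I => ?_
    rw [Finset.mem_powerset]
    refine imp_congr_right fun hI => ?_
    rw [f_insert K fun hvI => Finset.notMem_erase v E (hI hvI), sub_le_iff_le_add']
  rw [b, Int.toNat_of_nonneg, h]
  refine sub_nonneg.2 (Finset.le_inf' _ _ fun I hI => ?_)
  exact (K.le_g_iff E _).1 le_rfl _
    (Finset.insert_subset hv ((Finset.mem_powerset.1 hI).trans (Finset.erase_subset v E)))

end Char

end Lattice
end PlumbingLattice

/-! ### Reversing the sign on the edges of a bipartite graph -/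

namespace PlumbingLattice
open Op TreeRecipe

section Lattice
variable {V : Type*} [Fintype V] [DecidableEq V] {G : SimpleGraph V} [DecidableRel G.Adj] {w : V → ℤ} {F : Finset V}

variable (G w F) in
/-- The change of framing coordinates that reverses the sign of the form on the edges, for a bipartition
of the graph with one side `F`. -/
def flip (E : Finset V) (c : V → ℤ) (v : V) : ℤ :=
  if v ∈ F then if v ∈ E then -c v else w v - c v else c v + ∑ x ∈ E, if G.Adj v x then 1 else 0

omit [Fintype V] in
theorem flip_injective (E : Finset V) : Function.Injective (flip G w F E) := by
  intro c c' h
  funext v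
  have h1 := congrFun h v
  rw [flip, flip] at h1
  split_ifs at h1 <;> linarith

omit [Fintype V] in
theorem flip_surjective (E : Finset V) : Function.Surjective (flip G w F E) := by
  intro c
  refine ⟨fun v => if v ∈ F then if v ∈ E then -c v else w v - c v else
    c v - ∑ x ∈ E, if G.Adj v x then 1 else 0, funext fun v => ?_⟩
  simp only [flip]
  split_ifs <;> ring

/-- The part of a sum over a finite set that comes from one side of the bipartition. -/
def sideSum (F E : Finset V) (c : V → ℤ) : ℤ := ∑ v ∈ E, if v ∈ F then c v else 0

omit [Fintype V] in
theorem sideSum_erase {E : Finset V} {v : V} (hv : v ∈ E) (c : V → ℤ) :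
    sideSum F (E.erase v) c = sideSum F E c - if v ∈ F then c v else 0 := by
  rw [sideSum, sideSum, ← Finset.add_sum_erase E _ hv]
  ring

omit [Fintype V] in
theorem sum_adj_erase {E : Finset V} {v : V} (hv : v ∈ E) (x : V) :
    ∑ y ∈ E.erase v, (if G.Adj x y then (1 : ℤ) else 0) =
      ∑ y ∈ E, (if G.Adj x y then (1 : ℤ) else 0) - if G.Adj v x then 1 else 0 := by
  rw [← Finset.add_sum_erase E _ hv, eq_sub_iff_add_eq, add_comm]
  simp only [G.adj_comm v x]

variable (hF : ∀ u v, G.Adj u v → (u ∈ F ↔ v ∉ F))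
include hF

/-- Take an edge with u outside F and v in F. Then u lies in both or neither of I and its symmetric
difference with E ∩ F, whereas v, if it is in E, lies in exactly one of them. So an edge from I \ F
to E is counted for precisely one of the two sets, and the correction term in `flip` changes the
sign of the edge count. -/
theorem two_mul_sum_flip {E I : Finset V} (hI : I ⊆ E) (c : V → ℤ) :
    2 * ∑ v ∈ I, flip G w F E c v - pairs G I =
      2 * ∑ v ∈ symmDiff I (E ∩ F), c v + pairs G (symmDiff I (E ∩ F)) - 2 * sideSum F E c := by
  have h1 : ∀ I : Finset V, pairs G I = ∑ u, ∑ v, if G.Adj u v then if u ∈ I ∧ v ∈ I then 1 else 0 else 0 := by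
    intro I
    rw [pairs, Finset.sum_eq_sum_ite]
    refine Finset.sum_congr rfl fun u _ => ?_
    by_cases hu : u ∈ I
    · rw [if_pos hu, Finset.sum_eq_sum_ite]
      refine Finset.sum_congr rfl fun v _ => ?_
      simp only [hu, true_and]
      split_ifs <;> rfl
    · simp [hu]
  have h2 : ∑ v ∈ I, flip G w F E c v = ∑ v ∈ symmDiff I (E ∩ F), c v - sideSum F E c +
      ∑ u, ∑ v, if G.Adj u v then if u ∈ I ∧ u ∉ F ∧ v ∈ E then 1 else 0 else 0 := by
    rw [sideSum, Finset.sum_eq_sum_ite I, Finset.sum_eq_sum_ite E, Finset.sum_eq_sum_ite (symmDiff I (E ∩ F)),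
      ← Finset.sum_sub_distrib, ← Finset.sum_add_distrib]
    refine Finset.sum_congr rfl fun v _ => ?_
    by_cases h3 : v ∈ I
    · have h4 := hI h3
      by_cases h5 : v ∈ F
      · simp [flip, Finset.mem_symmDiff, h3, h4, h5]
      · simp only [flip, Finset.mem_symmDiff, h3, h4, h5, Finset.mem_inter, if_true, if_false, and_false, not_false_iff,
          and_true, true_and, sub_zero]
        rw [Finset.sum_eq_sum_ite E]
        congr 1
        refine Finset.sum_congr rfl fun x _ => ?_
        split_ifs <;> rfl
    · by_cases h4 : v ∈ E <;> by_cases h5 : v ∈ F <;> simp [Finset.mem_symmDiff, h3, h4, h5]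
  have h3 : ∑ u, ∑ v, (if G.Adj u v then if u ∈ I ∧ u ∉ F ∧ v ∈ E then 1 else 0 else 0 : ℤ) =
      ∑ u, ∑ v, if G.Adj u v then if v ∈ I ∧ v ∉ F ∧ u ∈ E then 1 else 0 else 0 := by
    rw [Finset.sum_comm]
    simp only [G.adj_comm]
  have h4 : ∑ u, ∑ v, (if G.Adj u v then if u ∈ I ∧ u ∉ F ∧ v ∈ E then 1 else 0 else 0 : ℤ) +
      ∑ u, ∑ v, (if G.Adj u v then if v ∈ I ∧ v ∉ F ∧ u ∈ E then 1 else 0 else 0 : ℤ) =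
      pairs G I + pairs G (symmDiff I (E ∩ F)) := by
    simp only [h1, ← Finset.sum_add_distrib]
    refine Finset.sum_congr rfl fun u _ => Finset.sum_congr rfl fun v _ => ?_
    by_cases h : G.Adj u v
    · have h5 := hF u v h
      have h6 := @hI u
      have h7 := @hI v
      simp only [h, if_true, Finset.mem_symmDiff, Finset.mem_inter]
      by_cases a1 : u ∈ I <;> by_cases a2 : v ∈ I <;> by_cases a3 : v ∈ F <;> by_cases a4 : u ∈ E <;>
        by_cases a5 : v ∈ E <;> simp_all
    · simp [h]
  rw [h2]
  linarith

/-- Symmetric difference with E ∩ F permutes the subsets of E, so the minimum over I becomes g(K,E),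
up to the constant `sideSum`. -/
theorem forall_flip_iff (K : Char G w) (E : Finset V) (i : ℤ) :
    (∀ I ⊆ E, 0 ≤ 2 * (i + ∑ v ∈ I, flip G w F E K.coord v) - pairs G I) ↔
      0 ≤ i - sideSum F E K.coord + K.g E := by
  have h1 : 0 ≤ i - sideSum F E K.coord + K.g E ↔ sideSum F E K.coord - i ≤ K.g E := by
    constructor <;> intro h <;> linarith
  have h2 : ∀ I ⊆ E, 2 * (i + ∑ v ∈ I, flip G w F E K.coord v) - pairs G I =
      2 * (i - sideSum F E K.coord + K.f (symmDiff I (E ∩ F))) := by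
    intro I hI
    have h3 := two_mul_sum_flip (w := w) hF hI K.coord
    have h4 := K.two_mul_f (symmDiff I (E ∩ F))
    linarith
  have h3 : ∀ I ⊆ E, symmDiff I (E ∩ F) ⊆ E := fun I hI x hx => by
    rcases Finset.mem_symmDiff.1 hx with h | h
    · exact hI h.1
    · exact (Finset.mem_inter.1 h.1).1
  rw [h1, Char.le_g_iff]
  constructor
  · intro h J hJ
    have h4 := h _ (h3 J hJ)
    rw [h2 _ (h3 J hJ), symmDiff_symmDiff_cancel_right] at h4
    linarith
  · intro h I hI
    have h4 := h _ (h3 I hI)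
    rw [h2 I hI]
    linarith

/-- In flipped coordinates, erasing v while keeping K is a shift by the form when v is in F and no
change otherwise. By `flip_shift` the rôles are reversed for K + 2 v^*, so the two summands of the
differential are interchanged at vertices of F. -/
theorem flip_erase {E : Finset V} {v : V} (hv : v ∈ E) (K : Char G w) :
    flip G w F (E.erase v) K.coord = if v ∈ F then fun x => flip G w F E K.coord x + negForm G w v x
      else flip G w F E K.coord := by
  split_ifs with hvF <;> funext x <;> have h2 := hF v x <;> simp only [flip, sum_adj_erase hv, negForm, Finset.mem_erase]
  · by_cases h3 : v = x
    · subst h3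
      simp [hvF, hv]; ring
    · have h4 : x ≠ v := Ne.symm h3
      by_cases h5 : x ∈ F
      · have h6 : ¬ G.Adj v x := fun e => (h2 e).1 hvF h5
        simp [h3, h4, h5, h6]
      · simp only [h5, h3, if_false]
        split_ifs <;> ring
  · by_cases h3 : v = x
    · subst h3
      simp [hvF]
    · have h4 : x ≠ v := Ne.symm h3
      by_cases h5 : x ∈ F
      · simp [h4, h5]
      · have h6 : ¬ G.Adj v x := fun e => hvF ((h2 e).2 h5)
        simp [h5, h6]

theorem flip_shift {E : Finset V} {v : V} (hv : v ∈ E) (K : Char G w) :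
    flip G w F (E.erase v) (K.shift v).coord = if v ∈ F then flip G w F E K.coord else
      fun x => flip G w F E K.coord x + negForm G w v x := by
  split_ifs with hvF <;> funext x <;> have h2 := hF v x <;>
    simp only [flip, sum_adj_erase hv, negForm, Finset.mem_erase, Char.coord_shift]
  · by_cases h3 : v = x
    · subst h3
      simp [hvF, hv]
    · have h4 : x ≠ v := Ne.symm h3
      by_cases h5 : x ∈ F
      · have h6 : ¬ G.Adj v x := fun e => (h2 e).1 hvF h5
        simp [h3, h4, h5, h6]
      · simp only [h5, h3, if_false]
        split_ifs <;> ring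
  · by_cases h3 : v = x
    · subst h3
      simp [hvF]; ring
    · have h4 : x ≠ v := Ne.symm h3
      by_cases h5 : x ∈ F
      · simp only [h5, h3, h4, if_true, if_false, ne_eq, not_false_iff, true_and]
        split_ifs <;> ring
      · have h6 : ¬ G.Adj v x := fun e => hvF ((h2 e).2 h5)
        simp [h3, h5, h6]

/-- Neighbours of v lie on the other side, so shifting by v affects the sum over F only when v is
outside F. The change is what the exponents of the two summands require. -/
theorem sideSum_shift {E : Finset V} {v : V} (hv : v ∈ E) (K : Char G w) :
    sideSum F (E.erase v) (K.shift v).coord = sideSum F E K.coord +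
      if v ∈ F then -K.coord v else ∑ x ∈ E, if G.Adj v x then 1 else 0 := by
  have h : sideSum F (E.erase v) (K.shift v).coord = sideSum F (E.erase v) K.coord +
      if v ∈ F then 0 else ∑ x ∈ E, if G.Adj v x then 1 else 0 := by
    rw [← Finset.add_sum_erase E _ hv, if_neg G.irrefl, zero_add]
    split_ifs with hvF
    · rw [add_zero]
      refine Finset.sum_congr rfl fun x hx => ?_
      have h1 : v ≠ x := (Finset.ne_of_mem_erase hx).symm
      split_ifs with h2
      · have h3 : ¬ G.Adj v x := fun e => (hF v x e).1 hvF h2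
        simp [Char.coord_shift, h1, h3]
      · rfl
    · rw [sideSum, sideSum, ← Finset.sum_add_distrib]
      refine Finset.sum_congr rfl fun x hx => ?_
      have h1 : v ≠ x := (Finset.ne_of_mem_erase hx).symm
      split_ifs with h2 h3 h3
      · simp [Char.coord_shift, h1, h3]
      · simp [Char.coord_shift, h1, h3]
      · exact absurd ((hF v x h3).2 h2) hvF
      · rfl
  rw [h, sideSum_erase hv]
  split_ifs <;> ring

end Lattice
end PlumbingLattice

/-! ### The chart of the lattice complex -/

namespace PlumbingLattice
open Op TreeRecipe

section Lattice
variable {V : Type*} [Fintype V] [DecidableEq V] {G : SimpleGraph V} [DecidableRel G.Adj] {w : V → ℤ}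

open Classical in
/-- The values of the lattice differential as formal sums of monomials. -/
noncomputable def latticeTerms (p : Char G w × Finset V) : (Char G w × Finset V) × ℕ →₀ F2 :=
  ∑ v ∈ p.2, (bv ((p.1, p.2.erase v), p.1.a p.2 v) + bv ((p.1.shift v, p.2.erase v), p.1.b p.2 v))

theorem latticeComplex_bd (p : Char G w × Finset V) :
    (latticeComplex G w).bd p = ser (Char G w × Finset V) (latticeTerms p) := by
  rw [latticeTerms, map_sum]
  simp only [map_add, ser_bv, Finset.sum_add_distrib]
  rfl

variable {T : TreeRecipe} (φ : T.Vertex ≃ V)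

/-- The basis element of the cone that corresponds to `U^k [K, E]`. -/
noncomputable def latticeState (F : Finset V) (p : (Char G w × Finset V) × ℕ) : (T.mdl.C × Z2) × Bool :=
  vstate φ p.1.2 (flip G w F p.1.2 p.1.1.coord) (p.2 - p.1.1.g p.1.2 + sideSum F p.1.2 p.1.1.coord)

theorem latticeState_injective (F : Finset V) : Function.Injective (latticeState (G := G) (w := w) φ F) := by
  rintro ⟨⟨K, E⟩, k⟩ ⟨⟨K', E'⟩, k'⟩ h
  obtain ⟨h1, h2, h3⟩ := vstate_injective φ h
  obtain rfl : E = E' := h1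
  obtain rfl : K = K' := Char.ext_coord (flip_injective E h2)
  have h4 : (k : ℤ) = k' := by simpa using h3
  rw [Nat.cast_inj.1 h4]

omit [DecidableEq V] [DecidableRel G.Adj] in
-- The parity of the distance from the root changes along every edge.
theorem exists_bipartition (hadj : ∀ x y, G.Adj (φ x) (φ y) ↔ T.Adj x y) :
    ∃ F : Finset V, ∀ u v, G.Adj u v → (u ∈ F ↔ v ∉ F) := by
  refine ⟨Finset.univ.filter fun v => Odd (T.vdepth (φ.symm v)), fun u v h => ?_⟩
  have h1 : T.Adj (φ.symm u) (φ.symm v) := (hadj _ _).1 (by simpa using h)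
  simp only [Finset.mem_filter, Finset.mem_univ, true_and]
  obtain ⟨x, h2, h3⟩ | ⟨x, h2, h3⟩ := h1 <;>
  · rw [h2, h3]
    have h4 : T.vdepth (some x) = T.vdepth (T.parent x) + 1 := T.depth_parent x
    rw [h4, Nat.odd_add_one]
    try rw [not_not]

variable {v₀ : V} (h0 : φ none = v₀) (hadj : ∀ x y, G.Adj (φ x) (φ y) ↔ T.Adj x y)
  (hw : ∀ x, w (φ (some x)) = T.weight x)
include h0 hadj hw

/-- Vertex by vertex both sides have two summands. The positions agree by `flip_erase` and
`flip_shift`; the powers of U agree because a and b are differences of minima g, up to the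
coordinate of v. -/
theorem cone_latticeState {F : Finset V} (hF : ∀ u v, G.Adj u v → (u ∈ F ↔ v ∉ F)) (p : Char G w × Finset V) :
    cone (w v₀) T.mdl.dL T.mdl.tL (bv (latticeState φ F (p, 0))) =
      Op.map (latticeState φ F) (latticeTerms p) := by
  obtain ⟨K, E⟩ := p
  rw [latticeState, cone_vstate φ h0 hadj hw, latticeTerms, map_sum]
  refine Finset.sum_congr rfl fun v hv => ?_
  have hv' : v ∈ E := hv
  rw [map_add, map_bv, map_bv, latticeState, latticeState]
  dsimp only
  rw [flip_erase hF hv', flip_shift hF hv', sideSum_erase hv', sideSum_shift hF hv', Char.coe_a, Char.coe_b K hv']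
  by_cases h : v ∈ F
  · simp only [h, if_true]
    -- For v in F the two summands correspond in the opposite order.
    rw [add_comm]
    congr 3
    · simp only [flip, h, hv', if_true]; push_cast; ring
    · push_cast; ring
  · simp only [h, if_false]
    congr 3
    · push_cast; ring
    · simp only [flip, h, if_false]; push_cast; ring

theorem exists_latticeChart :
    Nonempty ((latticeComplex G w).Chart (cone (w v₀) T.mdl.dL T.mdl.tL) T.mdl.HonestL) := by
  obtain ⟨F, hF⟩ := exists_bipartition φ hadj
  refine ⟨⟨latticeState φ F, latticeState_injective φ F, ?_, ?_, ?_, ?_⟩⟩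
  · rintro ⟨⟨K, E⟩, k⟩
    refine (honestL_vstate φ hadj E _ _).2 ((forall_flip_iff hF K E _).2 ?_)
    dsimp only
    have : (0 : ℤ) ≤ k := Int.natCast_nonneg k
    linarith
  · intro s hs
    obtain ⟨E, c, i, rfl⟩ := vstate_surjective φ s
    obtain ⟨c, rfl⟩ := flip_surjective (G := G) (w := w) (F := F) E c
    obtain ⟨K, rfl⟩ := Char.exists_coord_eq G w c
    -- Honesty says exactly that the power of U to be used is nonnegative.
    have h := (forall_flip_iff hF K E i).1 ((honestL_vstate φ hadj E _ _).1 hs)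
    refine ⟨((K, E), (i - sideSum F E K.coord + K.g E).toNat), ?_⟩
    refine congrArg (vstate φ E _) ?_
    change (((i - sideSum F E K.coord + K.g E).toNat : ℤ) - K.g E + sideSum F E K.coord) = i
    rw [Int.toNat_of_nonneg h]
    ring
  · intro p k
    simp only [latticeState, vstate, state]
    refine Prod.ext (Prod.ext rfl (Prod.ext ?_ ?_)) rfl
    · simp; ring
    · simp; ring
  · exact fun p => ⟨latticeTerms p, latticeComplex_bd p, cone_latticeState φ h0 hadj hw hF p⟩

end Lattice
end PlumbingLattice

/-! ### Every rooted tree has a recipe -/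

namespace PlumbingLattice

namespace TreeRecipe

/-- A rooted forest given by a function to the parent, with roots attached to `r`, comes from a recipe. -/
theorem exists_of_parent {V : Type*} [DecidableEq V] (p : V → V) (rank : V → ℕ)
    (hrank : ∀ v, rank (p v) ≤ rank v) (w : V → ℤ) (n : ℕ) : ∀ (S : Finset V) (r : V), S.card ≤ n → r ∉ S →
    (∀ v ∈ S, p v ∈ S ∨ p v = r) → (∀ v ∈ S, rank (p v) < rank v) →
    ∃ (T : TreeRecipe) (φ : T.NonRoot → V), Function.Injective φ ∧ (∀ v, v ∈ S ↔ ∃ x, φ x = v) ∧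
      (∀ x, p (φ x) = (T.parent x).elim r φ) ∧ ∀ x, w (φ x) = T.weight x := by
  classical
  have hiter : ∀ k v, rank (p^[k] v) ≤ rank v := by
    intro k
    induction k with
    | zero => exact fun v => le_rfl
    | succ k ih => exact fun v => (ih (p v)).trans (hrank v)
  induction n with
  | zero =>
    intro S r hS _ _ _
    obtain rfl : S = ∅ := Finset.card_eq_zero.1 (Nat.le_zero.1 hS)
    have e : vertex.NonRoot → False := fun x => nomatch x
    exact ⟨vertex, fun x => (e x).elim, fun x => (e x).elim,
      fun v => ⟨fun h => absurd h (Finset.notMem_empty v), fun ⟨x, _⟩ => (e x).elim⟩,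
      fun x => (e x).elim, fun x => (e x).elim⟩
  | succ n ih =>
    intro S r hS hr hp hlt
    obtain rfl | hne := S.eq_empty_or_nonempty
    · exact ih ∅ r (Nat.zero_le n) hr hp hlt
    -- A vertex of least rank has its parent outside S, so it is a child of r.
    obtain ⟨x₀, hx, hmin⟩ := S.exists_min_image rank hne
    have hx₀ : p x₀ = r := (hp x₀ hx).resolve_left fun h => (hlt x₀ hx).not_ge (hmin _ h)
    -- The proper descendants of x₀ form a smaller forest with its roots attached to x₀.
    obtain ⟨T₁, φ₁, i₁, s₁, q₁, w₁⟩ := ih (S.filter fun v => v ≠ x₀ ∧ ∃ k, p^[k] v = x₀) x₀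
      (Nat.le_of_lt_succ ((Finset.card_lt_card (Finset.filter_ssubset.2 ⟨x₀, hx, by simp⟩)).trans_le hS)) (by simp)
      (fun v hv => by
        obtain ⟨hvS, hvx, k, hk⟩ := by simpa using hv
        cases k with
        | zero => exact absurd hk hvx
        | succ k =>
          by_cases h : p v = x₀
          · exact Or.inr h
          -- The parent of v cannot be r: an iterated parent of r has rank at most that of r = p x₀,
          -- which is less than the rank of x₀.
          · refine Or.inl (Finset.mem_filter.2 ⟨(hp v hvS).resolve_right fun e => ?_, h, k, hk⟩)
            have h1 := hiter k (p v)
            have h2 := hlt x₀ hx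
            have h3 : p^[k] (p v) = x₀ := hk
            rw [h3, e] at h1
            rw [hx₀] at h2
            omega)
      (fun v hv => hlt v (Finset.mem_filter.1 hv).1)
    -- The vertices that do not descend from x₀ form a smaller forest still attached to r.
    obtain ⟨T₂, φ₂, i₂, s₂, q₂, w₂⟩ := ih (S.filter fun v => ¬ ∃ k, p^[k] v = x₀) r
      (Nat.le_of_lt_succ ((Finset.card_lt_card (Finset.filter_ssubset.2 ⟨x₀, hx, by
        rw [not_not]; exact ⟨0, rfl⟩⟩)).trans_le hS)) (fun h => hr (Finset.mem_filter.1 h).1)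
      (fun v hv => by
        obtain ⟨hvS, h⟩ := Finset.mem_filter.1 hv
        refine (hp v hvS).imp_left fun h2 => Finset.mem_filter.2 ⟨h2, ?_⟩
        rintro ⟨k, hk⟩
        exact h ⟨k + 1, hk⟩)
      (fun v hv => hlt v (Finset.mem_filter.1 hv).1)
    have m₁ : ∀ x, φ₁ x ∈ S ∧ φ₁ x ≠ x₀ ∧ ∃ k, p^[k] (φ₁ x) = x₀ := fun x =>
      Finset.mem_filter.1 ((s₁ _).2 ⟨x, rfl⟩)
    have m₂ : ∀ x, φ₂ x ∈ S ∧ ¬ ∃ k, p^[k] (φ₂ x) = x₀ := fun x => Finset.mem_filter.1 ((s₂ _).2 ⟨x, rfl⟩)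
    -- Growing turns x₀ into a child of the new root, recording its weight; joining glues this
    -- branch to the rest at r.
    refine ⟨join (grow (w x₀) T₁) T₂, Sum.elim (fun o : Option T₁.NonRoot => o.elim x₀ φ₁) φ₂, ?_, ?_, ?_, ?_⟩
    · refine Function.Injective.sumElim ?_ i₂ ?_
      · rintro (_ | x) (_ | y) h
        · rfl
        · exact absurd h.symm (m₁ y).2.1
        · exact absurd h (m₁ x).2.1
        · exact congrArg some (i₁ h)
      · rintro (_ | x) y h
        · exact (m₂ y).2 ⟨0, h.symm⟩
        · have h' : φ₁ x = φ₂ y := h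
          exact (m₂ y).2 (h' ▸ (m₁ x).2.2)
    · intro v
      constructor
      · intro hv
        by_cases h : ∃ k, p^[k] v = x₀
        · by_cases h2 : v = x₀
          · exact ⟨.inl none, h2.symm⟩
          · obtain ⟨x, rfl⟩ := (s₁ v).1 (Finset.mem_filter.2 ⟨hv, h2, h⟩)
            exact ⟨.inl (some x), rfl⟩
        · obtain ⟨x, rfl⟩ := (s₂ v).1 (Finset.mem_filter.2 ⟨hv, h⟩)
          exact ⟨.inr x, rfl⟩
      · rintro ⟨(_ | x) | x, rfl⟩
        · exact hx
        · exact (m₁ x).1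
        · exact (m₂ x).1
    · rintro ((_ | x) | x)
      · exact hx₀
      · refine (q₁ x).trans ?_
        change _ = (Option.map Sum.inl (some (T₁.parent x))).elim r _
        rfl
      · refine (q₂ x).trans ?_
        change _ = (Option.map Sum.inr (T₂.parent x)).elim r _
        cases T₂.parent x <;> rfl
    · rintro ((_ | x) | x)
      · rfl
      · exact w₁ x
      · exact w₂ x

end TreeRecipe

/-- The last but one vertex of a shortest path is such a neighbour. A shortest path to any other
closer neighbour avoids v, hence extends to a path to v, and paths in a tree are unique. -/
theorem _root_.SimpleGraph.IsTree.existsUnique_adj_dist_lt {V : Type*} {G : SimpleGraph V} (hG : G.IsTree)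
    {v₀ v : V} (hv : v ≠ v₀) : ∃! u, G.Adj v u ∧ G.dist v₀ u < G.dist v₀ v := by
  classical
  obtain ⟨p, hp, hlen⟩ := hG.connected.exists_path_of_dist v₀ v
  have hnil : ¬ p.Nil := SimpleGraph.Walk.not_nil_of_ne hv.symm
  refine ⟨p.penultimate, ⟨(p.adj_penultimate hnil).symm, ?_⟩, ?_⟩
  · have h1 := SimpleGraph.dist_le p.dropLast
    have h2 : p.dropLast.length + 1 = p.length := SimpleGraph.Walk.length_dropLast_add_one hnil
    omega
  · rintro u ⟨hu, hd⟩
    obtain ⟨q, hq, hql⟩ := hG.connected.exists_path_of_dist v₀ u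
    have h1 : v ∉ q.support := fun h => by
      have h2 := SimpleGraph.dist_le (q.takeUntil v h)
      have h3 := q.length_takeUntil_le_length h
      omega
    exact hG.isAcyclic.eq_penultimate_of_adj_end hp hu
      (hG.isAcyclic.mem_support_of_ne_mem_support_of_adj_of_isPath hp hq hu h1)

/-- The parent of a vertex is its unique neighbour closer to v₀, and the distance from v₀ serves as
rank. -/
theorem TreeRecipe.exists_builds {V : Type*} [Fintype V] [DecidableEq V] {G : SimpleGraph V} (hG : G.IsTree)
    (w : V → ℤ) (v₀ : V) : ∃ T : TreeRecipe, T.Builds G w v₀ := by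
  choose f hf hu using fun (v : V) (hv : v ≠ v₀) => hG.existsUnique_adj_dist_lt hv
  let p : V → V := fun v => if hv : v = v₀ then v₀ else f v hv
  have p_of_ne : ∀ v (hv : v ≠ v₀), p v = f v hv := fun v hv => dif_neg hv
  have hlt : ∀ v, v ≠ v₀ → G.dist v₀ (p v) < G.dist v₀ v := fun v hv => by rw [p_of_ne v hv]; exact (hf v hv).2
  obtain ⟨T, φ, hi, hs, hp, hw⟩ := exists_of_parent p (G.dist v₀)
    (fun v => by
      by_cases hv : v = v₀
      · subst hv; exact le_of_eq (congrArg _ (dif_pos rfl))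
      · exact (hlt v hv).le)
    w _ (Finset.univ.erase v₀) v₀ le_rfl (by simp)
    (fun v _ => by
      by_cases h : p v = v₀
      · exact Or.inr h
      · exact Or.inl (by simpa using h))
    (fun v hv => hlt v (Finset.ne_of_mem_erase hv))
  have hne : ∀ x, φ x ≠ v₀ := fun x => Finset.ne_of_mem_erase ((hs _).2 ⟨x, rfl⟩)
  let ψ : T.Vertex → V := fun x => x.elim v₀ φ
  have hψ : Function.Bijective ψ := by
    constructor
    · rintro (_ | x) (_ | y) h
      · rfl
      · exact absurd h.symm (hne y)
      · exact absurd h (hne x)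
      · exact congrArg some (hi h)
    · intro v
      by_cases hv : v = v₀
      · exact ⟨none, hv.symm⟩
      · obtain ⟨x, rfl⟩ := (hs v).1 (by simpa using hv)
        exact ⟨some x, rfl⟩
  have hpar : ∀ x, p (φ x) = ψ (T.parent x) := hp
  have hadj : ∀ x, G.Adj (φ x) (ψ (T.parent x)) := fun x => by
    rw [← hpar, p_of_ne _ (hne x)]; exact (hf _ (hne x)).1
  have key : ∀ x y, G.Adj (ψ x) (ψ y) → G.dist v₀ (ψ y) < G.dist v₀ (ψ x) → ∃ z, x = some z ∧ y = T.parent z := by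
    rintro (_ | x) y h hd
    · rw [show ψ none = v₀ from rfl, SimpleGraph.dist_self] at hd
      exact absurd hd (Nat.not_lt_zero _)
    · refine ⟨x, rfl, hψ.1 ?_⟩
      rw [← hpar, p_of_ne _ (hne x)]
      exact hu _ (hne x) _ ⟨h, hd⟩
  refine ⟨T, Equiv.ofBijective ψ hψ, rfl, fun x y => ⟨fun h => ?_, ?_⟩, fun x => hw x⟩
  -- In a tree the ends of an edge have distances from the root that differ by one, so the closer
  -- end is the parent of the other.
  · obtain h2 | h2 := hG.dist_eq_dist_add_one_of_adj v₀ h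
    · exact Or.inl (key x y h (h2 ▸ Nat.lt_succ_self _))
    · exact Or.inr (key y x h.symm (h2 ▸ Nat.lt_succ_self _))
  · rintro (⟨z, rfl, rfl⟩ | ⟨z, rfl, rfl⟩)
    · exact hadj z
    · exact (hadj z).symm

end PlumbingLattice

theorem mainTheorem4 {V : Type*} [Fintype V] [DecidableEq V] (G : SimpleGraph V)
    [DecidableRel G.Adj] (hG : G.IsTree) (w : V → ℤ) (v₀ : V) :
    (∃ T : PlumbingLattice.TreeRecipe, T.Builds G w v₀) ∧
    ∀ T : PlumbingLattice.TreeRecipe, T.Builds G w v₀ →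
      (T.complex (w v₀)).IsComplex ∧ (PlumbingLattice.latticeComplex G w).IsComplex ∧
      (T.complex (w v₀)).HomotopyEquivalent (PlumbingLattice.latticeComplex G w) := by
  refine ⟨PlumbingLattice.TreeRecipe.exists_builds hG w v₀, ?_⟩
  rintro T ⟨φ, h0, hadj, hw⟩
  obtain ⟨N, hN⟩ := T.exists_nf_le
  obtain ⟨E⟩ := PlumbingLattice.exists_latticeChart φ h0 hadj hw
  exact T.good_mdl.homotopyEquivalent (w v₀) hN (T.models.chart T.good_mdl (w v₀)) E
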